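/- **Setting.** Let $\mathcal X_1,\mathcal X_2,\mathcal Y_1,\mathcal Y_2$ be finite sets, $q(x_1,x_2)$ a pmf on $\mathcal X_1\times\mathcal X_2$, $q(y_1,y_2|x_1,x_2)$ a channel, and $r\ge 1$ an integer. Write $X_{[1:2]}=(X_1,X_2)$, $Y_{[1:2]}=(Y_1,Y_2)$, $F_{[1:i]}=(F_1,\dots,F_i)$; entropies and mutual informations are in bits. An $(n,R_0,R_{12},R_{21})$ channel simulation code with $r$ rounds works as follows. The sources $X_{[1:2]}^n$ are i.i.d. copies of $X_{[1:2]}\sim q$; the common randomness $\omega$ is independent of them and uniform on the integers in $[1,2^{nR_0}]$. The messages $C_1,\dots,C_r$ take values in finite sets and are generated successively by randomized encoders, $\tilde p(c_i|c_{[1:i-1]},x_1^n,\omega)$ at terminal 1 for odd $i$ and $\tilde p(c_i|c_{[1:i-1]},x_2^n,\omega)$ at terminal 2 for even $i$. The outputs are generated by randomized decoders $\tilde p(y_1^n|c_{[1:r]},x_1^n,\omega)$ and $\tilde p(y_2^n|c_{[1:r]},x_2^n,\omega)$. It is required that $$\frac1n\sum_{i\text{ odd}}H(C_i)\le R_{12},\qquad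 \frac1n\sum_{i\text{ even}}H(C_i)\le R_{21}.$$ A tuple $(R_0,R_{12},R_{21})$ of non-negative reals is *achievable* if there is a sequence of such codes ($n=1,2,\dots$) for which the total variation distance between the induced pmf $\tilde p(x_{[1:2]}^n,y_{[1:2]}^n)$ and $\prod_{t=1}^n q(x_{[1:2],t})\,q(y_{[1:2],t}|x_{[1:2],t})$ tends to $0$ as $n\to\infty$. The *simulation rate region* is the closure in $\mathbb R^3$ of the set of achievable tuples. **Theorem.** The simulation rate region equals the set $\mathcal S(r)$ of all non-negative tuples $(R_0,R_{12},R_{21})$ for which there is $p(f_1,\dots,f_r,x_{[1:2]},y_{[1:2]})\in T(r)$ with $$\begin{aligned} R_{12}&\ge I(X_1;F_{[1:r]}|X_2),\\ R_{21}&\ge I(X_2;F_{[1:r]}|X_1),\\ R_0+R_{12}&\ge I(X_1;F_{[1:r]}|X_2)+I(F_1;Y_{[1:2]}|X_{[1:2]}),\\ R_0+R_{12}+R_{21}&\ge I(X_1;F_{[1:r]}|X_2)+I(X_2;F_{[1:r]}|X_1)+I(F_{[1:r]};Y_{[1:2]}|X_{[1:2]}). \end{aligned}$$ Here $T(r)$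 is the set of pmfs $p(f_1,\dots,f_r,x_{[1:2]},y_{[1:2]})$, with $F_i$ taking values in a finite set $\mathcal F_i$, such that $(X_{[1:2]},Y_{[1:2]})\sim q(x_{[1:2]})q(y_{[1:2]}|x_{[1:2]})$; the Markov chains $$\begin{aligned} &F_i-(F_{[1:i-1]},X_1)-X_2\ (i\text{ odd}),\qquad F_i-(F_{[1:i-1]},X_2)-X_1\ (i\text{ even}),\\ &Y_1-(F_{[1:r]},X_1)-(X_2,Y_2),\qquad Y_2-(F_{[1:r]},X_2)-(X_1,Y_1) \end{aligned}$$ hold; and $|\mathcal F_1|\le|\mathcal X_1||\mathcal X_2||\mathcal Y_1||\mathcal Y_2|+3$, and $|\mathcal F_i|\le|\mathcal X_1||\mathcal X_2||\mathcal Y_1||\mathcal Y_2|\prod_{j=1}^{i-1}|\mathcal F_j|+2$ for all $1<i\le r$. -/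

import Mathlib

namespace ChannelSim

noncomputable section

/-! ### Information measures of finite random variables

A pmf on a finite sample space `Ω` is an element of `stdSimplex ℝ Ω`; a random variable is a
function on `Ω`. All entropies are in bits. -/

section Info

variable {Ω α β γ : Type*} [Fintype Ω]

open Classical in
/-- The law (marginal pmf) of the random variable `A` under the pmf `p`. -/
def law (p : Ω → ℝ) (A : Ω → α) (a : α) : ℝ := ∑ w, if A w = a then p w else 0

/-- Shannon entropy `H(A)`, in bits. -/
def entropy [Fintype α] (p : Ω → ℝ) (A : Ω → α) : ℝ :=
  (∑ a, Real.negMulLog (law p A a)) / Real.log 2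

/-- Conditional entropy `H(A|B) = H(A,B) - H(B)`. -/
def condEntropy [Fintype α] [Fintype β] (p : Ω → ℝ) (A : Ω → α) (B : Ω → β) : ℝ :=
  entropy p (fun w => (A w, B w)) - entropy p B

/-- Conditional mutual information `I(A;B|C) = H(A|C) - H(A|B,C)`. -/
def condMutualInfo [Fintype α] [Fintype β] [Fintype γ] (p : Ω → ℝ)
    (A : Ω → α) (B : Ω → β) (C : Ω → γ) : ℝ :=
  condEntropy p A C - condEntropy p A (fun w => (B w, C w))

/-- The Markov chain `A - B - C`: `p(a,b,c) p(b) = p(a,b) p(b,c)` for all `a`, `b`, `c`. -/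
def IsMarkov (p : Ω → ℝ) (A : Ω → α) (B : Ω → β) (C : Ω → γ) : Prop :=
  ∀ a b c, law p (fun w => (A w, B w, C w)) (a, b, c) * law p B b =
    law p (fun w => (A w, B w)) (a, b) * law p (fun w => (B w, C w)) (b, c)

/-- Total variation distance of two pmfs on a finite set. -/
def tvDist (p q : Ω → ℝ) : ℝ := (∑ w, |p w - q w|) / 2

end Info

/-- The tuples `(c_j)_{j < i}` of the symbols that precede round `i`, the symbol of round `j`
having the alphabet `Fin (k j)`. -/
abbrev Past {r : ℕ} (k : Fin r → ℕ) (i : Fin r) : Type := (j : {j : Fin r // j < i}) → Fin (k j)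

/-- The part of a tuple that precedes round `i`. -/
def past {r : ℕ} {k : Fin r → ℕ} (c : (j : Fin r) → Fin (k j)) (i : Fin r) : Past k i :=
  fun j => c j

/-! ### Channel simulation codes

Rounds are indexed by `Fin r`, from `0`: the round of index `i` is the `(i+1)`-st one, so that
the odd-numbered rounds, in which terminal 1 speaks, are those of even index. -/

section Codes

variable {X₁ X₂ Y₁ Y₂ : Type*} [Fintype X₁] [Fintype X₂] [Fintype Y₁] [Fintype Y₂]

/-- An `r`-round simulation code of block length `n` whose common randomness takes `N` values.
The encoder `enc₁ i` matters only for `i` of even index and `enc₂ i` only for `i` of odd index. -/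
structure Code (X₁ X₂ Y₁ Y₂ : Type*) [Fintype Y₁] [Fintype Y₂] (r n N : ℕ) where
  /-- The size of the alphabet of the message of each round. -/
  size : Fin r → ℕ
  /-- Randomized encodings `p(c_i | c_{<i}, x₁ⁿ, ω)` of terminal 1. -/
  enc₁ : (i : Fin r) → Past size i → (Fin n → X₁) → Fin N → Fin (size i) → ℝ
  /-- Randomized encodings `p(c_i | c_{<i}, x₂ⁿ, ω)` of terminal 2. -/
  enc₂ : (i : Fin r) → Past size i → (Fin n → X₂) → Fin N → Fin (size i) → ℝ
  /-- Randomized decoder `p(y₁ⁿ | c, x₁ⁿ, ω)` of terminal 1. -/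
  dec₁ : ((i : Fin r) → Fin (size i)) → (Fin n → X₁) → Fin N → (Fin n → Y₁) → ℝ
  /-- Randomized decoder `p(y₂ⁿ | c, x₂ⁿ, ω)` of terminal 2. -/
  dec₂ : ((i : Fin r) → Fin (size i)) → (Fin n → X₂) → Fin N → (Fin n → Y₂) → ℝ
  enc₁_mem : ∀ i : Fin r, Even i.val → ∀ c x ω, enc₁ i c x ω ∈ stdSimplex ℝ (Fin (size i))
  enc₂_mem : ∀ i : Fin r, Odd i.val → ∀ c x ω, enc₂ i c x ω ∈ stdSimplex ℝ (Fin (size i))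
  dec₁_mem : ∀ c x ω, dec₁ c x ω ∈ stdSimplex ℝ (Fin n → Y₁)
  dec₂_mem : ∀ c x ω, dec₂ c x ω ∈ stdSimplex ℝ (Fin n → Y₂)

namespace Code

variable {r n N : ℕ}

/-- The sample space of a code: `(ω, x₁ⁿ, x₂ⁿ, c, y₁ⁿ, y₂ⁿ)`. -/
abbrev Outcome (K : Code X₁ X₂ Y₁ Y₂ r n N) : Type _ :=
  Fin N × (Fin n → X₁) × (Fin n → X₂) × ((i : Fin r) → Fin (K.size i)) ×
    (Fin n → Y₁) × (Fin n → Y₂)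

/-- The joint pmf induced by a code: `ω` is uniform and independent of the i.i.d. inputs, the
messages are produced alternately by the encoders, and the outputs by the decoders. -/
def induced (K : Code X₁ X₂ Y₁ Y₂ r n N) (qX : X₁ × X₂ → ℝ) : K.Outcome → ℝ :=
  fun (ω, x₁, x₂, c, y₁, y₂) =>
    (1 / (N : ℝ)) * (∏ t, qX (x₁ t, x₂ t)) *
      (∏ i : Fin r, if Even i.val then K.enc₁ i (past c i) x₁ ω (c i)
        else K.enc₂ i (past c i) x₂ ω (c i)) *
      K.dec₁ c x₁ ω y₁ * K.dec₂ c x₂ ω y₂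

/-- The message `C_i` as a random variable. -/
def message (K : Code X₁ X₂ Y₁ Y₂ r n N) (i : Fin r) : K.Outcome → Fin (K.size i) :=
  fun (_, _, _, c, _, _) => c i

/-- The inputs and outputs `((x₁ⁿ, x₂ⁿ), (y₁ⁿ, y₂ⁿ))` as a random variable. -/
def inputOutput (K : Code X₁ X₂ Y₁ Y₂ r n N) :
    K.Outcome → ((Fin n → X₁) × (Fin n → X₂)) × ((Fin n → Y₁) × (Fin n → Y₂)) :=
  fun (_, x₁, x₂, _, y₁, y₂) => ((x₁, x₂), (y₁, y₂))

/-- `(1/n) ∑ H(C_i)` over the odd-numbered rounds (those of even index). -/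
def rate₁₂ (K : Code X₁ X₂ Y₁ Y₂ r n N) (qX : X₁ × X₂ → ℝ) : ℝ :=
  (1 / (n : ℝ)) * ∑ i : Fin r with Even i.val, entropy (K.induced qX) (K.message i)

/-- `(1/n) ∑ H(C_i)` over the even-numbered rounds (those of odd index). -/
def rate₂₁ (K : Code X₁ X₂ Y₁ Y₂ r n N) (qX : X₁ × X₂ → ℝ) : ℝ :=
  (1 / (n : ℝ)) * ∑ i : Fin r with Odd i.val, entropy (K.induced qX) (K.message i)

end Code

/-- The i.i.d. pmf `∏ q(x_t) q(y_t | x_t)` that a code of block length `n` has to imitate. -/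
def target (qX : X₁ × X₂ → ℝ) (W : X₁ × X₂ → Y₁ × Y₂ → ℝ) (n : ℕ) :
    ((Fin n → X₁) × (Fin n → X₂)) × ((Fin n → Y₁) × (Fin n → Y₂)) → ℝ :=
  fun ((x₁, x₂), (y₁, y₂)) => ∏ t, qX (x₁ t, x₂ t) * W (x₁ t, x₂ t) (y₁ t, y₂ t)

/-- The rate tuple `(R₀, R₁₂, R₂₁)` is achievable with `r` rounds. The common randomness of block
length `n` is uniform over the integers in `[1, 2^(n R₀)]`. -/
def Achievable (r : ℕ) (qX : X₁ × X₂ → ℝ) (W : X₁ × X₂ → Y₁ × Y₂ → ℝ) (R : ℝ × ℝ × ℝ) : Prop :=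
  0 ≤ R.1 ∧ 0 ≤ R.2.1 ∧ 0 ≤ R.2.2 ∧
  ∃ K : (n : ℕ) → Code X₁ X₂ Y₁ Y₂ r n ⌊(2 : ℝ) ^ ((n : ℝ) * R.1)⌋₊,
    (∀ n, 0 < n → (K n).rate₁₂ qX ≤ R.2.1 ∧ (K n).rate₂₁ qX ≤ R.2.2) ∧
    Filter.Tendsto
      (fun n => tvDist (law ((K n).induced qX) (K n).inputOutput) (target qX W n))
      Filter.atTop (nhds 0)

/-- The simulation rate region: the closure of the set of achievable tuples `(R₀, R₁₂, R₂₁)`. -/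
def simulationRegion (r : ℕ) (qX : X₁ × X₂ → ℝ) (W : X₁ × X₂ → Y₁ × Y₂ → ℝ) : Set (ℝ × ℝ × ℝ) :=
  closure {R | Achievable r qX W R}

end Codes

/-! ### The single-letter region -/

section Region

variable {X₁ X₂ Y₁ Y₂ : Type*} [Fintype X₁] [Fintype X₂] [Fintype Y₁] [Fintype Y₂] {r : ℕ}

/-- The sample space `(f_1, …, f_r, x₁, x₂, y₁, y₂)`, where `f_i` ranges over `Fin (m i)`. -/
abbrev AuxSpace (X₁ X₂ Y₁ Y₂ : Type*) (m : Fin r → ℕ) : Type _ :=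
  ((i : Fin r) → Fin (m i)) × X₁ × X₂ × Y₁ × Y₂

namespace AuxSpace

variable {m : Fin r → ℕ}

/-- All auxiliary variables `F_1, …, F_r`. -/
def F (w : AuxSpace X₁ X₂ Y₁ Y₂ m) : (i : Fin r) → Fin (m i) := w.1

/-- The single auxiliary variable of round `i`. -/
def Fi (i : Fin r) (w : AuxSpace X₁ X₂ Y₁ Y₂ m) : Fin (m i) := w.1 i

/-- The first source. -/
def x₁ (w : AuxSpace X₁ X₂ Y₁ Y₂ m) : X₁ := w.2.1

/-- The second source. -/
def x₂ (w : AuxSpace X₁ X₂ Y₁ Y₂ m) : X₂ := w.2.2.1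

/-- The first output. -/
def y₁ (w : AuxSpace X₁ X₂ Y₁ Y₂ m) : Y₁ := w.2.2.2.1

/-- The second output. -/
def y₂ (w : AuxSpace X₁ X₂ Y₁ Y₂ m) : Y₂ := w.2.2.2.2

/-- Both sources. -/
def x (w : AuxSpace X₁ X₂ Y₁ Y₂ m) : X₁ × X₂ := (x₁ w, x₂ w)

/-- Both outputs. -/
def y (w : AuxSpace X₁ X₂ Y₁ Y₂ m) : Y₁ × Y₂ := (y₁ w, y₂ w)

end AuxSpace

open AuxSpace

/-- The set `T(r)`: `p` is a pmf of `(F_1, …, F_r, X₁, X₂, Y₁, Y₂)`, with `F_i` in an alphabet of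
size `m i`, that obeys the prescribed marginal, the Markov chains and the cardinality bounds. -/
structure IsAdmissible [NeZero r] (qX : X₁ × X₂ → ℝ) (W : X₁ × X₂ → Y₁ × Y₂ → ℝ)
    (m : Fin r → ℕ) (p : AuxSpace X₁ X₂ Y₁ Y₂ m → ℝ) : Prop where
  isPMF : p ∈ stdSimplex ℝ (AuxSpace X₁ X₂ Y₁ Y₂ m)
  marginal : ∀ a b, law p (fun w => (x w, y w)) (a, b) = qX a * W a b
  markov_odd_round : ∀ i : Fin r, Even i.val →
    IsMarkov p (Fi i) (fun w => (past (F w) i, x₁ w)) x₂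
  markov_even_round : ∀ i : Fin r, Odd i.val →
    IsMarkov p (Fi i) (fun w => (past (F w) i, x₂ w)) x₁
  markov_out₁ : IsMarkov p y₁ (fun w => (F w, x₁ w)) (fun w => (x₂ w, y₂ w))
  markov_out₂ : IsMarkov p y₂ (fun w => (F w, x₂ w)) (fun w => (x₁ w, y₁ w))
  card_first : m 0 ≤
    Fintype.card X₁ * Fintype.card X₂ * Fintype.card Y₁ * Fintype.card Y₂ + 3
  card_later : ∀ i : Fin r, 0 < i → m i ≤
    Fintype.card X₁ * Fintype.card X₂ * Fintype.card Y₁ * Fintype.card Y₂ *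
      (∏ j : Fin r with j < i, m j) + 2

/-- The region `S(r)`. -/
def rateRegion (r : ℕ) [NeZero r] (qX : X₁ × X₂ → ℝ) (W : X₁ × X₂ → Y₁ × Y₂ → ℝ) :
    Set (ℝ × ℝ × ℝ) :=
  {(R₀, R₁₂, R₂₁) | 0 ≤ R₀ ∧ 0 ≤ R₁₂ ∧ 0 ≤ R₂₁ ∧
    ∃ (m : Fin r → ℕ) (p : AuxSpace X₁ X₂ Y₁ Y₂ m → ℝ), IsAdmissible qX W m p ∧
      condMutualInfo p x₁ F x₂ ≤ R₁₂ ∧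
      condMutualInfo p x₂ F x₁ ≤ R₂₁ ∧
      condMutualInfo p x₁ F x₂ + condMutualInfo p (Fi 0) y x ≤ R₀ + R₁₂ ∧
      condMutualInfo p x₁ F x₂ + condMutualInfo p x₂ F x₁ + condMutualInfo p F y x
        ≤ R₀ + R₁₂ + R₂₁}

end Region

end

end ChannelSim

/-! The two inclusions are independent: `simulationRegion_subset` is the converse,
`rateRegion_subset` the achievability.

Converse. Given a code of block length n, let T be a uniform time index independent of everything
else, and let the auxiliary variable of a round consist of T, the common randomness, the first
source before T, the second source after T, and the message of the round. With X₁ at T also given,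
at every time one of the two sources is known (likewise with X₂ at T). A swapping argument
(`IsMarkov.of_exchange`) then gives the Markov chains; the first round, which has no past to carry
the side information, needs the i.i.d. property instead. In a round of terminal 1 the message
entropy bounds the conditional entropy given X₂, in a round of terminal 2 the one given X₁, and
telescoping over the rounds yields `Code.message_entropy_bounds`. The chain rule over time turns
these into the four single-letter bounds of `Code.letter_bounds`, up to an error that vanishes
because the total variation distance does (`sum_negMulLog_ge`). So an achievable tuple satisfies the
single-letter conditions up to any slack (`IsNear`), but with alphabets that grow with n.
`IsChain.exists_card_le` shrinks them: reweighting one auxiliary variable changes conditional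
entropies given it linearly, so a Carathéodory argument leaves as many values as there are linear
constraints. After that compactness removes the slack (`mem_rateRegion_of_isNear`), which also takes
care of the closure.

Achievability is by random binning. The symbol of round i, a block of letters F_i together with a
local uniform variable, is given three random bin indices: a shared one that is fixed at the end,
one that is read off the common randomness, and one that is sent as the message. If the first two
are nearly uniform given the preceding symbols and the inputs, then drawing the indices uniformly
and the symbol conditionally on them is almost the same as drawing the symbol and computing its
indices (leftover hashing, `expect_bin_uniform_le`). If all three indices determine the symbol given
the past and either source, both terminals follow the conversation (`exists_decoder`). If the shared
indices of all rounds are jointly nearly independent of inputs and outputs, they can be fixed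
without spoiling the simulated law. `exists_oneShot` combines these for arbitrary kernels;
`exists_binningBound_le` evaluates it for i.i.d. blocks by Chernoff bounds.

The conditions on the rates are met in `achievable_add`: the shared indices take all of the entropy
of F_i given the past and both sources, the messages supply what the listener lacks, and surplus
communication rate carries fresh local randomness of the speaker, which substitutes for common
randomness. That is why R₁₂ enters the third inequality and R₂₁ only the fourth: the first round can
use the surplus of terminal 1 only. -/

set_option linter.unusedSectionVars false

namespace ChannelSim

open Classical

/-! ### Marginal laws of random variables on a finite space. -/

section Law

variable {Ω Ω' α β γ δ : Type*} [Fintype Ω] [Fintype Ω']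

lemma law_nonneg {p : Ω → ℝ} (hp : ∀ w, 0 ≤ p w) (A : Ω → α) (a : α) : 0 ≤ law p A a :=
  Finset.sum_nonneg fun w _ => by split_ifs <;> simp [hp]

lemma law_eq_filter (p : Ω → ℝ) (A : Ω → α) (a : α) : law p A a = ∑ w with A w = a, p w :=
  (Finset.sum_filter _ _).symm

lemma law_eq_sum_mul (p : Ω → ℝ) (A : Ω → α) (a : α) [∀ w, Decidable (A w = a)] :
    law p A a = ∑ w, p w * if A w = a then 1 else 0 := by
  refine Finset.sum_congr rfl fun w _ => ?_
  split_ifs <;> simp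

lemma le_law_self {p : Ω → ℝ} (hp : ∀ w, 0 ≤ p w) (A : Ω → α) (w : Ω) : p w ≤ law p A (A w) := by
  have := Finset.single_le_sum (f := fun v => if A v = A w then p v else 0)
    (fun v _ => by split_ifs <;> simp [hp]) (Finset.mem_univ w)
  simpa [law] using this

lemma law_self_pos {p : Ω → ℝ} (hp : ∀ w, 0 ≤ p w) (A : Ω → α) {w : Ω} (hw : 0 < p w) :
    0 < law p A (A w) := hw.trans_le (le_law_self hp A w)

lemma sum_law_mul [Fintype α] (p : Ω → ℝ) (A : Ω → α) (g : α → ℝ) :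
    ∑ a, law p A a * g a = ∑ w, p w * g (A w) := by
  simp only [law, Finset.sum_mul]
  rw [Finset.sum_comm]
  refine Finset.sum_congr rfl fun w _ => ?_
  simp [ite_mul]

lemma sum_law [Fintype α] (p : Ω → ℝ) (A : Ω → α) : ∑ a, law p A a = ∑ w, p w := by
  simpa using sum_law_mul p A (fun _ => 1)

lemma law_mem_stdSimplex [Fintype α] {p : Ω → ℝ} (hp : p ∈ stdSimplex ℝ Ω) (A : Ω → α) :
    law p A ∈ stdSimplex ℝ α :=
  ⟨law_nonneg hp.1 A, by rw [sum_law, hp.2]⟩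

lemma law_law [Fintype α] (p : Ω → ℝ) (A : Ω → α) (B : α → β) (b : β) :
    law (law p A) B b = law p (fun w => B (A w)) b := by
  have := sum_law_mul p A (fun a => if B a = b then 1 else 0)
  simpa [law] using this

/-- Only the partition induced by a random variable matters. All regrouping and re-encoding of
tuples goes through this kernel criterion and its entropy version `entropy_congr_ker`. -/
lemma law_congr_ker (p : Ω → ℝ) {A : Ω → α} {B : Ω → β} {w : Ω}
    (h : ∀ w', A w' = A w ↔ B w' = B w) : law p A (A w) = law p B (B w) := by
  simp only [law, h]

lemma law_comp_injective (p : Ω → ℝ) (A : Ω → α) {e : α → β} (he : Function.Injective e) (a : α) :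
    law p (fun w => e (A w)) (e a) = law p A a := by
  simp only [law, he.eq_iff]

lemma law_fst_sum [Fintype α] (p : Ω → ℝ) (A : Ω → α) (B : Ω → β) (b : β) :
    ∑ a, law p (fun w => (A w, B w)) (a, b) = law p B b := by
  simp only [law]
  rw [Finset.sum_comm]
  refine Finset.sum_congr rfl fun w _ => ?_
  simp only [Prod.mk.injEq, ite_and]
  simp

lemma law_snd_sum [Fintype β] (p : Ω → ℝ) (A : Ω → α) (B : Ω → β) (a : α) :
    ∑ b, law p (fun w => (A w, B w)) (a, b) = law p A a := by
  simp only [law]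
  rw [Finset.sum_comm]
  refine Finset.sum_congr rfl fun w _ => ?_
  by_cases h : A w = a <;> simp [h]

lemma law_pair_le_snd {p : Ω → ℝ} (hp : ∀ w, 0 ≤ p w) (A : Ω → α) (B : Ω → β) (a : α) (b : β) :
    law p (fun w => (A w, B w)) (a, b) ≤ law p B b := by
  refine Finset.sum_le_sum fun w _ => ?_
  by_cases h : A w = a <;> by_cases h' : B w = b <;> simp [h, h', hp]

lemma law_pair_le_fst {p : Ω → ℝ} (hp : ∀ w, 0 ≤ p w) (A : Ω → α) (B : Ω → β) (a : α) (b : β) :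
    law p (fun w => (A w, B w)) (a, b) ≤ law p A a := by
  refine Finset.sum_le_sum fun w _ => ?_
  by_cases h : A w = a <;> by_cases h' : B w = b <;> simp [h, h', hp]

lemma law_comp_equiv (p : Ω → ℝ) (e : Ω' ≃ Ω) (A : Ω → α) (a : α) :
    law (fun v => p (e v)) (fun v => A (e v)) a = law p A a :=
  Equiv.sum_comp e (fun w => if A w = a then p w else 0)

lemma law_le_sum {p : Ω → ℝ} (hp : ∀ w, 0 ≤ p w) (A : Ω → α) (a : α) : law p A a ≤ ∑ w, p w :=
  Finset.sum_le_sum fun w _ => by split_ifs <;> simp [hp]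

lemma continuous_law (A : Ω → α) (a : α) : Continuous fun p : Ω → ℝ => law p A a := by
  unfold law
  refine continuous_finsetSum _ fun w _ => ?_
  split_ifs
  · exact continuous_apply w
  · exact continuous_const

end Law

/-! ### Entropy inequalities and continuity. -/

section Entropy

variable {Ω Ω' α β γ δ : Type*} [Fintype Ω] [Fintype Ω'] [Fintype α] [Fintype β] [Fintype γ]
  [Fintype δ]

lemma log_two_pos : 0 < Real.log 2 := Real.log_pos (by norm_num)

/-- As a mean over sample points, entropies of variables with different alphabets become sums over
the same space and can be compared term by term. -/
lemma entropy_eq (p : Ω → ℝ) (A : Ω → α) :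
    entropy p A = (∑ w, p w * (-Real.log (law p A (A w)))) / Real.log 2 := by
  rw [entropy, ← sum_law_mul p A (fun a => -Real.log (law p A a))]
  simp [Real.negMulLog]

lemma entropy_congr_ker (p : Ω → ℝ) {A : Ω → α} {B : Ω → β}
    (h : ∀ w w', A w' = A w ↔ B w' = B w) : entropy p A = entropy p B := by
  rw [entropy_eq, entropy_eq]
  refine congrArg (· / _) (Finset.sum_congr rfl fun w _ => ?_)
  rw [law_congr_ker p (h w)]

lemma entropy_congr_law {p : Ω → ℝ} {p' : Ω' → ℝ} {A : Ω → α} {A' : Ω' → α}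
    (h : ∀ a, law p A a = law p' A' a) : entropy p A = entropy p' A' := by
  simp only [entropy, h]

lemma condEntropy_eq (p : Ω → ℝ) (A : Ω → α) (B : Ω → β) :
    condEntropy p A B = (∑ w, p w * (Real.log (law p B (B w)) -
      Real.log (law p (fun w => (A w, B w)) (A w, B w)))) / Real.log 2 := by
  rw [condEntropy, entropy_eq, entropy_eq, ← sub_div, ← Finset.sum_sub_distrib]
  exact congrArg (· / _) (Finset.sum_congr rfl fun w _ => by ring)

lemma entropy_mono {p : Ω → ℝ} (hp : ∀ w, 0 ≤ p w) {A : Ω → α} {B : Ω → β}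
    (h : ∀ w w', A w' = A w → B w' = B w) : entropy p B ≤ entropy p A := by
  rw [entropy_eq, entropy_eq]
  refine div_le_div_of_nonneg_right (Finset.sum_le_sum fun w _ => ?_) log_two_pos.le
  rcases (hp w).eq_or_lt with h0 | h0
  · simp [← h0]
  · refine mul_le_mul_of_nonneg_left (neg_le_neg ?_) (hp w)
    refine Real.log_le_log (law_self_pos hp A h0) (Finset.sum_le_sum fun v _ => ?_)
    by_cases hv : A v = A w
    · simp [hv, h w v hv]
    · simp only [hv, if_false]; split_ifs <;> simp [hp]

lemma entropy_nonneg {p : Ω → ℝ} (hp : p ∈ stdSimplex ℝ Ω) (A : Ω → α) : 0 ≤ entropy p A := by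
  refine div_nonneg (Finset.sum_nonneg fun a _ => Real.negMulLog_nonneg (law_nonneg hp.1 A a) ?_)
    log_two_pos.le
  exact (law_le_sum hp.1 A a).trans hp.2.le

/-- The key inequality behind strong subadditivity. -/
lemma entropy_submodular {p : Ω → ℝ} (hp : ∀ w, 0 ≤ p w) (A : Ω → α) (B : Ω → β) (C : Ω → γ) :
    entropy p (fun w => (A w, B w, C w)) + entropy p C ≤
      entropy p (fun w => (A w, C w)) + entropy p (fun w => (B w, C w)) := by
  simp only [entropy_eq, ← add_div, ← Finset.sum_add_distrib]
  refine div_le_div_of_nonneg_right ?_ log_two_pos.le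
  rw [← sub_nonneg, ← Finset.sum_sub_distrib]
  set q : α → β → γ → ℝ := fun a b c => law p (fun w => (A w, B w, C w)) (a, b, c) with hq
  -- The mean of this likelihood ratio is at most one, and `1 - g ≤ -log g`: nonnegativity of a
  -- relative entropy.
  set g : α × β × γ → ℝ := fun x => law p (fun w => (A w, C w)) (x.1, x.2.2) *
    law p (fun w => (B w, C w)) (x.2.1, x.2.2) /
      (q x.1 x.2.1 x.2.2 * law p C x.2.2) with hg
  have h1 : ∑ w, p w * (1 - g (A w, B w, C w)) ≥ 0 := by
    have e : ∑ w, p w * (1 - g (A w, B w, C w)) =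
        ∑ w, p w - ∑ x, law p (fun w => (A w, B w, C w)) x * g x := by
      rw [sum_law_mul, ← Finset.sum_sub_distrib]
      exact Finset.sum_congr rfl fun w _ => by ring
    rw [e, ge_iff_le, sub_nonneg]
    calc ∑ x, law p (fun w => (A w, B w, C w)) x * g x
        ≤ ∑ x : α × β × γ, law p (fun w => (A w, C w)) (x.1, x.2.2) *
          law p (fun w => (B w, C w)) (x.2.1, x.2.2) / law p C x.2.2 := by
          refine Finset.sum_le_sum fun x _ => ?_
          have n1 := law_nonneg hp (fun w => (A w, C w)) (x.1, x.2.2)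
          have n2 := law_nonneg hp (fun w => (B w, C w)) (x.2.1, x.2.2)
          have n3 := law_nonneg hp C x.2.2
          by_cases h0 : law p (fun w => (A w, B w, C w)) x = 0
          · rw [h0, zero_mul]; positivity
          · simp only [hg, hq]
            have : law p (fun w => (A w, B w, C w)) (x.1, x.2.1, x.2.2) ≠ 0 := h0
            rw [← mul_div_assoc, mul_comm (law p _ x), mul_comm (law p _ (x.1, x.2.1, x.2.2))]
            rw [mul_div_mul_right _ _ this]
      _ = ∑ c, (∑ a, law p (fun w => (A w, C w)) (a, c)) *
          (∑ b, law p (fun w => (B w, C w)) (b, c)) / law p C c := by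
          simp only [Fintype.sum_prod_type, Finset.sum_mul_sum, Finset.sum_div]
          rw [Finset.sum_comm' (s := Finset.univ) (t := fun _ => Finset.univ)
            (t' := Finset.univ) (s' := fun _ => Finset.univ) (by simp)]
          conv_rhs => rw [Finset.sum_comm' (s := Finset.univ) (t := fun _ => Finset.univ)
            (t' := Finset.univ) (s' := fun _ => Finset.univ) (by simp)]
          rw [Finset.sum_comm]
          refine Finset.sum_congr rfl fun a _ => ?_
          rw [Finset.sum_comm]
      _ ≤ ∑ c, law p C c := by
          refine Finset.sum_le_sum fun c _ => ?_
          rw [law_fst_sum, law_fst_sum]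
          exact mul_self_div_self _ |>.le
      _ = ∑ w, p w := sum_law p C
  refine h1.trans (Finset.sum_le_sum fun w _ => ?_)
  rcases (hp w).eq_or_lt with h0 | h0
  · simp [← h0]
  have l1 := law_self_pos hp (fun w => (A w, B w, C w)) h0
  have l2 := law_self_pos hp C h0
  have l3 := law_self_pos hp (fun w => (A w, C w)) h0
  have l4 := law_self_pos hp (fun w => (B w, C w)) h0
  have := Real.one_sub_inv_le_log_of_pos (x := (g (A w, B w, C w))⁻¹)
    (by simp only [hg, hq]; positivity)
  rw [inv_inv, Real.log_inv] at this
  have e : Real.log (g (A w, B w, C w)) = Real.log (law p (fun w => (A w, C w)) (A w, C w)) +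
      Real.log (law p (fun w => (B w, C w)) (B w, C w)) -
      (Real.log (law p (fun w => (A w, B w, C w)) (A w, B w, C w)) + Real.log (law p C (C w))) := by
    simp only [hg, hq]
    rw [Real.log_div (by positivity) (by positivity), Real.log_mul l3.ne' l4.ne',
      Real.log_mul l1.ne' l2.ne']
  rw [e] at this
  have := mul_le_mul_of_nonneg_left this h0.le
  linarith

lemma entropy_markov {p : Ω → ℝ} (hp : ∀ w, 0 ≤ p w) {A : Ω → α} {B : Ω → β} {C : Ω → γ}
    (h : IsMarkov p A B C) :
    entropy p (fun w => (A w, B w, C w)) + entropy p B =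
      entropy p (fun w => (A w, B w)) + entropy p (fun w => (B w, C w)) := by
  simp only [entropy_eq, ← add_div, ← Finset.sum_add_distrib]
  refine congrArg (· / _) (Finset.sum_congr rfl fun w _ => ?_)
  rcases (hp w).eq_or_lt with h0 | h0
  · simp [← h0]
  have l1 := law_self_pos hp (fun w => (A w, B w, C w)) h0
  have l2 := law_self_pos hp B h0
  have l3 := law_self_pos hp (fun w => (A w, B w)) h0
  have l4 := law_self_pos hp (fun w => (B w, C w)) h0
  have := congrArg Real.log (h (A w) (B w) (C w))
  rw [Real.log_mul l1.ne' l2.ne', Real.log_mul l3.ne' l4.ne'] at this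
  linear_combination (-p w) * this

lemma entropy_const {p : Ω → ℝ} (hp : p ∈ stdSimplex ℝ Ω) (a : α) : entropy p (fun _ => a) = 0 := by
  rw [entropy_eq]
  simp [law, hp.2]

lemma entropy_pair_le {p : Ω → ℝ} (hp : p ∈ stdSimplex ℝ Ω) (A : Ω → α) (B : Ω → β) :
    entropy p (fun w => (A w, B w)) ≤ entropy p A + entropy p B := by
  have := entropy_submodular hp.1 A B (fun _ => ())
  rw [entropy_const hp] at this
  rw [entropy_congr_ker p (A := fun w => (A w, B w)) (B := fun w => (A w, B w, ())) (by simp),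
    entropy_congr_ker p (A := A) (B := fun w => (A w, ())) (by simp),
    entropy_congr_ker p (A := B) (B := fun w => (B w, ())) (by simp)]
  linarith

/-- Jensen's inequality with uniform weights. The masses need not add up to one, because the lemma
is also applied to the part of a pmf that exceeds another pmf. -/
lemma sum_negMulLog_le {s : α → ℝ} (hs : ∀ a, 0 ≤ s a) :
    ∑ a, Real.negMulLog (s a) ≤
      (∑ a, s a) * Real.log (Fintype.card α) + Real.negMulLog (∑ a, s a) := by
  rcases isEmpty_or_nonempty α with he | he
  · simp
  have hc : (0 : ℝ) < Fintype.card α := by exact_mod_cast Fintype.card_pos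
  have key := Real.concaveOn_negMulLog.le_map_sum (t := Finset.univ)
    (w := fun _ : α => (1 / (Fintype.card α : ℝ))) (p := s) (fun _ _ => by positivity)
    (by simp [hc.ne']) (fun a _ => hs a)
  simp only [smul_eq_mul, ← Finset.mul_sum] at key
  have h2 : Real.negMulLog (1 / (Fintype.card α : ℝ) * ∑ a, s a) =
      (1 / (Fintype.card α : ℝ)) * ((∑ a, s a) * Real.log (Fintype.card α) +
        Real.negMulLog (∑ a, s a)) := by
    rw [Real.negMulLog_mul]
    simp only [Real.negMulLog, one_div, Real.log_inv]
    ring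
  rw [h2] at key
  exact le_of_mul_le_mul_left key (by positivity)

lemma entropy_le_logb_card {p : Ω → ℝ} (hp : p ∈ stdSimplex ℝ Ω) (A : Ω → α) :
    entropy p A ≤ Real.logb 2 (Fintype.card α) := by
  have := sum_negMulLog_le (s := law p A) (law_nonneg hp.1 A)
  rw [sum_law, hp.2] at this
  rw [entropy, Real.logb]
  refine div_le_div_of_nonneg_right ?_ log_two_pos.le
  simpa using this

lemma negMulLog_add_le {x y : ℝ} (hx : 0 ≤ x) (hy : 0 ≤ y) :
    Real.negMulLog (x + y) ≤ Real.negMulLog x + Real.negMulLog y := by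
  rcases hx.eq_or_lt with rfl | hx
  · simp
  rcases hy.eq_or_lt with rfl | hy
  · simp
  simp only [Real.negMulLog]
  have h1 := Real.log_le_log hx (by linarith : x ≤ x + y)
  have h2 := Real.log_le_log hy (by linarith : y ≤ x + y)
  nlinarith

/-- On the unit interval the derivative `-log t - 1` of `negMulLog` is at least `-1`. -/
lemma negMulLog_sub_le {x y : ℝ} (hx : 0 ≤ x) (hxy : x ≤ y) (hy : y ≤ 1) :
    Real.negMulLog x - (y - x) ≤ Real.negMulLog y := by
  rcases hx.eq_or_lt with rfl | hx
  · simp only [Real.negMulLog_zero]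
    have := Real.negMulLog_nonneg hxy hy
    linarith
  have hy0 : 0 < y := hx.trans_le hxy
  simp only [Real.negMulLog]
  have h1 : Real.log y - Real.log x ≤ y / x - 1 := by
    rw [← Real.log_div hy0.ne' hx.ne']
    exact Real.log_le_sub_one_of_pos (by positivity)
  have h2 : Real.log y ≤ 0 := Real.log_nonpos hy0.le hy
  have h3 : x * (Real.log y - Real.log x) ≤ y - x := by
    have := mul_le_mul_of_nonneg_left h1 hx.le
    have e : x * (y / x - 1) = y - x := by field_simp
    linarith
  nlinarith

/-- A lower bound for the entropy of a pmf close to `q` in total variation. -/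
lemma sum_negMulLog_ge {p q : α → ℝ} (hp : p ∈ stdSimplex ℝ α) (hq : q ∈ stdSimplex ℝ α) :
    ∑ a, Real.negMulLog (q a) - tvDist p q * Real.log (Fintype.card α)
      - Real.negMulLog (tvDist p q) - tvDist p q ≤ ∑ a, Real.negMulLog (p a) := by
  -- Both pmfs are compared with their overlap `min (p a) (q a)`, from which each differs by the
  -- mass `tvDist p q`. From `q` to the overlap one loses at most the entropy of the defect, by
  -- subadditivity of `negMulLog`; from the overlap to `p` at most the mass of the defect.
  have hs : ∑ a, (q a - min (p a) (q a)) = tvDist p q := by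
    have e : ∀ a, q a - min (p a) (q a) = (|p a - q a| + (q a - p a)) / 2 := by
      intro a
      rcases le_total (p a) (q a) with h | h
      · rw [min_eq_left h, abs_of_nonpos (by linarith)]; ring
      · rw [min_eq_right h, abs_of_nonneg (by linarith)]; ring
    simp only [e, ← Finset.sum_div, Finset.sum_add_distrib, Finset.sum_sub_distrib, hp.2, hq.2,
      tvDist]
    ring
  have hs' : ∑ a, (p a - min (p a) (q a)) = tvDist p q := by
    rw [← hs, Finset.sum_sub_distrib, Finset.sum_sub_distrib, hp.2, hq.2]
  have h1 := sum_negMulLog_le (s := fun a => q a - min (p a) (q a)) (fun a => by simp)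
  rw [hs] at h1
  have h2 : ∑ a, Real.negMulLog (q a) ≤ ∑ a, Real.negMulLog (min (p a) (q a)) +
      ∑ a, Real.negMulLog (q a - min (p a) (q a)) := by
    rw [← Finset.sum_add_distrib]
    refine Finset.sum_le_sum fun a _ => ?_
    have := negMulLog_add_le (x := min (p a) (q a)) (y := q a - min (p a) (q a))
      (le_min (hp.1 a) (hq.1 a)) (by simp)
    simpa using this
  have h3 : ∑ a, Real.negMulLog (min (p a) (q a)) - ∑ a, (p a - min (p a) (q a)) ≤
      ∑ a, Real.negMulLog (p a) := by
    rw [← Finset.sum_sub_distrib]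
    refine Finset.sum_le_sum fun a _ => ?_
    refine negMulLog_sub_le (le_min (hp.1 a) (hq.1 a)) (min_le_left _ _) ?_
    rw [← hp.2]
    exact Finset.single_le_sum (fun a _ => hp.1 a) (Finset.mem_univ a)
  rw [hs'] at h3
  linarith

lemma continuous_entropy (A : Ω → α) : Continuous fun p : Ω → ℝ => entropy p A := by
  unfold entropy
  exact (continuous_finsetSum _ fun a _ =>
    Real.continuous_negMulLog.comp (continuous_law A a)).div_const _

lemma continuous_condEntropy (A : Ω → α) (B : Ω → β) :
    Continuous fun p : Ω → ℝ => condEntropy p A B :=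
  (continuous_entropy _).sub (continuous_entropy _)

lemma continuous_condMutualInfo (A : Ω → α) (B : Ω → β) (C : Ω → γ) :
    Continuous fun p : Ω → ℝ => condMutualInfo p A B C :=
  (continuous_condEntropy _ _).sub (continuous_condEntropy _ _)

lemma condMutualInfo_comm (p : Ω → ℝ) (A : Ω → α) (B : Ω → β) (C : Ω → γ) :
    condMutualInfo p A B C = condMutualInfo p B A C := by
  simp only [condMutualInfo, condEntropy]
  rw [entropy_congr_ker p (A := fun w => (A w, B w, C w)) (B := fun w => (B w, A w, C w))
    (by intro w w'; simp only [Prod.mk.injEq]; tauto)]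
  ring

end Entropy

/-! ### Markov chains and their invariances. -/

section Markov

variable {Ω Ω' α β γ α' β' γ' : Type*} [Fintype Ω] [Fintype Ω']

/-- A Markov chain follows if the part of the sample point that carries `C` can be exchanged
between two sample points with the same `B`. -/
lemma IsMarkov.of_exchange {p : Ω → ℝ} {A : Ω → α} {B : Ω → β} {C : Ω → γ} (σ : Ω → Ω → Ω)
    (hσ : ∀ w w', B w = B w' → A (σ w w') = A w ∧ B (σ w w') = B w ∧ C (σ w w') = C w' ∧
      σ (σ w w') (σ w' w) = w ∧ p (σ w w') * p (σ w' w) = p w * p w') :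
    IsMarkov p A B C := by
  intro a b c
  simp only [law_eq_filter, Finset.sum_mul_sum]
  rw [← Finset.sum_product', ← Finset.sum_product']
  -- Both sides of the Markov identity sum `p w * p w'` over pairs of sample points with common `B`;
  -- the exchange is an involution between the two sets of pairs and keeps the summand.
  refine Finset.sum_nbij' (fun x => (σ x.1 x.2, σ x.2 x.1)) (fun x => (σ x.1 x.2, σ x.2 x.1))
    ?_ ?_ ?_ ?_ ?_
  · rintro ⟨w, w'⟩ h
    simp only [Finset.mem_product, Finset.mem_filter, Finset.mem_univ, true_and,
      Prod.mk.injEq] at h ⊢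
    obtain ⟨⟨h1, h2, h3⟩, h4⟩ := h
    have e := hσ w w' (h2.trans h4.symm)
    have e' := hσ w' w (h4.trans h2.symm)
    simp [e, e', h1, h2, h3, h4]
  · rintro ⟨w, w'⟩ h
    simp only [Finset.mem_product, Finset.mem_filter, Finset.mem_univ, true_and,
      Prod.mk.injEq] at h ⊢
    obtain ⟨⟨h1, h2⟩, h4, h3⟩ := h
    have e := hσ w w' (h2.trans h4.symm)
    have e' := hσ w' w (h4.trans h2.symm)
    simp [e, e', h1, h2, h3, h4]
  · rintro ⟨w, w'⟩ h
    simp only [Finset.mem_product, Finset.mem_filter, Finset.mem_univ, true_and,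
      Prod.mk.injEq] at h ⊢
    obtain ⟨⟨h1, h2, h3⟩, h4⟩ := h
    exact ⟨(hσ w w' (h2.trans h4.symm)).2.2.2.1, (hσ w' w (h4.trans h2.symm)).2.2.2.1⟩
  · rintro ⟨w, w'⟩ h
    simp only [Finset.mem_product, Finset.mem_filter, Finset.mem_univ, true_and,
      Prod.mk.injEq] at h ⊢
    obtain ⟨⟨h1, h2⟩, h4, h3⟩ := h
    exact ⟨(hσ w w' (h2.trans h4.symm)).2.2.2.1, (hσ w' w (h4.trans h2.symm)).2.2.2.1⟩
  · rintro ⟨w, w'⟩ h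
    simp only [Finset.mem_product, Finset.mem_filter, Finset.mem_univ, true_and,
      Prod.mk.injEq] at h ⊢
    obtain ⟨⟨h1, h2, h3⟩, h4⟩ := h
    exact (hσ w w' (h2.trans h4.symm)).2.2.2.2.symm

lemma IsMarkov.congr_law [Fintype α] [Fintype γ] {p : Ω → ℝ} {p' : Ω' → ℝ} {A : Ω → α}
    {B : Ω → β} {C : Ω → γ} {A' : Ω' → α} {B' : Ω' → β} {C' : Ω' → γ}
    (h : ∀ a b c, law p (fun w => (A w, B w, C w)) (a, b, c) =
      law p' (fun w => (A' w, B' w, C' w)) (a, b, c))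
    (hM : IsMarkov p A B C) : IsMarkov p' A' B' C' := by
  have h1 : ∀ b c, law p (fun w => (B w, C w)) (b, c) = law p' (fun w => (B' w, C' w)) (b, c) := by
    intro b c
    rw [← law_fst_sum p A, ← law_fst_sum p' A']
    exact Finset.sum_congr rfl fun a _ => h a b c
  have h2 : ∀ b, law p B b = law p' B' b := by
    intro b
    rw [← law_snd_sum p B C, ← law_snd_sum p' B' C']
    exact Finset.sum_congr rfl fun c _ => h1 b c
  have h3 : ∀ a b, law p (fun w => (A w, B w)) (a, b) = law p' (fun w => (A' w, B' w)) (a, b) := by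
    intro a b
    rw [← law_snd_sum p _ C, ← law_snd_sum p' _ C']
    refine Finset.sum_congr rfl fun c _ => ?_
    have e1 := law_comp_injective p (fun w => ((A w, B w), C w)) (Equiv.prodAssoc α β γ).injective
      ((a, b), c)
    have e2 := law_comp_injective p' (fun w => ((A' w, B' w), C' w))
      (Equiv.prodAssoc α β γ).injective ((a, b), c)
    rw [← e1, ← e2]
    exact h a b c
  intro a b c
  rw [← h, ← h1, ← h2, ← h3]
  exact hM a b c

lemma IsMarkov.of_law_eq [Fintype α] [Fintype γ] {p p' : Ω → ℝ} {A : Ω → α}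
    {B : Ω → β} {C : Ω → γ}
    (h : ∀ z, law p' (fun w => (A w, B w, C w)) z = law p (fun w => (A w, B w, C w)) z)
    (hM : IsMarkov p A B C) : IsMarkov p' A B C :=
  hM.congr_law fun a b c => (h (a, b, c)).symm

/-- Values that are not attained make both sides of the identity vanish, so it can be tested at
sample points; there only the partitions enter. -/
lemma isMarkov_iff_ker {p : Ω → ℝ} {A : Ω → α} {B : Ω → β} {C : Ω → γ} :
    IsMarkov p A B C ↔ ∀ w₁ w₂, B w₁ = B w₂ →
      (∑ w, if (A w = A w₁ ∧ B w = B w₁) ∧ B w = B w₂ ∧ C w = C w₂ then p w else 0) *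
        (∑ w, if B w = B w₁ then p w else 0) =
      (∑ w, if A w = A w₁ ∧ B w = B w₁ then p w else 0) *
        (∑ w, if B w = B w₂ ∧ C w = C w₂ then p w else 0) := by
  constructor
  · intro h w₁ w₂ e
    have := h (A w₁) (B w₁) (C w₂)
    simp only [law, Prod.mk.injEq] at this
    rw [← e]
    have e1 : ∀ w, ((A w = A w₁ ∧ B w = B w₁) ∧ B w = B w₁ ∧ C w = C w₂) ↔
        (A w = A w₁ ∧ B w = B w₁ ∧ C w = C w₂) := fun w => by tauto
    simpa only [e1] using this
  · intro h a b c
    by_cases h1 : ∃ w₁, A w₁ = a ∧ B w₁ = b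
    · obtain ⟨w₁, rfl, rfl⟩ := h1
      by_cases h2 : ∃ w₂, B w₁ = B w₂ ∧ C w₂ = c
      · obtain ⟨w₂, e, rfl⟩ := h2
        have := h w₁ w₂ e
        simp only [law, Prod.mk.injEq]
        rw [← e] at this
        have e1 : ∀ w, ((A w = A w₁ ∧ B w = B w₁) ∧ B w = B w₁ ∧ C w = C w₂) ↔
            (A w = A w₁ ∧ B w = B w₁ ∧ C w = C w₂) := fun w => by tauto
        simpa only [e1] using this
      · have e1 : law p (fun w => (A w, B w, C w)) (A w₁, B w₁, c) = 0 :=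
          Finset.sum_eq_zero fun w _ => if_neg fun hw => h2 ⟨w, by simp_all⟩
        have e2 : law p (fun w => (B w, C w)) (B w₁, c) = 0 :=
          Finset.sum_eq_zero fun w _ => if_neg fun hw => h2 ⟨w, by simp_all⟩
        rw [e1, e2, zero_mul, mul_zero]
    · have e1 : law p (fun w => (A w, B w, C w)) (a, b, c) = 0 :=
        Finset.sum_eq_zero fun w _ => if_neg fun hw => h1 ⟨w, by simp_all⟩
      have e2 : law p (fun w => (A w, B w)) (a, b) = 0 :=
        Finset.sum_eq_zero fun w _ => if_neg fun hw => h1 ⟨w, by simp_all⟩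
      rw [e1, e2, zero_mul, zero_mul]

/-- The hypotheses compare `(A, B)` and `(B, C)` rather than `A` and `C`: parts of `B` may be
repeated in `A` or `C` without effect. The auxiliary variables built from a code repeat their side
information in every round. -/
lemma IsMarkov.congr_ker {p : Ω → ℝ} {A : Ω → α} {B : Ω → β} {C : Ω → γ} {A' : Ω → α'}
    {B' : Ω → β'} {C' : Ω → γ'} (hM : IsMarkov p A B C)
    (hB : ∀ w w', B w' = B w ↔ B' w' = B' w)
    (hAB : ∀ w w', (A w' = A w ∧ B w' = B w) ↔ (A' w' = A' w ∧ B' w' = B' w))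
    (hBC : ∀ w w', (B w' = B w ∧ C w' = C w) ↔ (B' w' = B' w ∧ C' w' = C' w)) :
    IsMarkov p A' B' C' := by
  rw [isMarkov_iff_ker] at hM ⊢
  intro w₁ w₂ e
  have := hM w₁ w₂ ((hB _ _).2 e)
  have e1 : ∀ w, ((A w = A w₁ ∧ B w = B w₁) ∧ B w = B w₂ ∧ C w = C w₂) ↔
    ((A' w = A' w₁ ∧ B' w = B' w₁) ∧ B' w = B' w₂ ∧ C' w = C' w₂) := fun w => by
    rw [hAB, hBC]
  simp only [e1] at this
  simp only [hAB w₁, hBC w₂] at this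
  simp only [hB w₁] at this
  exact this

lemma IsMarkov.law_iff {p : Ω → ℝ} (E : Ω → Ω') {A : Ω' → α} {B : Ω' → β}
    {C : Ω' → γ} : IsMarkov (law p E) A B C ↔
      IsMarkov p (fun w => A (E w)) (fun w => B (E w)) (fun w => C (E w)) := by
  simp only [IsMarkov, law_law]

lemma entropy_law [Fintype α] (p : Ω → ℝ) (E : Ω → Ω') (A : Ω' → α) :
    entropy (law p E) A = entropy p (fun w => A (E w)) := by
  simp only [entropy, law_law]

lemma condEntropy_law [Fintype α] [Fintype β] (p : Ω → ℝ) (E : Ω → Ω') (A : Ω' → α) (B : Ω' → β) :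
    condEntropy (law p E) A B = condEntropy p (fun w => A (E w)) (fun w => B (E w)) := by
  simp only [condEntropy, entropy_law]

lemma condMutualInfo_law [Fintype α] [Fintype β] [Fintype γ] (p : Ω → ℝ) (E : Ω → Ω')
    (A : Ω' → α) (B : Ω' → β) (C : Ω' → γ) :
    condMutualInfo (law p E) A B C =
      condMutualInfo p (fun w => A (E w)) (fun w => B (E w)) (fun w => C (E w)) := by
  simp only [condMutualInfo, condEntropy_law]

end Markov

/-! ### Successive transition kernels. -/

section Kernels

variable {r : ℕ} {φ : Fin r → Type*} [∀ i, Fintype (φ i)]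

/-- A family of successive transition kernels: `k i f` is the probability of the symbol `f i`
given the preceding symbols of the tuple `f`. -/
structure IsKernel (k : Fin r → ((i : Fin r) → φ i) → ℝ) : Prop where
  nonneg : ∀ i f, 0 ≤ k i f
  congr : ∀ i f f', (∀ j ≤ i, f j = f' j) → k i f = k i f'
  sum_one : ∀ i f, ∑ a, k i (Function.update f i a) = 1

/-- The map `(f, a) ↦ (Function.update f i a, f i)` is an involution. This permits summing over one
coordinate without splitting the dependent product. -/
lemma sum_update {ι : Type*} [Fintype ι] [DecidableEq ι] {φ : ι → Type*} [∀ i, Fintype (φ i)]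
    (i : ι) (g : ((i : ι) → φ i) → ℝ) :
    ∑ f, ∑ a, g (Function.update f i a) = (Fintype.card (φ i) : ℝ) * ∑ f, g f := by
  have : ∑ x : ((i : ι) → φ i) × φ i, g (Function.update x.1 i x.2) =
      ∑ x : ((i : ι) → φ i) × φ i, g x.1 := by
    refine Finset.sum_nbij' (fun x => (Function.update x.1 i x.2, x.1 i))
      (fun x => (Function.update x.1 i x.2, x.1 i)) ?_ ?_ ?_ ?_ ?_ <;> simp
  rw [Fintype.sum_prod_type, Fintype.sum_prod_type] at this
  rw [this]
  simp [Finset.mul_sum]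

/-- The kernels from `s` on integrate to one, as uniform kernels do. Uniform kernels serve as
placeholders so that all sums stay over full tuples. -/
lemma IsKernel.sum_mul_prod [∀ i, Nonempty (φ i)] {k : Fin r → ((i : Fin r) → φ i) → ℝ}
    (hk : IsKernel k) (s : ℕ) (h : ((i : Fin r) → φ i) → ℝ)
    (hh : ∀ f f', (∀ j, j.val < s → f j = f' j) → h f = h f') :
    ∑ f, h f * ∏ j with s ≤ j.val, k j f =
      ∑ f, h f * ∏ j : Fin r with s ≤ j.val, (1 / (Fintype.card (φ j) : ℝ)) := by
  by_cases hs : r ≤ s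
  · have : ∀ j : Fin r, ¬ s ≤ j.val := fun j => by have := j.2; omega
    simp [this]
  push Not at hs
  induction hd : r - s - 1 generalizing s h with
  | zero =>
    have hsub : (Finset.univ.filter fun j : Fin r => s ≤ j.val) = {⟨s, hs⟩} := by
      ext j
      have := j.2
      simp only [Finset.mem_filter, Finset.mem_univ, true_and, Finset.mem_singleton, Fin.ext_iff]
      omega
    simp only [hsub, Finset.prod_singleton]
    have hc : (Fintype.card (φ ⟨s, hs⟩) : ℝ) ≠ 0 := by exact_mod_cast Fintype.card_ne_zero
    rw [← mul_right_inj' hc, ← sum_update (φ := φ) ⟨s, hs⟩, Finset.mul_sum]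
    refine Finset.sum_congr rfl fun f _ => ?_
    have e : ∀ a, h (Function.update f ⟨s, hs⟩ a) = h f := fun a => hh _ _ fun j hj => by
      rw [Function.update_of_ne]
      rintro rfl
      simp at hj
    simp only [e, ← Finset.mul_sum, hk.sum_one]
    field_simp
  | succ d ih =>
    have hsub : (Finset.univ.filter fun j : Fin r => s ≤ j.val) =
        insert ⟨s, hs⟩ (Finset.univ.filter fun j : Fin r => s + 1 ≤ j.val) := by
      ext j
      simp only [Finset.mem_filter, Finset.mem_univ, true_and, Finset.mem_insert, Fin.ext_iff]
      omega
    have hnot : (⟨s, hs⟩ : Fin r) ∉ (Finset.univ.filter fun j : Fin r => s + 1 ≤ j.val) := by simp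
    simp only [hsub, Finset.prod_insert hnot, ← mul_assoc]
    rw [ih (s + 1) (fun f => h f * k ⟨s, hs⟩ f) ?_ (by omega) (by omega)]
    · have hc : (Fintype.card (φ ⟨s, hs⟩) : ℝ) ≠ 0 := by exact_mod_cast Fintype.card_ne_zero
      rw [← mul_right_inj' hc, ← sum_update (φ := φ) ⟨s, hs⟩, Finset.mul_sum]
      refine Finset.sum_congr rfl fun f _ => ?_
      have e : ∀ a, h (Function.update f ⟨s, hs⟩ a) = h f := fun a => hh _ _ fun j hj => by
        rw [Function.update_of_ne]
        rintro rfl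
        simp at hj
      simp only [e, ← Finset.mul_sum, ← Finset.sum_mul, hk.sum_one]
      field_simp
    · intro f f' hf
      rw [hh f f' fun j hj => hf j (by omega), hk.congr _ f f' fun j hj => hf j ?_]
      rw [Fin.le_def] at hj
      simp at hj
      omega

lemma isKernel_uniform [∀ i, Nonempty (φ i)] :
    IsKernel (fun i (_ : (i : Fin r) → φ i) => 1 / (Fintype.card (φ i) : ℝ)) where
  nonneg _ _ := by positivity
  congr _ _ _ _ := rfl
  sum_one i _ := by
    have hc : (Fintype.card (φ i) : ℝ) ≠ 0 := by exact_mod_cast Fintype.card_ne_zero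
    simp [hc]

lemma IsKernel.sum_prod [∀ i, Nonempty (φ i)] {k : Fin r → ((i : Fin r) → φ i) → ℝ}
    (hk : IsKernel k) : ∑ f, ∏ j, k j f = 1 := by
  have := hk.sum_mul_prod 0 (fun _ => 1) (fun _ _ _ => rfl)
  simp only [zero_le, Finset.filter_true, one_mul] at this
  rw [this, Finset.sum_const, Finset.card_univ, Fintype.card_pi, nsmul_eq_mul, Nat.cast_prod,
    ← Finset.prod_mul_distrib]
  refine Finset.prod_eq_one fun i _ => ?_
  have hc : (Fintype.card (φ i) : ℝ) ≠ 0 := by exact_mod_cast Fintype.card_ne_zero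
  field_simp

lemma prod_split (s : ℕ) (g : Fin r → ℝ) :
    ∏ j, g j = (∏ j with j.val < s, g j) * ∏ j with s ≤ j.val, g j := by
  rw [← Finset.prod_filter_mul_prod_filter_not Finset.univ (fun j : Fin r => j.val < s)]
  simp

end Kernels

/-! ### Basic solutions of linear systems. -/

section Carath

variable {α ι : Type*} [Fintype α] [Fintype ι]

/-- A point of a polytope cut out by `card ι` linear equations can be replaced by one with at most
`card ι` nonzero coordinates on which a given linear functional is not larger. -/
lemma exists_small_support (v : α → ι → ℝ) (c : α → ℝ) (l : ι → ℝ) (S : Finset α)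
    (hl : ∀ a ∈ S, 0 < ∑ i, l i * v a i) (x : α → ℝ) (hx : ∀ a, 0 ≤ x a)
    (hxS : ∀ a, a ∉ S → x a = 0) :
    ∃ (T : Finset α) (y : α → ℝ), T ⊆ S ∧ T.card ≤ Fintype.card ι ∧ (∀ a, 0 ≤ y a) ∧
      (∀ a, a ∉ T → y a = 0) ∧
      (∀ i, ∑ a, y a * v a i = ∑ a, x a * v a i) ∧ ∑ a, y a * c a ≤ ∑ a, x a * c a := by
  induction hn : S.card using Nat.strong_induction_on generalizing S x with
  | _ n ih =>
  by_cases hS : S.card ≤ Fintype.card ι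
  · exact ⟨S, x, subset_rfl, hS, hx, hxS, fun _ => rfl, le_rfl⟩
  push Not at hS
  -- More vectors than equations: there is a linear dependence supported on `S`.
  obtain ⟨μ, hμ0, a₀, ha₀, hμa⟩ : ∃ μ : α → ℝ, (∀ i, ∑ a ∈ S, μ a * v a i = 0) ∧
      ∃ a ∈ S, μ a ≠ 0 := by
    have hd : ¬ LinearIndependent ℝ (fun a : S => v a) := by
      intro h
      have := h.fintype_card_le_finrank
      simp at this
      omega
    rw [Fintype.not_linearIndependent_iff] at hd
    obtain ⟨g, hg, a, ha⟩ := hd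
    refine ⟨fun a => if h : a ∈ S then g ⟨a, h⟩ else 0, fun i => ?_, a, a.2, by simpa using ha⟩
    have := congrFun hg i
    simp only [Finset.sum_apply, Pi.smul_apply, smul_eq_mul, Pi.zero_apply] at this
    rw [← this, ← Finset.sum_coe_sort]
    exact Finset.sum_congr rfl fun a _ => by simp
  -- The sign is chosen so that moving along `-ν` does not raise the objective. Because of the
  -- positive functional `l`, a nonzero dependence cannot be nonpositive on `S`, so either sign has
  -- a positive coordinate.
  obtain ⟨ν, hν0, a₁, ha₁, hν1, hνc⟩ : ∃ ν : α → ℝ, (∀ i, ∑ a ∈ S, ν a * v a i = 0) ∧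
      ∃ a ∈ S, 0 < ν a ∧ 0 ≤ ∑ a ∈ S, ν a * c a := by
    have pos : ∀ ν : α → ℝ, (∀ i, ∑ a ∈ S, ν a * v a i = 0) → (∃ a ∈ S, ν a ≠ 0) →
        ∃ a ∈ S, 0 < ν a := by
      intro ν h ⟨a, ha, hne⟩
      by_contra! hcon
      have e : ∑ a ∈ S, ν a * ∑ i, l i * v a i = 0 := by
        simp only [Finset.mul_sum]
        rw [Finset.sum_comm]
        refine Finset.sum_eq_zero fun i _ => ?_
        rw [← mul_zero (l i), ← h i, Finset.mul_sum]
        exact Finset.sum_congr rfl fun a _ => by ring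
      rw [Finset.sum_eq_zero_iff_of_nonpos fun a ha =>
        mul_nonpos_of_nonpos_of_nonneg (hcon a ha) (hl a ha).le] at e
      exact hne ((mul_eq_zero.1 (e a ha)).resolve_right (hl a ha).ne')
    rcases le_total 0 (∑ a ∈ S, μ a * c a) with h | h
    · obtain ⟨a, ha, h'⟩ := pos μ hμ0 ⟨a₀, ha₀, hμa⟩
      exact ⟨μ, hμ0, a, ha, h', h⟩
    · have h0 : ∀ i, ∑ a ∈ S, (-μ a) * v a i = 0 := by simp [hμ0]
      obtain ⟨a, ha, h'⟩ := pos (fun a => -μ a) h0 ⟨a₀, ha₀, by simpa using hμa⟩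
      exact ⟨fun a => -μ a, h0, a, ha, h', by simpa using h⟩
  -- Ratio test: the longest step along `-ν` that keeps `x` nonnegative annihilates the coordinate
  -- `b`.
  obtain ⟨b, hb, hmin⟩ := Finset.exists_min_image (S.filter fun a => 0 < ν a) (fun a => x a / ν a)
    ⟨a₁, by simp [ha₁, hν1]⟩
  simp only [Finset.mem_filter] at hb hmin
  set t := x b / ν b with ht
  have ht0 : 0 ≤ t := div_nonneg (hx b) hb.2.le
  obtain ⟨T, y, hT, hTc, hy, hyT, hyv, hyc⟩ := ih (S.erase b).card
    (by rw [← hn]; exact Finset.card_erase_lt_of_mem hb.1) (S.erase b)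
    (fun a ha => hl a (Finset.mem_of_mem_erase ha))
    (fun a => if a ∈ S then x a - t * ν a else 0) (by
      intro a
      split_ifs with ha
      · rcases lt_or_ge 0 (ν a) with h | h
        · have := hmin a ⟨ha, h⟩
          rw [le_div_iff₀ h] at this
          linarith
        · have := hx a
          nlinarith
      · exact le_rfl) (by
      intro a ha
      split_ifs with h
      · have : a = b := by
          by_contra hne
          exact ha (Finset.mem_erase.2 ⟨hne, h⟩)
        subst this
        rw [ht, div_mul_cancel₀ _ hb.2.ne', sub_self]
      · rfl) rfl
  have key : ∀ u : α → ℝ, ∑ a, (if a ∈ S then x a - t * ν a else 0) * u a =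
      ∑ a, x a * u a - t * ∑ a ∈ S, ν a * u a := by
    intro u
    rw [Finset.mul_sum, ← Finset.sum_subset (Finset.subset_univ S) (f := fun a => x a * u a)
      (fun a _ ha => by rw [hxS a ha, zero_mul]), ← Finset.sum_sub_distrib]
    simp only [ite_mul, zero_mul, Finset.sum_ite_mem, Finset.univ_inter]
    exact Finset.sum_congr rfl fun a _ => by ring
  refine ⟨T, y, hT.trans (Finset.erase_subset _ _), hTc, hy, hyT, fun i => ?_, ?_⟩
  · rw [hyv i, key, hν0 i, mul_zero, sub_zero]
  · rw [key] at hyc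
    have := mul_nonneg ht0 hνc
    linarith

end Carath

/-! ### Reweighting the values of one random variable. -/

section Reweight

variable {Ω α β γ ζ : Type*} [Fintype Ω]

lemma law_reweight (p : Ω → ℝ) {G : Ω → α} {A : Ω → β} (g : β → α) (hg : ∀ w, G w = g (A w))
    (l : α → ℝ) (b : β) : law (fun w => l (G w) * p w) A b = l (g b) * law p A b := by
  simp only [law, Finset.mul_sum]
  refine Finset.sum_congr rfl fun w _ => ?_
  split_ifs with h
  · rw [hg, h]
  · simp

lemma IsMarkov.reweight {p : Ω → ℝ} {G : Ω → ζ} {A : Ω → α} {B : Ω → β} {C : Ω → γ}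
    (h : IsMarkov p A B C) (g : β → ζ) (hg : ∀ w, G w = g (B w)) (l : ζ → ℝ) :
    IsMarkov (fun w => l (G w) * p w) A B C := by
  intro a b c
  rw [law_reweight p (A := fun w => (A w, B w, C w)) (fun x => g x.2.1) hg,
    law_reweight p (A := fun w => (A w, B w)) (fun x => g x.2) hg,
    law_reweight p (A := fun w => (B w, C w)) (fun x => g x.1) hg, law_reweight p g hg]
  linear_combination (l (g b)) ^ 2 * h a b c

lemma law_comp_congr {Ω' : Type*} [Fintype Ω'] [Fintype β] {p : Ω → ℝ} {p' : Ω' → ℝ} {A : Ω → β}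
    {A' : Ω' → β} (h : ∀ b, law p A b = law p' A' b) (g : β → γ) (c : γ) :
    law p (fun w => g (A w)) c = law p' (fun w => g (A' w)) c := by
  rw [← law_law p A g, ← law_law p' A' g, funext h]

/-- Since `G` is a function of the conditioning variable, both laws inside the logarithms are scaled
by the same factor, which cancels. Conditional entropy is therefore linear in the weights `l` and
can serve as a linear constraint. -/
lemma condEntropy_reweight [Fintype α] [Fintype β] {p : Ω → ℝ} (hp : ∀ w, 0 ≤ p w) {G : Ω → ζ}
    (A : Ω → α) {B : Ω → β} (g : β → ζ) (hg : ∀ w, G w = g (B w)) (l : ζ → ℝ) :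
    condEntropy (fun w => l (G w) * p w) A B = ∑ w, l (G w) * p w *
      ((Real.log (law p B (B w)) -
        Real.log (law p (fun w => (A w, B w)) (A w, B w))) / Real.log 2) := by
  rw [condEntropy_eq, Finset.sum_div]
  refine Finset.sum_congr rfl fun w _ => ?_
  rw [law_reweight p (A := fun w => (A w, B w)) (fun x => g x.2) hg, law_reweight p g hg,
    mul_div_assoc]
  rcases (hp w).eq_or_lt with h0 | h0
  · simp [← h0]
  by_cases hl : l (G w) = 0
  · simp [hl]
  have l2 := law_self_pos hp B h0
  have l3 := law_self_pos hp (fun w => (A w, B w)) h0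
  rw [← hg, Real.log_mul hl l2.ne', Real.log_mul hl l3.ne']
  ring

lemma condEntropy_eq_sum [Fintype α] [Fintype β] (p : Ω → ℝ) (A : Ω → α) (B : Ω → β) :
    condEntropy p A B = ∑ w, p w * ((Real.log (law p B (B w)) -
        Real.log (law p (fun w => (A w, B w)) (A w, B w))) / Real.log 2) := by
  rw [condEntropy_eq, Finset.sum_div]
  exact Finset.sum_congr rfl fun w _ => mul_div_assoc _ _ _

lemma entropy_comp_congr {Ω' : Type*} [Fintype Ω'] [Fintype β] [Fintype γ] {p : Ω → ℝ}
    {p' : Ω' → ℝ} {A : Ω → β} {A' : Ω' → β} (h : ∀ b, law p A b = law p' A' b) (g : β → γ) :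
    entropy p (fun w => g (A w)) = entropy p' (fun w => g (A' w)) :=
  entropy_congr_law fun c => law_comp_congr h g c

/-- Reweighting a random variable `G` so that few of its values are used, while the law of `Z` and
the expectations of `e` functions are kept and another expectation does not grow. -/
lemma exists_reweight [Fintype α] [Fintype ζ] {p : Ω → ℝ} (hp : ∀ w, 0 ≤ p w) (G : Ω → α)
    (Z : Ω → ζ) (T : Finset ζ) (hT : ∀ w, p w ≠ 0 → Z w ∈ T) (e : ℕ) (u : Fin e → Ω → ℝ)
    (c : Ω → ℝ) :
    ∃ (S : Finset α) (l : α → ℝ), S.card ≤ T.card + e ∧ (∀ a, 0 ≤ l a) ∧ (∀ a, a ∉ S → l a = 0) ∧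
      (∀ z, law (fun w => l (G w) * p w) Z z = law p Z z) ∧
      (∀ k, ∑ w, l (G w) * p w * u k w = ∑ w, p w * u k w) ∧
      ∑ w, l (G w) * p w * c w ≤ ∑ w, p w * c w := by
  set S₀ := Finset.univ.filter fun a => 0 < law p G a with hS₀
  have hout : ∀ a, a ∉ S₀ → ∀ w, G w = a → p w = 0 := by
    rintro a ha w rfl
    by_contra hne
    exact ha (by simpa [hS₀] using law_self_pos hp G (lt_of_le_of_ne (hp w) (Ne.symm hne)))
  have key : ∀ (h : Ω → ℝ) (l : α → ℝ),
      ∑ a, l a * law (fun w => p w * h w) G a = ∑ w, l (G w) * p w * h w := by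
    intro h l
    simp only [mul_comm (l _)]
    rw [sum_law_mul]
    exact Finset.sum_congr rfl fun w _ => by ring
  have hx : ∀ h : Ω → ℝ, ∑ w, (if G w ∈ S₀ then (1 : ℝ) else 0) * p w * h w = ∑ w, p w * h w := by
    intro h
    refine Finset.sum_congr rfl fun w _ => ?_
    split_ifs with hw
    · ring
    · simp [hout _ hw w rfl]
  have hlaw : ∀ (l : α → ℝ) (z : ζ), ∑ w, l (G w) * p w * (if Z w = z then (1 : ℝ) else 0) =
      law (fun w => l (G w) * p w) Z z := by
    intro l z
    simp [law]
  -- The unknowns are the weights of the values of `G`, with unit weights as the starting point. The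
  -- equations for the law of `Z` add up to the mass of each value, which gives the required
  -- positive functional.
  obtain ⟨S, l, -, hSc, hl0, hlS, hlv, hlc⟩ := exists_small_support
    (fun a (i : T ⊕ Fin e) => Sum.elim
      (fun z => law (fun w => p w * (if Z w = z.1 then (1 : ℝ) else 0)) G a)
      (fun k => law (fun w => p w * u k w) G a) i)
    (fun a => law (fun w => p w * c w) G a) (Sum.elim (fun _ => 1) (fun _ => 0)) S₀ (by
      intro a ha
      simp only [Fintype.sum_sum_type, Sum.elim_inl, Sum.elim_inr, one_mul, zero_mul,
        Finset.sum_const_zero, add_zero]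
      have : ∑ z : T, law (fun w => p w * (if Z w = z.1 then (1 : ℝ) else 0)) G a = law p G a := by
        simp only [law]
        rw [Finset.sum_comm]
        refine Finset.sum_congr rfl fun w _ => ?_
        split_ifs with h
        · by_cases hw : p w = 0
          · simp [hw]
          rw [Finset.sum_coe_sort T (fun z => p w * (if Z w = z then (1 : ℝ) else 0))]
          simp [hT w hw]
        · simp
      rw [this]
      exact (Finset.mem_filter.1 ha).2)
    (fun a => if a ∈ S₀ then 1 else 0) (fun a => by split_ifs <;> norm_num)
    (fun a ha => if_neg ha)
  refine ⟨S, l, by simpa using hSc, hl0, hlS, fun z => ?_, fun k => ?_, ?_⟩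
  · by_cases hz : z ∈ T
    · have := hlv (Sum.inl ⟨z, hz⟩)
      simp only [Sum.elim_inl, key] at this
      rw [hlaw, hx] at this
      rw [this]
      simp [law]
    · have : ∀ w, Z w = z → p w = 0 := fun w hw => by
        by_contra hne
        exact hz (hw ▸ hT w hne)
      simp only [law]
      refine Finset.sum_congr rfl fun w _ => ?_
      split_ifs with h
      · simp [this w h]
      · rfl
  · have := hlv (Sum.inr k)
    simp only [Sum.elim_inr, key] at this
    rw [this, hx]
  · simp only [key] at hlc
    rw [hx] at hlc
    exact hlc

end Reweight

/-! ### Cardinality bounds and the passage to the limit. -/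

section Cardinality

variable {X₁ X₂ Y₁ Y₂ : Type*} [Fintype X₁] [Fintype X₂] [Fintype Y₁] [Fintype Y₂] {r : ℕ}
  {m : Fin r → ℕ}

open AuxSpace

/-- The pmfs that obey the Markov chains of `T(r)`. -/
structure IsChain (p : AuxSpace X₁ X₂ Y₁ Y₂ m → ℝ) : Prop where
  isPMF : p ∈ stdSimplex ℝ (AuxSpace X₁ X₂ Y₁ Y₂ m)
  markov_odd_round : ∀ i : Fin r, Even i.val →
    IsMarkov p (Fi i) (fun w => (past (F w) i, x₁ w)) x₂
  markov_even_round : ∀ i : Fin r, Odd i.val →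
    IsMarkov p (Fi i) (fun w => (past (F w) i, x₂ w)) x₁
  markov_out₁ : IsMarkov p y₁ (fun w => (F w, x₁ w)) (fun w => (x₂ w, y₂ w))
  markov_out₂ : IsMarkov p y₂ (fun w => (F w, x₂ w)) (fun w => (x₁ w, y₁ w))

/-- For a round before `s` the variables of the chain are functions of those with preserved law. At
round `s` the weight only multiplies the law of `F_s`, the joint law of past and inputs being
preserved. After `s` the weight is a function of the conditioning variable. -/
lemma IsMarkov.reweight_round {p : AuxSpace X₁ X₂ Y₁ Y₂ m → ℝ} (s i : Fin r) {ξ η : Type*}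
    [Fintype ξ] [Fintype η]
    (gx : X₁ × X₂ → ξ) (gy : X₁ × X₂ → η)
    (h : IsMarkov p (Fi i) (fun w => (past (F w) i, gx (x w))) (fun w => gy (x w)))
    (l : Fin (m s) → ℝ)
    (hl : ∀ z, law (fun w => l (Fi s w) * p w) (fun w => (past (F w) s, x w, y w)) z =
      law p (fun w => (past (F w) s, x w, y w)) z) :
    IsMarkov (fun w => l (Fi s w) * p w) (Fi i) (fun w => (past (F w) i, gx (x w)))
      (fun w => gy (x w)) := by
  rcases lt_trichotomy i s with his | rfl | his
  · refine IsMarkov.congr_law (fun a b c => ?_) h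
    exact (law_comp_congr hl (fun z : Past m s × (X₁ × X₂) × (Y₁ × Y₂) =>
      (z.1 ⟨i, his⟩, ((fun j => z.1 ⟨j, j.2.trans his⟩ : Past m i), gx z.2.1), gy z.2.1))
      (a, b, c)).symm
  · intro a b c
    have e1 := law_comp_congr hl (fun z : Past m i × (X₁ × X₂) × (Y₁ × Y₂) =>
      (z.1, gx z.2.1)) b
    have e2 := law_comp_congr hl (fun z : Past m i × (X₁ × X₂) × (Y₁ × Y₂) =>
      ((z.1, gx z.2.1), gy z.2.1)) (b, c)
    dsimp only at e1 e2
    rw [e1, e2, law_reweight p (G := Fi i) (A := fun w => (Fi i w, (past (F w) i, gx (x w)),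
      gy (x w))) (fun z => z.1) (fun _ => rfl), law_reweight p (G := Fi i)
      (A := fun w => (Fi i w, (past (F w) i, gx (x w)))) (fun z => z.1) (fun _ => rfl)]
    linear_combination (l a) * h a b c
  · exact h.reweight (fun b => b.1 ⟨s, his⟩) (fun _ => rfl) l

lemma IsChain.reweight {p : AuxSpace X₁ X₂ Y₁ Y₂ m → ℝ} (hp : IsChain p) (s : Fin r)
    (l : Fin (m s) → ℝ) (hl0 : ∀ a, 0 ≤ l a)
    (hl : ∀ z, law (fun w => l (Fi s w) * p w) (fun w => (past (F w) s, x w, y w)) z =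
      law p (fun w => (past (F w) s, x w, y w)) z) :
    IsChain (fun w => l (Fi s w) * p w) where
  isPMF := by
    refine ⟨fun w => mul_nonneg (hl0 _) (hp.isPMF.1 w), ?_⟩
    rw [← sum_law _ (fun w => (past (F w) s, x w, y w)), Finset.sum_congr rfl fun z _ => hl z,
      sum_law, hp.isPMF.2]
  markov_odd_round i hi :=
    IsMarkov.reweight_round s i Prod.fst Prod.snd (hp.markov_odd_round i hi) l hl
  markov_even_round i hi :=
    IsMarkov.reweight_round s i Prod.snd Prod.fst (hp.markov_even_round i hi) l hl
  markov_out₁ := hp.markov_out₁.reweight (fun b => b.1 s) (fun _ => rfl) l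
  markov_out₂ := hp.markov_out₂.reweight (fun b => b.1 s) (fun _ => rfl) l

/-- The round-`i` cardinality bound. -/
def cardBound (X₁ X₂ Y₁ Y₂ : Type*) [Fintype X₁] [Fintype X₂] [Fintype Y₁] [Fintype Y₂]
    (c : Fin r → ℕ) (i : Fin r) : ℕ :=
  Fintype.card X₁ * Fintype.card X₂ * Fintype.card Y₁ * Fintype.card Y₂ *
    (∏ j : Fin r with j < i, c j) + if i.val = 0 then 3 else 2

/-- Keeping the law of `(F_1, …, F_{s-1}, X, Y)` takes one equation per possible value, and the
informations about the two sources take two more. The information of the first auxiliary variable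
about the outputs takes a third equation in the first round only. The information of all of `F`
about the outputs need not be kept exactly, so it is the objective and costs no equation. -/
lemma IsChain.exists_reduction_step [NeZero r] {p : AuxSpace X₁ X₂ Y₁ Y₂ m → ℝ} (hp : IsChain p)
    (s : Fin r) (S : (i : Fin r) → Finset (Fin (m i))) (hS : ∀ w, p w ≠ 0 → ∀ i, w.1 i ∈ S i) :
    ∃ (T : Finset (Fin (m s))) (p' : AuxSpace X₁ X₂ Y₁ Y₂ m → ℝ), IsChain p' ∧
      T.card ≤ cardBound X₁ X₂ Y₁ Y₂ (fun i => (S i).card) s ∧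
      (∀ w, p' w ≠ 0 → w.1 s ∈ T ∧ ∀ i, w.1 i ∈ S i) ∧
      (∀ z, law p' (fun w => (x w, y w)) z = law p (fun w => (x w, y w)) z) ∧
      condMutualInfo p' x₁ F x₂ = condMutualInfo p x₁ F x₂ ∧
      condMutualInfo p' x₂ F x₁ = condMutualInfo p x₂ F x₁ ∧
      condMutualInfo p' (Fi 0) y x = condMutualInfo p (Fi 0) y x ∧
      condMutualInfo p' F y x ≤ condMutualInfo p F y x := by
  have hp0 := hp.isPMF.1
  let cA : AuxSpace X₁ X₂ Y₁ Y₂ m → ℝ := fun w => (Real.log (law p (fun w => (F w, x₂ w))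
    (F w, x₂ w)) - Real.log (law p (fun w => (x₁ w, F w, x₂ w)) (x₁ w, F w, x₂ w))) / Real.log 2
  let cB : AuxSpace X₁ X₂ Y₁ Y₂ m → ℝ := fun w => (Real.log (law p (fun w => (F w, x₁ w))
    (F w, x₁ w)) - Real.log (law p (fun w => (x₂ w, F w, x₁ w)) (x₂ w, F w, x₁ w))) / Real.log 2
  let cC : AuxSpace X₁ X₂ Y₁ Y₂ m → ℝ := fun w => (Real.log (law p (fun w => (Fi 0 w, x w))
    (Fi 0 w, x w)) - Real.log (law p (fun w => (y w, Fi 0 w, x w)) (y w, Fi 0 w, x w))) /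
      Real.log 2
  let cD : AuxSpace X₁ X₂ Y₁ Y₂ m → ℝ := fun w => (Real.log (law p (fun w => (F w, x w))
    (F w, x w)) - Real.log (law p (fun w => (y w, F w, x w)) (y w, F w, x w))) / Real.log 2
  let e := if s.val = 0 then 3 else 2
  let u : Fin e → AuxSpace X₁ X₂ Y₁ Y₂ m → ℝ := fun k =>
    if k.val = 0 then cA else if k.val = 1 then cB else cC
  have he2 : 2 ≤ e := by simp only [e]; split_ifs <;> norm_num
  let T₀ : Finset (Past m s × (X₁ × X₂) × (Y₁ × Y₂)) :=
    (Fintype.piFinset fun j : {j : Fin r // j < s} => S j) ×ˢ Finset.univ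
  -- The mean of `cD` is the entropy of the outputs given `F` and the inputs. It must not decrease,
  -- hence the sign.
  obtain ⟨T, l, hTc, hl0, hlT, hlaw, hlu, hlc⟩ := exists_reweight hp0 (Fi s)
    (fun w => (past (F w) s, x w, y w)) T₀ (fun w hw => by
      simp only [T₀, Finset.mem_product, Fintype.mem_piFinset, Finset.mem_univ, and_true]
      exact fun j => hS w hw j) e u (fun w => -cD w)
  set p' : AuxSpace X₁ X₂ Y₁ Y₂ m → ℝ := fun w => l (Fi s w) * p w with hp'
  have hA : condMutualInfo p' x₁ F x₂ = condMutualInfo p x₁ F x₂ := by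
    have h1 : condEntropy p' x₁ (fun w => (F w, x₂ w)) = condEntropy p x₁ (fun w => (F w, x₂ w)) := by
      rw [condEntropy_eq_sum p]
      exact (condEntropy_reweight hp0 (G := Fi s) x₁ (B := fun w => (F w, x₂ w))
        (fun b => b.1 s) (fun _ => rfl) l).trans (hlu ⟨0, by omega⟩)
    rw [condMutualInfo, condMutualInfo, h1, condEntropy, condEntropy]
    rw [show entropy p' (fun w => (x₁ w, x₂ w)) = _ from entropy_comp_congr hlaw (fun z => z.2.1),
      show entropy p' x₂ = _ from entropy_comp_congr hlaw (fun z => z.2.1.2)]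
    rfl
  have hB : condMutualInfo p' x₂ F x₁ = condMutualInfo p x₂ F x₁ := by
    have h1 : condEntropy p' x₂ (fun w => (F w, x₁ w)) = condEntropy p x₂ (fun w => (F w, x₁ w)) := by
      rw [condEntropy_eq_sum p]
      exact (condEntropy_reweight hp0 (G := Fi s) x₂ (B := fun w => (F w, x₁ w))
        (fun b => b.1 s) (fun _ => rfl) l).trans (hlu ⟨1, by omega⟩)
    rw [condMutualInfo, condMutualInfo, h1, condEntropy, condEntropy]
    rw [show entropy p' (fun w => (x₂ w, x₁ w)) = _ from entropy_comp_congr hlaw (fun z => z.2.1.swap),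
      show entropy p' x₁ = _ from entropy_comp_congr hlaw (fun z => z.2.1.1)]
    rfl
  have hyx : condEntropy p' y x = condEntropy p y x := by
    rw [condEntropy, condEntropy,
      show entropy p' (fun w => (y w, x w)) = _ from entropy_comp_congr hlaw (fun z => (z.2.2, z.2.1)),
      show entropy p' x = _ from entropy_comp_congr hlaw (fun z => z.2.1)]
  have hC : condMutualInfo p' (Fi 0) y x = condMutualInfo p (Fi 0) y x := by
    rw [condMutualInfo_comm, condMutualInfo_comm p, condMutualInfo, condMutualInfo, hyx]
    congr 1
    rcases eq_or_ne s 0 with hs | hs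
    · subst hs
      rw [condEntropy_eq_sum p]
      exact (condEntropy_reweight hp0 (G := Fi 0) y (B := fun w => (Fi 0 w, x w))
        (fun b => b.1) (fun _ => rfl) l).trans (hlu ⟨2, by simp [e]⟩)
    -- After the first round, `Fi 0` belongs to the past, whose joint law with inputs and outputs is
    -- preserved.
    · have h0 : (0 : Fin r) < s := Fin.pos_iff_ne_zero.2 hs
      rw [condEntropy, condEntropy]
      congr 1
      · exact entropy_congr_law fun a => law_comp_congr hlaw
          (fun z => (z.2.2, (z.1 ⟨0, h0⟩, z.2.1))) a
      · exact entropy_congr_law fun a => law_comp_congr hlaw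
          (fun z => (z.1 ⟨0, h0⟩, z.2.1)) a
  have hD : condMutualInfo p' F y x ≤ condMutualInfo p F y x := by
    rw [condMutualInfo_comm, condMutualInfo_comm p, condMutualInfo, condMutualInfo, hyx]
    refine sub_le_sub_left ?_ _
    rw [condEntropy_eq_sum p]
    simp only [mul_neg, Finset.sum_neg_distrib, neg_le_neg_iff] at hlc
    exact hlc.trans (condEntropy_reweight hp0 (G := Fi s) y (B := fun w => (F w, x w))
        (fun b => b.1 s) (fun _ => rfl) l).ge
  refine ⟨T, p', hp.reweight s l hl0 hlaw, ?_, fun w hw => ⟨?_, hS w ?_⟩, fun z => ?_,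
    hA, hB, hC, hD⟩
  · refine hTc.trans (le_of_eq ?_)
    have : ∏ j : {j : Fin r // j < s}, (S j).card = ∏ j : Fin r with j < s, (S j).card := by
      rw [Finset.prod_subtype (p := fun j => j < s)]
      simp
    simp only [T₀, Finset.card_product, Fintype.card_piFinset, Finset.card_univ, Fintype.card_prod,
      this, cardBound, e]
    ring
  · by_contra h
    exact hw (by simp only [hp']; rw [show l (Fi s w) = 0 from hlT _ h, zero_mul])
  · intro h
    exact hw (by simp only [hp', h, mul_zero])
  · exact law_comp_congr hlaw (fun z => z.2) z

/-- The rounds are treated in increasing order: the bound of a round refers to the already reduced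
alphabets of the preceding rounds, and reducing a later one does not disturb it. -/
lemma IsChain.exists_support [NeZero r] {p : AuxSpace X₁ X₂ Y₁ Y₂ m → ℝ} (hp : IsChain p) (s : ℕ)
    (hs : s ≤ r) :
    ∃ (S : (i : Fin r) → Finset (Fin (m i))) (p' : AuxSpace X₁ X₂ Y₁ Y₂ m → ℝ), IsChain p' ∧
      (∀ i : Fin r, i.val < s → (S i).card ≤ cardBound X₁ X₂ Y₁ Y₂ (fun i => (S i).card) i) ∧
      (∀ w, p' w ≠ 0 → ∀ i, w.1 i ∈ S i) ∧
      (∀ z, law p' (fun w => (x w, y w)) z = law p (fun w => (x w, y w)) z) ∧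
      condMutualInfo p' x₁ F x₂ = condMutualInfo p x₁ F x₂ ∧
      condMutualInfo p' x₂ F x₁ = condMutualInfo p x₂ F x₁ ∧
      condMutualInfo p' (Fi 0) y x = condMutualInfo p (Fi 0) y x ∧
      condMutualInfo p' F y x ≤ condMutualInfo p F y x := by
  induction s with
  | zero => exact ⟨fun _ => Finset.univ, p, hp, by simp, by simp, by simp, rfl, rfl, rfl, le_rfl⟩
  | succ s ih =>
    obtain ⟨S, p₁, h1, h2, h3, h4, h5, h6, h7, h8⟩ := ih (by omega)
    obtain ⟨T, p₂, k1, k2, k3, k4, k5, k6, k7, k8⟩ := h1.exists_reduction_step ⟨s, hs⟩ S h3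
    have hb : ∀ i : Fin r, i.val ≤ s →
        cardBound X₁ X₂ Y₁ Y₂ (fun i => (Function.update S ⟨s, hs⟩ T i).card) i =
          cardBound X₁ X₂ Y₁ Y₂ (fun i => (S i).card) i := by
      intro i hi
      simp only [cardBound]
      congr 2
      refine Finset.prod_congr rfl fun j hj => ?_
      simp only [Finset.mem_filter, Finset.mem_univ, true_and, Fin.lt_def] at hj
      rw [Function.update_of_ne]
      rintro rfl
      simp only at hj
      omega
    refine ⟨Function.update S ⟨s, hs⟩ T, p₂, k1, fun i hi => ?_, fun w hw i => ?_,
      fun z => (k4 z).trans (h4 z), k5.trans h5, k6.trans h6, k7.trans h7, k8.trans h8⟩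
    · rw [hb i (by omega)]
      by_cases his : i = ⟨s, hs⟩
      · subst his
        simpa using k2
      · rw [Function.update_of_ne his]
        refine h2 i (lt_of_le_of_ne (by omega) ?_)
        intro h
        exact his (Fin.ext h)
    · by_cases his : i = ⟨s, hs⟩
      · subst his
        simpa using (k3 w hw).1
      · rw [Function.update_of_ne his]
        exact (k3 w hw).2 i

lemma condMutualInfo_congr_ker {Ω α β γ α' β' γ' : Type*} [Fintype Ω] [Fintype α] [Fintype β]
    [Fintype γ] [Fintype α'] [Fintype β'] [Fintype γ'] (p : Ω → ℝ) {A : Ω → α} {B : Ω → β}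
    {C : Ω → γ} {A' : Ω → α'} {B' : Ω → β'} {C' : Ω → γ'}
    (hA : ∀ w w', A w' = A w ↔ A' w' = A' w) (hB : ∀ w w', B w' = B w ↔ B' w' = B' w)
    (hC : ∀ w w', C w' = C w ↔ C' w' = C' w) :
    condMutualInfo p A B C = condMutualInfo p A' B' C' := by
  simp only [condMutualInfo, condEntropy]
  rw [entropy_congr_ker p (A := fun w => (A w, C w)) (B := fun w => (A' w, C' w))
      (by simp [hA, hC]), entropy_congr_ker p hC,
    entropy_congr_ker p (A := fun w => (A w, B w, C w)) (B := fun w => (A' w, B' w, C' w))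
      (by simp [hA, hB, hC]),
    entropy_congr_ker p (A := fun w => (B w, C w)) (B := fun w => (B' w, C' w))
      (by simp [hB, hC])]

/-- Cardinality bounds: the alphabets of the auxiliary variables may be taken small. -/
lemma IsChain.exists_card_le [NeZero r] {p : AuxSpace X₁ X₂ Y₁ Y₂ m → ℝ} (hp : IsChain p) :
    ∃ (m' : Fin r → ℕ) (p' : AuxSpace X₁ X₂ Y₁ Y₂ m' → ℝ), IsChain p' ∧
      (∀ i : Fin r, m' i ≤ cardBound X₁ X₂ Y₁ Y₂ m' i) ∧
      (∀ z, law p' (fun w => (x w, y w)) z = law p (fun w => (x w, y w)) z) ∧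
      condMutualInfo p' x₁ F x₂ = condMutualInfo p x₁ F x₂ ∧
      condMutualInfo p' x₂ F x₁ = condMutualInfo p x₂ F x₁ ∧
      condMutualInfo p' (Fi 0) y x = condMutualInfo p (Fi 0) y x ∧
      condMutualInfo p' F y x ≤ condMutualInfo p F y x := by
  obtain ⟨S, p₁, h1, h2, h3, h4, h5, h6, h7, h8⟩ := hp.exists_support r le_rfl
  let emb : AuxSpace X₁ X₂ Y₁ Y₂ (fun i => (S i).card) → AuxSpace X₁ X₂ Y₁ Y₂ m :=
    fun w => (fun i => (S i).orderEmbOfFin rfl (w.1 i), w.2)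
  have hinj : Function.Injective emb := by
    rintro ⟨f, v⟩ ⟨f', v'⟩ h
    simp only [emb, Prod.mk.injEq] at h
    refine Prod.ext (funext fun i => ?_) h.2
    exact (S i).orderEmbOfFin rfl |>.injective (congrFun h.1 i)
  set p₂ : AuxSpace X₁ X₂ Y₁ Y₂ (fun i => (S i).card) → ℝ := fun w => p₁ (emb w) with hp₂
  -- Relabelling the supports by initial segments loses no mass, because `p₁` vanishes off the
  -- supports.
  have hlaw : law p₂ emb = p₁ := by
    funext w
    by_cases hw : ∃ v, emb v = w
    · obtain ⟨v, rfl⟩ := hw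
      refine (Finset.sum_eq_single v (fun v' _ hv' => if_neg fun h => hv' (hinj h))
        (by simp)).trans ?_
      simp
    · have : p₁ w = 0 := by
        by_contra hne
        have := h3 w hne
        have hr : ∀ i, ∃ a, (S i).orderEmbOfFin rfl a = w.1 i := fun i => by
          have h' := Finset.range_orderEmbOfFin (S i) rfl
          have : w.1 i ∈ Set.range ((S i).orderEmbOfFin rfl) := by rw [h']; exact this i
          exact this
        choose a ha using hr
        exact hw ⟨(a, w.2), Prod.ext (funext ha) rfl⟩
      rw [this]
      exact Finset.sum_eq_zero fun v _ => if_neg fun h => hw ⟨v, h⟩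
  rw [← hlaw] at h1 h4 h5 h6 h7 h8
  have kF : ∀ w w', F (emb w') = F (emb w) ↔ F w' = F w := by
    intro w w'
    simp only [F, emb, funext_iff, EmbeddingLike.apply_eq_iff_eq]
  have kFi : ∀ i w w', Fi i (emb w') = Fi i (emb w) ↔ Fi i w' = Fi i w := by
    intro i w w'
    simp only [Fi, emb, EmbeddingLike.apply_eq_iff_eq]
  have kpast : ∀ i w w', past (F (emb w')) i = past (F (emb w)) i ↔
      past (F w') i = past (F w) i := by
    intro i w w'
    simp only [F, past, emb, funext_iff, EmbeddingLike.apply_eq_iff_eq]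
  have kx₁ : ∀ w w', x₁ (emb w') = x₁ (emb w) ↔ x₁ w' = x₁ w := fun _ _ => Iff.rfl
  have kx₂ : ∀ w w', x₂ (emb w') = x₂ (emb w) ↔ x₂ w' = x₂ w := fun _ _ => Iff.rfl
  have ky₁ : ∀ w w', y₁ (emb w') = y₁ (emb w) ↔ y₁ w' = y₁ w := fun _ _ => Iff.rfl
  have ky₂ : ∀ w w', y₂ (emb w') = y₂ (emb w) ↔ y₂ w' = y₂ w := fun _ _ => Iff.rfl
  have kx : ∀ w w', x (emb w') = x (emb w) ↔ x w' = x w := fun _ _ => Iff.rfl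
  have ky : ∀ w w', y (emb w') = y (emb w) ↔ y w' = y w := fun _ _ => Iff.rfl
  refine ⟨fun i => (S i).card, p₂, ⟨⟨fun w => ?_, ?_⟩, fun i hi => ?_, fun i hi => ?_, ?_, ?_⟩,
    fun i => h2 i i.2, fun z => ?_, ?_, ?_, ?_, ?_⟩
  · have := h1.isPMF.1 (emb w)
    rwa [hlaw] at this
  · rw [← h1.isPMF.2, sum_law]
  · refine ((IsMarkov.law_iff emb).1 (h1.markov_odd_round i hi)).congr_ker ?_ ?_ ?_ <;>
      simp only [Prod.mk.injEq, kFi, kpast, kx₁, kx₂, implies_true]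
  · refine ((IsMarkov.law_iff emb).1 (h1.markov_even_round i hi)).congr_ker ?_ ?_ ?_ <;>
      simp only [Prod.mk.injEq, kFi, kpast, kx₁, kx₂, implies_true]
  · refine ((IsMarkov.law_iff emb).1 h1.markov_out₁).congr_ker ?_ ?_ ?_ <;>
      simp only [Prod.mk.injEq, kF, ky₁, ky₂, kx₁, kx₂, implies_true]
  · refine ((IsMarkov.law_iff emb).1 h1.markov_out₂).congr_ker ?_ ?_ ?_ <;>
      simp only [Prod.mk.injEq, kF, ky₁, ky₂, kx₁, kx₂, implies_true]
  · rw [← h4, law_law]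
    rfl
  · rw [← h5, condMutualInfo_law]
    exact (condMutualInfo_congr_ker _ kx₁ kF kx₂).symm
  · rw [← h6, condMutualInfo_law]
    exact (condMutualInfo_congr_ker _ kx₂ kF kx₁).symm
  · rw [← h7, condMutualInfo_law]
    exact (condMutualInfo_congr_ker _ (kFi 0) ky kx).symm
  · rw [condMutualInfo_law] at h8
    exact (condMutualInfo_congr_ker _ kF ky kx).symm.le.trans h8

/-! ### Constraints that survive limits of pmfs. -/

section Limits

variable {Ω α β γ ι : Type*} [Fintype Ω] {P : ι → Ω → ℝ} {p : Ω → ℝ} {l : Filter ι}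

lemma tendsto_law (h : Filter.Tendsto P l (nhds p)) (A : Ω → α) (a : α) :
    Filter.Tendsto (fun k => law (P k) A a) l (nhds (law p A a)) :=
  ((continuous_law A a).tendsto p).comp h

lemma tendsto_condMutualInfo [Fintype α] [Fintype β] [Fintype γ] (h : Filter.Tendsto P l (nhds p))
    (A : Ω → α) (B : Ω → β) (C : Ω → γ) :
    Filter.Tendsto (fun k => condMutualInfo (P k) A B C) l (nhds (condMutualInfo p A B C)) :=
  ((continuous_condMutualInfo A B C).tendsto p).comp h

lemma isMarkov_of_tendsto [l.NeBot] (h : Filter.Tendsto P l (nhds p)) {A : Ω → α} {B : Ω → β}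
    {C : Ω → γ} (hM : ∀ᶠ k in l, IsMarkov (P k) A B C) : IsMarkov p A B C := fun a b c =>
  tendsto_nhds_unique_of_eventuallyEq ((tendsto_law h _ _).mul (tendsto_law h _ _))
    ((tendsto_law h _ _).mul (tendsto_law h _ _)) (hM.mono fun _ hk => hk a b c)

end Limits

/-- Approximate admissibility with slack `ε`. -/
structure IsNear [NeZero r] (qX : X₁ × X₂ → ℝ) (W : X₁ × X₂ → Y₁ × Y₂ → ℝ) (R : ℝ × ℝ × ℝ) (ε : ℝ)
    (p : AuxSpace X₁ X₂ Y₁ Y₂ m → ℝ) : Prop where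
  chain : IsChain p
  marginal : ∀ a b, |law p (fun w => (x w, y w)) (a, b) - qX a * W a b| ≤ ε
  rate₁₂ : condMutualInfo p x₁ F x₂ ≤ R.2.1 + ε
  rate₂₁ : condMutualInfo p x₂ F x₁ ≤ R.2.2 + ε
  rate_first : condMutualInfo p x₁ F x₂ + condMutualInfo p (Fi 0) y x ≤ R.1 + R.2.1 + ε
  rate_sum : condMutualInfo p x₁ F x₂ + condMutualInfo p x₂ F x₁ + condMutualInfo p F y x ≤
    R.1 + R.2.1 + R.2.2 + ε

/-- The bounds are recursive in the alphabets of the preceding rounds. Unfolding the recursion makes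
them absolute, so that only finitely many tuples of alphabet sizes occur. -/
lemma exists_uniform_cardBound (X₁ X₂ Y₁ Y₂ : Type*) [Fintype X₁] [Fintype X₂] [Fintype Y₁]
    [Fintype Y₂] (r : ℕ) : ∃ b : Fin r → ℕ, ∀ m : Fin r → ℕ,
      (∀ i, m i ≤ cardBound X₁ X₂ Y₁ Y₂ m i) → ∀ i, m i ≤ b i := by
  have : ∀ i : Fin r, ∃ b : ℕ, ∀ m : Fin r → ℕ,
      (∀ i, m i ≤ cardBound X₁ X₂ Y₁ Y₂ m i) → m i ≤ b := by
    intro i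
    induction i using WellFoundedLT.induction with
    | ind i ih =>
    choose! b hb using ih
    refine ⟨cardBound X₁ X₂ Y₁ Y₂ b i, fun m hm => (hm i).trans ?_⟩
    simp only [cardBound]
    gcongr with j hj
    exact hb j (by simpa using hj) m hm
  choose b hb using this
  exact ⟨b, fun m hm i => hb i m hm⟩

/-- Approximately admissible pmfs with vanishing slack yield an admissible one. -/
theorem mem_rateRegion_of_isNear [NeZero r] {qX : X₁ × X₂ → ℝ} {W : X₁ × X₂ → Y₁ × Y₂ → ℝ}
    {R : ℝ × ℝ × ℝ} (hR : 0 ≤ R.1 ∧ 0 ≤ R.2.1 ∧ 0 ≤ R.2.2)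
    (h : ∀ ε > 0, ∃ (m : Fin r → ℕ) (p : AuxSpace X₁ X₂ Y₁ Y₂ m → ℝ), IsNear qX W R ε p) :
    R ∈ rateRegion r qX W := by
  have h' : ∀ k : ℕ, ∃ (m : Fin r → ℕ), (∀ i, m i ≤ cardBound X₁ X₂ Y₁ Y₂ m i) ∧
      ∃ p : AuxSpace X₁ X₂ Y₁ Y₂ m → ℝ, IsNear qX W R (1 / ((k : ℝ) + 1)) p := by
    intro k
    obtain ⟨m, p, hp⟩ := h (1 / ((k : ℝ) + 1)) (by positivity)
    obtain ⟨m', p', h1, h2, h3, h4, h5, h6, h7⟩ := hp.chain.exists_card_le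
    refine ⟨m', h2, p', h1, fun a b => ?_, ?_, ?_, ?_, ?_⟩
    · rw [h3]; exact hp.marginal a b
    · rw [h4]; exact hp.rate₁₂
    · rw [h5]; exact hp.rate₂₁
    · rw [h4, h6]; exact hp.rate_first
    · rw [h4, h5]; linarith [hp.rate_sum]
  choose mm hmm hpp using h'
  obtain ⟨b, hb⟩ := exists_uniform_cardBound X₁ X₂ Y₁ Y₂ r
  -- Along a nonprincipal ultrafilter the alphabet sizes, ranging over a finite set, are constant,
  -- and the pmfs then converge by compactness of the simplex.
  let U : Ultrafilter ℕ := Filter.hyperfilter ℕ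
  have hU : (U : Filter ℕ) ≤ Filter.atTop := Nat.hyperfilter_le_atTop
  obtain ⟨m, -, hm⟩ : ∃ m ∈ Set.Iic b, U.map mm = pure m :=
    Ultrafilter.eq_pure_of_finite_mem (Set.finite_Iic b)
      (Filter.univ_mem' (f := (U : Filter ℕ)) fun k => hb _ (hmm k))
  have hev : ∀ᶠ k in (U : Filter ℕ), mm k = m := by
    have : {m} ∈ U.map mm := by rw [hm]; exact rfl
    exact this
  have hcard : ∀ i, m i ≤ cardBound X₁ X₂ Y₁ Y₂ m i := by
    obtain ⟨k, hk⟩ := hev.exists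
    rw [← hk]
    exact hmm k
  have hP : ∃ P : ℕ → AuxSpace X₁ X₂ Y₁ Y₂ m → ℝ,
      ∀ᶠ k : ℕ in (U : Filter ℕ), IsNear qX W R (1 / ((k : ℝ) + 1)) (P k) := by
    have : ∀ k, ∃ p : AuxSpace X₁ X₂ Y₁ Y₂ m → ℝ,
        mm k = m → IsNear qX W R (1 / ((k : ℝ) + 1)) p := by
      intro k
      by_cases hk : mm k = m
      · obtain ⟨p, hp⟩ := hpp k
        subst hk
        exact ⟨p, fun _ => hp⟩
      -- A dummy value: indices with other alphabet sizes are negligible for `U`.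
      · exact ⟨0, fun h => absurd h hk⟩
    choose P hP using this
    exact ⟨P, hev.mono fun k hk => hP k hk⟩
  obtain ⟨P, hP⟩ := hP
  obtain ⟨p, hpS, hp⟩ := (isCompact_stdSimplex ℝ (AuxSpace X₁ X₂ Y₁ Y₂ m)).ultrafilter_le_nhds
    (U.map P) (Filter.le_principal_iff.2 (hP.mono fun k hk => hk.chain.isPMF))
  have hT : Filter.Tendsto P U (nhds p) := hp
  have hε : Filter.Tendsto (fun k : ℕ => 1 / ((k : ℝ) + 1)) U (nhds 0) :=
    tendsto_one_div_add_atTop_nhds_zero_nat.mono_left hU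
  refine ⟨hR.1, hR.2.1, hR.2.2, m, p, ⟨hpS, fun a b' => ?_, fun i hi => ?_, fun i hi => ?_, ?_, ?_,
    ?_, fun i hi => ?_⟩, ?_, ?_, ?_, ?_⟩
  · have h1 := ((tendsto_law hT (fun w => (x w, y w)) (a, b')).sub_const (qX a * W a b')).abs
    have h2 := le_of_tendsto_of_tendsto h1 hε (hP.mono fun k hk => hk.marginal a b')
    linarith [abs_nonpos_iff.1 h2]
  · exact isMarkov_of_tendsto hT (hP.mono fun k hk => hk.chain.markov_odd_round i hi)
  · exact isMarkov_of_tendsto hT (hP.mono fun k hk => hk.chain.markov_even_round i hi)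
  · exact isMarkov_of_tendsto hT (hP.mono fun k hk => hk.chain.markov_out₁)
  · exact isMarkov_of_tendsto hT (hP.mono fun k hk => hk.chain.markov_out₂)
  · refine (hcard 0).trans (le_of_eq ?_)
    simp [cardBound]
  · refine (hcard i).trans (le_of_eq ?_)
    have : i.val ≠ 0 := by
      rw [Fin.lt_def] at hi
      simp at hi
      omega
    simp [cardBound, this]
  · simpa using le_of_tendsto_of_tendsto (tendsto_condMutualInfo hT _ _ _) (hε.const_add R.2.1)
      (hP.mono fun k hk => hk.rate₁₂)
  · simpa using le_of_tendsto_of_tendsto (tendsto_condMutualInfo hT _ _ _) (hε.const_add R.2.2)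
      (hP.mono fun k hk => hk.rate₂₁)
  · simpa using le_of_tendsto_of_tendsto ((tendsto_condMutualInfo hT _ _ _).add (tendsto_condMutualInfo hT _ _ _))
      (hε.const_add (R.1 + R.2.1)) (hP.mono fun k hk => hk.rate_first)
  · simpa using le_of_tendsto_of_tendsto (((tendsto_condMutualInfo hT _ _ _).add (tendsto_condMutualInfo hT _ _ _)).add (tendsto_condMutualInfo hT _ _ _))
      (hε.const_add (R.1 + R.2.1 + R.2.2)) (hP.mono fun k hk => hk.rate_sum)


end Cardinality

/-! ### The law induced by a code and its exchange symmetries. -/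

section CodeBasics

variable {X₁ X₂ Y₁ Y₂ : Type*} [Fintype X₁] [Fintype X₂] [Fintype Y₁] [Fintype Y₂] {r n N : ℕ}

lemma past_eq_iff {k : Fin r → ℕ} {c c' : (j : Fin r) → Fin (k j)} {i : Fin r} :
    past c i = past c' i ↔ ∀ j < i, c j = c' j := by
  simp [past, funext_iff]

namespace Code

/-- The successive kernels of the messages of a code. -/
noncomputable def kern (K : Code X₁ X₂ Y₁ Y₂ r n N) (ω : Fin N) (x₁ : Fin n → X₁) (x₂ : Fin n → X₂)
    (i : Fin r) (c : (i : Fin r) → Fin (K.size i)) : ℝ :=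
  if Even i.val then K.enc₁ i (past c i) x₁ ω (c i) else K.enc₂ i (past c i) x₂ ω (c i)

lemma isKernel_kern (K : Code X₁ X₂ Y₁ Y₂ r n N) (ω : Fin N) (x₁ : Fin n → X₁)
    (x₂ : Fin n → X₂) : IsKernel (K.kern ω x₁ x₂) where
  nonneg i c := by
    unfold kern
    split_ifs with h
    · exact (K.enc₁_mem i h _ _ _).1 _
    · exact (K.enc₂_mem i (Nat.not_even_iff_odd.1 h) _ _ _).1 _
  congr i c c' h := by
    unfold kern
    rw [past_eq_iff.2 fun j hj => h j hj.le, h i le_rfl]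
  sum_one i c := by
    unfold kern
    have : ∀ a, past (Function.update c i a) i = past c i := fun a =>
      past_eq_iff.2 fun j hj => Function.update_of_ne hj.ne _ _
    simp only [this, Function.update_self]
    split_ifs with h
    · exact (K.enc₁_mem i h _ _ _).2
    · exact (K.enc₂_mem i (Nat.not_even_iff_odd.1 h) _ _ _).2

/-- An empty alphabet carries no pmf. Evaluating an encoder requires an inhabited past, hence the
induction over the rounds. -/
lemma size_pos (K : Code X₁ X₂ Y₁ Y₂ r n N) [Nonempty X₁] [Nonempty X₂] (hN : 0 < N) (i : Fin r) :
    0 < K.size i := by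
  induction i using WellFoundedLT.induction with
  | ind i ih =>
  have : Nonempty (Fin n → X₁) := inferInstance
  have : Nonempty (Fin n → X₂) := inferInstance
  let c : Past K.size i := fun j => ⟨0, ih j j.2⟩
  by_contra h0
  have h0 : K.size i = 0 := by omega
  have he : IsEmpty (Fin (K.size i)) := by rw [h0]; infer_instance
  by_cases h : Even i.val
  · have := (K.enc₁_mem i h c (Classical.arbitrary _) ⟨0, hN⟩).2
    simp at this
  · have := (K.enc₂_mem i (Nat.not_even_iff_odd.1 h) c (Classical.arbitrary _) ⟨0, hN⟩).2
    simp at this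

lemma induced_apply (K : Code X₁ X₂ Y₁ Y₂ r n N) (qX : X₁ × X₂ → ℝ) (o : K.Outcome) :
    K.induced qX o = (1 / (N : ℝ)) * (∏ t, qX (o.2.1 t, o.2.2.1 t)) *
      (∏ i, K.kern o.1 o.2.1 o.2.2.1 i o.2.2.2.1) * K.dec₁ o.2.2.2.1 o.2.1 o.1 o.2.2.2.2.1 *
        K.dec₂ o.2.2.2.1 o.2.2.1 o.1 o.2.2.2.2.2 := rfl

lemma induced_nonneg (K : Code X₁ X₂ Y₁ Y₂ r n N) {qX : X₁ × X₂ → ℝ} (hq : ∀ a, 0 ≤ qX a)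
    (o : K.Outcome) : 0 ≤ K.induced qX o := by
  rw [induced_apply]
  refine mul_nonneg (mul_nonneg (mul_nonneg (mul_nonneg (by positivity)
    (Finset.prod_nonneg fun t _ => hq _)) (Finset.prod_nonneg fun i _ =>
      (K.isKernel_kern _ _ _).nonneg _ _)) ((K.dec₁_mem _ _ _).1 _)) ((K.dec₂_mem _ _ _).1 _)

/-- The law of a code with the messages from round `s` on, and the outputs, drawn uniformly. -/
noncomputable def trunc (K : Code X₁ X₂ Y₁ Y₂ r n N) (qX : X₁ × X₂ → ℝ) (s : ℕ) (o : K.Outcome) : ℝ :=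
  (1 / (N : ℝ)) * (∏ t, qX (o.2.1 t, o.2.2.1 t)) *
    (∏ i : Fin r with i.val < s, K.kern o.1 o.2.1 o.2.2.1 i o.2.2.2.1) *
    (∏ i : Fin r with s ≤ i.val, (1 / (Fintype.card (Fin (K.size i)) : ℝ))) *
    (1 / (Fintype.card (Fin n → Y₁) : ℝ)) * (1 / (Fintype.card (Fin n → Y₂) : ℝ))

/-- Integrating out the outputs and the messages from round `s` on. -/
lemma sum_induced_mul (K : Code X₁ X₂ Y₁ Y₂ r n N) [Nonempty X₁] [Nonempty X₂] (qX : X₁ × X₂ → ℝ)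
    (s : ℕ)
    (g : Fin N → (Fin n → X₁) → (Fin n → X₂) → ((i : Fin r) → Fin (K.size i)) → ℝ)
    (hg : ∀ ω x₁ x₂ c c', (∀ j : Fin r, j.val < s → c j = c' j) → g ω x₁ x₂ c = g ω x₁ x₂ c') :
    ∑ o, K.induced qX o * g o.1 o.2.1 o.2.2.1 o.2.2.2.1 =
      ∑ ω, ∑ x₁, ∑ x₂, ∑ c, (1 / (N : ℝ)) * (∏ t, qX (x₁ t, x₂ t)) *
        (∏ i : Fin r with i.val < s, K.kern ω x₁ x₂ i c) *
        (∏ i : Fin r with s ≤ i.val, (1 / (Fintype.card (Fin (K.size i)) : ℝ))) * g ω x₁ x₂ c := by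
  simp only [Fintype.sum_prod_type]
  refine Finset.sum_congr rfl fun ω _ => Finset.sum_congr rfl fun x₁ _ =>
    Finset.sum_congr rfl fun x₂ _ => ?_
  have hpos : ∀ i, 0 < K.size i := K.size_pos (Fin.pos ω)
  have : ∀ i, Nonempty (Fin (K.size i)) := fun i => ⟨⟨0, hpos i⟩⟩
  have h1 : ∀ c, ∑ y₁, ∑ y₂, K.induced qX (ω, x₁, x₂, c, y₁, y₂) * g ω x₁ x₂ c =
      ((1 / (N : ℝ)) * (∏ t, qX (x₁ t, x₂ t)) *
        (∏ i : Fin r with i.val < s, K.kern ω x₁ x₂ i c) * g ω x₁ x₂ c) *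
        ∏ i : Fin r with s ≤ i.val, K.kern ω x₁ x₂ i c := by
    intro c
    simp only [induced_apply]
    simp only [← Finset.sum_mul, ← Finset.mul_sum, (K.dec₁_mem c x₁ ω).2, (K.dec₂_mem c x₂ ω).2,
      mul_one]
    rw [prod_split s (fun i => K.kern ω x₁ x₂ i c)]
    ring
  simp only [h1]
  rw [(K.isKernel_kern ω x₁ x₂).sum_mul_prod s]
  · exact Finset.sum_congr rfl fun c _ => by ring
  · intro c c' h
    rw [hg ω x₁ x₂ c c' h]
    congr 2
    refine Finset.prod_congr rfl fun i hi => (K.isKernel_kern ω x₁ x₂).congr i c c' fun j hj => ?_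
    simp only [Finset.mem_filter, Finset.mem_univ, true_and] at hi
    exact h j (lt_of_le_of_lt hj hi)

lemma sum_trunc_mul (K : Code X₁ X₂ Y₁ Y₂ r n N) [Nonempty Y₁] [Nonempty Y₂]
    (qX : X₁ × X₂ → ℝ) (s : ℕ)
    (g : Fin N → (Fin n → X₁) → (Fin n → X₂) → ((i : Fin r) → Fin (K.size i)) → ℝ) :
    ∑ o, K.trunc qX s o * g o.1 o.2.1 o.2.2.1 o.2.2.2.1 =
      ∑ ω, ∑ x₁, ∑ x₂, ∑ c, (1 / (N : ℝ)) * (∏ t, qX (x₁ t, x₂ t)) *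
        (∏ i : Fin r with i.val < s, K.kern ω x₁ x₂ i c) *
        (∏ i : Fin r with s ≤ i.val, (1 / (Fintype.card (Fin (K.size i)) : ℝ))) * g ω x₁ x₂ c := by
  simp only [Fintype.sum_prod_type]
  refine Finset.sum_congr rfl fun ω _ => Finset.sum_congr rfl fun x₁ _ =>
    Finset.sum_congr rfl fun x₂ _ => Finset.sum_congr rfl fun c _ => ?_
  have h1 : (Fintype.card (Fin n → Y₁) : ℝ) ≠ 0 := by exact_mod_cast Fintype.card_ne_zero
  have h2 : (Fintype.card (Fin n → Y₂) : ℝ) ≠ 0 := by exact_mod_cast Fintype.card_ne_zero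
  simp only [trunc, Finset.sum_const, Finset.card_univ, nsmul_eq_mul]
  field_simp

/-- Variables that involve only the messages before round `s` may be studied under `trunc`, whose
explicit product form is open to exchange arguments. -/
lemma law_induced_eq_trunc (K : Code X₁ X₂ Y₁ Y₂ r n N) [Nonempty X₁] [Nonempty X₂] [Nonempty Y₁]
    [Nonempty Y₂] (qX : X₁ × X₂ → ℝ) (s : ℕ) {α : Type*} (A : K.Outcome → α)
    (g : Fin N → (Fin n → X₁) → (Fin n → X₂) → ((i : Fin r) → Fin (K.size i)) → α)
    (hA : ∀ o, A o = g o.1 o.2.1 o.2.2.1 o.2.2.2.1)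
    (hg : ∀ ω x₁ x₂ c c', (∀ j : Fin r, j.val < s → c j = c' j) → g ω x₁ x₂ c = g ω x₁ x₂ c')
    (a : α) : law (K.induced qX) A a = law (K.trunc qX s) A a := by
  have h1 := K.sum_induced_mul qX s (fun ω x₁ x₂ c => if g ω x₁ x₂ c = a then 1 else 0)
    (fun ω x₁ x₂ c c' h => by rw [hg ω x₁ x₂ c c' h])
  have h2 := K.sum_trunc_mul qX s (fun ω x₁ x₂ c => if g ω x₁ x₂ c = a then 1 else 0)
  rw [← h2] at h1
  simpa [law, hA] using h1

/-- At each time one of the sources agrees in the two samples, so swapping the second source there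
gives the same two letters up to order. -/
lemma prod_exchange (qX : X₁ × X₂ → ℝ) (x₁ x₁' : Fin n → X₁) (x₂ x₂' : Fin n → X₂)
    (h : ∀ t, x₁ t = x₁' t ∨ x₂ t = x₂' t) :
    (∏ t, qX (x₁ t, x₂' t)) * (∏ t, qX (x₁' t, x₂ t)) =
      (∏ t, qX (x₁ t, x₂ t)) * (∏ t, qX (x₁' t, x₂' t)) := by
  rw [← Finset.prod_mul_distrib, ← Finset.prod_mul_distrib]
  refine Finset.prod_congr rfl fun t _ => ?_
  rcases h t with h | h
  · rw [h, mul_comm]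
  · rw [h]

/-- Terminal 1 does not see the second source; in a round of terminal 2 the messages agree, and the
swap merely permutes the two factors. -/
lemma kern_exchange (K : Code X₁ X₂ Y₁ Y₂ r n N) (ω : Fin N) (x₁ x₁' : Fin n → X₁)
    (x₂ x₂' : Fin n → X₂) (c c' : (i : Fin r) → Fin (K.size i)) (i : Fin r)
    (h : Odd i.val → ∀ j ≤ i, c j = c' j) :
    K.kern ω x₁ x₂' i c * K.kern ω x₁' x₂ i c' = K.kern ω x₁ x₂ i c * K.kern ω x₁' x₂' i c' := by
  unfold kern
  split_ifs with hi
  · rfl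
  · have h := h (Nat.not_even_iff_odd.1 hi)
    rw [past_eq_iff.2 fun j hj => h j hj.le, h i le_rfl, mul_comm]

lemma kern_exchange' (K : Code X₁ X₂ Y₁ Y₂ r n N) (ω : Fin N) (x₁ x₁' : Fin n → X₁)
    (x₂ x₂' : Fin n → X₂) (c c' : (i : Fin r) → Fin (K.size i)) (i : Fin r)
    (h : Even i.val → ∀ j ≤ i, c j = c' j) :
    K.kern ω x₁' x₂ i c * K.kern ω x₁ x₂' i c' = K.kern ω x₁ x₂ i c * K.kern ω x₁' x₂' i c' := by
  unfold kern
  split_ifs with hi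
  · have h := h hi
    rw [past_eq_iff.2 fun j hj => h j hj.le, h i le_rfl, mul_comm]
  · rfl

/-- The message of round `i` itself may differ in the two samples, since it is drawn by terminal 1,
whose source is not exchanged. -/
lemma trunc_exchange (K : Code X₁ X₂ Y₁ Y₂ r n N) (qX : X₁ × X₂ → ℝ) (i : Fin r)
    (hi : Even i.val) (o o' : K.Outcome) (hω : o.1 = o'.1)
    (hx : ∀ t, o.2.1 t = o'.2.1 t ∨ o.2.2.1 t = o'.2.2.1 t)
    (hc : ∀ j < i, o.2.2.2.1 j = o'.2.2.2.1 j) :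
    K.trunc qX (i.val + 1) (o.1, o.2.1, o'.2.2.1, o.2.2.2) *
      K.trunc qX (i.val + 1) (o'.1, o'.2.1, o.2.2.1, o'.2.2.2) =
    K.trunc qX (i.val + 1) o * K.trunc qX (i.val + 1) o' := by
  obtain ⟨ω, x₁, x₂, c, y⟩ := o
  obtain ⟨ω', x₁', x₂', c', y'⟩ := o'
  simp only at hω hx hc
  subst hω
  have h1 := prod_exchange qX x₁ x₁' x₂ x₂' hx
  have h2 : (∏ j : Fin r with j.val < i.val + 1, K.kern ω x₁ x₂' j c) *
      (∏ j : Fin r with j.val < i.val + 1, K.kern ω x₁' x₂ j c') =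
      (∏ j : Fin r with j.val < i.val + 1, K.kern ω x₁ x₂ j c) *
      (∏ j : Fin r with j.val < i.val + 1, K.kern ω x₁' x₂' j c') := by
    rw [← Finset.prod_mul_distrib, ← Finset.prod_mul_distrib]
    refine Finset.prod_congr rfl fun j hj => K.kern_exchange _ _ _ _ _ _ _ j fun hodd l hl => ?_
    simp only [Finset.mem_filter, Finset.mem_univ, true_and] at hj
    refine hc l (lt_of_le_of_lt hl (lt_of_le_of_ne (Fin.le_def.2 (by omega)) ?_))
    rintro rfl
    exact Nat.not_even_iff_odd.2 hodd hi
  simp only [trunc]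
  linear_combination ((1 / (N : ℝ)) * (1 / (N : ℝ)) *
    (∏ i_1 : Fin r with i.val + 1 ≤ i_1.val, (1 / (Fintype.card (Fin (K.size i_1)) : ℝ))) ^ 2 *
    (1 / (Fintype.card (Fin n → Y₁) : ℝ)) ^ 2 * (1 / (Fintype.card (Fin n → Y₂) : ℝ)) ^ 2) *
    ((∏ j : Fin r with j.val < i.val + 1, K.kern ω x₁ x₂' j c) *
      (∏ j : Fin r with j.val < i.val + 1, K.kern ω x₁' x₂ j c') * h1 +
     ((∏ t, qX (x₁ t, x₂ t)) * (∏ t, qX (x₁' t, x₂' t))) * h2)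

lemma trunc_exchange' (K : Code X₁ X₂ Y₁ Y₂ r n N) (qX : X₁ × X₂ → ℝ) (i : Fin r)
    (hi : Odd i.val) (o o' : K.Outcome) (hω : o.1 = o'.1)
    (hx : ∀ t, o.2.1 t = o'.2.1 t ∨ o.2.2.1 t = o'.2.2.1 t)
    (hc : ∀ j < i, o.2.2.2.1 j = o'.2.2.2.1 j) :
    K.trunc qX (i.val + 1) (o.1, o'.2.1, o.2.2) *
      K.trunc qX (i.val + 1) (o'.1, o.2.1, o'.2.2) =
    K.trunc qX (i.val + 1) o * K.trunc qX (i.val + 1) o' := by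
  obtain ⟨ω, x₁, x₂, c, y⟩ := o
  obtain ⟨ω', x₁', x₂', c', y'⟩ := o'
  simp only at hω hx hc
  subst hω
  have h1 := prod_exchange qX x₁ x₁' x₂ x₂' hx
  have h2 : (∏ j : Fin r with j.val < i.val + 1, K.kern ω x₁' x₂ j c) *
      (∏ j : Fin r with j.val < i.val + 1, K.kern ω x₁ x₂' j c') =
      (∏ j : Fin r with j.val < i.val + 1, K.kern ω x₁ x₂ j c) *
      (∏ j : Fin r with j.val < i.val + 1, K.kern ω x₁' x₂' j c') := by
    rw [← Finset.prod_mul_distrib, ← Finset.prod_mul_distrib]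
    refine Finset.prod_congr rfl fun j hj => K.kern_exchange' _ _ _ _ _ _ _ j fun hev l hl => ?_
    simp only [Finset.mem_filter, Finset.mem_univ, true_and] at hj
    refine hc l (lt_of_le_of_lt hl (lt_of_le_of_ne (Fin.le_def.2 (by omega)) ?_))
    rintro rfl
    exact Nat.not_even_iff_odd.2 hi hev
  simp only [trunc]
  linear_combination ((1 / (N : ℝ)) * (1 / (N : ℝ)) *
    (∏ i_1 : Fin r with i.val + 1 ≤ i_1.val, (1 / (Fintype.card (Fin (K.size i_1)) : ℝ))) ^ 2 *
    (1 / (Fintype.card (Fin n → Y₁) : ℝ)) ^ 2 * (1 / (Fintype.card (Fin n → Y₂) : ℝ)) ^ 2) *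
    ((∏ j : Fin r with j.val < i.val + 1, K.kern ω x₁' x₂ j c) *
      (∏ j : Fin r with j.val < i.val + 1, K.kern ω x₁ x₂' j c') * h1 +
     ((∏ t, qX (x₁ t, x₂ t)) * (∏ t, qX (x₁' t, x₂' t))) * h2)

lemma induced_exchange (K : Code X₁ X₂ Y₁ Y₂ r n N) (qX : X₁ × X₂ → ℝ) (o o' : K.Outcome)
    (hω : o.1 = o'.1) (hx : ∀ t, o.2.1 t = o'.2.1 t ∨ o.2.2.1 t = o'.2.2.1 t)
    (hc : o.2.2.2.1 = o'.2.2.2.1) :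
    K.induced qX (o.1, o.2.1, o'.2.2.1, o.2.2.2.1, o.2.2.2.2.1, o'.2.2.2.2.2) *
      K.induced qX (o'.1, o'.2.1, o.2.2.1, o'.2.2.2.1, o'.2.2.2.2.1, o.2.2.2.2.2) =
    K.induced qX o * K.induced qX o' := by
  obtain ⟨ω, x₁, x₂, c, y₁, y₂⟩ := o
  obtain ⟨ω', x₁', x₂', c', y₁', y₂'⟩ := o'
  simp only at hω hx hc
  subst hω hc
  have h1 := prod_exchange qX x₁ x₁' x₂ x₂' hx
  have h2 : (∏ j : Fin r, K.kern ω x₁ x₂' j c) * (∏ j : Fin r, K.kern ω x₁' x₂ j c) =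
      (∏ j : Fin r, K.kern ω x₁ x₂ j c) * (∏ j : Fin r, K.kern ω x₁' x₂' j c) := by
    rw [← Finset.prod_mul_distrib, ← Finset.prod_mul_distrib]
    exact Finset.prod_congr rfl fun j hj => K.kern_exchange _ _ _ _ _ _ _ j fun _ _ _ => rfl
  simp only [induced_apply]
  linear_combination ((1 / (N : ℝ)) * (1 / (N : ℝ)) * K.dec₁ c x₁ ω y₁ * K.dec₁ c x₁' ω y₁' *
    K.dec₂ c x₂ ω y₂ * K.dec₂ c x₂' ω y₂') *
    ((∏ j : Fin r, K.kern ω x₁ x₂' j c) * (∏ j : Fin r, K.kern ω x₁' x₂ j c) * h1 +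
     ((∏ t, qX (x₁ t, x₂ t)) * (∏ t, qX (x₁' t, x₂' t))) * h2)

end Code

end CodeBasics

/-! ### A uniform time index. -/

section Mixture

variable {Ω α β γ : Type*} [Fintype Ω] {n : ℕ}

/-- The law of a uniform time index together with an independent sample point. -/
noncomputable def timed (n : ℕ) (p : Ω → ℝ) (v : Fin n × Ω) : ℝ := (1 / (n : ℝ)) * p v.2

lemma law_timed (p : Ω → ℝ) (A : Fin n × Ω → α) (a : α) :
    law (timed n p) A a = (1 / (n : ℝ)) * ∑ t, law p (fun w => A (t, w)) a := by
  simp only [law, timed, Fintype.sum_prod_type, Finset.mul_sum]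
  refine Finset.sum_congr rfl fun t _ => Finset.sum_congr rfl fun w _ => ?_
  split_ifs <;> simp

lemma timed_mem_stdSimplex (hn : 0 < n) {p : Ω → ℝ} (hp : p ∈ stdSimplex ℝ Ω) :
    timed n p ∈ stdSimplex ℝ (Fin n × Ω) := by
  refine ⟨fun v => mul_nonneg (by positivity) (hp.1 _), ?_⟩
  have : (n : ℝ) ≠ 0 := by positivity
  simp [timed, Fintype.sum_prod_type, ← Finset.mul_sum, hp.2, this]

lemma law_timed_of_time (p : Ω → ℝ) (A : Fin n × Ω → α) (hA : ∀ v v', A v = A v' → v.1 = v'.1)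
    (t : Fin n) (w : Ω) :
    law (timed n p) A (A (t, w)) = (1 / (n : ℝ)) * law p (fun w => A (t, w)) (A (t, w)) := by
  rw [law_timed, Finset.sum_eq_single t]
  · intro t' _ hne
    exact Finset.sum_eq_zero fun w' _ => if_neg fun h => hne (hA _ _ h)
  · simp

/-- Because `B` determines the time, the factor `1 / n` appears in both logarithms and cancels. -/
lemma condEntropy_timed [Fintype α] [Fintype β] (hn : 0 < n) {p : Ω → ℝ} (hp : ∀ w, 0 ≤ p w)
    (A : Fin n × Ω → α) (B : Fin n × Ω → β) (hB : ∀ v v', B v = B v' → v.1 = v'.1) :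
    condEntropy (timed n p) A B =
      (1 / (n : ℝ)) * ∑ t, condEntropy p (fun w => A (t, w)) (fun w => B (t, w)) := by
  simp only [condEntropy_eq_sum, Fintype.sum_prod_type, Finset.mul_sum]
  refine Finset.sum_congr rfl fun t _ => Finset.sum_congr rfl fun w _ => ?_
  rw [law_timed_of_time p B hB, law_timed_of_time p (fun v => (A v, B v))
    (fun v v' h => hB v v' (Prod.mk.inj h).2), timed, mul_assoc]
  rcases (hp w).eq_or_lt with h0 | h0
  · simp [← h0]
  have hn' : (1 / (n : ℝ)) ≠ 0 := by positivity
  have l2 := law_self_pos hp (fun w => B (t, w)) h0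
  have l3 := law_self_pos hp (fun w => (A (t, w), B (t, w))) h0
  rw [Real.log_mul hn' l2.ne', Real.log_mul hn' l3.ne']
  ring

end Mixture

/-! ### Auxiliary variables extracted from a code. -/

section Chain

variable {X₁ X₂ Y₁ Y₂ : Type*} [Fintype X₁] [Fintype X₂] [Fintype Y₁] [Fintype Y₂] {r n N : ℕ}

namespace Code

/-- The type of the side information that enters every auxiliary variable. -/
abbrev Side (X₁ X₂ : Type*) (n N : ℕ) : Type _ :=
  Fin n × Fin N × (Fin n → Option X₁) × (Fin n → Option X₂)

variable (K : Code X₁ X₂ Y₁ Y₂ r n N)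

/-- The time index, the common randomness, the past of the first and the future of the second
source. -/
def side (v : Fin n × K.Outcome) : Side X₁ X₂ n N :=
  (v.1, v.2.1, fun t => if t < v.1 then some (v.2.2.1 t) else none,
    fun t => if v.1 < t then some (v.2.2.2.1 t) else none)

/-- The auxiliary variable of round `i`. -/
def aux (i : Fin r) (v : Fin n × K.Outcome) : Side X₁ X₂ n N × Fin (K.size i) :=
  (K.side v, v.2.2.2.2.1 i)

variable {K} in
lemma side_eq_iff {v v' : Fin n × K.Outcome} : K.side v' = K.side v ↔ v'.1 = v.1 ∧ v'.2.1 = v.2.1 ∧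
    (∀ t < v.1, v'.2.2.1 t = v.2.2.1 t) ∧ (∀ t, v.1 < t → v'.2.2.2.1 t = v.2.2.2.1 t) := by
  simp only [side, Prod.mk.injEq, funext_iff]
  constructor
  · rintro ⟨h1, h2, h3, h4⟩
    refine ⟨h1, h2, fun t ht => ?_, fun t ht => ?_⟩
    · have := h3 t
      rw [h1] at this
      simpa [ht] using this
    · have := h4 t
      rw [h1] at this
      simpa [ht] using this
  · rintro ⟨h1, h2, h3, h4⟩
    refine ⟨h1, h2, fun t => ?_, fun t => ?_⟩
    · rw [h1]
      split_ifs with h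
      · rw [h3 t h]
      · rfl
    · rw [h1]
      split_ifs with h
      · rw [h4 t h]
      · rfl

lemma side_congr {v v' : Fin n × K.Outcome} (h1 : v'.1 = v.1) (h2 : v'.2.1 = v.2.1)
    (h3 : ∀ t < v.1, v'.2.2.1 t = v.2.2.1 t) (h4 : ∀ t, v.1 < t → v'.2.2.2.1 t = v.2.2.2.1 t) :
    K.side v' = K.side v := side_eq_iff.2 ⟨h1, h2, h3, h4⟩

/-- The auxiliary variables with the input and output at the time index. -/
noncomputable def auxPoint (v : Fin n × K.Outcome) : AuxSpace X₁ X₂ Y₁ Y₂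
    (fun i : Fin r => Fintype.card (Side X₁ X₂ n N × Fin (K.size i))) :=
  (fun i => Fintype.equivFin _ (K.aux i v), v.2.2.1 v.1, v.2.2.2.1 v.1, v.2.2.2.2.2.1 v.1,
    v.2.2.2.2.2.2 v.1)

lemma x₁_auxPoint (v : Fin n × K.Outcome) : AuxSpace.x₁ (K.auxPoint v) = v.2.2.1 v.1 := rfl

lemma x₂_auxPoint (v : Fin n × K.Outcome) : AuxSpace.x₂ (K.auxPoint v) = v.2.2.2.1 v.1 := rfl

variable [Nonempty X₁] [Nonempty X₂] [Nonempty Y₁] [Nonempty Y₂]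

variable {K} in
lemma law_timed_induced_eq_trunc (qX : X₁ × X₂ → ℝ) (s : ℕ) {α : Type*}
    (A : Fin n × K.Outcome → α)
    (g : Fin n → Fin N → (Fin n → X₁) → (Fin n → X₂) → ((i : Fin r) → Fin (K.size i)) → α)
    (hA : ∀ v, A v = g v.1 v.2.1 v.2.2.1 v.2.2.2.1 v.2.2.2.2.1)
    (hg : ∀ t ω x₁ x₂ c c', (∀ j : Fin r, j.val < s → c j = c' j) →
      g t ω x₁ x₂ c = g t ω x₁ x₂ c')
    (a : α) : law (timed n (K.induced qX)) A a = law (timed n (K.trunc qX s)) A a := by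
  rw [law_timed, law_timed]
  refine congrArg _ (Finset.sum_congr rfl fun t _ => ?_)
  exact K.law_induced_eq_trunc qX s _ (g t) (fun o => hA (t, o)) (hg t) a

/-- With the side information and the first source at T given, two samples agree in the first source
up to T and in the second one after T. This is what `prod_exchange` needs for swapping the whole
second source. -/
lemma isMarkov_even (qX : X₁ × X₂ → ℝ) (i : Fin r) (hi : Even i.val) :
    IsMarkov (timed n (K.induced qX)) (fun v => v.2.2.2.2.1 i)
      (fun v => (K.side v, past v.2.2.2.2.1 i, v.2.2.1 v.1)) (fun v => v.2.2.2.1 v.1) := by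
  refine IsMarkov.of_law_eq (p := timed n (K.trunc qX (i.val + 1))) (fun z => ?_)
    (IsMarkov.of_exchange
      (fun v v' => (v.1, v.2.1, v.2.2.1, v'.2.2.2.1, v.2.2.2.2)) ?_)
  · refine law_timed_induced_eq_trunc qX (i.val + 1) _
      (fun t ω x₁ x₂ c => (c i, ((t, ω, fun s => if s < t then some (x₁ s) else none,
        fun s => if t < s then some (x₂ s) else none), past c i, x₁ t), x₂ t)) (fun v => rfl) ?_ _
    intro t ω x₁ x₂ c c' h
    rw [h i (by omega), past_eq_iff.2 fun j hj => h j (by rw [Fin.lt_def] at hj; omega)]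
  · intro v v' h
    simp only [Prod.mk.injEq, side_eq_iff, past_eq_iff] at h
    obtain ⟨⟨h1, h2, h3, h4⟩, h5, h6⟩ := h
    have hx1 : ∀ t, t ≤ v'.1 → v.2.2.1 t = v'.2.2.1 t := by
      intro t ht
      rcases ht.lt_or_eq with ht | rfl
      · exact h3 t ht
      · rw [← h6, h1]
    refine ⟨rfl, ?_, ?_, rfl, ?_⟩
    · simp only [Prod.mk.injEq, and_true]
      refine K.side_congr rfl rfl (fun _ _ => rfl) fun t ht => ?_
      exact (h4 t (h1 ▸ ht)).symm
    · simp only [h1]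
    · have := K.trunc_exchange qX i hi v.2 v'.2 h2 (fun t => by
        rcases le_or_gt t v'.1 with ht | ht
        · exact Or.inl (hx1 t ht)
        · exact Or.inr (h4 t ht)) h5
      simp only [timed]
      linear_combination (1 / (n : ℝ)) ^ 2 * this

/-- Mirror image: now the second source agrees from T on and the first one before T, and the first
source is swapped. -/
lemma isMarkov_odd (qX : X₁ × X₂ → ℝ) (i : Fin r) (hi : Odd i.val) :
    IsMarkov (timed n (K.induced qX)) (fun v => v.2.2.2.2.1 i)
      (fun v => (K.side v, past v.2.2.2.2.1 i, v.2.2.2.1 v.1)) (fun v => v.2.2.1 v.1) := by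
  refine IsMarkov.of_law_eq (p := timed n (K.trunc qX (i.val + 1))) (fun z => ?_)
    (IsMarkov.of_exchange
      (fun v v' => (v.1, v.2.1, v'.2.2.1, v.2.2.2)) ?_)
  · refine law_timed_induced_eq_trunc qX (i.val + 1) _
      (fun t ω x₁ x₂ c => (c i, ((t, ω, fun s => if s < t then some (x₁ s) else none,
        fun s => if t < s then some (x₂ s) else none), past c i, x₂ t), x₁ t)) (fun v => rfl) ?_ _
    intro t ω x₁ x₂ c c' h
    rw [h i (by omega), past_eq_iff.2 fun j hj => h j (by rw [Fin.lt_def] at hj; omega)]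
  · intro v v' h
    simp only [Prod.mk.injEq, side_eq_iff, past_eq_iff] at h
    obtain ⟨⟨h1, h2, h3, h4⟩, h5, h6⟩ := h
    have hx2 : ∀ t, v'.1 ≤ t → v.2.2.2.1 t = v'.2.2.2.1 t := by
      intro t ht
      rcases ht.lt_or_eq with ht | rfl
      · exact h4 t ht
      · rw [← h6, h1]
    refine ⟨rfl, ?_, ?_, rfl, ?_⟩
    · simp only [Prod.mk.injEq, and_true]
      refine K.side_congr rfl rfl (fun t ht => ?_) fun _ _ => rfl
      exact (h3 t (h1 ▸ ht)).symm
    · simp only [h1]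
    · have := K.trunc_exchange' qX i hi v.2 v'.2 h2 (fun t => by
        rcases lt_or_ge t v'.1 with ht | ht
        · exact Or.inl (h3 t ht)
        · exact Or.inr (hx2 t ht)) h5
      simp only [timed]
      linear_combination (1 / (n : ℝ)) ^ 2 * this

/-- The exchange of `isMarkov_even`, with the output of terminal 2 moving along with the second
source. -/
lemma isMarkov_out₁ (qX : X₁ × X₂ → ℝ) :
    IsMarkov (timed n (K.induced qX)) (fun v => v.2.2.2.2.2.1 v.1)
      (fun v => ((K.side v, v.2.2.2.2.1), v.2.2.1 v.1))
      (fun v => (v.2.2.2.1 v.1, v.2.2.2.2.2.2 v.1)) := by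
  refine IsMarkov.of_exchange (fun v v' => (v.1, v.2.1, v.2.2.1, v'.2.2.2.1, v.2.2.2.2.1,
    v.2.2.2.2.2.1, v'.2.2.2.2.2.2)) ?_
  intro v v' h
  simp only [Prod.mk.injEq, side_eq_iff] at h
  obtain ⟨⟨⟨h1, h2, h3, h4⟩, h5⟩, h6⟩ := h
  have hx1 : ∀ t, t ≤ v'.1 → v.2.2.1 t = v'.2.2.1 t := by
    intro t ht
    rcases ht.lt_or_eq with ht | rfl
    · exact h3 t ht
    · rw [← h6, h1]
  refine ⟨rfl, ?_, ?_, rfl, ?_⟩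
  · simp only [Prod.mk.injEq, and_true]
    refine K.side_congr rfl rfl (fun _ _ => rfl) fun t ht => ?_
    exact (h4 t (h1 ▸ ht)).symm
  · simp only [h1]
  · have := K.induced_exchange qX v.2 v'.2 h2 (fun t => by
      rcases le_or_gt t v'.1 with ht | ht
      · exact Or.inl (hx1 t ht)
      · exact Or.inr (h4 t ht)) h5
    simp only [timed]
    linear_combination (1 / (n : ℝ)) ^ 2 * this

lemma isMarkov_out₂ (qX : X₁ × X₂ → ℝ) :
    IsMarkov (timed n (K.induced qX)) (fun v => v.2.2.2.2.2.2 v.1)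
      (fun v => ((K.side v, v.2.2.2.2.1), v.2.2.2.1 v.1))
      (fun v => (v.2.2.1 v.1, v.2.2.2.2.2.1 v.1)) := by
  refine IsMarkov.of_exchange (fun v v' => (v.1, v.2.1, v'.2.2.1, v.2.2.2.1, v.2.2.2.2.1,
    v'.2.2.2.2.2.1, v.2.2.2.2.2.2)) ?_
  intro v v' h
  simp only [Prod.mk.injEq, side_eq_iff] at h
  obtain ⟨⟨⟨h1, h2, h3, h4⟩, h5⟩, h6⟩ := h
  have hx2 : ∀ t, v'.1 ≤ t → v.2.2.2.1 t = v'.2.2.2.1 t := by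
    intro t ht
    rcases ht.lt_or_eq with ht | rfl
    · exact h4 t ht
    · rw [← h6, h1]
  refine ⟨rfl, ?_, ?_, rfl, ?_⟩
  · simp only [Prod.mk.injEq, and_true]
    refine K.side_congr rfl rfl (fun t ht => ?_) fun _ _ => rfl
    exact (h3 t (h1 ▸ ht)).symm
  · simp only [h1]
  · have := K.induced_exchange qX v.2 v'.2 h2 (fun t => by
      rcases lt_or_ge t v'.1 with ht | ht
      · exact Or.inl (h3 t ht)
      · exact Or.inr (hx2 t ht)) h5
    simp only [timed, h2, h5]
    simp only [h2, h5] at this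
    linear_combination (1 / (n : ℝ)) ^ 2 * this

/-- In the first round no past carries the side information, so it counts as part of the auxiliary
variable. The chain holds because the letters are i.i.d. and the first message does not depend on
the second source: only the letter at T of that source is swapped, and the two samples may have
different time indices. -/
lemma isMarkov_first [NeZero r] (qX : X₁ × X₂ → ℝ) :
    IsMarkov (timed n (K.induced qX)) (fun v => (K.side v, v.2.2.2.2.1 0))
      (fun v => v.2.2.1 v.1) (fun v => v.2.2.2.1 v.1) := by
  refine IsMarkov.of_law_eq (p := timed n (K.trunc qX 1)) (fun z => ?_)
    (IsMarkov.of_exchange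
      (fun v v' => (v.1, v.2.1, v.2.2.1, Function.update v.2.2.2.1 v.1 (v'.2.2.2.1 v'.1),
        v.2.2.2.2)) ?_)
  · refine law_timed_induced_eq_trunc qX 1 _
      (fun t ω x₁ x₂ c => (((t, ω, fun s => if s < t then some (x₁ s) else none,
        fun s => if t < s then some (x₂ s) else none), c 0), x₁ t, x₂ t)) (fun v => rfl) ?_ _
    intro t ω x₁ x₂ c c' h
    rw [h 0 (by simp)]
  · intro v v' h
    refine ⟨?_, rfl, by simp, by simp, ?_⟩
    · simp only [Prod.mk.injEq, and_true]
      exact K.side_congr rfl rfl (fun _ _ => rfl) fun t ht => Function.update_of_ne ht.ne' _ _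
    · have key : ∀ (x₁ : Fin n → X₁) (x₂ : Fin n → X₂) (t : Fin n) (a : X₂),
          (∏ s, qX (x₁ s, Function.update x₂ t a s)) =
            qX (x₁ t, a) * ∏ s ∈ Finset.univ.erase t, qX (x₁ s, x₂ s) := by
        intro x₁ x₂ t a
        rw [← Finset.mul_prod_erase Finset.univ _ (Finset.mem_univ t), Function.update_self]
        congr 1
        refine Finset.prod_congr rfl fun s hs => ?_
        rw [Function.update_of_ne (Finset.ne_of_mem_erase hs)]
      have hk : ∀ (ω : Fin N) (x₁ : Fin n → X₁) (x₂ x₂' : Fin n → X₂) c,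
          (∏ i : Fin r with i.val < 1, K.kern ω x₁ x₂ i c) =
            ∏ i : Fin r with i.val < 1, K.kern ω x₁ x₂' i c := by
        intro ω x₁ x₂ x₂' c
        refine Finset.prod_congr rfl fun i hi => ?_
        simp only [Finset.mem_filter, Finset.mem_univ, true_and, Nat.lt_one_iff] at hi
        simp [kern, hi]
      simp only [timed, trunc, key]
      rw [hk v.2.1 v.2.2.1 _ v.2.2.2.1, hk v'.2.1 v'.2.2.1 _ v'.2.2.2.1,
        ← Finset.mul_prod_erase Finset.univ (fun s => qX (v.2.2.1 s, v.2.2.2.1 s))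
          (Finset.mem_univ v.1),
        ← Finset.mul_prod_erase Finset.univ (fun s => qX (v'.2.2.1 s, v'.2.2.2.1 s))
          (Finset.mem_univ v'.1), h]
      ring

variable {K} in
-- A nonempty past contains the side information through the first round. For the empty past this
-- fails, so the first round is treated apart.
lemma past_aux_eq_iff {v v' : Fin n × K.Outcome} {i : Fin r} (hi : 0 < i.val) :
    (∀ j < i, K.aux j v' = K.aux j v) ↔
      K.side v' = K.side v ∧ past v'.2.2.2.2.1 i = past v.2.2.2.2.1 i := by
  simp only [aux, Prod.mk.injEq, past_eq_iff]
  constructor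
  · intro h
    exact ⟨(h ⟨0, by omega⟩ (Fin.lt_def.2 hi)).1, fun j hj => (h j hj).2⟩
  · intro h j hj
    exact ⟨h.1, h.2 j hj⟩

variable {K} in
lemma all_aux_eq_iff [NeZero r] {v v' : Fin n × K.Outcome} :
    (∀ j, K.aux j v' = K.aux j v) ↔ K.side v' = K.side v ∧ v'.2.2.2.2.1 = v.2.2.2.2.1 := by
  simp only [aux, Prod.mk.injEq, funext_iff]
  exact ⟨fun h => ⟨(h 0).1, fun j => (h j).2⟩, fun h j => ⟨h.1, h.2 j⟩⟩

variable {K} in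
lemma past_auxPoint_eq_iff {v v' : Fin n × K.Outcome} {i : Fin r} :
    past (AuxSpace.F (K.auxPoint v')) i = past (AuxSpace.F (K.auxPoint v)) i ↔
      ∀ j < i, K.aux j v' = K.aux j v := by
  simp [past_eq_iff, AuxSpace.F, auxPoint]

variable {K} in
lemma F_auxPoint_eq_iff [NeZero r] {v v' : Fin n × K.Outcome} :
    AuxSpace.F (K.auxPoint v') = AuxSpace.F (K.auxPoint v) ↔
      K.side v' = K.side v ∧ v'.2.2.2.2.1 = v.2.2.2.2.1 := by
  rw [← all_aux_eq_iff]
  simp [AuxSpace.F, auxPoint, funext_iff]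

variable {K} in
lemma Fi_auxPoint_eq_iff {v v' : Fin n × K.Outcome} {i : Fin r} :
    AuxSpace.Fi i (K.auxPoint v') = AuxSpace.Fi i (K.auxPoint v) ↔
      K.side v' = K.side v ∧ v'.2.2.2.2.1 i = v.2.2.2.2.1 i := by
  simp [AuxSpace.Fi, auxPoint, aux]

/-- The auxiliary variables built from a code obey the Markov chains. -/
lemma isChain_auxPoint [NeZero r] {qX : X₁ × X₂ → ℝ} (hn : 0 < n)
    (hK : K.induced qX ∈ stdSimplex ℝ K.Outcome) :
    IsChain (law (timed n (K.induced qX)) K.auxPoint) where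
  isPMF := law_mem_stdSimplex (timed_mem_stdSimplex hn hK) _
  markov_odd_round i hi := by
    rw [IsMarkov.law_iff]
    rcases Nat.eq_zero_or_pos i.val with h0 | h0
    · have h0 : i = 0 := Fin.ext (by simpa using h0)
      subst h0
      have hp : ∀ v v' : Fin n × K.Outcome,
          past (AuxSpace.F (K.auxPoint v')) 0 = past (AuxSpace.F (K.auxPoint v)) 0 := by
        intro v v'
        rw [past_eq_iff]
        intro j hj
        exact absurd hj (by simp)
      refine (K.isMarkov_first qX).congr_ker (fun v v' => ?_) (fun v v' => ?_) (fun v v' => ?_)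
      · simp only [Prod.mk.injEq, hp v v', true_and]; rfl
      · simp only [Prod.mk.injEq, hp v v', true_and, Fi_auxPoint_eq_iff]; rfl
      · simp only [Prod.mk.injEq, hp v v', true_and]; rfl
    · refine (K.isMarkov_even qX i hi).congr_ker (fun v v' => ?_) (fun v v' => ?_)
        (fun v v' => ?_)
      · simp only [Prod.mk.injEq, past_auxPoint_eq_iff, past_aux_eq_iff h0, and_assoc]; rfl
      · simp only [Prod.mk.injEq, past_auxPoint_eq_iff, past_aux_eq_iff h0, Fi_auxPoint_eq_iff,
          and_assoc, x₁_auxPoint]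
        tauto
      · simp only [Prod.mk.injEq, past_auxPoint_eq_iff, past_aux_eq_iff h0, and_assoc]; rfl
  markov_even_round i hi := by
    rw [IsMarkov.law_iff]
    have h0 : 0 < i.val := hi.pos
    refine (K.isMarkov_odd qX i hi).congr_ker (fun v v' => ?_) (fun v v' => ?_)
        (fun v v' => ?_)
    · simp only [Prod.mk.injEq, past_auxPoint_eq_iff, past_aux_eq_iff h0, and_assoc]; rfl
    · simp only [Prod.mk.injEq, past_auxPoint_eq_iff, past_aux_eq_iff h0, Fi_auxPoint_eq_iff,
          and_assoc, x₂_auxPoint]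
      tauto
    · simp only [Prod.mk.injEq, past_auxPoint_eq_iff, past_aux_eq_iff h0, and_assoc]; rfl
  markov_out₁ := by
    rw [IsMarkov.law_iff]
    refine (K.isMarkov_out₁ qX).congr_ker (fun v v' => ?_) (fun v v' => ?_) (fun v v' => ?_) <;>
    · simp only [Prod.mk.injEq, F_auxPoint_eq_iff]; rfl
  markov_out₂ := by
    rw [IsMarkov.law_iff]
    refine (K.isMarkov_out₂ qX).congr_ker (fun v v' => ?_) (fun v v' => ?_) (fun v v' => ?_) <;>
    · simp only [Prod.mk.injEq, F_auxPoint_eq_iff]; rfl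

end Code

end Chain

/-! ### Chain rules over time. -/

section ChainRule

variable {Ω α β γ : Type*} [Fintype Ω] [Fintype α] [Fintype β] [Fintype γ] {n : ℕ}

/-- Conditioning on more reduces entropy. -/
lemma condEntropy_anti {p : Ω → ℝ} (hp : ∀ w, 0 ≤ p w) (A : Ω → α) {B : Ω → β} {C : Ω → γ}
    (h : ∀ w w', B w' = B w → C w' = C w) : condEntropy p A B ≤ condEntropy p A C := by
  have := entropy_submodular hp A B C
  rw [entropy_congr_ker p (A := fun w => (A w, B w, C w)) (B := fun w => (A w, B w))
      (by intro w w'; simp only [Prod.mk.injEq]; have := h w w'; tauto),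
    entropy_congr_ker p (A := fun w => (B w, C w)) (B := B)
      (by intro w w'; simp only [Prod.mk.injEq]; have := h w w'; tauto)] at this
  simp only [condEntropy]
  linarith

lemma sum_fin_sub (G : ℕ → ℝ) (n : ℕ) : ∑ t : Fin n, (G (t.val + 1) - G t.val) = G n - G 0 := by
  rw [Fin.sum_univ_eq_sum_range (fun s => G (s + 1) - G s) n, Finset.sum_range_sub]

lemma entropy_chain_rule (p : Ω → ℝ) (Z : Fin n → Ω → α) (D : Ω → β) :
    entropy p (fun w => ((fun t => Z t w), D w)) - entropy p D =
      ∑ t, condEntropy p (Z t) (fun w => ((fun s : {s // s < t} => Z s w), D w)) := by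
  set G : ℕ → ℝ := fun s => entropy p (fun w => ((fun t : {t : Fin n // t.val < s} => Z t w), D w))
    with hG
  have h1 : entropy p (fun w => ((fun t => Z t w), D w)) = G n := by
    refine entropy_congr_ker p fun w w' => ?_
    simp only [Prod.mk.injEq, funext_iff, Subtype.forall]
    exact ⟨fun h => ⟨fun t _ => h.1 t, h.2⟩, fun h => ⟨fun t => h.1 t t.2, h.2⟩⟩
  have h0 : entropy p D = G 0 := by
    refine entropy_congr_ker p fun w w' => ?_
    simp [Prod.mk.injEq, funext_iff]
  rw [h1, h0, ← sum_fin_sub]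
  refine Finset.sum_congr rfl fun t _ => ?_
  rw [condEntropy]
  congr 1
  refine entropy_congr_ker p fun w w' => ?_
  simp only [Prod.mk.injEq, funext_iff, Subtype.forall]
  constructor
  · exact fun h => ⟨h.1 t (by omega), fun s hs => h.1 s (by rw [Fin.lt_def] at hs; omega), h.2⟩
  · rintro ⟨h1, h2, h3⟩
    refine ⟨fun s hs => ?_, h3⟩
    rcases lt_or_eq_of_le (Nat.lt_succ_iff.1 hs) with h | h
    · exact h2 s (Fin.lt_def.2 h)
    · rw [Fin.ext h]; exact h1

/-- The version that conditions on the future, as the side information contains the future of the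
second source. -/
lemma entropy_chain_rule_rev (p : Ω → ℝ) (Z : Fin n → Ω → α) (D : Ω → β) :
    entropy p (fun w => ((fun t => Z t w), D w)) - entropy p D =
      ∑ t, condEntropy p (Z t) (fun w => ((fun s : {s // t < s} => Z s w), D w)) := by
  have h := entropy_chain_rule p (fun t => Z (Fin.rev t)) D
  rw [← Equiv.sum_comp Fin.revPerm]
  rw [entropy_congr_ker p (A := fun w => ((fun t => Z t w), D w))
    (B := fun w => ((fun t => Z (Fin.rev t) w), D w)), h]
  · refine Finset.sum_congr rfl fun t _ => ?_
    simp only [condEntropy, Fin.revPerm_apply]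
    congr 1
    · refine entropy_congr_ker p fun w w' => ?_
      simp only [Prod.mk.injEq, funext_iff, Subtype.forall]
      refine and_congr Iff.rfl (and_congr ⟨fun h s hs => ?_, fun h s hs => ?_⟩ Iff.rfl)
      · have := h (Fin.rev s) (by rw [Fin.rev_lt_iff]; exact hs)
        rwa [Fin.rev_rev] at this
      · exact h (Fin.rev s) (Fin.rev_lt_rev.2 hs)
    · refine entropy_congr_ker p fun w w' => ?_
      simp only [Prod.mk.injEq, funext_iff, Subtype.forall]
      refine (and_congr ⟨fun h s hs => ?_, fun h s hs => ?_⟩ Iff.rfl)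
      · have := h (Fin.rev s) (by rw [Fin.rev_lt_iff]; exact hs)
        rwa [Fin.rev_rev] at this
      · exact h (Fin.rev s) (Fin.rev_lt_rev.2 hs)
  · intro w w'
    simp only [Prod.mk.injEq, funext_iff]
    refine (and_congr ⟨fun h s => h _, fun h s => ?_⟩ Iff.rfl)
    have := h (Fin.rev s)
    rwa [Fin.rev_rev] at this

end ChainRule

/-! ### Product pmfs. -/

section IID

variable {Ω α β : Type*} [Fintype Ω] [Fintype α] [Fintype β] {n : ℕ}

lemma sum_prod_eq_prod_sum {κ : Fin n → Type*} [∀ t, Fintype (κ t)] (g : (t : Fin n) → κ t → ℝ) :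
    ∑ a : (t : Fin n) → κ t, ∏ t, g t (a t) = ∏ t, ∑ b, g t b := by
  rw [Finset.prod_univ_sum, Fintype.piFinset_univ]

lemma sum_prod_mul_apply {q : α → ℝ} (hq : ∑ a, q a = 1) (t : Fin n) (g : α → ℝ) :
    ∑ a : Fin n → α, (∏ s, q (a s)) * g (a t) = ∑ b, q b * g b := by
  have : ∀ a : Fin n → α, (∏ s, q (a s)) * g (a t) =
      ∏ s, (q (a s) * if s = t then g (a s) else 1) := by
    intro a
    rw [Finset.prod_mul_distrib]
    congr 1
    rw [Finset.prod_ite_eq' Finset.univ t (fun s => g (a s))]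
    simp
  simp only [this]
  rw [sum_prod_eq_prod_sum (fun s b => q b * if s = t then g b else 1)]
  rw [Finset.prod_eq_single t]
  · simp
  · intro s _ hs
    simp [hs, hq]
  · simp

lemma sum_prod_eq_one {q : α → ℝ} (hq : ∑ a, q a = 1) : ∑ a : Fin n → α, ∏ s, q (a s) = 1 := by
  rw [sum_prod_eq_prod_sum (fun _ b => q b)]
  simp [hq]

lemma law_iid (q : α → ℝ) (A : α → β) (b : Fin n → β) :
    law (fun a : Fin n → α => ∏ t, q (a t)) (fun a t => A (a t)) b = ∏ t, law q A (b t) := by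
  simp only [law]
  rw [← sum_prod_eq_prod_sum (fun t a => if A a = b t then q a else 0)]
  refine Finset.sum_congr rfl fun a _ => ?_
  split_ifs with h
  · exact Finset.prod_congr rfl fun t _ => by rw [if_pos (congrFun h t)]
  · symm
    obtain ⟨t, ht⟩ := Function.ne_iff.1 h
    exact Finset.prod_eq_zero (Finset.mem_univ t) (if_neg ht)

lemma sum_negMulLog_prod {q : α → ℝ} (hq : q ∈ stdSimplex ℝ α) :
    ∑ a : Fin n → α, Real.negMulLog (∏ t, q (a t)) = n * ∑ a, Real.negMulLog (q a) := by
  have h1 : ∀ a : Fin n → α, Real.negMulLog (∏ t, q (a t)) =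
      ∑ t, (∏ s, q (a s)) * -Real.log (q (a t)) := by
    intro a
    rw [← Finset.mul_sum, Real.negMulLog, Finset.sum_neg_distrib]
    by_cases h : ∃ t, q (a t) = 0
    · obtain ⟨t, ht⟩ := h
      rw [Finset.prod_eq_zero (Finset.mem_univ t) ht]
      simp
    · push Not at h
      rw [Real.log_prod fun t _ => h t]
      ring
  simp only [h1]
  rw [Finset.sum_comm]
  simp only [fun t => sum_prod_mul_apply hq.2 t (fun b => -Real.log (q b))]
  simp [Real.negMulLog]

lemma entropy_of_law_iid {p : Ω → ℝ} {A : Ω → Fin n → α} {q : α → ℝ} (hq : q ∈ stdSimplex ℝ α)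
    (h : ∀ a, law p A a = ∏ t, q (a t)) :
    entropy p A = n * ((∑ a, Real.negMulLog (q a)) / Real.log 2) := by
  rw [entropy, ← mul_div_assoc, ← sum_negMulLog_prod hq]
  simp only [h]

end IID

/-! ### Entropies of the messages. -/

section Converse

variable {X₁ X₂ Y₁ Y₂ : Type*} [Fintype X₁] [Fintype X₂] [Fintype Y₁] [Fintype Y₂] {r n N : ℕ}

namespace Code

variable (K : Code X₁ X₂ Y₁ Y₂ r n N) [Nonempty X₁] [Nonempty X₂]

lemma sum_induced_inputs (qX : X₁ × X₂ → ℝ) (g : Fin N → (Fin n → X₁) → (Fin n → X₂) → ℝ) :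
    ∑ o, K.induced qX o * g o.1 o.2.1 o.2.2.1 =
      ∑ ω, ∑ x₁, ∑ x₂, (1 / (N : ℝ)) * (∏ t, qX (x₁ t, x₂ t)) * g ω x₁ x₂ := by
  rw [K.sum_induced_mul qX 0 (fun ω x₁ x₂ _ => g ω x₁ x₂) (fun _ _ _ _ _ _ => rfl)]
  refine Finset.sum_congr rfl fun ω _ => Finset.sum_congr rfl fun x₁ _ =>
    Finset.sum_congr rfl fun x₂ _ => ?_
  have hpos : ∀ i, 0 < K.size i := K.size_pos (Fin.pos ω)
  have : ∀ i, Nonempty (Fin (K.size i)) := fun i => ⟨⟨0, hpos i⟩⟩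
  have h := (isKernel_uniform (φ := fun i => Fin (K.size i))).sum_prod
  simp only [Nat.not_lt_zero, Finset.filter_false, Finset.prod_empty, mul_one, zero_le,
    Finset.filter_true]
  rw [← Finset.sum_mul, ← Finset.mul_sum, h, mul_one]

lemma law_inputs (qX : X₁ × X₂ → ℝ) (hN : 0 < N) (a : Fin n → X₁ × X₂) :
    law (K.induced qX) (fun o t => (o.2.1 t, o.2.2.1 t)) a = ∏ t, qX (a t) := by
  have h := K.sum_induced_inputs qX (fun _ x₁ x₂ => if (fun t => (x₁ t, x₂ t)) = a then 1 else 0)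
  have hN' : (N : ℝ) ≠ 0 := by positivity
  rw [(law_eq_sum_mul _ _ _).trans h]
  simp only [mul_ite, mul_one, mul_zero]
  rw [Finset.sum_const, Finset.card_univ, Fintype.card_fin, nsmul_eq_mul]
  rw [Finset.sum_eq_single (fun t => (a t).1), Finset.sum_eq_single (fun t => (a t).2)]
  · simp
    field_simp
  · intro x₂ _ hne
    refine if_neg fun e => hne (funext fun t => ?_)
    rw [← congrFun e t]
  · simp
  · intro x₁ _ hne
    refine Finset.sum_eq_zero fun x₂ _ => if_neg fun e => hne (funext fun t => ?_)
    rw [← congrFun e t]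
  · simp

lemma induced_mem_stdSimplex {qX : X₁ × X₂ → ℝ} (hq : qX ∈ stdSimplex ℝ (X₁ × X₂)) (hN : 0 < N) :
    K.induced qX ∈ stdSimplex ℝ K.Outcome := by
  refine ⟨K.induced_nonneg hq.1, ?_⟩
  rw [← sum_law _ (fun o t => (o.2.1 t, o.2.2.1 t)),
    Finset.sum_congr rfl fun a _ => K.law_inputs qX hN a, sum_prod_eq_one hq.2]

/-- The common randomness is uniform and independent of the inputs, so its contribution is exact. It
is the only source of `logb 2 N` in the converse. -/
lemma entropy_common {qX : X₁ × X₂ → ℝ} (hq : qX ∈ stdSimplex ℝ (X₁ × X₂)) (hN : 0 < N)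
    {ξ : Type*} [Fintype ξ] (g : (Fin n → X₁) → (Fin n → X₂) → ξ) :
    entropy (K.induced qX) (fun o => (o.1, g o.2.1 o.2.2.1)) =
      Real.logb 2 N + entropy (K.induced qX) (fun o => g o.2.1 o.2.2.1) := by
  have hN' : (N : ℝ) ≠ 0 := by positivity
  have hp := K.induced_mem_stdSimplex hq hN
  have h : ∀ ω z, law (K.induced qX) (fun o => (o.1, g o.2.1 o.2.2.1)) (ω, z) =
      (1 / (N : ℝ)) * law (K.induced qX) (fun o => g o.2.1 o.2.2.1) z := by
    intro ω z
    have h1 := K.sum_induced_inputs qX (fun ω' x₁ x₂ => if (ω', g x₁ x₂) = (ω, z) then 1 else 0)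
    have h2 := K.sum_induced_inputs qX (fun _ x₁ x₂ => if g x₁ x₂ = z then 1 else 0)
    rw [(law_eq_sum_mul _ _ _).trans h1, (law_eq_sum_mul _ _ _).trans h2]
    simp only [mul_ite, mul_one, mul_zero]
    rw [Finset.sum_const, Finset.card_univ, Fintype.card_fin, nsmul_eq_mul,
      ← mul_assoc, one_div_mul_cancel hN', one_mul, Finset.sum_eq_single ω]
    · simp
    · intro ω' _ hne
      simp [hne]
    · simp
  rw [entropy_eq, entropy_eq, Real.logb, ← add_div]
  congr 1
  rw [← one_mul (Real.log N), ← hp.2, Finset.sum_mul, ← Finset.sum_add_distrib]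
  refine Finset.sum_congr rfl fun o _ => ?_
  rcases (hp.1 o).eq_or_lt with h0 | h0
  · simp [← h0]
  have l := law_self_pos hp.1 (fun o => g o.2.1 o.2.2.1) h0
  rw [h, Real.log_mul (by positivity) l.ne', one_div, Real.log_inv]
  ring

/-- The messages before round `s`. -/
def pre (s : ℕ) (o : K.Outcome) : (j : {j : Fin r // j.val < s}) → Fin (K.size j) :=
  fun j => o.2.2.2.1 j

variable {K} in
lemma pre_eq_iff {s : ℕ} {o o' : K.Outcome} :
    K.pre s o' = K.pre s o ↔ ∀ j : Fin r, j.val < s → o'.2.2.2.1 j = o.2.2.2.1 j := by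
  simp [pre, funext_iff]

variable {K} in
lemma pre_succ_eq_iff {i : Fin r} {o o' : K.Outcome} :
    K.pre (i.val + 1) o' = K.pre (i.val + 1) o ↔
      o'.2.2.2.1 i = o.2.2.2.1 i ∧ K.pre i.val o' = K.pre i.val o := by
  simp only [pre_eq_iff]
  constructor
  · exact fun h => ⟨h i (by omega), fun j hj => h j (by omega)⟩
  · rintro ⟨h1, h2⟩ j hj
    rcases lt_or_eq_of_le (Nat.lt_succ_iff.1 hj) with h | h
    · exact h2 j h
    · rw [Fin.ext h]; exact h1

/-- Entropy of the messages before round `s`, the common randomness and a function of the inputs. -/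
noncomputable def preEntropy (qX : X₁ × X₂ → ℝ) {ξ : Type*} [Fintype ξ]
    (g : (Fin n → X₁) → (Fin n → X₂) → ξ) (s : ℕ) : ℝ :=
  entropy (K.induced qX) (fun o => (K.pre s o, o.1, g o.2.1 o.2.2.1))

lemma preEntropy_succ_le {qX : X₁ × X₂ → ℝ} (hp : K.induced qX ∈ stdSimplex ℝ K.Outcome)
    {ξ : Type*} [Fintype ξ] (g : (Fin n → X₁) → (Fin n → X₂) → ξ) (i : Fin r) :
    K.preEntropy qX g (i.val + 1) - K.preEntropy qX g i.val ≤
      entropy (K.induced qX) (K.message i) := by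
  have := entropy_pair_le hp (K.message i) (fun o => (K.pre i.val o, o.1, g o.2.1 o.2.2.1))
  unfold preEntropy
  rw [entropy_congr_ker _ (A := fun o => (K.pre (i.val + 1) o, o.1, g o.2.1 o.2.2.1))
    (B := fun o => (K.message i o, K.pre i.val o, o.1, g o.2.1 o.2.2.1))]
  · linarith
  · intro o o'
    simp only [Prod.mk.injEq, pre_succ_eq_iff, message, and_assoc]

lemma preEntropy_mono {qX : X₁ × X₂ → ℝ} (hp : K.induced qX ∈ stdSimplex ℝ K.Outcome)
    {ξ : Type*} [Fintype ξ] (g : (Fin n → X₁) → (Fin n → X₂) → ξ) (i : Fin r) :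
    K.preEntropy qX g i.val ≤ K.preEntropy qX g (i.val + 1) := by
  refine entropy_mono hp.1 fun o o' h => ?_
  simp only [Prod.mk.injEq, pre_succ_eq_iff] at h ⊢
  tauto

lemma preEntropy_zero {qX : X₁ × X₂ → ℝ} (hq : qX ∈ stdSimplex ℝ (X₁ × X₂)) (hN : 0 < N)
    {ξ : Type*} [Fintype ξ] (g : (Fin n → X₁) → (Fin n → X₂) → ξ) :
    K.preEntropy qX g 0 =
      Real.logb 2 N + entropy (K.induced qX) (fun o => g o.2.1 o.2.2.1) := by
  rw [← K.entropy_common hq hN g]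
  refine entropy_congr_ker _ fun o o' => ?_
  simp [Prod.mk.injEq, pre_eq_iff]

lemma preEntropy_last (qX : X₁ × X₂ → ℝ) {ξ : Type*} [Fintype ξ]
    (g : (Fin n → X₁) → (Fin n → X₂) → ξ) :
    K.preEntropy qX g r =
      entropy (K.induced qX) (fun o => (o.2.2.2.1, o.1, g o.2.1 o.2.2.1)) := by
  refine entropy_congr_ker _ fun o o' => ?_
  simp only [Prod.mk.injEq, pre_eq_iff, funext_iff (f := o'.2.2.2.1)]
  exact and_congr ⟨fun h j => h j j.2, fun h j _ => h j⟩ Iff.rfl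

variable [Nonempty Y₁] [Nonempty Y₂]

/-- Terminal 1 draws the message from the preceding messages, the common randomness and its own
source; given these, the other source is irrelevant. -/
lemma preEntropy_even {qX : X₁ × X₂ → ℝ} (hp : K.induced qX ∈ stdSimplex ℝ K.Outcome) (i : Fin r)
    (hi : Even i.val) :
    K.preEntropy qX (fun x₁ x₂ => (x₁, x₂)) (i.val + 1) +
        K.preEntropy qX (fun x₁ _ => x₁) i.val =
      K.preEntropy qX (fun x₁ _ => x₁) (i.val + 1) +
        K.preEntropy qX (fun x₁ x₂ => (x₁, x₂)) i.val := by
  have hM : IsMarkov (K.induced qX) (fun o => o.2.2.2.1 i) (fun o => (K.pre i.val o, o.1, o.2.1))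
      (fun o => o.2.2.1) := by
    refine IsMarkov.of_law_eq (p := K.trunc qX (i.val + 1)) (fun z => ?_)
      (IsMarkov.of_exchange (fun o o' => (o.1, o.2.1, o'.2.2.1, o.2.2.2)) ?_)
    · refine K.law_induced_eq_trunc qX (i.val + 1) _ (fun ω x₁ x₂ c =>
        (c i, ((fun j : {j : Fin r // j.val < i.val} => c j), ω, x₁), x₂)) (fun _ => rfl) ?_ z
      intro ω x₁ x₂ c c' h
      rw [h i (by omega)]
      simp only [Prod.mk.injEq, and_true, true_and, funext_iff, Subtype.forall]
      exact fun j hj => h j (by omega)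
    · intro o o' h
      simp only [Prod.mk.injEq, pre_eq_iff] at h
      obtain ⟨h1, h2, h3⟩ := h
      refine ⟨rfl, rfl, rfl, rfl, ?_⟩
      exact K.trunc_exchange qX i hi o o' h2 (fun t => Or.inl (congrFun h3 t)) fun j hj => h1 j hj
  have := entropy_markov hp.1 hM
  unfold preEntropy
  rw [entropy_congr_ker _ (A := fun o => (K.pre (i.val + 1) o, o.1, o.2.1, o.2.2.1))
    (B := fun o => (o.2.2.2.1 i, (K.pre i.val o, o.1, o.2.1), o.2.2.1))
    (by intro o o'; simp only [Prod.mk.injEq, pre_succ_eq_iff, and_assoc]), this,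
    entropy_congr_ker _ (A := fun o => (K.pre (i.val + 1) o, o.1, o.2.1))
    (B := fun o => (o.2.2.2.1 i, (K.pre i.val o, o.1, o.2.1)))
    (by intro o o'; simp only [Prod.mk.injEq, pre_succ_eq_iff, and_assoc])]
  congr 1
  refine entropy_congr_ker _ ?_
  intro o o'
  simp only [Prod.mk.injEq, and_assoc]

lemma preEntropy_odd {qX : X₁ × X₂ → ℝ} (hp : K.induced qX ∈ stdSimplex ℝ K.Outcome) (i : Fin r)
    (hi : Odd i.val) :
    K.preEntropy qX (fun x₁ x₂ => (x₁, x₂)) (i.val + 1) +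
        K.preEntropy qX (fun _ x₂ => x₂) i.val =
      K.preEntropy qX (fun _ x₂ => x₂) (i.val + 1) +
        K.preEntropy qX (fun x₁ x₂ => (x₁, x₂)) i.val := by
  have hM : IsMarkov (K.induced qX) (fun o => o.2.2.2.1 i) (fun o => (K.pre i.val o, o.1, o.2.2.1))
      (fun o => o.2.1) := by
    refine IsMarkov.of_law_eq (p := K.trunc qX (i.val + 1)) (fun z => ?_)
      (IsMarkov.of_exchange (fun o o' => (o.1, o'.2.1, o.2.2)) ?_)
    · refine K.law_induced_eq_trunc qX (i.val + 1) _ (fun ω x₁ x₂ c =>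
        (c i, ((fun j : {j : Fin r // j.val < i.val} => c j), ω, x₂), x₁)) (fun _ => rfl) ?_ z
      intro ω x₁ x₂ c c' h
      rw [h i (by omega)]
      simp only [Prod.mk.injEq, and_true, true_and, funext_iff, Subtype.forall]
      exact fun j hj => h j (by omega)
    · intro o o' h
      simp only [Prod.mk.injEq, pre_eq_iff] at h
      obtain ⟨h1, h2, h3⟩ := h
      refine ⟨rfl, rfl, rfl, rfl, ?_⟩
      exact K.trunc_exchange' qX i hi o o' h2 (fun t => Or.inr (congrFun h3 t)) fun j hj => h1 j hj
  have := entropy_markov hp.1 hM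
  unfold preEntropy
  rw [entropy_congr_ker _ (A := fun o => (K.pre (i.val + 1) o, o.1, o.2.1, o.2.2.1))
    (B := fun o => (o.2.2.2.1 i, (K.pre i.val o, o.1, o.2.2.1), o.2.1))
    (by intro o o'; simp only [Prod.mk.injEq, pre_succ_eq_iff]; tauto), this,
    entropy_congr_ker _ (A := fun o => (K.pre (i.val + 1) o, o.1, o.2.2.1))
    (B := fun o => (o.2.2.2.1 i, (K.pre i.val o, o.1, o.2.2.1)))
    (by intro o o'; simp only [Prod.mk.injEq, pre_succ_eq_iff, and_assoc])]
  congr 1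
  refine entropy_congr_ker _ ?_
  intro o o'
  simp only [Prod.mk.injEq]
  tauto

/-- The entropies of the messages dominate the information they carry. -/
lemma message_entropy_bounds [NeZero r] {qX : X₁ × X₂ → ℝ}
    (hp : K.induced qX ∈ stdSimplex ℝ K.Outcome) :
    let h₁ := K.preEntropy qX (fun x₁ _ => x₁)
    let h₂ := K.preEntropy qX (fun _ x₂ => x₂)
    let h := K.preEntropy qX (fun x₁ x₂ => (x₁, x₂))
    let S₁₂ := ∑ i : Fin r with Even i.val, entropy (K.induced qX) (K.message i)
    let S₂₁ := ∑ i : Fin r with Odd i.val, entropy (K.induced qX) (K.message i)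
    (h₂ r - h r) - (h₂ 0 - h 0) + (h 1 - h 0) ≤ S₁₂ ∧ (h₁ r - h r) - (h₁ 0 - h 0) ≤ S₂₁ ∧
    (h₂ r - h r) - (h₂ 0 - h 0) + ((h₁ r - h r) - (h₁ 0 - h 0)) + (h r - h 0) ≤ S₁₂ + S₂₁ ∧
    h 0 ≤ h 1 := by
  intro h₁ h₂ h S₁₂ S₂₁
  -- Telescope `h₂ - h` over the rounds. The increments in the rounds of terminal 2 vanish by
  -- `preEntropy_odd`. In the rounds of terminal 1 the increments of `h` are added back, which
  -- leaves those of `h₂`, each at most the entropy of a message.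
  have e12 : (h₂ r - h r) - (h₂ 0 - h 0) +
      ∑ i : Fin r with Even i.val, (h (i.val + 1) - h i.val) ≤ S₁₂ := by
    rw [← sum_fin_sub (fun s => h₂ s - h s) r,
      ← Finset.sum_filter_add_sum_filter_not Finset.univ (fun i : Fin r => Even i.val)]
    rw [Finset.sum_eq_zero (s := Finset.univ.filter fun i : Fin r => ¬ Even i.val), add_zero,
      ← Finset.sum_add_distrib]
    · refine Finset.sum_le_sum fun i _ => ?_
      have := K.preEntropy_succ_le hp (fun _ x₂ => x₂) i
      linarith
    · intro i hi
      have := K.preEntropy_odd hp i (Nat.not_even_iff_odd.1 (Finset.mem_filter.1 hi).2)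
      simp only [h₂, h]
      linarith
  have e21 : (h₁ r - h r) - (h₁ 0 - h 0) +
      ∑ i : Fin r with Odd i.val, (h (i.val + 1) - h i.val) ≤ S₂₁ := by
    rw [← sum_fin_sub (fun s => h₁ s - h s) r,
      ← Finset.sum_filter_add_sum_filter_not Finset.univ (fun i : Fin r => Odd i.val)]
    rw [Finset.sum_eq_zero (s := Finset.univ.filter fun i : Fin r => ¬ Odd i.val), add_zero,
      ← Finset.sum_add_distrib]
    · refine Finset.sum_le_sum fun i _ => ?_
      have := K.preEntropy_succ_le hp (fun x₁ _ => x₁) i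
      linarith
    · intro i hi
      have := K.preEntropy_even hp i (Nat.not_odd_iff_even.1 (Finset.mem_filter.1 hi).2)
      simp only [h₁, h]
      linarith
  have hmono : ∀ i : Fin r, 0 ≤ h (i.val + 1) - h i.val := fun i =>
    sub_nonneg.2 (K.preEntropy_mono hp _ i)
  have hfirst : h 1 - h 0 ≤ ∑ i : Fin r with Even i.val, (h (i.val + 1) - h i.val) := by
    have := Finset.single_le_sum (f := fun i : Fin r => h (i.val + 1) - h i.val)
      (s := Finset.univ.filter fun i : Fin r => Even i.val) (fun i _ => hmono i)
      (Finset.mem_filter.2 ⟨Finset.mem_univ (0 : Fin r), by simp⟩)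
    simpa using this
  have hsum : h r - h 0 = ∑ i : Fin r with Even i.val, (h (i.val + 1) - h i.val) +
      ∑ i : Fin r with Odd i.val, (h (i.val + 1) - h i.val) := by
    rw [← sum_fin_sub h r,
      ← Finset.sum_filter_add_sum_filter_not Finset.univ (fun i : Fin r => Even i.val)]
    simp only [Nat.not_even_iff_odd]
  have hodd : 0 ≤ ∑ i : Fin r with Odd i.val, (h (i.val + 1) - h i.val) :=
    Finset.sum_nonneg fun i _ => hmono i
  have h01 : 0 ≤ h 1 - h 0 := by simpa using hmono 0
  refine ⟨by linarith, by linarith, by linarith, by linarith⟩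

end Code

end Converse

/-! ### Single-letter bounds and the slack of approximate simulation. -/

section Converse

variable {X₁ X₂ Y₁ Y₂ : Type*} [Fintype X₁] [Fintype X₂] [Fintype Y₁] [Fintype Y₂] {r n N : ℕ}

namespace Code

variable (K : Code X₁ X₂ Y₁ Y₂ r n N) [Nonempty X₁] [Nonempty X₂]

/-- The single-letter law built from a code. -/
noncomputable def letter (qX : X₁ × X₂ → ℝ) : AuxSpace X₁ X₂ Y₁ Y₂
    (fun i : Fin r => Fintype.card (Side X₁ X₂ n N × Fin (K.size i))) → ℝ :=
  law (timed n (K.induced qX)) K.auxPoint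

lemma law_input_at {qX : X₁ × X₂ → ℝ} (hq : qX ∈ stdSimplex ℝ (X₁ × X₂)) (hN : 0 < N) (t : Fin n)
    (a : X₁ × X₂) : law (K.induced qX) (fun o => (o.2.1 t, o.2.2.1 t)) a = qX a := by
  have h := law_law (K.induced qX) (fun o t => (o.2.1 t, o.2.2.1 t)) (fun b => b t) a
  rw [← h, law_eq_sum_mul]
  simp only [K.law_inputs qX hN]
  rw [sum_prod_mul_apply hq.2 t (fun b => if b = a then 1 else 0)]
  simp

lemma law_letter_x {qX : X₁ × X₂ → ℝ} (hq : qX ∈ stdSimplex ℝ (X₁ × X₂)) (hN : 0 < N) (hn : 0 < n)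
    (a : X₁ × X₂) : law (K.letter qX) AuxSpace.x a = qX a := by
  have hn' : (n : ℝ) ≠ 0 := by positivity
  rw [letter, law_law, law_timed]
  have : ∀ t : Fin n, law (K.induced qX) (fun o => AuxSpace.x (K.auxPoint (t, o))) a = qX a :=
    fun t => K.law_input_at hq hN t a
  simp only [this, Finset.sum_const, Finset.card_univ, Fintype.card_fin, nsmul_eq_mul]
  field_simp

lemma entropy_letter_inputs {qX : X₁ × X₂ → ℝ} (hq : qX ∈ stdSimplex ℝ (X₁ × X₂)) (hN : 0 < N)
    (hn : 0 < n) {ξ : Type*} [Fintype ξ] (g : X₁ × X₂ → ξ) :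
    entropy (K.induced qX) (fun o t => g (o.2.1 t, o.2.2.1 t)) =
      n * entropy (K.letter qX) (fun w => g (AuxSpace.x w)) := by
  rw [entropy_of_law_iid (law_mem_stdSimplex hq g)]
  · congr 1
    rw [entropy]
    simp only [← law_law (K.letter qX) AuxSpace.x g]
    rw [funext (K.law_letter_x hq hN hn)]
  · intro b
    rw [← law_iid]
    rw [← law_law (K.induced qX) (fun o t => (o.2.1 t, o.2.2.1 t)) (fun a t => g (a t)),
      funext (K.law_inputs qX hN)]

lemma condEntropy_letter (hn : 0 < n) {qX : X₁ × X₂ → ℝ} (hp : ∀ o, 0 ≤ K.induced qX o)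
    {α β : Type*} [Fintype α] [Fintype β]
    (A : AuxSpace X₁ X₂ Y₁ Y₂ (fun i : Fin r => Fintype.card (Side X₁ X₂ n N × Fin (K.size i))) → α)
    (B : AuxSpace X₁ X₂ Y₁ Y₂ (fun i : Fin r => Fintype.card (Side X₁ X₂ n N × Fin (K.size i))) → β)
    (hB : ∀ v v', B (K.auxPoint v) = B (K.auxPoint v') → v.1 = v'.1) :
    n * condEntropy (K.letter qX) A B = ∑ t, condEntropy (K.induced qX)
      (fun o => A (K.auxPoint (t, o))) (fun o => B (K.auxPoint (t, o))) := by
  have hn' : (n : ℝ) ≠ 0 := by positivity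
  rw [letter, condEntropy_law, condEntropy_timed hn hp _ _ hB]
  field_simp

variable [Nonempty Y₁] [Nonempty Y₂] [NeZero r]

-- The chain rule over time compares the block entropies of `message_entropy_bounds` with n times
-- single-letter conditional entropies, whose conditions are contained in those of the chain rule.
-- The defect `σ` would vanish for an exact simulation. The first message alone yields the third
-- bound, all messages together the fourth.
open AuxSpace in
lemma letter_bounds {qX : X₁ × X₂ → ℝ} (hq : qX ∈ stdSimplex ℝ (X₁ × X₂)) (hN : 0 < N)
    (hn : 0 < n) :
    let Q := K.letter qX
    let S₁₂ := ∑ i : Fin r with Even i.val, entropy (K.induced qX) (K.message i)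
    let S₂₁ := ∑ i : Fin r with Odd i.val, entropy (K.induced qX) (K.message i)
    let σ := n * entropy Q (fun w => (x w, y w)) - entropy (K.induced qX) K.inputOutput
    n * condMutualInfo Q x₁ F x₂ ≤ S₁₂ ∧ n * condMutualInfo Q x₂ F x₁ ≤ S₂₁ ∧
    n * (condMutualInfo Q x₁ F x₂ + condMutualInfo Q (Fi 0) y x) ≤ Real.logb 2 N + S₁₂ + σ ∧
    n * (condMutualInfo Q x₁ F x₂ + condMutualInfo Q x₂ F x₁ + condMutualInfo Q F y x) ≤
      Real.logb 2 N + S₁₂ + S₂₁ + σ := by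
  intro Q S₁₂ S₂₁ σ
  have hp := K.induced_mem_stdSimplex hq hN
  obtain ⟨b1, b2, b3, b4⟩ := K.message_entropy_bounds hp
  have z1 := K.preEntropy_zero hq hN (fun x₁ _ => x₁)
  have z2 := K.preEntropy_zero hq hN (fun _ x₂ => x₂)
  have z := K.preEntropy_zero hq hN (fun x₁ x₂ => (x₁, x₂))
  have l1 := K.preEntropy_last qX (fun x₁ _ => x₁)
  have l2 := K.preEntropy_last qX (fun _ x₂ => x₂)
  have l := K.preEntropy_last qX (fun x₁ x₂ => (x₁, x₂))
  have i1 : entropy (K.induced qX) (fun o => o.2.1) = n * entropy Q x₁ :=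
    K.entropy_letter_inputs hq hN hn Prod.fst
  have i2 : entropy (K.induced qX) (fun o => o.2.2.1) = n * entropy Q x₂ :=
    K.entropy_letter_inputs hq hN hn Prod.snd
  have i12 : entropy (K.induced qX) (fun o => (o.2.1, o.2.2.1)) = n * entropy Q x := by
    rw [← K.entropy_letter_inputs hq hN hn (fun a => a)]
    refine entropy_congr_ker _ fun o o' => ?_
    simp only [Prod.mk.injEq, funext_iff, forall_and]
  have x12 : entropy Q (fun w => (x₁ w, x₂ w)) = entropy Q x := rfl
  have x21 : entropy Q (fun w => (x₂ w, x₁ w)) = entropy Q x :=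
    entropy_congr_ker _ fun w w' => by simp only [x, Prod.mk.injEq]; tauto
  have yx : entropy Q (fun w => (y w, x w)) = entropy Q (fun w => (x w, y w)) :=
    entropy_congr_ker _ fun w w' => by simp only [Prod.mk.injEq]; tauto
  -- The first source is expanded forwards in time, and in `hB` the second one backwards, to match
  -- the past and the future contained in the side information.
  have hA : K.preEntropy qX (fun x₁ x₂ => (x₁, x₂)) r - K.preEntropy qX (fun _ x₂ => x₂) r ≤
      n * condEntropy Q x₁ (fun w => (F w, x₂ w)) := by
    rw [K.condEntropy_letter hn hp.1 _ _ (fun v v' h => by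
      simp only [Prod.mk.injEq, F_auxPoint_eq_iff, side_eq_iff] at h; exact h.1.1.1), l, l2,
      entropy_congr_ker _ (A := fun o : K.Outcome => (o.2.2.2.1, o.1, o.2.1, o.2.2.1))
      (B := fun o : K.Outcome => ((fun t => o.2.1 t), (o.2.2.2.1, o.1, o.2.2.1)))
      (by intro o o'; simp only [Prod.mk.injEq]; tauto),
      entropy_chain_rule (K.induced qX) (fun t o => o.2.1 t)]
    refine Finset.sum_le_sum fun t _ => condEntropy_anti hp.1 _ fun o o' h => ?_
    simp only [Prod.mk.injEq, funext_iff, Subtype.forall] at h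
    obtain ⟨h1, h2, h3, h4⟩ := h
    simp only [Prod.mk.injEq, F_auxPoint_eq_iff]
    exact ⟨⟨K.side_congr rfl h3 h1 fun s _ => h4 s, funext h2⟩, h4 t⟩
  have hB : K.preEntropy qX (fun x₁ x₂ => (x₁, x₂)) r - K.preEntropy qX (fun x₁ _ => x₁) r ≤
      n * condEntropy Q x₂ (fun w => (F w, x₁ w)) := by
    rw [K.condEntropy_letter hn hp.1 _ _ (fun v v' h => by
      simp only [Prod.mk.injEq, F_auxPoint_eq_iff, side_eq_iff] at h; exact h.1.1.1), l, l1,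
      entropy_congr_ker _ (A := fun o : K.Outcome => (o.2.2.2.1, o.1, o.2.1, o.2.2.1))
      (B := fun o : K.Outcome => ((fun t => o.2.2.1 t), (o.2.2.2.1, o.1, o.2.1)))
      (by intro o o'; simp only [Prod.mk.injEq]; tauto),
      entropy_chain_rule_rev (K.induced qX) (fun t o => o.2.2.1 t)]
    refine Finset.sum_le_sum fun t _ => condEntropy_anti hp.1 _ fun o o' h => ?_
    simp only [Prod.mk.injEq, funext_iff, Subtype.forall] at h
    obtain ⟨h1, h2, h3, h4⟩ := h
    simp only [Prod.mk.injEq, F_auxPoint_eq_iff]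
    exact ⟨⟨K.side_congr rfl h3 (fun s _ => h4 s) h1, funext h2⟩, h4 t⟩
  have hD : entropy (K.induced qX) K.inputOutput - K.preEntropy qX (fun x₁ x₂ => (x₁, x₂)) r ≤
      n * condEntropy Q y (fun w => (F w, x w)) := by
    rw [K.condEntropy_letter hn hp.1 _ _ (fun v v' h => by
      simp only [Prod.mk.injEq, F_auxPoint_eq_iff, side_eq_iff] at h; exact h.1.1.1), l]
    refine (sub_le_sub_right (entropy_mono hp.1 (A := fun o : K.Outcome =>
      ((fun t => (o.2.2.2.2.1 t, o.2.2.2.2.2 t)), (o.2.2.2.1, o.1, o.2.1, o.2.2.1))) ?_) _).trans ?_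
    · intro o o' h
      simp only [Prod.mk.injEq, funext_iff, forall_and] at h
      simp only [inputOutput, Prod.mk.injEq, funext_iff]
      tauto
    rw [entropy_chain_rule (K.induced qX) (fun t o => (o.2.2.2.2.1 t, o.2.2.2.2.2 t))]
    refine Finset.sum_le_sum fun t _ => condEntropy_anti hp.1 _ fun o o' h => ?_
    simp only [Prod.mk.injEq, funext_iff, Subtype.forall] at h
    obtain ⟨-, h2, h3, h4, h5⟩ := h
    simp only [Prod.mk.injEq, F_auxPoint_eq_iff, x]
    exact ⟨⟨K.side_congr rfl h3 (fun s _ => h4 s) (fun s _ => h5 s), funext h2⟩, h4 t, h5 t⟩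
  have hC : entropy (K.induced qX) K.inputOutput - K.preEntropy qX (fun x₁ x₂ => (x₁, x₂)) 1 ≤
      n * condEntropy Q y (fun w => (Fi 0 w, x w)) := by
    rw [K.condEntropy_letter hn hp.1 _ _ (fun v v' h => by
      simp only [Prod.mk.injEq, Fi_auxPoint_eq_iff, side_eq_iff] at h; exact h.1.1.1)]
    unfold preEntropy
    refine (sub_le_sub_right (entropy_mono hp.1 (A := fun o : K.Outcome =>
      ((fun t => (o.2.2.2.2.1 t, o.2.2.2.2.2 t)), (K.pre 1 o, o.1, o.2.1, o.2.2.1))) ?_) _).trans ?_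
    · intro o o' h
      simp only [Prod.mk.injEq, funext_iff (f := o'.2.1), funext_iff (f := o'.2.2.1),
        funext_iff (f := fun t => (o'.2.2.2.2.1 t, o'.2.2.2.2.2 t)), forall_and] at h
      simp only [inputOutput, Prod.mk.injEq, funext_iff]
      tauto
    rw [entropy_chain_rule (K.induced qX) (fun t o => (o.2.2.2.2.1 t, o.2.2.2.2.2 t))]
    refine Finset.sum_le_sum fun t _ => condEntropy_anti hp.1 _ fun o o' h => ?_
    simp only [Prod.mk.injEq, pre_eq_iff] at h
    obtain ⟨-, h2, h3, h4, h5⟩ := h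
    simp only [Prod.mk.injEq, Fi_auxPoint_eq_iff, x]
    exact ⟨⟨K.side_congr rfl h3 (fun s _ => congrFun h4 s) (fun s _ => congrFun h5 s),
      h2 0 (by simp)⟩, congrFun h4 t, congrFun h5 t⟩
  have eA : n * condMutualInfo Q x₁ F x₂ = n * entropy Q x - n * entropy Q x₂ -
      n * condEntropy Q x₁ (fun w => (F w, x₂ w)) := by
    rw [condMutualInfo, condEntropy, x12]; ring
  have eB : n * condMutualInfo Q x₂ F x₁ = n * entropy Q x - n * entropy Q x₁ -
      n * condEntropy Q x₂ (fun w => (F w, x₁ w)) := by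
    rw [condMutualInfo, condEntropy, x21]; ring
  have eC : n * condMutualInfo Q (Fi 0) y x = n * entropy Q (fun w => (x w, y w)) -
      n * entropy Q x - n * condEntropy Q y (fun w => (Fi 0 w, x w)) := by
    rw [condMutualInfo_comm, condMutualInfo, condEntropy, yx]; ring
  have eD : n * condMutualInfo Q F y x = n * entropy Q (fun w => (x w, y w)) -
      n * entropy Q x - n * condEntropy Q y (fun w => (F w, x w)) := by
    rw [condMutualInfo_comm, condMutualInfo, condEntropy, yx]; ring
  rw [mul_add, mul_add, mul_add, eA, eB, eC, eD]
  simp only [S₁₂, S₂₁, σ]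
  refine ⟨by linarith, by linarith, by linarith, by linarith⟩

end Code

lemma abs_law_sub_le {Ω α : Type*} [Fintype Ω] (p p' : Ω → ℝ) (A : Ω → α) (a : α) :
    |law p A a - law p' A a| ≤ 2 * tvDist p p' := by
  rw [tvDist, mul_div_cancel₀ _ (by norm_num : (2 : ℝ) ≠ 0), law, law, ← Finset.sum_sub_distrib]
  refine (Finset.abs_sum_le_sum_abs _ _).trans (Finset.sum_le_sum fun w _ => ?_)
  split_ifs
  · exact le_rfl
  · simp

/-- Sequences of letters and tuples of sequences. -/
def letterEquiv (X₁ X₂ Y₁ Y₂ : Type*) (n : ℕ) : (Fin n → (X₁ × X₂) × (Y₁ × Y₂)) ≃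
    ((Fin n → X₁) × (Fin n → X₂)) × ((Fin n → Y₁) × (Fin n → Y₂)) where
  toFun a := ((fun t => (a t).1.1, fun t => (a t).1.2), (fun t => (a t).2.1, fun t => (a t).2.2))
  invFun b t := ((b.1.1 t, b.1.2 t), (b.2.1 t, b.2.2 t))
  left_inv _ := rfl
  right_inv _ := rfl

section Target

variable {qX : X₁ × X₂ → ℝ} {W : X₁ × X₂ → Y₁ × Y₂ → ℝ}

lemma joint_mem_stdSimplex (hq : qX ∈ stdSimplex ℝ (X₁ × X₂))
    (hW : ∀ x, W x ∈ stdSimplex ℝ (Y₁ × Y₂)) :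
    (fun z : (X₁ × X₂) × (Y₁ × Y₂) => qX z.1 * W z.1 z.2) ∈
      stdSimplex ℝ ((X₁ × X₂) × (Y₁ × Y₂)) := by
  refine ⟨fun z => mul_nonneg (hq.1 _) ((hW _).1 _), ?_⟩
  rw [Fintype.sum_prod_type]
  simp only [← Finset.mul_sum, (hW _).2, mul_one, hq.2]

lemma target_letterEquiv (a : Fin n → (X₁ × X₂) × (Y₁ × Y₂)) :
    target qX W n (letterEquiv X₁ X₂ Y₁ Y₂ n a) = ∏ t, qX (a t).1 * W (a t).1 (a t).2 := rfl

lemma target_mem_stdSimplex (hq : qX ∈ stdSimplex ℝ (X₁ × X₂))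
    (hW : ∀ x, W x ∈ stdSimplex ℝ (Y₁ × Y₂)) :
    target qX W n ∈
      stdSimplex ℝ (((Fin n → X₁) × (Fin n → X₂)) × ((Fin n → Y₁) × (Fin n → Y₂))) := by
  have hj := joint_mem_stdSimplex hq hW
  refine ⟨fun z => Finset.prod_nonneg fun t _ => hj.1 ((z.1.1 t, z.1.2 t), (z.2.1 t, z.2.2 t)), ?_⟩
  rw [← Equiv.sum_comp (letterEquiv X₁ X₂ Y₁ Y₂ n)]
  simp only [target_letterEquiv]
  exact sum_prod_eq_one hj.2

lemma law_target_at (hq : qX ∈ stdSimplex ℝ (X₁ × X₂))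
    (hW : ∀ x, W x ∈ stdSimplex ℝ (Y₁ × Y₂)) (t : Fin n) (z : (X₁ × X₂) × (Y₁ × Y₂)) :
    law (target qX W n) (fun b => ((b.1.1 t, b.1.2 t), (b.2.1 t, b.2.2 t))) z =
      qX z.1 * W z.1 z.2 := by
  have hj := joint_mem_stdSimplex hq hW
  rw [← law_comp_equiv _ (letterEquiv X₁ X₂ Y₁ Y₂ n), law_eq_sum_mul]
  simp only [target_letterEquiv]
  have := sum_prod_mul_apply hj.2 t (fun b => if b = z then 1 else 0)
  refine Eq.trans ?_ (this.trans ?_)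
  · exact Finset.sum_congr rfl fun a _ => rfl
  · simp

lemma sum_negMulLog_target (hq : qX ∈ stdSimplex ℝ (X₁ × X₂))
    (hW : ∀ x, W x ∈ stdSimplex ℝ (Y₁ × Y₂)) :
    ∑ b, Real.negMulLog (target qX W n b) =
      n * ∑ z : (X₁ × X₂) × (Y₁ × Y₂), Real.negMulLog (qX z.1 * W z.1 z.2) := by
  rw [← sum_negMulLog_prod (joint_mem_stdSimplex hq hW),
    ← Equiv.sum_comp (letterEquiv X₁ X₂ Y₁ Y₂ n)]
  rfl

end Target

lemma tvDist_nonneg {Ω : Type*} [Fintype Ω] (p q : Ω → ℝ) : 0 ≤ tvDist p q :=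
  div_nonneg (Finset.sum_nonneg fun _ _ => abs_nonneg _) (by norm_num)

lemma Code.abs_law_letter_sub_le [Nonempty X₁] [Nonempty X₂] (K : Code X₁ X₂ Y₁ Y₂ r n N)
    {qX : X₁ × X₂ → ℝ} {W : X₁ × X₂ → Y₁ × Y₂ → ℝ} (hq : qX ∈ stdSimplex ℝ (X₁ × X₂))
    (hW : ∀ x, W x ∈ stdSimplex ℝ (Y₁ × Y₂)) (hn : 0 < n) (z : (X₁ × X₂) × (Y₁ × Y₂)) :
    |law (K.letter qX) (fun w => (AuxSpace.x w, AuxSpace.y w)) z - qX z.1 * W z.1 z.2| ≤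
      2 * tvDist (law (K.induced qX) K.inputOutput) (target qX W n) := by
  have hn' : (n : ℝ) ≠ 0 := by positivity
  rw [Code.letter, law_law, law_timed]
  have e : ∀ t : Fin n, law (K.induced qX) (fun o => ((K.auxPoint (t, o)).x, (K.auxPoint (t, o)).y)) z
      = law (law (K.induced qX) K.inputOutput)
        (fun b => ((b.1.1 t, b.1.2 t), (b.2.1 t, b.2.2 t))) z := fun t => by
    rw [law_law]; rfl
  have h : qX z.1 * W z.1 z.2 = 1 / (n : ℝ) * ∑ t : Fin n, law (target qX W n)
      (fun b => ((b.1.1 t, b.1.2 t), (b.2.1 t, b.2.2 t))) z := by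
    simp only [law_target_at hq hW, Finset.sum_const, Finset.card_univ, Fintype.card_fin,
      nsmul_eq_mul]
    field_simp
  rw [h, ← mul_sub, ← Finset.sum_sub_distrib, abs_mul, abs_of_nonneg (by positivity)]
  simp only [e]
  refine (mul_le_mul_of_nonneg_left ((Finset.abs_sum_le_sum_abs _ _).trans
    (Finset.sum_le_sum fun t _ => abs_law_sub_le _ _ _ _)) (by positivity)).trans (le_of_eq ?_)
  simp only [Finset.sum_const, Finset.card_univ, Fintype.card_fin, nsmul_eq_mul]
  field_simp

/-- Achievable tuples are approximated by single-letter laws. -/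
lemma Achievable.exists_isNear [NeZero r] {qX : X₁ × X₂ → ℝ} {W : X₁ × X₂ → Y₁ × Y₂ → ℝ}
    (hq : qX ∈ stdSimplex ℝ (X₁ × X₂)) (hW : ∀ x, W x ∈ stdSimplex ℝ (Y₁ × Y₂)) {R : ℝ × ℝ × ℝ}
    (hR : Achievable r qX W R) {ε : ℝ} (hε : 0 < ε) :
    ∃ (m : Fin r → ℕ) (p : AuxSpace X₁ X₂ Y₁ Y₂ m → ℝ), IsNear qX W R ε p := by
  obtain ⟨hR0, -, -, K, hK, hT⟩ := hR
  have hne : Nonempty (X₁ × X₂) := by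
    by_contra h
    rw [not_nonempty_iff] at h
    simpa using hq.2
  have hX₁ : Nonempty X₁ := hne.map Prod.fst
  have hX₂ : Nonempty X₂ := hne.map Prod.snd
  have hne' : Nonempty (Y₁ × Y₂) := by
    by_contra h
    rw [not_nonempty_iff] at h
    simpa using (hW hne.some).2
  have hY₁ : Nonempty Y₁ := hne'.map Prod.fst
  have hY₂ : Nonempty Y₂ := hne'.map Prod.snd
  have hN : ∀ n : ℕ, 0 < ⌊(2 : ℝ) ^ ((n : ℝ) * R.1)⌋₊ := fun n => Nat.floor_pos.2
    (Real.one_le_rpow (by norm_num) (by positivity))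
  set δ : ℕ → ℝ := fun n => tvDist (law ((K n).induced qX) (K n).inputOutput) (target qX W n)
    with hδ
  set μ : ℕ → (X₁ × X₂) × (Y₁ × Y₂) → ℝ := fun n =>
    law ((K n).letter qX) (fun w => (AuxSpace.x w, AuxSpace.y w)) with hμ
  set ν : (X₁ × X₂) × (Y₁ × Y₂) → ℝ := fun z => qX z.1 * W z.1 z.2 with hν
  have hμν : Filter.Tendsto μ Filter.atTop (nhds ν) := by
    rw [tendsto_pi_nhds]
    intro z
    rw [tendsto_iff_norm_sub_tendsto_zero]
    refine squeeze_zero' (Filter.Eventually.of_forall fun n => norm_nonneg _) ?_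
      (by simpa using hT.const_mul 2)
    filter_upwards [Filter.eventually_gt_atTop 0] with n hn
    exact (K n).abs_law_letter_sub_le hq hW hn z
  have hH : Filter.Tendsto (fun n => (∑ z, Real.negMulLog (μ n z)) / Real.log 2) Filter.atTop
      (nhds ((∑ z, Real.negMulLog (ν z)) / Real.log 2)) := by
    refine Filter.Tendsto.div_const (tendsto_finsetSum _ fun z _ => ?_) _
    exact (Real.continuous_negMulLog.tendsto _).comp (tendsto_pi_nhds.1 hμν z)
  set L := Real.log (Fintype.card ((X₁ × X₂) × (Y₁ × Y₂))) with hL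
  -- The slack per letter: convergence of the single-letter entropy, plus the loss in the block
  -- entropy. The latter involves the logarithm `n * L` of the block alphabet, so dividing by n
  -- leaves a term that vanishes with `δ`.
  have hslack : Filter.Tendsto (fun n => ((∑ z, Real.negMulLog (μ n z)) / Real.log 2 -
      (∑ z, Real.negMulLog (ν z)) / Real.log 2) +
      (δ n * L + |Real.negMulLog (δ n)| + δ n) / Real.log 2) Filter.atTop (nhds 0) := by
    have h1 := hH.sub_const ((∑ z, Real.negMulLog (ν z)) / Real.log 2)
    rw [sub_self] at h1
    have h2 : Filter.Tendsto (fun n => |Real.negMulLog (δ n)|) Filter.atTop (nhds 0) := by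
      have := ((Real.continuous_negMulLog.tendsto 0).comp hT).abs
      simpa using this
    have h3 := (((hT.mul_const L).add h2).add hT).div_const (Real.log 2)
    simpa using h1.add h3
  obtain ⟨n, hn, hn1, hn2⟩ := ((Filter.eventually_gt_atTop 0).and
    ((hslack.eventually_lt_const hε).and ((hT.const_mul 2).eventually_lt_const
      (by simpa using hε : 2 * (0 : ℝ) < ε)))).exists
  have hn' : (0 : ℝ) < n := by exact_mod_cast hn
  have hp := (K n).induced_mem_stdSimplex hq (hN n)
  obtain ⟨c1, c2, c3, c4⟩ := (K n).letter_bounds hq (hN n) hn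
  have r12 : ∑ i : Fin r with Even i.val, entropy ((K n).induced qX) ((K n).message i) ≤
      n * R.2.1 := by
    have := (hK n hn).1
    rw [Code.rate₁₂, one_div, inv_mul_le_iff₀ hn'] at this
    exact this
  have r21 : ∑ i : Fin r with Odd i.val, entropy ((K n).induced qX) ((K n).message i) ≤
      n * R.2.2 := by
    have := (hK n hn).2
    rw [Code.rate₂₁, one_div, inv_mul_le_iff₀ hn'] at this
    exact this
  have r0 : Real.logb 2 (⌊(2 : ℝ) ^ ((n : ℝ) * R.1)⌋₊ : ℝ) ≤ n * R.1 := by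
    rw [Real.logb_le_iff_le_rpow (by norm_num) (by exact_mod_cast hN n)]
    exact Nat.floor_le (by positivity)
  have hσ : n * entropy ((K n).letter qX) (fun w => (AuxSpace.x w, AuxSpace.y w)) -
      entropy ((K n).induced qX) (K n).inputOutput ≤ n * ε := by
    have f := sum_negMulLog_ge (law_mem_stdSimplex hp (K n).inputOutput)
      (target_mem_stdSimplex (n := n) hq hW)
    rw [sum_negMulLog_target hq hW] at f
    have hc : Real.log (Fintype.card (((Fin n → X₁) × (Fin n → X₂)) ×
        ((Fin n → Y₁) × (Fin n → Y₂)))) = n * L := by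
      rw [← Fintype.card_congr (letterEquiv X₁ X₂ Y₁ Y₂ n), Fintype.card_fun, Fintype.card_fin,
        Nat.cast_pow, Real.log_pow]
    rw [hc] at f
    have e1 : entropy ((K n).letter qX) (fun w => (AuxSpace.x w, AuxSpace.y w)) =
      (∑ z, Real.negMulLog (μ n z)) / Real.log 2 := rfl
    have e2 : (n * (∑ z, Real.negMulLog (ν z)) - δ n * (n * L) - Real.negMulLog (δ n) - δ n) /
        Real.log 2 ≤ entropy ((K n).induced qX) (K n).inputOutput :=
      div_le_div_of_nonneg_right f log_two_pos.le
    have hδ0 : 0 ≤ δ n := tvDist_nonneg _ _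
    have hn1' : (1 : ℝ) ≤ n := by exact_mod_cast hn
    -- The absolute value makes the middle term nonnegative without a bound `δ n ≤ 1`, so that
    -- multiplying it by `n ≥ 1` only enlarges it.
    have e3 : (δ n * (n * L) + Real.negMulLog (δ n) + δ n) / Real.log 2 ≤
        n * ((δ n * L + |Real.negMulLog (δ n)| + δ n) / Real.log 2) := by
      rw [← mul_div_assoc]
      refine div_le_div_of_nonneg_right ?_ log_two_pos.le
      have := le_abs_self (Real.negMulLog (δ n))
      have := abs_nonneg (Real.negMulLog (δ n))
      nlinarith
    have e4 := mul_le_mul_of_nonneg_left hn1.le hn'.le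
    rw [e1]
    have e5 : (n * (∑ z, Real.negMulLog (ν z)) - δ n * (n * L) - Real.negMulLog (δ n) - δ n) /
        Real.log 2 = n * ((∑ z, Real.negMulLog (ν z)) / Real.log 2) -
        (δ n * (n * L) + Real.negMulLog (δ n) + δ n) / Real.log 2 := by ring
    rw [e5] at e2
    rw [mul_add, mul_sub] at e4
    linarith
  refine ⟨_, (K n).letter qX, (K n).isChain_auxPoint hn hp, fun a b => ?_, ?_, ?_, ?_, ?_⟩
  · exact ((K n).abs_law_letter_sub_le hq hW hn (a, b)).trans hn2.le
  · refine le_of_mul_le_mul_left ?_ hn'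
    rw [mul_add]
    have : 0 ≤ n * ε := by positivity
    linarith
  · refine le_of_mul_le_mul_left ?_ hn'
    rw [mul_add]
    have : 0 ≤ n * ε := by positivity
    linarith
  · refine le_of_mul_le_mul_left ?_ hn'
    rw [mul_add (n : ℝ) (R.1 + R.2.1), mul_add (n : ℝ) R.1]
    linarith
  · refine le_of_mul_le_mul_left ?_ hn'
    rw [mul_add (n : ℝ) (R.1 + R.2.1 + R.2.2), mul_add (n : ℝ) (R.1 + R.2.1), mul_add (n : ℝ) R.1]
    linarith

/-- The factor three covers the inequality that contains all three rates. -/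
lemma IsNear.mono [NeZero r] {qX : X₁ × X₂ → ℝ} {W : X₁ × X₂ → Y₁ × Y₂ → ℝ} {R R' : ℝ × ℝ × ℝ}
    {ε ε' : ℝ} {m : Fin r → ℕ} {p : AuxSpace X₁ X₂ Y₁ Y₂ m → ℝ} (h : IsNear qX W R ε p)
    (h0 : |R.1 - R'.1| ≤ ε') (h1 : |R.2.1 - R'.2.1| ≤ ε') (h2 : |R.2.2 - R'.2.2| ≤ ε') :
    IsNear qX W R' (ε + 3 * ε') p := by
  have k0 := (abs_le.1 h0).2
  have k1 := (abs_le.1 h1).2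
  have k2 := (abs_le.1 h2).2
  have k3 := (abs_nonneg _).trans h0
  exact ⟨h.chain, fun a b => (h.marginal a b).trans (by linarith), h.rate₁₂.trans (by linarith),
    h.rate₂₁.trans (by linarith), h.rate_first.trans (by linarith),
    h.rate_sum.trans (by linarith)⟩

/-- The converse part: the simulation region lies in the single-letter region. -/
theorem simulationRegion_subset [NeZero r] {qX : X₁ × X₂ → ℝ} {W : X₁ × X₂ → Y₁ × Y₂ → ℝ}
    (hq : qX ∈ stdSimplex ℝ (X₁ × X₂)) (hW : ∀ x, W x ∈ stdSimplex ℝ (Y₁ × Y₂)) :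
    simulationRegion r qX W ⊆ rateRegion r qX W := by
  intro R hR
  refine mem_rateRegion_of_isNear ?_ fun ε hε => ?_
  · have hcl : IsClosed {R : ℝ × ℝ × ℝ | 0 ≤ R.1 ∧ 0 ≤ R.2.1 ∧ 0 ≤ R.2.2} := by
      refine IsClosed.and ?_ (IsClosed.and ?_ ?_) <;>
      exact isClosed_le continuous_const (by fun_prop)
    exact closure_minimal (show {R | Achievable r qX W R} ⊆
        {R : ℝ × ℝ × ℝ | 0 ≤ R.1 ∧ 0 ≤ R.2.1 ∧ 0 ≤ R.2.2} from
        fun R h => ⟨h.1, h.2.1, h.2.2.1⟩) hcl hR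
  -- `ε / 6`, because the three rates together contribute `3 * (ε / 6)` to the slack `ε / 2` of the
  -- code.
  · obtain ⟨R', hR', hd⟩ := Metric.mem_closure_iff.1 hR (ε / 6) (by positivity)
    obtain ⟨m, p, hp⟩ := Achievable.exists_isNear hq hW hR' (half_pos hε)
    refine ⟨m, p, ?_⟩
    rw [dist_comm, Prod.dist_eq, max_lt_iff, Prod.dist_eq, max_lt_iff] at hd
    have := hp.mono (R' := R) (ε' := ε / 6) hd.1.le hd.2.1.le hd.2.2.le
    convert this using 1
    ring

end Converse

/-! ### Random binning: leftover hashing and Slepian–Wolf decoding. -/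

section Binning

open Finset
open scoped BigOperators

variable {Ω α β ζ K M : Type*} [Fintype Ω] [Fintype α] [Fintype β] [Fintype ζ] [Fintype K]
  [Fintype M] [DecidableEq α] [Nonempty β] [Nonempty K] [Nonempty M]

/-- Distinct points collide under a uniformly random map with probability `1 / card β`. -/
lemma expect_collision {a a' : α} (h : a ≠ a') :
    𝔼 κ : α → β, (if κ a = κ a' then (1 : ℝ) else 0) = 1 / Fintype.card β := by
  have hc : (Fintype.card β : ℝ) ≠ 0 := by exact_mod_cast Fintype.card_ne_zero
  have hc' : (Fintype.card (α → β) : ℝ) ≠ 0 := by exact_mod_cast Fintype.card_ne_zero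
  have := sum_update (φ := fun _ : α => β) a (fun κ => if κ a = κ a' then (1 : ℝ) else 0)
  simp only [Function.update_self, Function.update_of_ne h.symm, Finset.sum_ite_eq',
    Finset.mem_univ, if_true, Finset.sum_const, Finset.card_univ, nsmul_eq_mul, mul_one] at this
  rw [Fintype.expect_eq_sum_div_card, div_eq_div_iff hc' hc, mul_comm, ← this, one_mul]

/-- The second moment of the bin masses counts colliding pairs, whose probability is known. -/
lemma sum_sq_bins (κ : α → β) (v : α → ℝ) :
    ∑ b, (∑ a with κ a = b, v a) ^ 2 = ∑ a, ∑ a', v a * v a' * if κ a = κ a' then 1 else 0 := by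
  simp only [sq, Finset.sum_mul_sum, Finset.sum_filter]
  rw [Finset.sum_comm]
  refine Finset.sum_congr rfl fun a _ => ?_
  rw [Finset.sum_eq_single (κ a)]
  · simp only [if_true, Finset.mul_sum, mul_ite, mul_one, mul_zero, eq_comm]
  · intro b _ hb
    simp [hb.symm]
  · simp

/-- The bin masses under a uniformly random map are close to uniform, in mean square. -/
lemma expect_sum_sq_bins_le (v : α → ℝ) :
    𝔼 κ : α → β, ∑ b, ((∑ a with κ a = b, v a) - (∑ a, v a) / Fintype.card β) ^ 2 ≤
      ∑ a, v a ^ 2 := by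
  have hc : (0 : ℝ) < Fintype.card β := by exact_mod_cast Fintype.card_pos
  have h1 : ∀ κ : α → β,
      ∑ b, ((∑ a with κ a = b, v a) - (∑ a, v a) / Fintype.card β) ^ 2 =
        (∑ a, ∑ a', v a * v a' * if κ a = κ a' then 1 else 0) - (∑ a, v a) ^ 2 / Fintype.card β := by
    intro κ
    have h2 : ∑ b, ∑ a with κ a = b, v a = ∑ a, v a := Finset.sum_fiberwise _ _ _
    rw [← sum_sq_bins]
    simp only [sub_sq, Finset.sum_add_distrib, Finset.sum_sub_distrib, ← Finset.sum_mul,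
      ← Finset.mul_sum, h2, Finset.sum_const, Finset.card_univ, nsmul_eq_mul]
    field_simp
    ring
  simp only [h1, Finset.expect_sub_distrib, Fintype.expect_const, Finset.expect_sum_comm,
    ← Finset.mul_expect]
  rw [sub_le_iff_le_add]
  have h3 : ∀ a a', v a * v a' * 𝔼 κ : α → β, (if κ a = κ a' then (1 : ℝ) else 0) ≤
      (if a = a' then v a * v a' else 0) + v a * v a' / Fintype.card β := by
    intro a a'
    by_cases h : a = a'
    · subst h
      simp only [if_true, Fintype.expect_const, mul_one]
      have : 0 ≤ v a * v a / Fintype.card β := div_nonneg (mul_self_nonneg _) hc.le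
      linarith
    · rw [expect_collision h]
      simp [h, div_eq_mul_inv]
  refine (Finset.sum_le_sum fun a _ => Finset.sum_le_sum fun a' _ => h3 a a').trans (le_of_eq ?_)
  simp only [Finset.sum_add_distrib, Finset.sum_ite_eq, Finset.mem_univ, if_true]
  rw [sq (∑ a, v a), Finset.sum_mul_sum, Finset.sum_div]
  simp only [sq, Finset.sum_div]

/-- From the second moment by Cauchy–Schwarz, once over the bins and once over the random map. -/
lemma expect_sum_abs_bins_le (v : α → ℝ) :
    𝔼 κ : α → β, ∑ b, |(∑ a with κ a = b, v a) - (∑ a, v a) / Fintype.card β| ≤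
      √(Fintype.card β * ∑ a, v a ^ 2) := by
  refine Real.le_sqrt_of_sq_le ?_
  set g : (α → β) → β → ℝ :=
    fun κ b => (∑ a with κ a = b, v a) - (∑ a, v a) / Fintype.card β with hg
  have h1 := Finset.expect_mul_sq_le_sq_mul_sq (Finset.univ : Finset (α → β))
    (fun κ => ∑ b, |g κ b|) (fun _ => (1 : ℝ))
  simp only [mul_one, one_pow, Fintype.expect_const] at h1
  refine h1.trans ?_
  have h2 : 𝔼 κ : α → β, (∑ b, |g κ b|) ^ 2 ≤ 𝔼 κ : α → β, (Fintype.card β : ℝ) * ∑ b, g κ b ^ 2 := by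
    refine Finset.expect_le_expect fun κ _ => ?_
    have := sq_sum_le_card_mul_sum_sq (s := Finset.univ) (f := fun b => |g κ b|)
    simpa [sq_abs] using this
  refine h2.trans ?_
  rw [← Finset.mul_expect]
  exact mul_le_mul_of_nonneg_left (expect_sum_sq_bins_le v) (Nat.cast_nonneg _)

lemma law_bin (p : Ω → ℝ) (A : Ω → α) (Z : Ω → ζ) (κ : α → β) (b : β) (z : ζ) :
    law p (fun w => (κ (A w), Z w)) (b, z) =
      ∑ a with κ a = b, law p (fun w => (A w, Z w)) (a, z) := by
  rw [Finset.sum_filter]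
  simp only [law, Prod.mk.injEq]
  have : ∀ a, (if κ a = b then ∑ w, (if A w = a ∧ Z w = z then p w else 0) else 0) =
      ∑ w, if κ a = b ∧ A w = a ∧ Z w = z then p w else 0 := by
    intro a
    by_cases h : κ a = b <;> simp [h]
  simp only [this]
  rw [Finset.sum_comm]
  refine Finset.sum_congr rfl fun w _ => ?_
  rw [Finset.sum_eq_single (A w)]
  · simp
  · intro a _ ha
    simp [Ne.symm ha]
  · simp

/-- Leftover hashing: a random bin index of `A` is nearly uniform and independent of `Z`, provided
that the conditional probabilities of `A` are small except on an event of small probability. -/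
lemma expect_bin_uniform_le {p : Ω → ℝ} (hp : ∀ w, 0 ≤ p w) (hp1 : ∑ w, p w ≤ 1) (A : Ω → α)
    (Z : Ω → ζ) {h : ζ → ℝ} (hh : ∀ z, 0 ≤ h z) :
    𝔼 κ : α → β, ∑ b, ∑ z, |law p (fun w => (κ (A w), Z w)) (b, z) - law p Z z / Fintype.card β| ≤
      2 * ∑ w, p w * (if h (Z w) < law p (fun w => (A w, Z w)) (A w, Z w) then 1 else 0) +
        √(Fintype.card β * ∑ z, h z) := by
  have hc : (0 : ℝ) < Fintype.card β := by exact_mod_cast Fintype.card_pos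
  set u : ζ → α → ℝ := fun z a => law p (fun w => (A w, Z w)) (a, z) with hu
  -- Atoms above the threshold go into `e`; their mass is charged twice, for the bins and for their
  -- mean. The remaining atoms are at most `h z`, so their squares sum to at most `h z` times their
  -- mass, and Cauchy–Schwarz over `z` finishes.
  set v : ζ → α → ℝ := fun z a => if h z < u z a then 0 else u z a with hv
  set e : ζ → α → ℝ := fun z a => if h z < u z a then u z a else 0 with he
  have hu0 : ∀ z a, 0 ≤ u z a := fun z a => law_nonneg hp _ _
  have he0 : ∀ z a, 0 ≤ e z a := fun z a => by simp only [he]; split_ifs <;> simp [hu0]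
  have hv0 : ∀ z a, 0 ≤ v z a := fun z a => by simp only [hv]; split_ifs <;> simp [hu0]
  have huv : ∀ z a, u z a = v z a + e z a := fun z a => by simp only [hv, he]; split_ifs <;> simp
  have hvh : ∀ z a, v z a ≤ h z := fun z a => by
    simp only [hv]; split_ifs with hc; exacts [hh z, not_lt.1 hc]
  have hE : ∑ z, ∑ a, e z a =
      ∑ w, p w * (if h (Z w) < law p (fun w => (A w, Z w)) (A w, Z w) then 1 else 0) := by
    rw [← sum_law_mul p (fun w => (A w, Z w))
      (fun x => if h x.2 < law p (fun w => (A w, Z w)) x then 1 else 0), Fintype.sum_prod_type,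
      Finset.sum_comm]
    refine Finset.sum_congr rfl fun a _ => Finset.sum_congr rfl fun z _ => ?_
    simp only [he, hu]
    split_ifs <;> simp
  have hV : ∑ z, ∑ a, v z a ≤ 1 := by
    refine le_trans (Finset.sum_le_sum fun z _ => Finset.sum_le_sum fun a _ =>
      (by linarith [huv z a, he0 z a] : v z a ≤ u z a)) ?_
    simp only [hu, law_fst_sum, sum_law]
    exact hp1
  have key : ∀ κ : α → β,
      ∑ b, ∑ z, |law p (fun w => (κ (A w), Z w)) (b, z) - law p Z z / Fintype.card β| ≤
        (∑ z, ∑ b, |(∑ a with κ a = b, v z a) - (∑ a, v z a) / Fintype.card β|) +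
          2 * ∑ z, ∑ a, e z a := by
    intro κ
    rw [Finset.sum_comm, Finset.mul_sum, ← Finset.sum_add_distrib]
    refine Finset.sum_le_sum fun z _ => ?_
    have hb : ∀ b, |law p (fun w => (κ (A w), Z w)) (b, z) - law p Z z / Fintype.card β| ≤
        |(∑ a with κ a = b, v z a) - (∑ a, v z a) / Fintype.card β| +
          ((∑ a with κ a = b, e z a) + (∑ a, e z a) / Fintype.card β) := by
      intro b
      have e1 : law p (fun w => (κ (A w), Z w)) (b, z) - law p Z z / Fintype.card β =
          ((∑ a with κ a = b, v z a) - (∑ a, v z a) / Fintype.card β) +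
          ((∑ a with κ a = b, e z a) - (∑ a, e z a) / Fintype.card β) := by
        rw [law_bin, ← law_fst_sum p A Z z]
        change (∑ a with κ a = b, u z a) - (∑ a, u z a) / _ = _
        simp only [huv, Finset.sum_add_distrib]
        ring
      have p1 : 0 ≤ ∑ a with κ a = b, e z a := Finset.sum_nonneg fun a _ => he0 z a
      have p2 : 0 ≤ (∑ a, e z a) / Fintype.card β :=
        div_nonneg (Finset.sum_nonneg fun a _ => he0 z a) hc.le
      rw [e1]
      refine (abs_add_le _ _).trans (add_le_add le_rfl ?_)
      rw [abs_le]
      constructor <;> linarith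
    refine (Finset.sum_le_sum fun b _ => hb b).trans (le_of_eq ?_)
    have hf : ∑ b, ∑ a with κ a = b, e z a = ∑ a, e z a := Finset.sum_fiberwise _ _ _
    rw [Finset.sum_add_distrib, Finset.sum_add_distrib, hf, Finset.sum_const,
      Finset.card_univ, nsmul_eq_mul, mul_div_cancel₀ _ hc.ne']
    ring
  refine (Finset.expect_le_expect fun κ _ => key κ).trans ?_
  rw [Finset.expect_add_distrib, Fintype.expect_const, Finset.expect_sum_comm, hE, add_comm]
  refine add_le_add le_rfl ?_
  calc ∑ z, 𝔼 κ : α → β, ∑ b, |(∑ a with κ a = b, v z a) - (∑ a, v z a) / Fintype.card β|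
      ≤ ∑ z, √(Fintype.card β * h z) * √(∑ a, v z a) := by
        refine Finset.sum_le_sum fun z _ => (expect_sum_abs_bins_le (v z)).trans ?_
        rw [← Real.sqrt_mul (mul_nonneg hc.le (hh z)), mul_assoc]
        refine Real.sqrt_le_sqrt (mul_le_mul_of_nonneg_left ?_ hc.le)
        rw [Finset.mul_sum]
        refine Finset.sum_le_sum fun a _ => ?_
        rw [sq]
        exact mul_le_mul_of_nonneg_right (hvh z a) (hv0 z a)
    _ ≤ √(∑ z, Fintype.card β * h z) * √(∑ z, ∑ a, v z a) :=
        Real.sum_sqrt_mul_sqrt_le _ (fun z => mul_nonneg hc.le (hh z))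
          (fun z => Finset.sum_nonneg fun a _ => hv0 z a)
    _ ≤ √(Fintype.card β * ∑ z, h z) := by
        rw [← Finset.mul_sum]
        refine mul_le_of_le_one_right (Real.sqrt_nonneg _) ?_
        exact Real.sqrt_le_one.2 hV

/-- Slepian–Wolf decoding: `A` can be recovered from a random bin index and `Z`, provided that the
conditional probabilities of `A` are at least `θ` except on an event of small probability. -/
lemma exists_decoder [Nonempty α] {p : Ω → ℝ} (hp : ∀ w, 0 ≤ p w) (hp1 : ∑ w, p w ≤ 1)
    (A : Ω → α) (Z : Ω → ζ) {θ : ℝ} (hθ : 0 < θ) :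
    ∃ D : (α → K) → ζ → K → α,
      𝔼 κ : α → K, ∑ w, p w * (if D κ (Z w) (κ (A w)) = A w then 0 else 1) ≤
        ∑ w, p w * (if law p (fun w => (A w, Z w)) (A w, Z w) < θ * law p Z (Z w) then 1 else 0) +
          1 / (θ * Fintype.card K) := by
  have hc : (0 : ℝ) < Fintype.card K := by exact_mod_cast Fintype.card_pos
  -- The decoder picks any likely element of the bin. Given `z` there are at most `1 / θ` likely
  -- elements, and each one different from the truth falls into its bin with probability `1 /
  -- Fintype.card K`.
  set good : α → ζ → Prop := fun a z => θ * law p Z z ≤ law p (fun w => (A w, Z w)) (a, z) with hg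
  refine ⟨fun κ z k => if h : ∃ a, κ a = k ∧ good a z then h.choose else Classical.arbitrary α, ?_⟩
  have key : ∀ (κ : α → K) w,
      (if (if h : ∃ a, κ a = κ (A w) ∧ good a (Z w) then h.choose else Classical.arbitrary α) = A w
        then (0 : ℝ) else 1) ≤
      (if law p (fun w => (A w, Z w)) (A w, Z w) < θ * law p Z (Z w) then 1 else 0) +
        ∑ a with good a (Z w) ∧ a ≠ A w, if κ a = κ (A w) then 1 else 0 := by
    intro κ w
    have hs : 0 ≤ ∑ a with good a (Z w) ∧ a ≠ A w, if κ a = κ (A w) then (1 : ℝ) else 0 :=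
      Finset.sum_nonneg fun a _ => by split_ifs <;> simp
    by_cases h1 : law p (fun w => (A w, Z w)) (A w, Z w) < θ * law p Z (Z w)
    · rw [if_pos h1]
      split_ifs <;> linarith
    · rw [if_neg h1, zero_add]
      have hex : ∃ a, κ a = κ (A w) ∧ good a (Z w) := ⟨A w, rfl, not_lt.1 h1⟩
      rw [dif_pos hex]
      split_ifs with h2
      · exact hs
      · have := Finset.single_le_sum (f := fun a => if κ a = κ (A w) then (1 : ℝ) else 0)
          (s := Finset.univ.filter fun a => good a (Z w) ∧ a ≠ A w)
          (fun a _ => by split_ifs <;> simp) (a := hex.choose)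
          (by simp only [Finset.mem_filter, Finset.mem_univ, true_and]
              exact ⟨hex.choose_spec.2, h2⟩)
        rwa [if_pos hex.choose_spec.1] at this
  have hexp : ∀ w, 𝔼 κ : α → K,
      (∑ a with good a (Z w) ∧ a ≠ A w, if κ a = κ (A w) then (1 : ℝ) else 0) ≤
        (Finset.univ.filter fun a => good a (Z w)).card / (Fintype.card K : ℝ) := by
    intro w
    rw [Finset.expect_sum_comm, Finset.sum_congr rfl
      (fun a ha => expect_collision (by simpa using (Finset.mem_filter.1 ha).2.2)),
      Finset.sum_const, nsmul_eq_mul, mul_one_div]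
    refine div_le_div_of_nonneg_right ?_ hc.le
    exact_mod_cast Finset.card_le_card fun a ha => by
      simp only [Finset.mem_filter, Finset.mem_univ, true_and] at ha ⊢
      exact ha.1
  have hcount : ∀ w, p w * ((Finset.univ.filter fun a => good a (Z w)).card / (Fintype.card K : ℝ)) ≤
      p w * (1 / (θ * Fintype.card K)) := by
    intro w
    rcases (hp w).eq_or_lt with h0 | h0
    · simp [← h0]
    refine mul_le_mul_of_nonneg_left ?_ h0.le
    have hz := law_self_pos hp Z h0
    have h1 : (Finset.univ.filter fun a => good a (Z w)).card * (θ * law p Z (Z w)) ≤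
        law p Z (Z w) := by
      rw [← nsmul_eq_mul, ← Finset.sum_const]
      refine (Finset.sum_le_sum (g := fun a => law p (fun w => (A w, Z w)) (a, Z w))
        fun a ha => (Finset.mem_filter.1 ha).2).trans ?_
      refine (Finset.sum_le_univ_sum_of_nonneg fun a => law_nonneg hp _ _).trans (le_of_eq ?_)
      exact law_fst_sum p A Z (Z w)
    rw [div_le_div_iff₀ hc (by positivity), one_mul]
    have h2 : (Finset.univ.filter fun a => good a (Z w)).card * θ ≤ (1 : ℝ) := by
      by_contra hcon
      push Not at hcon
      nlinarith
    nlinarith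
  refine (Finset.expect_le_expect fun κ _ => Finset.sum_le_sum fun w _ =>
    mul_le_mul_of_nonneg_left (key κ w) (hp w)).trans ?_
  simp only [mul_add, Finset.sum_add_distrib, Finset.expect_add_distrib, Fintype.expect_const]
  refine add_le_add le_rfl ?_
  rw [Finset.expect_sum_comm]
  simp only [← Finset.mul_expect]
  calc _ ≤ ∑ w, p w * (1 / (θ * Fintype.card K)) :=
        Finset.sum_le_sum fun w _ => (mul_le_mul_of_nonneg_left (hexp w) (hp w)).trans (hcount w)
    _ ≤ 1 / (θ * Fintype.card K) := by
        rw [← Finset.sum_mul]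
        exact mul_le_of_le_one_left (by positivity) hp1

/-- A functional of the first component of a random map has the same mean as the functional of a
random map. -/
lemma expect_fst_comp (g : (α → K) → ℝ) :
    𝔼 κ : α → K × M, g (fun a => (κ a).1) = 𝔼 κ : α → K, g κ := by
  have h := Fintype.expect_equiv (Equiv.arrowProdEquivProdArrow α (fun _ => K) (fun _ => M))
    (fun κ => g (fun a => (κ a).1)) (fun x => g x.1) (fun _ => rfl)
  rw [h, ← Finset.univ_product_univ, Finset.expect_product]
  simp

end Binning

/-! ### Prefixes of tuples, represented as full tuples. -/

section Truncate

variable {r : ℕ} {φ : Fin r → Type*} [∀ i, Nonempty (φ i)]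

/-- The tuple `f` with all coordinates from `s` on replaced by default values. -/
noncomputable def truncate (s : ℕ) (f : (i : Fin r) → φ i) : (i : Fin r) → φ i :=
  fun j => if j.val < s then f j else Classical.arbitrary _

lemma truncate_apply {s : ℕ} {j : Fin r} (h : j.val < s) (f : (i : Fin r) → φ i) :
    truncate s f j = f j := if_pos h

lemma truncate_congr {s : ℕ} {f f' : (i : Fin r) → φ i} (h : ∀ j, j.val < s → f j = f' j) :
    truncate s f = truncate s f' := by
  funext j
  simp only [truncate]
  split_ifs with hj
  · exact h j hj
  · rfl

lemma truncate_eq_iff {s : ℕ} {f f' : (i : Fin r) → φ i} :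
    truncate s f = truncate s f' ↔ ∀ j, j.val < s → f j = f' j := by
  refine ⟨fun h j hj => ?_, truncate_congr⟩
  rw [← truncate_apply hj f, h, truncate_apply hj]

lemma truncate_of_le {s : ℕ} (h : r ≤ s) (f : (i : Fin r) → φ i) : truncate s f = f := by
  funext j
  exact truncate_apply (j.2.trans_le h) f

lemma truncate_truncate {s t : ℕ} (h : s ≤ t) (f : (i : Fin r) → φ i) :
    truncate s (truncate t f) = truncate s f :=
  truncate_congr fun j hj => truncate_apply (hj.trans_le h) f

lemma card_truncate_fixed [∀ i, Fintype (φ i)] (s : ℕ) :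
    (Finset.univ.filter fun f : (i : Fin r) → φ i => truncate s f = f).card =
      ∏ i : Fin r with i.val < s, Fintype.card (φ i) := by
  have : (Finset.univ.filter fun f : (i : Fin r) → φ i => truncate s f = f) =
      Fintype.piFinset fun i : Fin r =>
        if i.val < s then (Finset.univ : Finset (φ i)) else {Classical.arbitrary _} := by
    ext f
    simp only [Finset.mem_filter, Finset.mem_univ, true_and, Fintype.mem_piFinset]
    constructor
    · intro h i
      split_ifs with hi
      · simp
      · rw [← h]
        simp [truncate, hi]
    · intro h
      funext i
      have := h i
      by_cases hi : i.val < s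
      · exact truncate_apply hi f
      · rw [if_neg hi, Finset.mem_singleton] at this
        simp [truncate, hi, this]
  rw [this, Fintype.card_piFinset, Finset.prod_filter]
  refine Finset.prod_congr rfl fun i _ => ?_
  split_ifs <;> simp

end Truncate

/-! ### The distance between two sequential distributions. -/

section Kernels

variable {r : ℕ} {φ : Fin r → Type*} [∀ i, Fintype (φ i)] [∀ i, Nonempty (φ i)]

lemma prod_filter_succ_le (i : Fin r) (g : Fin r → ℝ) :
    ∏ j with i.val ≤ j.val, g j = g i * ∏ j with i.val + 1 ≤ j.val, g j := by
  have : (Finset.univ.filter fun j : Fin r => i.val ≤ j.val) =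
      insert i (Finset.univ.filter fun j : Fin r => i.val + 1 ≤ j.val) := by
    ext j
    simp only [Finset.mem_filter, Finset.mem_univ, true_and, Finset.mem_insert, Fin.ext_iff]
    omega
  rw [this, Finset.prod_insert (by simp)]

lemma prod_filter_lt_succ (i : Fin r) (g : Fin r → ℝ) :
    ∏ j with j.val < i.val + 1, g j = (∏ j with j.val < i.val, g j) * g i := by
  have : (Finset.univ.filter fun j : Fin r => j.val < i.val + 1) =
      insert i (Finset.univ.filter fun j : Fin r => j.val < i.val) := by
    ext j
    simp only [Finset.mem_filter, Finset.mem_univ, true_and, Finset.mem_insert, Fin.ext_iff]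
    omega
  rw [this, Finset.prod_insert (by simp), mul_comm]

/-- Summing out all coordinates after `i`, and then the coordinate `i`. -/
lemma IsKernel.sum_mul_prod_succ {k k' : Fin r → ((i : Fin r) → φ i) → ℝ} (hk : IsKernel k)
    (hk' : IsKernel k') (i : Fin r) (F : ((i : Fin r) → φ i) → ℝ)
    (hF : ∀ f f', (∀ j ≤ i, f j = f' j) → F f = F f') :
    ∑ f, F f * ∏ j with i.val + 1 ≤ j.val, k' j f =
      ∑ f, (∑ a, F (Function.update f i a)) * ∏ j with i.val ≤ j.val, k j f := by
  have hc : (Fintype.card (φ i) : ℝ) ≠ 0 := by exact_mod_cast Fintype.card_ne_zero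
  rw [hk'.sum_mul_prod (i.val + 1) F fun f f' h => hF f f' fun j hj => h j (Nat.lt_succ_of_le hj),
    hk.sum_mul_prod i.val (fun f => ∑ a, F (Function.update f i a)) fun f f' h =>
      Finset.sum_congr rfl fun a _ => hF _ _ fun j hj => ?_,
    prod_filter_succ_le i fun j => 1 / (Fintype.card (φ j) : ℝ)]
  · rw [← mul_right_inj' hc, ← sum_update (φ := φ) i, Finset.mul_sum]
    refine Finset.sum_congr rfl fun f _ => ?_
    rw [← Finset.sum_mul]
    field_simp
  · rcases hj.eq_or_lt with rfl | hlt
    · simp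
    · rw [Function.update_of_ne hlt.ne, Function.update_of_ne hlt.ne]
      exact h j hlt

lemma update_congr_lt {i : Fin r} {f f' : (i : Fin r) → φ i} (h : ∀ j < i, f j = f' j) (a : φ i) :
    ∀ j ≤ i, Function.update f i a j = Function.update f' i a j := by
  intro j hj
  rcases hj.eq_or_lt with rfl | hlt
  · simp
  · rw [Function.update_of_ne hlt.ne, Function.update_of_ne hlt.ne]
    exact h j hlt

lemma IsKernel.prod_lt_congr {k : Fin r → ((i : Fin r) → φ i) → ℝ} (hk : IsKernel k) (s : ℕ)
    {f f' : (i : Fin r) → φ i} (h : ∀ j, j.val < s → f j = f' j) :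
    ∏ j with j.val < s, k j f = ∏ j with j.val < s, k j f' := by
  refine Finset.prod_congr rfl fun j hj => hk.congr j f f' fun l hl => h l ?_
  simp only [Finset.mem_filter, Finset.mem_univ, true_and] at hj
  exact lt_of_le_of_lt hl hj

lemma IsKernel.prod_lt_update {k : Fin r → ((i : Fin r) → φ i) → ℝ} (hk : IsKernel k) (i : Fin r)
    (f : (i : Fin r) → φ i) (a : φ i) :
    ∏ j with j.val < i.val, k j (Function.update f i a) = ∏ j with j.val < i.val, k j f := by
  refine hk.prod_lt_congr _ fun j hj => Function.update_of_ne ?_ _ _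
  rintro rfl
  exact lt_irrefl _ hj

/-- The conditional mean of a function of the first coordinates up to `i`, given those before. -/
lemma IsKernel.sum_prod_mul {k : Fin r → ((i : Fin r) → φ i) → ℝ} (hk : IsKernel k) (i : Fin r)
    (g : ((i : Fin r) → φ i) → ℝ) (hg : ∀ f f', (∀ j ≤ i, f j = f' j) → g f = g f') :
    ∑ f, (∏ j, k j f) * g f =
      ∑ f, (∏ j, k j f) * ∑ a, k i (Function.update f i a) * g (Function.update f i a) := by
  have h := hk.sum_mul_prod_succ hk i (fun f => (∏ j with j.val < i.val, k j f) * (k i f * g f))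
    fun f f' h => by
      rw [hk.prod_lt_congr i.val fun j hj => h j (le_of_lt hj), hk.congr i f f' h, hg f f' h]
  refine Eq.trans (Finset.sum_congr rfl fun f _ => ?_) (h.trans (Finset.sum_congr rfl fun f _ => ?_))
  · rw [prod_split i.val, prod_filter_succ_le i]
    ring
  · rw [prod_split i.val fun j => k j f]
    simp only [hk.prod_lt_update, ← Finset.mul_sum]
    ring

/-- The hybrid bound on the distance of two sequential distributions. -/
lemma IsKernel.sum_abs_prod_sub_le {k k' : Fin r → ((i : Fin r) → φ i) → ℝ} (hk : IsKernel k)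
    (hk' : IsKernel k') :
    ∑ f, |∏ j, k j f - ∏ j, k' j f| ≤
      ∑ i, ∑ f, (∏ j, k j f) *
        ∑ a, |k i (Function.update f i a) - k' i (Function.update f i a)| := by
  -- The prefixes of length `s` are compared, completed by the normalized kernels `k'`. Each further
  -- round adds its one-round distance, averaged over prefixes drawn by `k`.
  have key : ∀ s ≤ r, ∑ f, |∏ j with j.val < s, k j f - ∏ j with j.val < s, k' j f| *
        ∏ j with s ≤ j.val, k' j f ≤
      ∑ i : Fin r with i.val < s, ∑ f, (∏ j, k j f) *
        ∑ a, |k i (Function.update f i a) - k' i (Function.update f i a)| := by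
    intro s
    induction s with
    | zero => intro _; simp
    | succ s ih =>
      intro hs
      have ih := ih (by omega)
      set i : Fin r := ⟨s, hs⟩ with hi
      have hsum : ∑ l : Fin r with l.val < s + 1, ∑ f, (∏ j, k j f) *
          ∑ a, |k l (Function.update f l a) - k' l (Function.update f l a)| =
          (∑ l : Fin r with l.val < s, ∑ f, (∏ j, k j f) *
          ∑ a, |k l (Function.update f l a) - k' l (Function.update f l a)|) +
          ∑ f, (∏ j, k j f) * ∑ a, |k i (Function.update f i a) - k' i (Function.update f i a)| := by
        have : (Finset.univ.filter fun j : Fin r => j.val < s + 1) =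
            insert i (Finset.univ.filter fun j : Fin r => j.val < s) := by
          ext j
          simp only [Finset.mem_filter, Finset.mem_univ, true_and, Finset.mem_insert, Fin.ext_iff,
            hi]
          omega
        rw [this, Finset.sum_insert (by simp [hi]), add_comm]
      rw [hsum]
      have h1 : ∑ f, (∏ j with j.val < s, k j f) * |k i f - k' i f| *
            ∏ j with s + 1 ≤ j.val, k' j f =
          ∑ f, (∏ j, k j f) *
            ∑ a, |k i (Function.update f i a) - k' i (Function.update f i a)| := by
        have h := hk.sum_mul_prod_succ hk' i
          (fun f => (∏ j with j.val < i.val, k j f) * |k i f - k' i f|)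
          fun f f' h => by
            rw [hk.prod_lt_congr i.val fun j hj => h j (le_of_lt hj), hk.congr i f f' h,
              hk'.congr i f f' h]
        refine h.trans (Finset.sum_congr rfl fun f _ => ?_)
        rw [prod_split i.val fun j => k j f]
        simp only [hk.prod_lt_update, ← Finset.mul_sum]
        ring
      rw [← h1]
      refine le_trans ?_ (add_le_add ih le_rfl)
      rw [← Finset.sum_add_distrib]
      refine Finset.sum_le_sum fun f _ => ?_
      have e1 := prod_filter_lt_succ i fun j => k j f
      have e2 := prod_filter_lt_succ i fun j => k' j f
      have e3 := prod_filter_succ_le i fun j => k' j f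
      simp only [hi] at e1 e2 e3
      rw [e1, e2, e3]
      have t0 : 0 ≤ ∏ j with s + 1 ≤ j.val, k' j f := Finset.prod_nonneg fun j _ => hk'.nonneg j f
      have t1 : 0 ≤ ∏ j with j.val < s, k j f := Finset.prod_nonneg fun j _ => hk.nonneg j f
      rw [← mul_assoc, ← add_mul]
      refine mul_le_mul_of_nonneg_right ?_ t0
      set a := ∏ j with j.val < s, k j f
      set b := ∏ j with j.val < s, k' j f
      change |a * k i f - b * k' i f| ≤ |a - b| * k' i f + a * |k i f - k' i f|
      calc |a * k i f - b * k' i f| = |(a - b) * k' i f + a * (k i f - k' i f)| := by ring_nf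
        _ ≤ _ := abs_add_le _ _
        _ = _ := by rw [abs_mul, abs_mul, abs_of_nonneg (hk'.nonneg i f), abs_of_nonneg t1]
  have := key r le_rfl
  have h1 : ∀ g : Fin r → ℝ, ∏ j with r ≤ j.val, g j = 1 := fun g => by
    rw [Finset.filter_false_of_mem (fun j _ => by have := j.2; omega), Finset.prod_empty]
  simpa [h1] using this

end Kernels

/-! ### Symbols conditioned on their bin indices. -/

section Scheme

variable {r : ℕ} {φ B : Fin r → Type*} [∀ i, Fintype (φ i)] [∀ i, Nonempty (φ i)]
  [∀ i, Fintype (B i)] [∀ i, Nonempty (B i)] {S : Type*}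
  {k : Fin r → ((i : Fin r) → φ i) → S → ℝ}

/-- The conditional probability, given the symbols before `i`, that the symbol of round `i` falls
into the bin `b`. -/
noncomputable def binMass (k : Fin r → ((i : Fin r) → φ i) → S → ℝ)
    (β : (i : Fin r) → ((i : Fin r) → φ i) → B i) (i : Fin r) (f : (i : Fin r) → φ i) (s : S)
    (b : B i) : ℝ :=
  ∑ a, k i (Function.update f i a) s *
    if β i (truncate (i.val + 1) (Function.update f i a)) = b then 1 else 0

/-- The kernel `k` conditioned on the bin index `b`. -/
noncomputable def tilt (k : Fin r → ((i : Fin r) → φ i) → S → ℝ)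
    (β : (i : Fin r) → ((i : Fin r) → φ i) → B i) (i : Fin r) (f : (i : Fin r) → φ i) (s : S)
    (b : B i) : ℝ :=
  -- For an empty bin the unconditioned kernel is used, so that `tilt` is a kernel for every index.
  if binMass k β i f s b = 0 then k i f s
  else k i f s * (if β i (truncate (i.val + 1) f) = b then 1 else 0) / binMass k β i f s b

variable (hk : ∀ σ : Fin r → S, IsKernel fun i f => k i f (σ i))
  (β : (i : Fin r) → ((i : Fin r) → φ i) → B i)

lemma truncate_congr_le {i : Fin r} {f f' : (i : Fin r) → φ i} (h : ∀ j ≤ i, f j = f' j) :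
    truncate (i.val + 1) f = truncate (i.val + 1) f' :=
  truncate_congr fun j hj => h j (Nat.le_of_lt_succ hj)

include hk

lemma binMass_congr (i : Fin r) {f f' : (i : Fin r) → φ i} (h : ∀ j < i, f j = f' j) (s : S)
    (b : B i) : binMass k β i f s b = binMass k β i f' s b := by
  refine Finset.sum_congr rfl fun a _ => ?_
  have := update_congr_lt h a
  rw [(hk fun _ => s).congr i _ _ this, truncate_congr_le this]

lemma binMass_update (i : Fin r) (f : (i : Fin r) → φ i) (a : φ i) (s : S) (b : B i) :
    binMass k β i (Function.update f i a) s b = binMass k β i f s b :=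
  binMass_congr hk β i (fun _ hj => Function.update_of_ne hj.ne _ _) s b

lemma binMass_nonneg (i : Fin r) (f : (i : Fin r) → φ i) (s : S) (b : B i) :
    0 ≤ binMass k β i f s b :=
  Finset.sum_nonneg fun a _ => mul_nonneg ((hk fun _ => s).nonneg i _) (by split_ifs <;> simp)

lemma isKernel_tilt (σ : Fin r → S) (b : (i : Fin r) → B i) :
    IsKernel fun i f => tilt k β i f (σ i) (b i) where
  nonneg i f := by
    have h := (hk σ).nonneg i f
    have h' := binMass_nonneg hk β i f (σ i) (b i)
    simp only [tilt]
    split_ifs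
    · exact h
    · simp only [mul_one]; exact div_nonneg h h'
    · simp
  congr i f f' h := by
    simp only [tilt]
    rw [binMass_congr hk β i (fun j hj => h j hj.le), truncate_congr_le h, (hk σ).congr i f f' h]
  sum_one i f := by
    simp only [tilt, binMass_update hk]
    split_ifs with h
    · exact (hk σ).sum_one i f
    · rw [← Finset.sum_div]
      exact div_self h

omit hk in
lemma fst_update {ψ : Fin r → Type*} (e : (i : Fin r) → φ i × ψ i) (i : Fin r) (x : φ i × ψ i) :
    (fun j => (Function.update e i x j).1) = Function.update (fun j => (e j).1) i x.1 := by
  funext j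
  by_cases h : j = i
  · subst h; simp
  · simp [h]

/-- Both orders of generating a symbol and its index are kernels on pairs: here the symbol comes
first, in `isKernel_tilted` a uniform index does. The hybrid bound then applies to the two. -/
lemma isKernel_binned (σ : Fin r → S) :
    IsKernel fun i (e : (i : Fin r) → φ i × B i) => k i (fun j => (e j).1) (σ i) *
      if β i (truncate (i.val + 1) fun j => (e j).1) = (e i).2 then 1 else 0 where
  nonneg i e := mul_nonneg ((hk σ).nonneg i _) (by split_ifs <;> simp)
  congr i e e' h := by
    have h' : ∀ j ≤ i, (e j).1 = (e' j).1 := fun j hj => by rw [h j hj]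
    rw [(hk σ).congr i _ _ h', truncate_congr_le h', h i le_rfl]
  sum_one i e := by
    simp only [fst_update, Function.update_self]
    rw [Fintype.sum_prod_type]
    simp only [← Finset.mul_sum, Finset.sum_ite_eq, Finset.mem_univ, if_true, mul_one]
    exact (hk σ).sum_one i _

lemma isKernel_tilted (σ : Fin r → S) :
    IsKernel fun i (e : (i : Fin r) → φ i × B i) =>
      tilt k β i (fun j => (e j).1) (σ i) (e i).2 / Fintype.card (B i) where
  nonneg i e := div_nonneg ((isKernel_tilt hk β σ fun j => (e j).2).nonneg i _) (Nat.cast_nonneg _)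
  congr i e e' h := by
    have h' : ∀ j ≤ i, (e j).1 = (e' j).1 := fun j hj => by rw [h j hj]
    have : tilt k β i (fun j => (e j).1) (σ i) (e i).2 =
        tilt k β i (fun j => (e' j).1) (σ i) (e i).2 :=
      (isKernel_tilt hk β σ fun j => (e j).2).congr i _ _ h'
    rw [this, h i le_rfl]
  sum_one i e := by
    have hc : (Fintype.card (B i) : ℝ) ≠ 0 := by exact_mod_cast Fintype.card_ne_zero
    simp only [fst_update, Function.update_self]
    rw [Fintype.sum_prod_type, Finset.sum_comm]
    have : ∀ b : B i, ∑ a, tilt k β i (Function.update (fun j => (e j).1) i a) (σ i) b = 1 := by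
      intro b
      have := (isKernel_tilt hk β σ (Function.update (fun j => (e j).2) i b)).sum_one i
        (fun j => (e j).1)
      simpa using this
    simp only [← Finset.sum_div, this, Finset.sum_const, Finset.card_univ, nsmul_eq_mul, mul_one]
    exact div_self hc

/-- Given the index both orders have the same conditional law of the symbol, so only the law of the
index contributes. An empty bin contributes the mass of its fallback, which is again the deviation
of its index. -/
lemma sum_abs_binned_sub_tilted (σ : Fin r → S) (i : Fin r) (f : (i : Fin r) → φ i) :
    ∑ x : φ i × B i, |k i (Function.update f i x.1) (σ i) *
        (if β i (truncate (i.val + 1) (Function.update f i x.1)) = x.2 then 1 else 0) -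
      tilt k β i (Function.update f i x.1) (σ i) x.2 / Fintype.card (B i)| =
    ∑ b, |binMass k β i f (σ i) b - 1 / Fintype.card (B i)| := by
  have hc : (0 : ℝ) < Fintype.card (B i) := by exact_mod_cast Fintype.card_pos
  rw [Fintype.sum_prod_type, Finset.sum_comm]
  refine Finset.sum_congr rfl fun b _ => ?_
  have hn := fun a => (hk σ).nonneg i (Function.update f i a)
  by_cases h0 : binMass k β i f (σ i) b = 0
  · have hz := (Finset.sum_eq_zero_iff_of_nonneg (fun a _ =>
      mul_nonneg (hn a) (by split_ifs <;> simp))).1 h0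
    simp only [tilt, binMass_update hk, h0, if_true, zero_sub, abs_neg]
    have : ∀ a, |k i (Function.update f i a) (σ i) *
        (if β i (truncate (i.val + 1) (Function.update f i a)) = b then 1 else 0) -
        k i (Function.update f i a) (σ i) / Fintype.card (B i)| =
        k i (Function.update f i a) (σ i) / Fintype.card (B i) := by
      intro a
      rw [hz a (Finset.mem_univ a), zero_sub, abs_neg, abs_of_nonneg (div_nonneg (hn a) hc.le)]
    simp only [this]
    rw [← Finset.sum_div, (hk σ).sum_one i f, abs_of_pos (by positivity)]
  · have hpos : 0 < binMass k β i f (σ i) b :=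
      lt_of_le_of_ne (binMass_nonneg hk β i f (σ i) b) (Ne.symm h0)
    simp only [tilt, binMass_update hk, h0, if_false]
    have : ∀ a, |k i (Function.update f i a) (σ i) *
        (if β i (truncate (i.val + 1) (Function.update f i a)) = b then 1 else 0) -
        k i (Function.update f i a) (σ i) *
        (if β i (truncate (i.val + 1) (Function.update f i a)) = b then 1 else 0) /
          binMass k β i f (σ i) b / Fintype.card (B i)| =
        k i (Function.update f i a) (σ i) *
        (if β i (truncate (i.val + 1) (Function.update f i a)) = b then 1 else 0) *
        |1 - 1 / (binMass k β i f (σ i) b * Fintype.card (B i))| := by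
      intro a
      have hn' : 0 ≤ k i (Function.update f i a) (σ i) *
        (if β i (truncate (i.val + 1) (Function.update f i a)) = b then 1 else 0) :=
        mul_nonneg (hn a) (by split_ifs <;> simp)
      conv_rhs => rw [← abs_of_nonneg hn', ← abs_mul]
      congr 1
      field_simp
    simp only [this]
    rw [← Finset.sum_mul]
    change binMass k β i f (σ i) b * _ = _
    nth_rewrite 1 [← abs_of_pos hpos]
    rw [← abs_mul]
    congr 1
    field_simp

lemma sum_prod_binned_mul (σ : Fin r → S)
    (g : ((i : Fin r) → φ i) → ((i : Fin r) → B i) → ℝ) :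
    ∑ e : (i : Fin r) → φ i × B i, (∏ i, k i (fun j => (e j).1) (σ i) *
        if β i (truncate (i.val + 1) fun j => (e j).1) = (e i).2 then 1 else 0) *
        g (fun j => (e j).1) (fun j => (e j).2) =
      ∑ f, (∏ i, k i f (σ i)) * g f (fun i => β i (truncate (i.val + 1) f)) := by
  refine (Fintype.sum_equiv (Equiv.arrowProdEquivProdArrow (Fin r) φ B) _
    (fun x => (∏ i, k i x.1 (σ i) *
        if β i (truncate (i.val + 1) x.1) = x.2 i then 1 else 0) * g x.1 x.2)
      (fun _ => rfl)).trans ?_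
  rw [Fintype.sum_prod_type]
  refine Finset.sum_congr rfl fun f _ => ?_
  rw [Finset.sum_eq_single fun i => β i (truncate (i.val + 1) f)]
  · simp
  · intro b _ hb
    obtain ⟨i, hi⟩ := Function.ne_iff.1 hb
    rw [Finset.prod_eq_zero (Finset.mem_univ i) (by simp [hi.symm]), zero_mul]
  · simp

/-- Drawing the bin indices uniformly and the symbols conditionally on them is close to drawing
the symbols and computing their bin indices. -/
lemma sum_abs_prod_binned_sub_le (σ : Fin r → S) :
    ∑ e : (i : Fin r) → φ i × B i, |(∏ i, k i (fun j => (e j).1) (σ i) *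
        if β i (truncate (i.val + 1) fun j => (e j).1) = (e i).2 then 1 else 0) -
        ∏ i, tilt k β i (fun j => (e j).1) (σ i) (e i).2 / Fintype.card (B i)| ≤
      ∑ i, ∑ f, (∏ j, k j f (σ j)) *
        ∑ b, |binMass k β i f (σ i) b - 1 / Fintype.card (B i)| := by
  refine ((isKernel_binned hk β σ).sum_abs_prod_sub_le (isKernel_tilted hk β σ)).trans
    (Finset.sum_le_sum fun i _ => le_of_eq ?_)
  simp only [fst_update, Function.update_self]
  simp only [sum_abs_binned_sub_tilted hk β σ i]
  exact sum_prod_binned_mul hk β σ fun f _ =>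
    ∑ b, |binMass k β i f (σ i) b - 1 / Fintype.card (B i)|

end Scheme

/-! ### The joint law of symbols, inputs and outputs. -/

section Joint

variable {r : ℕ} {φ B : Fin r → Type*} [∀ i, Fintype (φ i)] [∀ i, Nonempty (φ i)]
  [∀ i, Fintype (B i)] [∀ i, Nonempty (B i)] {S X Y : Type*} [Fintype X] [Fintype Y]

/-- The joint pmf of the symbols, inputs and outputs. -/
def seqJoint (q : X → ℝ) (k : Fin r → ((i : Fin r) → φ i) → S → ℝ) (own : Fin r → X → S)
    (d : ((i : Fin r) → φ i) → X → Y → ℝ) (w : ((i : Fin r) → φ i) × X × Y) : ℝ :=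
  q w.2.1 * (∏ i, k i w.1 (own i w.2.1)) * d w.1 w.2.1 w.2.2

variable {q : X → ℝ} {k : Fin r → ((i : Fin r) → φ i) → S → ℝ} {own : Fin r → X → S}
  {d : ((i : Fin r) → φ i) → X → Y → ℝ}

lemma sum_seqJoint_mul (hd : ∀ f x, ∑ y, d f x y = 1) (g : ((i : Fin r) → φ i) → X → ℝ) :
    ∑ w, seqJoint q k own d w * g w.1 w.2.1 =
      ∑ x, q x * ∑ f, (∏ i, k i f (own i x)) * g f x := by
  simp only [Fintype.sum_prod_type, seqJoint]
  rw [Finset.sum_comm]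
  refine Finset.sum_congr rfl fun x _ => ?_
  rw [Finset.mul_sum]
  refine Finset.sum_congr rfl fun f _ => ?_
  rw [← Finset.sum_mul, ← Finset.mul_sum, hd]
  ring

lemma seqJoint_nonneg (hq : ∀ x, 0 ≤ q x) (hk : ∀ σ : Fin r → S, IsKernel fun i f => k i f (σ i))
    (hd : ∀ f x y, 0 ≤ d f x y) (w) : 0 ≤ seqJoint q k own d w :=
  mul_nonneg (mul_nonneg (hq _) (Finset.prod_nonneg fun i _ =>
    (hk fun i => own i w.2.1).nonneg i w.1)) (hd _ _ _)

lemma sum_seqJoint (hq : ∑ x, q x = 1) (hk : ∀ σ : Fin r → S, IsKernel fun i f => k i f (σ i))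
    (hd : ∀ f x, ∑ y, d f x y = 1) : ∑ w, seqJoint q k own d w = 1 := by
  have := sum_seqJoint_mul (q := q) (k := k) (own := own) hd (fun _ _ => 1)
  simp only [mul_one] at this
  rw [this, Finset.sum_congr rfl fun x _ => by rw [(hk fun i => own i x).sum_prod, mul_one], hq]

/-- The mean distance of the bin masses from uniformity, as a distance of laws. -/
lemma sum_binMass_eq (hq : ∀ x, 0 ≤ q x) (hk : ∀ σ : Fin r → S, IsKernel fun i f => k i f (σ i))
    (hd : ∀ f x, ∑ y, d f x y = 1) (hd0 : ∀ f x y, 0 ≤ d f x y)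
    (β : (i : Fin r) → ((i : Fin r) → φ i) → B i) (i : Fin r) :
    ∑ x, q x * ∑ f, (∏ j, k j f (own j x)) *
        ∑ b, |binMass k β i f (own i x) b - 1 / Fintype.card (B i)| =
      ∑ b, ∑ z, |law (seqJoint q k own d)
          (fun w => (β i (truncate (i.val + 1) w.1), truncate i.val w.1, w.2.1)) (b, z) -
        law (seqJoint q k own d) (fun w => (truncate i.val w.1, w.2.1)) z /
          Fintype.card (B i)| := by
  set P := seqJoint q k own d with hP
  have hP0 := seqJoint_nonneg (own := own) hq hk hd0
  -- `binMass` is the conditional law of the index given prefix and inputs. The product form avoids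
  -- dividing by prefixes of probability zero.
  have hb : ∀ b (t : (i : Fin r) → φ i) x,
      law P (fun w => (β i (truncate (i.val + 1) w.1), truncate i.val w.1, w.2.1)) (b, t, x) =
        law P (fun w => (truncate i.val w.1, w.2.1)) (t, x) * binMass k β i t (own i x) b := by
    intro b t x
    rw [law_eq_sum_mul, law_eq_sum_mul]
    have e1 := sum_seqJoint_mul (q := q) (k := k) (own := own) hd fun f x' =>
      if (β i (truncate (i.val + 1) f), truncate i.val f, x') = (b, t, x) then 1 else 0
    have e2 := sum_seqJoint_mul (q := q) (k := k) (own := own) hd fun f x' =>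
      if (truncate i.val f, x') = (t, x) then 1 else 0
    rw [hP, e1, e2, Finset.sum_mul]
    refine Finset.sum_congr rfl fun x' _ => ?_
    rw [mul_assoc]
    congr 1
    by_cases hx : x' = x
    swap
    · simp [hx]
    subst hx
    simp only [Prod.mk.injEq, and_true]
    have hlt : ∀ (f : (i : Fin r) → φ i) a,
        truncate i.val (Function.update f i a) = truncate i.val f := fun f a =>
      truncate_congr fun j hj => Function.update_of_ne (by rintro rfl; exact lt_irrefl _ hj) _ _
    rw [(hk fun j => own j x').sum_prod_mul i, Finset.sum_mul]
    · refine Finset.sum_congr rfl fun f _ => ?_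
      rw [mul_assoc]
      congr 1
      simp only [hlt]
      by_cases ht : truncate i.val f = t
      · have : binMass k β i t (own i x') b = binMass k β i f (own i x') b :=
          binMass_congr hk β i (fun j hj => by rw [← ht, truncate_apply hj]) _ _
        simp only [ht, and_true, if_true, one_mul, this]
        rfl
      · simp [ht]
    · intro f f' h
      rw [truncate_congr_le h, truncate_congr fun j hj => h j (le_of_lt hj)]
  have hl : ∀ z, 0 ≤ law P (fun w => (truncate i.val w.1, w.2.1)) z := fun z => law_nonneg hP0 _ _
  have e3 := sum_seqJoint_mul (q := q) (k := k) (own := own) hd fun f x =>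
    ∑ b, |binMass k β i f (own i x) b - 1 / Fintype.card (B i)|
  rw [← e3]
  have e4 : ∀ w : ((i : Fin r) → φ i) × X × Y,
      ∑ b, |binMass k β i w.1 (own i w.2.1) b - 1 / Fintype.card (B i)| =
      ∑ b, |binMass k β i (truncate i.val w.1) (own i w.2.1) b - 1 / Fintype.card (B i)| := by
    intro w
    refine Finset.sum_congr rfl fun b _ => ?_
    rw [binMass_congr hk β i (f := w.1) (f' := truncate i.val w.1)
      (fun j hj => (truncate_apply hj _).symm)]
  simp only [e4]
  rw [← sum_law_mul P (fun w => (truncate i.val w.1, w.2.1)) (fun z =>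
    ∑ b, |binMass k β i z.1 (own i z.2) b - 1 / Fintype.card (B i)|), Finset.sum_comm]
  refine Finset.sum_congr rfl fun z _ => ?_
  rw [Finset.mul_sum]
  refine Finset.sum_congr rfl fun b _ => ?_
  rw [hb b z.1 z.2]
  nth_rewrite 1 [← abs_of_nonneg (hl z)]
  rw [← abs_mul]
  congr 1
  ring

end Joint

/-! ### Successive decoding and the encoders built on it. -/

section Decoding

variable {r : ℕ} {φ B M : Fin r → Type*} [∀ i, Fintype (φ i)] [∀ i, Nonempty (φ i)]
  [∀ i, Fintype (B i)] [∀ i, Nonempty (B i)] [∀ i, Fintype (M i)] [∀ i, Nonempty (M i)]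
  {S Y : Type*} [Fintype Y] {k : Fin r → ((i : Fin r) → φ i) → S → ℝ}

/-- The successive reconstructions of the symbols from the bin indices `b`, the messages `c` and
the side information `s`. -/
noncomputable def decodeSeq
    (D : (i : Fin r) → ((i : Fin r) → φ i) → S → B i × M i → (i : Fin r) → φ i)
    (b : (i : Fin r) → B i) (c : (i : Fin r) → M i) (s : S) : ℕ → (i : Fin r) → φ i
  | 0 => truncate 0 fun _ => Classical.arbitrary _
  | t + 1 => if h : t < r then D ⟨t, h⟩ (decodeSeq D b c s t) s (b ⟨t, h⟩, c ⟨t, h⟩)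
      else decodeSeq D b c s t

/-- The conditional law of the message of round `i`. -/
noncomputable def msgKernel (k : Fin r → ((i : Fin r) → φ i) → S → ℝ)
    (β : (i : Fin r) → ((i : Fin r) → φ i) → B i) (μ : (i : Fin r) → ((i : Fin r) → φ i) → M i)
    (D : (i : Fin r) → ((i : Fin r) → φ i) → S → B i × M i → (i : Fin r) → φ i)
    (i : Fin r) (b : (i : Fin r) → B i) (c : (i : Fin r) → M i) (s : S) (m : M i) : ℝ :=
  -- The speaker reconstructs all preceding symbols, its own included, from the messages, because an
  -- encoder of a code keeps no memory of what it drew. This is why decoding has to succeed with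
  -- either side information.
  ∑ a, tilt k β i (Function.update (decodeSeq D b c s i.val) i a) s (b i) *
    if μ i (truncate (i.val + 1) (Function.update (decodeSeq D b c s i.val) i a)) = m then 1 else 0

/-- All symbols of `f` are decoded correctly, with either side information. -/
def DecodesAt (μ : (i : Fin r) → ((i : Fin r) → φ i) → M i)
    (D : (i : Fin r) → ((i : Fin r) → φ i) → S → B i × M i → (i : Fin r) → φ i) (s₁ s₂ : S)
    (b : (i : Fin r) → B i) (f : (i : Fin r) → φ i) : Prop :=
  ∀ i : Fin r, ∀ s, s = s₁ ∨ s = s₂ →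
    D i (truncate i.val f) s (b i, μ i (truncate (i.val + 1) f)) = truncate (i.val + 1) f

variable (hk : ∀ σ : Fin r → S, IsKernel fun i f => k i f (σ i))
  (β : (i : Fin r) → ((i : Fin r) → φ i) → B i) (μ : (i : Fin r) → ((i : Fin r) → φ i) → M i)
  (D : (i : Fin r) → ((i : Fin r) → φ i) → S → B i × M i → (i : Fin r) → φ i)

lemma decodeSeq_congr (b : (i : Fin r) → B i) (s : S) (t : ℕ) {c c' : (i : Fin r) → M i}
    (h : ∀ j, j.val < t → c j = c' j) : decodeSeq D b c s t = decodeSeq D b c' s t := by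
  induction t with
  | zero => rfl
  | succ t ih =>
    simp only [decodeSeq]
    rw [ih fun j hj => h j (hj.trans (Nat.lt_succ_self t))]
    split_ifs with ht
    · rw [h ⟨t, ht⟩ (Nat.lt_succ_self t)]
    · rfl

lemma decodeSeq_eq {s₁ s₂ s : S} {b : (i : Fin r) → B i} {f : (i : Fin r) → φ i}
    (h : DecodesAt μ D s₁ s₂ b f) (hs : s = s₁ ∨ s = s₂) (t : ℕ) (ht : t ≤ r) :
    decodeSeq D b (fun i => μ i (truncate (i.val + 1) f)) s t = truncate t f := by
  induction t with
  | zero => exact truncate_congr fun j hj => absurd hj (Nat.not_lt_zero _)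
  | succ t ih =>
    have ht' : t < r := ht
    simp only [decodeSeq, dif_pos ht']
    rw [ih ht'.le]
    exact h ⟨t, ht'⟩ s hs

include hk

lemma msgKernel_nonneg (i : Fin r) (b : (i : Fin r) → B i) (c : (i : Fin r) → M i) (s : S)
    (m : M i) : 0 ≤ msgKernel k β μ D i b c s m :=
  Finset.sum_nonneg fun a _ => mul_nonneg ((isKernel_tilt hk β (fun _ => s) b).nonneg i _)
    (by split_ifs <;> simp)

lemma sum_msgKernel (i : Fin r) (b : (i : Fin r) → B i) (c : (i : Fin r) → M i) (s : S) :
    ∑ m, msgKernel k β μ D i b c s m = 1 := by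
  simp only [msgKernel]
  rw [Finset.sum_comm]
  simp only [← Finset.mul_sum, Finset.sum_ite_eq, Finset.mem_univ, if_true, mul_one]
  exact (isKernel_tilt hk β (fun _ => s) b).sum_one i _

omit hk in
lemma msgKernel_congr (i : Fin r) (b : (i : Fin r) → B i) {c c' : (i : Fin r) → M i}
    (h : ∀ j < i, c j = c' j) (s : S) :
    msgKernel k β μ D i b c s = msgKernel k β μ D i b c' s := by
  funext m
  simp only [msgKernel]
  rw [decodeSeq_congr D b s i.val h]

lemma isKernel_msgKernel (σ : Fin r → S) (b : (i : Fin r) → B i) :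
    IsKernel fun i c => msgKernel k β μ D i b c (σ i) (c i) where
  nonneg i c := msgKernel_nonneg hk β μ D i b c _ _
  congr i c c' h := by
    rw [msgKernel_congr β μ D i b (fun j hj => h j hj.le), h i le_rfl]
  sum_one i c := by
    have : ∀ m, msgKernel k β μ D i b (Function.update c i m) (σ i) = msgKernel k β μ D i b c (σ i) :=
      fun m => msgKernel_congr β μ D i b (fun j hj => Function.update_of_ne hj.ne _ _) _
    simp only [this, Function.update_self]
    exact sum_msgKernel hk β μ D i b c _

/-- If the preceding symbols are decoded correctly, the encoder draws from the right tilted kernel,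
and the probability of a message is at least that of any one symbol that produces it. -/
lemma tilt_le_msgKernel {s₁ s₂ s : S} {b : (i : Fin r) → B i} {f : (i : Fin r) → φ i}
    (h : DecodesAt μ D s₁ s₂ b f) (hs : s = s₁ ∨ s = s₂) (i : Fin r) :
    tilt k β i f s (b i) ≤
      msgKernel k β μ D i b (fun i => μ i (truncate (i.val + 1) f)) s
        (μ i (truncate (i.val + 1) f)) := by
  have hT := isKernel_tilt hk β (fun _ => s) b
  have hle : ∀ j ≤ i, Function.update (truncate i.val f) i (f i) j = f j := by
    intro j hj
    rcases hj.eq_or_lt with rfl | hlt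
    · simp
    · rw [Function.update_of_ne hlt.ne, truncate_apply hlt]
  simp only [msgKernel, decodeSeq_eq μ D h hs i.val i.2.le]
  refine le_trans (le_of_eq ?_) (Finset.single_le_sum (f := fun a =>
    tilt k β i (Function.update (truncate i.val f) i a) s (b i) *
    if μ i (truncate (i.val + 1) (Function.update (truncate i.val f) i a)) =
      μ i (truncate (i.val + 1) f) then (1 : ℝ) else 0)
    (fun a _ => mul_nonneg (hT.nonneg i _) (by split_ifs <;> simp)) (Finset.mem_univ (f i)))
  rw [truncate_congr_le hle, if_pos rfl, mul_one]
  exact (hT.congr i _ _ hle).symm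

/-- The outputs of the code are close to those computed from the correct symbols. -/
lemma sum_abs_code_sub_le {s₁ s₂ : S} {σ : Fin r → S} (hσ : ∀ i, σ i = s₁ ∨ σ i = s₂)
    (b : (i : Fin r) → B i) {d : ((i : Fin r) → φ i) → ((i : Fin r) → φ i) → Y → ℝ}
    (hd0 : ∀ f f' y, 0 ≤ d f f' y) (hd : ∀ f f', ∑ y, d f f' y = 1) :
    ∑ y, |(∑ c, (∏ i, msgKernel k β μ D i b c (σ i) (c i)) *
          d (decodeSeq D b c s₁ r) (decodeSeq D b c s₂ r) y) -
        ∑ f, (∏ i, tilt k β i f (σ i) (b i)) * d f f y| ≤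
      2 * ∑ f, (∏ i, tilt k β i f (σ i) (b i)) * if DecodesAt μ D s₁ s₂ b f then 0 else 1 := by
  have hT := isKernel_tilt hk β σ b
  have hE := isKernel_msgKernel hk β μ D σ b
  set t : ((i : Fin r) → φ i) → ℝ := fun f => ∏ i, tilt k β i f (σ i) (b i) with ht
  set u : ((i : Fin r) → M i) → ℝ := fun c => ∏ i, msgKernel k β μ D i b c (σ i) (c i) with hu
  have ht0 : ∀ f, 0 ≤ t f := fun f => Finset.prod_nonneg fun i _ => hT.nonneg i f
  have hu0 : ∀ c, 0 ≤ u c := fun c => Finset.prod_nonneg fun i _ => hE.nonneg i c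
  -- On the decodable tuples the messages determine the symbols, so the law produced by the code
  -- dominates the decodable part of the ideal one. Both have mass one, so they differ by at most
  -- twice the undecodable mass.
  have hgood : ∀ y, ∑ f with DecodesAt μ D s₁ s₂ b f, t f * d f f y ≤
      ∑ c, u c * d (decodeSeq D b c s₁ r) (decodeSeq D b c s₂ r) y := by
    intro y
    set m : ((i : Fin r) → φ i) → ((i : Fin r) → M i) := fun f i => μ i (truncate (i.val + 1) f)
    have hdec : ∀ f, DecodesAt μ D s₁ s₂ b f → ∀ s, s = s₁ ∨ s = s₂ →
        decodeSeq D b (m f) s r = f := fun f hf s hs => by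
      rw [decodeSeq_eq μ D hf hs r le_rfl, truncate_of_le le_rfl]
    have hinj : Set.InjOn m (Finset.univ.filter fun f => DecodesAt μ D s₁ s₂ b f) := by
      intro f hf f' hf' hff
      simp only [Finset.coe_filter, Finset.mem_univ, true_and, Set.mem_ofPred_eq] at hf hf'
      rw [← hdec f hf s₁ (Or.inl rfl), hff, hdec f' hf' s₁ (Or.inl rfl)]
    refine le_trans (Finset.sum_le_sum fun f hf => ?_) ((Finset.sum_image (s :=
      Finset.univ.filter fun f => DecodesAt μ D s₁ s₂ b f) (f := fun c => u c *
        d (decodeSeq D b c s₁ r) (decodeSeq D b c s₂ r) y) hinj).symm.le.trans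
        (Finset.sum_le_univ_sum_of_nonneg fun c => mul_nonneg (hu0 c) (hd0 _ _ _)))
    have hf := (Finset.mem_filter.1 hf).2
    rw [hdec f hf s₁ (Or.inl rfl), hdec f hf s₂ (Or.inr rfl)]
    exact mul_le_mul_of_nonneg_right (Finset.prod_le_prod (fun i _ => hT.nonneg i f)
      fun i _ => tilt_le_msgKernel hk β μ D hf (hσ i) i) (hd0 _ _ _)
  have hbad : ∑ f with ¬ DecodesAt μ D s₁ s₂ b f, t f =
      ∑ f, t f * if DecodesAt μ D s₁ s₂ b f then 0 else 1 := by
    rw [Finset.sum_filter]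
    refine Finset.sum_congr rfl fun f _ => ?_
    split_ifs <;> simp_all
  have hsplit : ∀ g : ((i : Fin r) → φ i) → ℝ, ∑ f, g f =
      ∑ f with DecodesAt μ D s₁ s₂ b f, g f + ∑ f with ¬ DecodesAt μ D s₁ s₂ b f, g f :=
    fun g => (Finset.sum_filter_add_sum_filter_not _ _ _).symm
  have habs : ∀ y, |(∑ c, u c * d (decodeSeq D b c s₁ r) (decodeSeq D b c s₂ r) y) -
        ∑ f, t f * d f f y| ≤
      (∑ c, u c * d (decodeSeq D b c s₁ r) (decodeSeq D b c s₂ r) y) -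
        ∑ f with DecodesAt μ D s₁ s₂ b f, t f * d f f y +
        ∑ f with ¬ DecodesAt μ D s₁ s₂ b f, t f * d f f y := by
    intro y
    have h1 := hgood y
    have h2 : 0 ≤ ∑ f with ¬ DecodesAt μ D s₁ s₂ b f, t f * d f f y :=
      Finset.sum_nonneg fun f _ => mul_nonneg (ht0 f) (hd0 _ _ _)
    rw [hsplit, abs_le]
    constructor <;> linarith
  refine (Finset.sum_le_sum fun y _ => habs y).trans (le_of_eq ?_)
  have hs : ∀ F : Finset ((i : Fin r) → φ i), ∑ y, ∑ f ∈ F, t f * d f f y = ∑ f ∈ F, t f := by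
    intro F
    rw [Finset.sum_comm]
    exact Finset.sum_congr rfl fun f _ => by rw [← Finset.mul_sum, hd, mul_one]
  have hs' : ∑ y, ∑ c, u c * d (decodeSeq D b c s₁ r) (decodeSeq D b c s₂ r) y = 1 := by
    rw [Finset.sum_comm, ← hE.sum_prod]
    exact Finset.sum_congr rfl fun f _ => by rw [← Finset.mul_sum, hd, mul_one]
  rw [Finset.sum_add_distrib, Finset.sum_sub_distrib, hs, hs, hs']
  have h1 := hsplit t
  rw [show ∑ f, t f = 1 from hT.sum_prod] at h1
  rw [← hbad]
  linarith

end Decoding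

/-! ### Performance for fixed binnings. -/

section OneShot

open scoped BigOperators

variable {r : ℕ} {φ G W M : Fin r → Type*} [∀ i, Fintype (φ i)] [∀ i, Nonempty (φ i)]
  [∀ i, Fintype (G i)] [∀ i, Nonempty (G i)] [∀ i, Fintype (W i)] [∀ i, Nonempty (W i)]
  [∀ i, Fintype (M i)] [∀ i, Nonempty (M i)]
  {S X Y : Type*} [Fintype X] [Fintype Y] {k : Fin r → ((i : Fin r) → φ i) → S → ℝ}

lemma sum_tuple_prod {ψ ψ' : Fin r → Type*} [∀ i, Fintype (ψ i)] [∀ i, Fintype (ψ' i)]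
    (F : ((i : Fin r) → ψ i × ψ' i) → ℝ) :
    ∑ e, F e = ∑ a : (i : Fin r) → ψ i, ∑ b : (i : Fin r) → ψ' i, F fun i => (a i, b i) := by
  refine (Fintype.sum_equiv (Equiv.arrowProdEquivProdArrow (Fin r) ψ ψ') F
    (fun x => F fun i => (x.1 i, x.2 i)) (fun _ => rfl)).trans ?_
  rw [Fintype.sum_prod_type]

/-- The probability that the decoder with side information `side` errs in round `i`. -/
noncomputable def decodeError (P : ((i : Fin r) → φ i) × X × Y → ℝ) (side : X → S) {B : Type*}
    (κ : ((i : Fin r) → φ i) → B) (i : Fin r)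
    (D : ((i : Fin r) → φ i) → S → B → (i : Fin r) → φ i) : ℝ :=
  ∑ w, P w * if D (truncate i.val w.1) (side w.2.1) (κ (truncate (i.val + 1) w.1)) =
    truncate (i.val + 1) w.1 then 0 else 1

/-- The distance from uniformity of the bin index of round `i`, given the preceding symbols and the
inputs. -/
noncomputable def binBias (P : ((i : Fin r) → φ i) × X × Y → ℝ) {B : Type*} [Fintype B]
    (β : ((i : Fin r) → φ i) → B) (i : Fin r) : ℝ :=
  ∑ b, ∑ z, |law P (fun w => (β (truncate (i.val + 1) w.1), truncate i.val w.1, w.2.1)) (b, z) -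
    law P (fun w => (truncate i.val w.1, w.2.1)) z / Fintype.card B|

variable {q : X → ℝ} (hq0 : ∀ x, 0 ≤ q x)
  (hk : ∀ σ : Fin r → S, IsKernel fun i f => k i f (σ i))
  {own : Fin r → X → S} {s₁ s₂ : X → S} (hown : ∀ i x, own i x = s₁ x ∨ own i x = s₂ x)
  {d : ((i : Fin r) → φ i) → ((i : Fin r) → φ i) → X → Y → ℝ}
  (hd0 : ∀ f f' x y, 0 ≤ d f f' x y) (hd : ∀ f f' x, ∑ y, d f f' x y = 1)
  (κ : (i : Fin r) → ((i : Fin r) → φ i) → (G i × W i) × M i)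
  (D : (i : Fin r) → ((i : Fin r) → φ i) → S → (G i × W i) × M i → (i : Fin r) → φ i)

include hq0 hk hown hd0 hd

/-- The bad mass under tilted symbols with uniform bin indices. -/
lemma tilted_bad_le :
    ∑ x, q x * ∑ f, ∑ b : (i : Fin r) → G i × W i,
      (∏ i, tilt k (fun i f => (κ i f).1) i f (own i x) (b i) / Fintype.card (G i × W i)) *
        (if DecodesAt (fun i f => (κ i f).2) D (s₁ x) (s₂ x) b f then 0 else 1) ≤
    (∑ i, (decodeError (seqJoint q k own fun f => d f f) s₁ (κ i) i (D i) +
      decodeError (seqJoint q k own fun f => d f f) s₂ (κ i) i (D i))) +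
    ∑ i, binBias (seqJoint q k own fun f => d f f) (fun f => (κ i f).1) i := by
  set P := seqJoint q k own fun f => d f f with hP
  set β : (i : Fin r) → ((i : Fin r) → φ i) → G i × W i := fun i f => (κ i f).1 with hβ
  set μ : (i : Fin r) → ((i : Fin r) → φ i) → M i := fun i f => (κ i f).2 with hμ
  have hU : ∑ i, binBias P (β i) i = ∑ x, q x * ∑ i, ∑ f, (∏ j, k j f (own j x)) *
      ∑ b, |binMass k β i f (own i x) b - 1 / Fintype.card (G i × W i)| := by
    simp only [Finset.mul_sum (s := (Finset.univ : Finset (Fin r)))]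
    rw [Finset.sum_comm]
    refine Finset.sum_congr rfl fun i _ => ?_
    exact (sum_binMass_eq (own := own) hq0 hk (fun f x => hd f f x)
      (fun f x y => hd0 f f x y) β i).symm
  -- When the indices are computed from the true symbols, the failure probability is at most the sum
  -- of the errors over rounds and terminals. Replacing them by uniform indices then costs the bias
  -- of the bins.
  have hS : ∑ x, q x * ∑ f, (∏ j, k j f (own j x)) *
      (if DecodesAt μ D (s₁ x) (s₂ x) (fun i => β i (truncate (i.val + 1) f)) f
        then (0 : ℝ) else 1) ≤
      ∑ i, (decodeError P s₁ (κ i) i (D i) + decodeError P s₂ (κ i) i (D i)) := by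
    have e1 := sum_seqJoint_mul (q := q) (k := k) (own := own) (d := fun f => d f f)
      (fun f x => hd f f x) fun f x =>
      (if DecodesAt μ D (s₁ x) (s₂ x) (fun i => β i (truncate (i.val + 1) f)) f
        then (0 : ℝ) else 1)
    rw [← e1]
    simp only [decodeError, ← Finset.sum_add_distrib, ← mul_add]
    rw [Finset.sum_comm]
    refine Finset.sum_le_sum fun w _ => ?_
    rw [← Finset.mul_sum]
    refine mul_le_mul_of_nonneg_left ?_ (seqJoint_nonneg hq0 hk (fun f x y => hd0 f f x y) w)
    have hn : ∀ i, (0 : ℝ) ≤ (if D i (truncate i.val w.1) (s₁ w.2.1)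
        (κ i (truncate (i.val + 1) w.1)) = truncate (i.val + 1) w.1 then 0 else 1) +
        (if D i (truncate i.val w.1) (s₂ w.2.1)
        (κ i (truncate (i.val + 1) w.1)) = truncate (i.val + 1) w.1 then 0 else 1) := by
      intro i
      split_ifs <;> norm_num
    split_ifs with h
    · exact Finset.sum_nonneg fun i _ => hn i
    · simp only [DecodesAt, not_forall] at h
      obtain ⟨i, s, hs, hne⟩ := h
      refine le_trans ?_ (Finset.single_le_sum (fun i _ => hn i) (Finset.mem_univ i))
      rcases hs with rfl | rfl
      · rw [if_neg hne]
        split_ifs <;> norm_num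
      · have e : (if D i (truncate i.val w.1) (s₂ w.2.1) (κ i (truncate (i.val + 1) w.1)) =
            truncate (i.val + 1) w.1 then (0 : ℝ) else 1) = 1 := if_neg hne
        rw [e]
        split_ifs <;> norm_num
  rw [hU]
  refine le_trans ?_ (add_le_add hS le_rfl)
  rw [← Finset.sum_add_distrib]
  refine Finset.sum_le_sum fun x _ => ?_
  rw [← mul_add]
  refine mul_le_mul_of_nonneg_left ?_ (hq0 x)
  have e2 := sum_prod_binned_mul hk β (fun i => own i x) fun f b =>
    (if DecodesAt μ D (s₁ x) (s₂ x) b f then (0 : ℝ) else 1)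
  have e3 := sum_abs_prod_binned_sub_le hk β (fun i => own i x)
  rw [← e2]
  refine le_trans ?_ (add_le_add le_rfl e3)
  rw [← Finset.sum_add_distrib, sum_tuple_prod (fun e : (i : Fin r) → φ i × (G i × W i) => _)]
  refine Finset.sum_le_sum fun f _ => Finset.sum_le_sum fun b _ => ?_
  have hgen : ∀ u v c : ℝ, c = 0 ∨ c = 1 → v * c ≤ u * c + |u - v| := by
    rintro u v c (rfl | rfl)
    · simp
    · have := neg_abs_le (u - v)
      linarith
  exact hgen _ _ _ (by split_ifs <;> simp)

/-- The averaged performance of the binning code. -/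
lemma exists_shared_bins :
    ∃ g : (i : Fin r) → G i,
      ∑ x, ∑ y, |(∑ v : (i : Fin r) → W i, q x *
          ∑ c, (∏ i, msgKernel k (fun i f => (κ i f).1) (fun i f => (κ i f).2) D i
            (fun j => (g j, v j)) c (own i x) (c i)) *
          d (decodeSeq D (fun j => (g j, v j)) c (s₁ x) r)
            (decodeSeq D (fun j => (g j, v j)) c (s₂ x) r) x y) /
            Fintype.card ((i : Fin r) → W i) -
        law (seqJoint q k own fun f => d f f) (fun w => w.2) (x, y)| ≤
      2 * (∑ i, (decodeError (seqJoint q k own fun f => d f f) s₁ (κ i) i (D i) +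
        decodeError (seqJoint q k own fun f => d f f) s₂ (κ i) i (D i))) +
      3 * (∑ i, binBias (seqJoint q k own fun f => d f f) (fun f => (κ i f).1) i) +
      ∑ g : (i : Fin r) → G i, ∑ z, |law (seqJoint q k own fun f => d f f)
          (fun w => ((fun i => (κ i (truncate (i.val + 1) w.1)).1.1 : (i : Fin r) → G i), w.2))
            (g, z) -
        law (seqJoint q k own fun f => d f f) (fun w => w.2) z /
          Fintype.card ((i : Fin r) → G i)| := by
  set P := seqJoint q k own fun f => d f f with hP
  set β : (i : Fin r) → ((i : Fin r) → φ i) → G i × W i := fun i f => (κ i f).1 with hβ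
  set μ : (i : Fin r) → ((i : Fin r) → φ i) → M i := fun i f => (κ i f).2 with hμ
  set NG : ℝ := (Fintype.card ((i : Fin r) → G i) : ℝ) with hNG
  set NW : ℝ := (Fintype.card ((i : Fin r) → W i) : ℝ) with hNW
  have hNG0 : 0 < NG := by rw [hNG]; exact_mod_cast Fintype.card_pos
  have hNW0 : 0 < NW := by rw [hNW]; exact_mod_cast Fintype.card_pos
  have hcard : ∏ i, (Fintype.card (G i × W i) : ℝ) = NG * NW := by
    simp only [hNG, hNW, Fintype.card_prod, Fintype.card_pi, Nat.cast_mul, Nat.cast_prod,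
      Finset.prod_mul_distrib]
  -- For given indices, `Rb` is produced by the code and `Qb` by ideal symbols conditioned on the
  -- indices, while `Pb` restricts to symbols whose computed indices are the given ones. `Rb` is
  -- close to `Qb` by decoding, and `Qb`, weighted by the uniform law of the indices, to `Pb` by
  -- hashing.
  set Rb : X → Y → ((i : Fin r) → G i) → ((i : Fin r) → W i) → ℝ := fun x y g v =>
    ∑ c, (∏ i, msgKernel k β μ D i (fun j => (g j, v j)) c (own i x) (c i)) *
          d (decodeSeq D (fun j => (g j, v j)) c (s₁ x) r)
            (decodeSeq D (fun j => (g j, v j)) c (s₂ x) r) x y with hRb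
  set Qb : X → Y → ((i : Fin r) → G i) → ((i : Fin r) → W i) → ℝ := fun x y g v =>
    ∑ f, (∏ i, tilt k β i f (own i x) (g i, v i)) * d f f x y with hQb
  set Pb : X → Y → ((i : Fin r) → G i) → ((i : Fin r) → W i) → ℝ := fun x y g v =>
    ∑ f, (∏ i, k i f (own i x) * if β i (truncate (i.val + 1) f) = (g i, v i) then 1 else 0) *
      d f f x y with hPb
  set SW := ∑ i, (decodeError P s₁ (κ i) i (D i) + decodeError P s₂ (κ i) i (D i)) with hSW
  set U := ∑ i, binBias P (β i) i with hUdef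
  have h1 : ∑ x, ∑ y, ∑ g, ∑ v, q x * |Rb x y g v - Qb x y g v| / (NG * NW) ≤ 2 * (SW + U) := by
    have hb := tilted_bad_le hq0 hk hown hd0 hd κ D
    refine le_trans ?_ (mul_le_mul_of_nonneg_left hb (by norm_num : (0 : ℝ) ≤ 2))
    rw [Finset.mul_sum]
    refine Finset.sum_le_sum fun x _ => ?_
    have e : ∀ g v, ∑ y, |Rb x y g v - Qb x y g v| ≤ _ := fun g v =>
      sum_abs_code_sub_le hk β μ D (fun i => hown i x) (fun j => (g j, v j))
        (d := fun f f' => d f f' x) (fun f f' y => hd0 f f' x y) (fun f f' => hd f f' x)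
    calc ∑ y, ∑ g, ∑ v, q x * |Rb x y g v - Qb x y g v| / (NG * NW)
        = ∑ g, ∑ v, q x * (∑ y, |Rb x y g v - Qb x y g v|) / (NG * NW) := by
          rw [Finset.sum_comm]
          refine Finset.sum_congr rfl fun g _ => ?_
          rw [Finset.sum_comm]
          refine Finset.sum_congr rfl fun v _ => ?_
          rw [Finset.mul_sum, Finset.sum_div]
      _ ≤ ∑ g : (i : Fin r) → G i, ∑ v : (i : Fin r) → W i, q x * (2 * ∑ f, (∏ i, tilt k β i f (own i x) (g i, v i)) *
            if DecodesAt μ D (s₁ x) (s₂ x) (fun j => (g j, v j)) f then 0 else 1) / (NG * NW) := by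
          refine Finset.sum_le_sum fun g _ => Finset.sum_le_sum fun v _ => ?_
          exact div_le_div_of_nonneg_right (mul_le_mul_of_nonneg_left (e g v) (hq0 x))
            (mul_pos hNG0 hNW0).le
      _ = _ := by
          rw [Finset.sum_comm (s := (Finset.univ : Finset ((i : Fin r) → φ i))),
            sum_tuple_prod (fun b : (i : Fin r) → G i × W i => _)]
          simp only [Finset.mul_sum, Finset.sum_div]
          refine Finset.sum_congr rfl fun g _ => Finset.sum_congr rfl fun v _ =>
            Finset.sum_congr rfl fun f _ => ?_
          rw [Finset.prod_div_distrib, hcard]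
          ring
  have h2 : ∑ x, ∑ y, ∑ g, ∑ v, q x * |Qb x y g v / (NG * NW) - Pb x y g v| ≤ U := by
    have hU : U = ∑ x, q x * ∑ i, ∑ f, (∏ j, k j f (own j x)) *
        ∑ b, |binMass k β i f (own i x) b - 1 / Fintype.card (G i × W i)| := by
      rw [hUdef]
      simp only [Finset.mul_sum (s := (Finset.univ : Finset (Fin r)))]
      rw [Finset.sum_comm]
      refine Finset.sum_congr rfl fun i _ => ?_
      exact (sum_binMass_eq (own := own) hq0 hk (fun f x => hd f f x)
        (fun f x y => hd0 f f x y) β i).symm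
    rw [hU]
    refine Finset.sum_le_sum fun x _ => ?_
    simp only [← Finset.mul_sum]
    refine mul_le_mul_of_nonneg_left ?_ (hq0 x)
    refine le_trans ?_ (sum_abs_prod_binned_sub_le hk β (fun i => own i x))
    rw [sum_tuple_prod (fun e : (i : Fin r) → φ i × (G i × W i) => _)]
    simp only
    rw [Finset.sum_comm (s := (Finset.univ : Finset ((i : Fin r) → φ i))),
      sum_tuple_prod (fun b : (i : Fin r) → G i × W i => _), Finset.sum_comm]
    refine Finset.sum_le_sum fun g _ => ?_
    rw [Finset.sum_comm]
    refine Finset.sum_le_sum fun v _ => ?_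
    calc ∑ y, |Qb x y g v / (NG * NW) - Pb x y g v|
        ≤ ∑ y, ∑ f, |(∏ i, k i f (own i x) *
            if β i (truncate (i.val + 1) f) = (g i, v i) then 1 else 0) -
            ∏ i, tilt k β i f (own i x) (g i, v i) / Fintype.card (G i × W i)| * d f f x y := by
          refine Finset.sum_le_sum fun y _ => ?_
          rw [abs_sub_comm]
          simp only [hQb, hPb, Finset.sum_div]
          rw [← Finset.sum_sub_distrib]
          refine (Finset.abs_sum_le_sum_abs _ _).trans (Finset.sum_le_sum fun f _ => le_of_eq ?_)
          rw [← abs_of_nonneg (hd0 f f x y), ← abs_mul, abs_of_nonneg (hd0 f f x y),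
            Finset.prod_div_distrib, hcard]
          congr 1
          ring
      _ = _ := by
          rw [Finset.sum_comm]
          refine Finset.sum_congr rfl fun f _ => ?_
          rw [← Finset.mul_sum, hd, mul_one]
          congr!
  have hlaw : ∀ x y g, law P (fun w => ((fun i => (κ i (truncate (i.val + 1) w.1)).1.1 :
      (i : Fin r) → G i), w.2)) (g, (x, y)) = q x * ∑ v, Pb x y g v := by
    intro x y g
    rw [law_eq_sum_mul]
    simp only [Fintype.sum_prod_type, hP, seqJoint, Prod.mk.injEq, hPb]
    rw [Finset.sum_comm (s := (Finset.univ : Finset ((i : Fin r) → W i))), Finset.mul_sum]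
    refine Finset.sum_congr rfl fun f _ => ?_
    rw [Finset.sum_eq_single x (fun x' _ hx => by simp [hx]) (by simp),
      Finset.sum_eq_single y (fun y' _ hy => by simp [hy]) (by simp)]
    simp only [and_true, Finset.prod_mul_distrib]
    have e : ∑ v : (i : Fin r) → W i,
        ∏ i, (if β i (truncate (i.val + 1) f) = (g i, v i) then (1 : ℝ) else 0) =
        if (fun i => (κ i (truncate (i.val + 1) f)).1.1) = g then 1 else 0 := by
      rw [Finset.sum_eq_single (fun i => (κ i (truncate (i.val + 1) f)).1.2)]
      · split_ifs with h
        · refine Finset.prod_eq_one fun i _ => if_pos ?_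
          rw [← h]
        · obtain ⟨i, hi⟩ := Function.ne_iff.1 h
          refine Finset.prod_eq_zero (Finset.mem_univ i) (if_neg fun h' => hi ?_)
          rw [hβ] at h'
          simp only at h'
          rw [h']
      · intro v _ hv
        obtain ⟨i, hi⟩ := Function.ne_iff.1 hv
        refine Finset.prod_eq_zero (Finset.mem_univ i) (if_neg fun h' => hi ?_)
        rw [hβ] at h'
        simp only at h'
        rw [h']
      · simp
    rw [← e]
    simp only [mul_assoc, ← Finset.mul_sum, ← Finset.sum_mul]
    ring
  set V := ∑ g : (i : Fin r) → G i, ∑ z, |law P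
          (fun w => ((fun i => (κ i (truncate (i.val + 1) w.1)).1.1 : (i : Fin r) → G i), w.2))
            (g, z) - law P (fun w => w.2) z / NG| with hV
  have h3 : ∑ x, ∑ y, ∑ g, |q x * ∑ v, Pb x y g v - law P (fun w => w.2) (x, y) / NG| = V := by
    rw [hV, Finset.sum_comm (s := (Finset.univ : Finset ((i : Fin r) → G i))),
      Fintype.sum_prod_type]
    simp only [hlaw]
  -- Triangle inequality along `Rb`, `Qb`, `Pb` and the product of the target with a uniform shared
  -- index; the bound on the mean over the shared index is then attained by some value of it.
  have havg : 𝔼 g : (i : Fin r) → G i,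
      ∑ x, ∑ y, |(∑ v, q x * Rb x y g v) / NW - law P (fun w => w.2) (x, y)| ≤
        2 * SW + 3 * U + V := by
    rw [Fintype.expect_eq_sum_div_card, ← hNG, Finset.sum_div]
    have e : ∀ g, (∑ x, ∑ y, |(∑ v, q x * Rb x y g v) / NW - law P (fun w => w.2) (x, y)|) / NG ≤
        ∑ x, ∑ y, ((∑ v, q x * |Rb x y g v - Qb x y g v| / (NG * NW)) +
          (∑ v, q x * |Qb x y g v / (NG * NW) - Pb x y g v|) +
          |q x * ∑ v, Pb x y g v - law P (fun w => w.2) (x, y) / NG|) := by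
      intro g
      simp only [Finset.sum_div]
      refine Finset.sum_le_sum fun x _ => Finset.sum_le_sum fun y _ => ?_
      have hsplit : ((∑ v, q x * Rb x y g v / NW) - law P (fun w => w.2) (x, y)) / NG =
          (∑ v, q x * (Rb x y g v - Qb x y g v) / (NG * NW)) +
          (∑ v, q x * (Qb x y g v / (NG * NW) - Pb x y g v)) +
          (q x * ∑ v, Pb x y g v - law P (fun w => w.2) (x, y) / NG) := by
        have e1 : (∑ v, q x * Rb x y g v / NW) / NG = ∑ v, q x * Rb x y g v / (NG * NW) := by
          rw [Finset.sum_div]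
          exact Finset.sum_congr rfl fun v _ => by rw [div_div, mul_comm NW]
        rw [sub_div, e1, Finset.mul_sum, ← Finset.sum_add_distrib, ← add_sub_assoc,
          ← Finset.sum_add_distrib]
        congr 1
        refine Finset.sum_congr rfl fun v _ => ?_
        ring
      rw [← abs_of_pos hNG0, ← abs_div, abs_of_pos hNG0, hsplit]
      refine (abs_add_le _ _).trans (add_le_add ((abs_add_le _ _).trans (add_le_add ?_ ?_)) le_rfl)
      · refine (Finset.abs_sum_le_sum_abs _ _).trans (Finset.sum_le_sum fun v _ => le_of_eq ?_)
        rw [abs_div, abs_mul, abs_of_nonneg (hq0 x), abs_of_pos (mul_pos hNG0 hNW0)]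
      · refine (Finset.abs_sum_le_sum_abs _ _).trans (Finset.sum_le_sum fun v _ => le_of_eq ?_)
        rw [abs_mul, abs_of_nonneg (hq0 x)]
    refine (Finset.sum_le_sum fun g _ => e g).trans ?_
    have hc : ∀ F : ((i : Fin r) → G i) → X → Y → ℝ,
        ∑ g, ∑ x, ∑ y, F g x y = ∑ x, ∑ y, ∑ g, F g x y := by
      intro F
      rw [Finset.sum_comm]
      exact Finset.sum_congr rfl fun x _ => Finset.sum_comm
    rw [hc]
    simp only [Finset.sum_add_distrib]
    rw [h3]
    linarith
  obtain ⟨g, -, hg⟩ := Finset.exists_le_of_expect_le Finset.univ_nonempty havg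
  exact ⟨g, hg⟩

end OneShot

/-! ### Tails of conditional probabilities. -/

section Tails

variable {Ω α ζ : Type*} [Fintype Ω]

/-- The probability that the conditional probability of `A` given `Z` exceeds `θ`. -/
noncomputable def upperTail (p : Ω → ℝ) (A : Ω → α) (Z : Ω → ζ) (θ : ℝ) : ℝ :=
  ∑ w, p w * if θ * law p Z (Z w) < law p (fun w => (A w, Z w)) (A w, Z w) then 1 else 0

/-- The probability that the conditional probability of `A` given `Z` is less than `θ`. -/
noncomputable def lowerTail (p : Ω → ℝ) (A : Ω → α) (Z : Ω → ζ) (θ : ℝ) : ℝ :=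
  ∑ w, p w * if law p (fun w => (A w, Z w)) (A w, Z w) < θ * law p Z (Z w) then 1 else 0

end Tails

/-! ### Choosing the binnings round by round. -/

section Bins

open scoped BigOperators

variable {r : ℕ} {φ G W M : Fin r → Type*} [∀ i, Fintype (φ i)] [∀ i, Nonempty (φ i)]
  [∀ i, Fintype (G i)] [∀ i, Nonempty (G i)] [∀ i, Fintype (W i)] [∀ i, Nonempty (W i)]
  [∀ i, Fintype (M i)] [∀ i, Nonempty (M i)]
  {S X Y ζ : Type*} [Fintype S] [Fintype X] [Fintype Y] [Fintype ζ]

/-- The distance from uniformity of the shared bin index of round `i`, given those of the preceding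
rounds and the remaining variables. -/
noncomputable def sharedBias (P : ((i : Fin r) → φ i) × ζ → ℝ)
    (Γ : ((i : Fin r) → φ i) → (i : Fin r) → G i) (i : Fin r)
    (γ : ((i : Fin r) → φ i) → G i) : ℝ :=
  ∑ b, ∑ z, |law P (fun w => (γ (truncate (i.val + 1) w.1), truncate i.val (Γ w.1), w.2)) (b, z) -
    law P (fun w => (truncate i.val (Γ w.1), w.2)) z / Fintype.card (G i)|

/-- The shared bin indices are nearly uniform if each of them is so given the preceding ones. -/
lemma sum_abs_shared_le (P : ((i : Fin r) → φ i) × ζ → ℝ)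
    (γ : (i : Fin r) → ((i : Fin r) → φ i) → G i) :
    ∑ g : (i : Fin r) → G i, ∑ z,
      |law P (fun w => ((fun i => γ i (truncate (i.val + 1) w.1) : (i : Fin r) → G i), w.2)) (g, z) -
        law P (fun w => w.2) z / Fintype.card ((i : Fin r) → G i)| ≤
      ∑ i, sharedBias P (fun f i => γ i (truncate (i.val + 1) f)) i (γ i) := by
  set Γ : ((i : Fin r) → φ i) → (i : Fin r) → G i := fun f i => γ i (truncate (i.val + 1) f) with hΓ
  -- The shared indices are replaced by independent uniform ones one round at a time. Only tuples
  -- that are their own prefix are summed over, so that every prefix is counted once.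
  have key : ∀ s ≤ r, ∑ t with truncate s t = t, ∑ z,
      |law P (fun w => (truncate s (Γ w.1), w.2)) (t, z) -
        law P (fun w => w.2) z * ∏ i : Fin r with i.val < s, (1 / (Fintype.card (G i) : ℝ))| ≤
      ∑ i : Fin r with i.val < s, sharedBias P Γ i (γ i) := by
    intro s
    induction s with
    | zero =>
      intro _
      simp only [Nat.not_lt_zero, Finset.filter_false, Finset.prod_empty, Finset.sum_empty, mul_one]
      refine le_of_eq (Finset.sum_eq_zero fun t ht => Finset.sum_eq_zero fun z _ => ?_)
      have h0 : ∀ g : (i : Fin r) → G i, truncate 0 g = t := fun g => by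
        rw [← (Finset.mem_filter.1 ht).2]
        exact truncate_congr fun j hj => absurd hj (Nat.not_lt_zero _)
      rw [abs_eq_zero, sub_eq_zero]
      simp only [law, Prod.mk.injEq, h0, true_and]
    | succ s ih =>
      intro hs
      have ih := ih (by omega)
      set i : Fin r := ⟨s, hs⟩ with hi
      have hc : (0 : ℝ) < Fintype.card (G i) := by exact_mod_cast Fintype.card_pos
      set π : ℝ := ∏ j : Fin r with j.val < s, (1 / (Fintype.card (G j) : ℝ)) with hπ
      have hprod : ∏ j : Fin r with j.val < s + 1, (1 / (Fintype.card (G j) : ℝ)) =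
          π * (1 / (Fintype.card (G i) : ℝ)) :=
        prod_filter_lt_succ i fun j => 1 / (Fintype.card (G j) : ℝ)
      have hsum : ∑ l : Fin r with l.val < s + 1, sharedBias P Γ l (γ l) =
          sharedBias P Γ i (γ i) + ∑ l : Fin r with l.val < s, sharedBias P Γ l (γ l) := by
        have : (Finset.univ.filter fun j : Fin r => j.val < s + 1) =
            insert i (Finset.univ.filter fun j : Fin r => j.val < s) := by
          ext j
          simp only [Finset.mem_filter, Finset.mem_univ, true_and, Finset.mem_insert, Fin.ext_iff,
            hi]
          omega
        rw [this, Finset.sum_insert (by simp [hi])]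
      set L3 : G i → ((i : Fin r) → G i) → ζ → ℝ := fun b t z =>
        law P (fun w => (γ i (truncate (i.val + 1) w.1), truncate i.val (Γ w.1), w.2)) (b, t, z)
        with hL3
      set H : G i × ((i : Fin r) → G i) → ℝ := fun x => ∑ z,
        |L3 x.1 x.2 z - law P (fun w => w.2) z * (π * (1 / (Fintype.card (G i) : ℝ)))| with hH
      have hH0 : ∀ x, 0 ≤ H x := fun x => Finset.sum_nonneg fun z _ => abs_nonneg _
      have hlaw : ∀ t : (i : Fin r) → G i, truncate (s + 1) t = t → ∀ z,
          law P (fun w => (truncate (s + 1) (Γ w.1), w.2)) (t, z) = L3 (t i) (truncate s t) z := by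
        intro t ht z
        simp only [hL3, law, Prod.mk.injEq]
        refine Finset.sum_congr rfl fun w _ => ?_
        have : truncate (s + 1) (Γ w.1) = t ↔
            γ i (truncate (i.val + 1) w.1) = t i ∧ truncate i.val (Γ w.1) = truncate s t := by
          nth_rewrite 1 [← ht]
          rw [truncate_eq_iff, truncate_eq_iff]
          constructor
          · intro h
            exact ⟨h i (Nat.lt_succ_self s), fun j hj => h j (hj.trans (Nat.lt_succ_self s))⟩
          · rintro ⟨h1, h2⟩ j hj
            rcases Nat.lt_succ_iff_lt_or_eq.1 hj with h | h
            · exact h2 j h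
            · have : j = i := Fin.ext h
              subst this
              exact h1
        simp only [this, and_assoc]
      have hinj : Set.InjOn (fun t : (i : Fin r) → G i => (t i, truncate s t))
          (Finset.univ.filter fun t : (i : Fin r) → G i => truncate (s + 1) t = t) := by
        intro t ht t' ht' h
        simp only [Finset.coe_filter, Finset.mem_univ, true_and, Set.mem_ofPred_eq] at ht ht'
        rw [Prod.mk.injEq, truncate_eq_iff] at h
        rw [← ht, ← ht', truncate_eq_iff]
        intro j hj
        rcases Nat.lt_succ_iff_lt_or_eq.1 hj with h' | h'
        · exact h.2 j h'
        · have : j = i := Fin.ext h'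
          subst this
          exact h.1
      rw [hprod, hsum]
      calc ∑ t with truncate (s + 1) t = t, ∑ z,
            |law P (fun w => (truncate (s + 1) (Γ w.1), w.2)) (t, z) -
              law P (fun w => w.2) z * (π * (1 / (Fintype.card (G i) : ℝ)))|
          = ∑ t with truncate (s + 1) t = t, H (t i, truncate s t) := by
            refine Finset.sum_congr rfl fun t ht => Finset.sum_congr rfl fun z _ => ?_
            rw [hlaw t (Finset.mem_filter.1 ht).2]
        _ ≤ ∑ b, ∑ t with truncate s t = t, H (b, t) := by
            rw [← Finset.sum_image (f := H) hinj,
              ← Finset.sum_product' (f := fun b t => H (b, t))]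
            refine Finset.sum_le_sum_of_subset_of_nonneg ?_ fun x _ _ => hH0 x
            intro x hx
            simp only [Finset.mem_image, Finset.mem_filter, Finset.mem_univ, true_and] at hx
            obtain ⟨t, -, rfl⟩ := hx
            simp [truncate_truncate le_rfl]
        _ ≤ ∑ b, ∑ t with truncate s t = t, ((∑ z, |L3 b t z -
              law P (fun w => (truncate i.val (Γ w.1), w.2)) (t, z) / Fintype.card (G i)|) +
              (∑ z, |law P (fun w => (truncate s (Γ w.1), w.2)) (t, z) -
                law P (fun w => w.2) z * π|) / Fintype.card (G i)) := by
            refine Finset.sum_le_sum fun b _ => Finset.sum_le_sum fun t _ => ?_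
            rw [Finset.sum_div, ← Finset.sum_add_distrib]
            refine Finset.sum_le_sum fun z _ => ?_
            nth_rewrite 3 [← abs_of_pos hc]
            rw [← abs_div]
            refine le_trans (le_of_eq ?_) (abs_add_le _ _)
            congr 1
            field_simp
            ring
        _ = (∑ b, ∑ t with truncate s t = t, ∑ z, |L3 b t z -
              law P (fun w => (truncate i.val (Γ w.1), w.2)) (t, z) / Fintype.card (G i)|) +
              ∑ t with truncate s t = t, ∑ z,
              |law P (fun w => (truncate s (Γ w.1), w.2)) (t, z) -
                law P (fun w => w.2) z * π| := by
            simp only [Finset.sum_add_distrib, ← Finset.sum_div, Finset.sum_const,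
              Finset.card_univ, nsmul_eq_mul]
            congr 1
            exact mul_div_cancel_left₀ _ hc.ne'
        _ ≤ _ := by
            refine add_le_add ?_ ih
            refine Finset.sum_le_sum fun b _ => ?_
            rw [Fintype.sum_prod_type]
            exact Finset.sum_le_univ_sum_of_nonneg fun t => Finset.sum_nonneg fun z _ => abs_nonneg _
  have := key r le_rfl
  have hall : ∀ i : Fin r, i.val < r := fun i => i.2
  simp only [truncate_of_le le_rfl, Finset.filter_true, hall] at this
  refine le_trans (le_of_eq ?_) this
  refine Finset.sum_congr rfl fun g _ => Finset.sum_congr rfl fun z _ => ?_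
  rw [Fintype.card_pi, Nat.cast_prod, Finset.prod_div_distrib, Finset.prod_const_one, mul_one_div]

/-- The bound on the mean error of a random binning of round `i`. -/
noncomputable def binningBound (P : ((i : Fin r) → φ i) × X × Y → ℝ) (s₁ s₂ : X → S)
    (G W M : Fin r → Type*) [∀ i, Fintype (G i)] [∀ i, Fintype (W i)] [∀ i, Fintype (M i)]
    (θ θ₁ θ₂ θ' : Fin r → ℝ) (i : Fin r) : ℝ :=
  (2 * upperTail P (fun w => truncate (i.val + 1) w.1) (fun w => (truncate i.val w.1, w.2.1))
      (θ i) + √(Fintype.card (G i × W i) * θ i)) +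
  (lowerTail P (fun w => truncate (i.val + 1) w.1) (fun w => (truncate i.val w.1, s₁ w.2.1))
      (θ₁ i) + 1 / (θ₁ i * Fintype.card ((G i × W i) × M i))) +
  (lowerTail P (fun w => truncate (i.val + 1) w.1) (fun w => (truncate i.val w.1, s₂ w.2.1))
      (θ₂ i) + 1 / (θ₂ i * Fintype.card ((G i × W i) × M i))) +
  (2 * upperTail P (fun w => truncate (i.val + 1) w.1) (fun w => w.2) (θ' i) +
    √(Fintype.card (G i) * (θ' i * ∏ j : Fin r with j.val < i.val, (Fintype.card (G j) : ℝ))))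

variable {P : ((i : Fin r) → φ i) × X × Y → ℝ} (hP : ∀ w, 0 ≤ P w) (hP1 : ∑ w, P w = 1)
  {s₁ s₂ : X → S} (hs : ∀ x x', s₁ x ≠ s₂ x') {θ θ₁ θ₂ θ' : Fin r → ℝ}
  (hθ : ∀ i, 0 < θ i) (hθ₁ : ∀ i, 0 < θ₁ i) (hθ₂ : ∀ i, 0 < θ₂ i) (hθ' : ∀ i, 0 < θ' i)

include hP hP1 hs hθ hθ₁ hθ₂ hθ'

/-- A single round has a good binning, whatever the binnings of the preceding rounds. -/
lemma exists_bin (i : Fin r) (Γ : ((i : Fin r) → φ i) → (i : Fin r) → G i)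
    (hΓ : ∀ f f', truncate (i.val + 1) f = truncate (i.val + 1) f' →
      truncate i.val (Γ f) = truncate i.val (Γ f')) :
    ∃ (κ : ((i : Fin r) → φ i) → (G i × W i) × M i)
      (D : ((i : Fin r) → φ i) → S → (G i × W i) × M i → (i : Fin r) → φ i),
      binBias P (fun f => (κ f).1) i + decodeError P s₁ κ i D + decodeError P s₂ κ i D +
        sharedBias P Γ i (fun f => (κ f).1.1) ≤ binningBound P s₁ s₂ G W M θ θ₁ θ₂ θ' i := by
  set A : ((i : Fin r) → φ i) × X × Y → ((i : Fin r) → φ i) :=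
    fun w => truncate (i.val + 1) w.1 with hA
  have hU := expect_bin_uniform_le (β := G i × W i) hP hP1.le A
    (fun w => (truncate i.val w.1, w.2.1))
    (h := fun z => θ i * law P (fun w => (truncate i.val w.1, w.2.1)) z)
    (fun z => mul_nonneg (hθ i).le (law_nonneg hP _ _))
  rw [← Finset.mul_sum, sum_law, hP1, mul_one] at hU
  -- Here the condition also contains the preceding shared indices. The threshold depends on the law
  -- of inputs and outputs alone and is supported on prefixes, so its total is `θ'` times the number
  -- of preceding index tuples.
  have hV := expect_bin_uniform_le (β := G i) hP hP1.le A
    (fun w => (truncate i.val (Γ w.1), w.2))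
    (h := fun z => if truncate i.val z.1 = z.1 then θ' i * law P (fun w => w.2) z.2 else 0)
    (fun z => by
      split_ifs
      · exact mul_nonneg (hθ' i).le (law_nonneg hP _ _)
      · exact le_rfl)
  have hVsum : ∑ z : ((i : Fin r) → G i) × X × Y,
      (if truncate i.val z.1 = z.1 then θ' i * law P (fun w => w.2) z.2 else 0) =
      θ' i * ∏ j : Fin r with j.val < i.val, (Fintype.card (G j) : ℝ) := by
    rw [Fintype.sum_prod_type]
    have : ∀ t : (i : Fin r) → G i, ∑ y, (if truncate i.val t = t then
        θ' i * law P (fun w => w.2) y else 0) = if truncate i.val t = t then θ' i else 0 := by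
      intro t
      split_ifs
      · rw [← Finset.mul_sum, sum_law, hP1, mul_one]
      · simp
    simp only [this]
    rw [← Finset.sum_filter, Finset.sum_const, card_truncate_fixed, nsmul_eq_mul, Nat.cast_prod,
      mul_comm]
  have hVtail : ∑ w, P w * (if (if truncate i.val (truncate i.val (Γ w.1)) =
        truncate i.val (Γ w.1) then θ' i * law P (fun w => w.2) w.2 else 0) <
        law P (fun w => (A w, truncate i.val (Γ w.1), w.2)) (A w, truncate i.val (Γ w.1), w.2)
        then 1 else 0) = upperTail P A (fun w => w.2) (θ' i) := by
    -- The preceding shared indices are functions of the symbols in `A`, so they can be dropped from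
    -- the joint law.
    refine Finset.sum_congr rfl fun w _ => ?_
    rw [truncate_truncate le_rfl, if_pos rfl,
      law_congr_ker P (A := fun w => (A w, truncate i.val (Γ w.1), w.2)) (B := fun w => (A w, w.2))
        (w := w)]
    intro w'
    simp only [Prod.mk.injEq]
    exact ⟨fun h => ⟨h.1, h.2.2⟩, fun h => ⟨h.1, hΓ _ _ h.1, h.2⟩⟩
  simp only at hV
  rw [hVsum, hVtail] at hV
  obtain ⟨D₁, hD₁⟩ := exists_decoder (K := (G i × W i) × M i) hP hP1.le A
    (fun w => (truncate i.val w.1, s₁ w.2.1)) (hθ₁ i)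
  obtain ⟨D₂, hD₂⟩ := exists_decoder (K := (G i × W i) × M i) hP hP1.le A
    (fun w => (truncate i.val w.1, s₂ w.2.1)) (hθ₂ i)
  -- The two kinds of side information have disjoint ranges, so one decoder can tell which terminal
  -- it serves.
  set D : (((i : Fin r) → φ i) → (G i × W i) × M i) → ((i : Fin r) → φ i) → S →
      (G i × W i) × M i → (i : Fin r) → φ i :=
    fun κ t s b => if ∃ x, s = s₁ x then D₁ κ (t, s) b else D₂ κ (t, s) b with hD
  have d₁ : ∀ κ t x b, D κ t (s₁ x) b = D₁ κ (t, s₁ x) b := fun κ t x b => if_pos ⟨x, rfl⟩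
  have d₂ : ∀ κ t x b, D κ t (s₂ x) b = D₂ κ (t, s₂ x) b := fun κ t x b =>
    if_neg fun ⟨x', hx⟩ => hs x' x hx.symm
  have hD₁' : 𝔼 κ, decodeError P s₁ κ i (D κ) ≤
      lowerTail P A (fun w => (truncate i.val w.1, s₁ w.2.1)) (θ₁ i) +
        1 / (θ₁ i * Fintype.card ((G i × W i) × M i)) := by
    simp only [decodeError, d₁]
    exact hD₁
  have hD₂' : 𝔼 κ, decodeError P s₂ κ i (D κ) ≤
      lowerTail P A (fun w => (truncate i.val w.1, s₂ w.2.1)) (θ₂ i) +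
        1 / (θ₂ i * Fintype.card ((G i × W i) × M i)) := by
    simp only [decodeError, d₂]
    exact hD₂
  have hU' : 𝔼 κ : ((i : Fin r) → φ i) → (G i × W i) × M i, binBias P (fun f => (κ f).1) i ≤
      2 * upperTail P A (fun w => (truncate i.val w.1, w.2.1)) (θ i) +
        √(Fintype.card (G i × W i) * θ i) := by
    rw [expect_fst_comp fun κ => binBias P κ i]
    exact hU
  have hV' : 𝔼 κ : ((i : Fin r) → φ i) → (G i × W i) × M i,
      sharedBias P Γ i (fun f => (κ f).1.1) ≤
      2 * upperTail P A (fun w => w.2) (θ' i) + √(Fintype.card (G i) *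
        (θ' i * ∏ j : Fin r with j.val < i.val, (Fintype.card (G j) : ℝ))) := by
    rw [expect_fst_comp (K := G i × W i) fun κ => sharedBias P Γ i fun f => (κ f).1,
      expect_fst_comp fun κ => sharedBias P Γ i κ]
    exact hV
  have havg : 𝔼 κ : ((i : Fin r) → φ i) → (G i × W i) × M i,
      (binBias P (fun f => (κ f).1) i + decodeError P s₁ κ i (D κ) + decodeError P s₂ κ i (D κ) +
        sharedBias P Γ i (fun f => (κ f).1.1)) ≤ binningBound P s₁ s₂ G W M θ θ₁ θ₂ θ' i := by
    rw [Finset.expect_add_distrib, Finset.expect_add_distrib, Finset.expect_add_distrib]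
    exact add_le_add (add_le_add (add_le_add hU' hD₁') hD₂') hV'
  obtain ⟨κ, -, hκ⟩ := Finset.exists_le_of_expect_le Finset.univ_nonempty havg
  exact ⟨κ, D κ, hκ⟩

/-- All rounds have good binnings simultaneously. -/
lemma exists_bins :
    ∃ (κ : (i : Fin r) → ((i : Fin r) → φ i) → (G i × W i) × M i)
      (D : (i : Fin r) → ((i : Fin r) → φ i) → S → (G i × W i) × M i → (i : Fin r) → φ i),
      ∀ i, binBias P (fun f => (κ i f).1) i + decodeError P s₁ (κ i) i (D i) +
        decodeError P s₂ (κ i) i (D i) +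
        sharedBias P (fun f j => (κ j (truncate (j.val + 1) f)).1.1) i (fun f => (κ i f).1.1) ≤
          binningBound P s₁ s₂ G W M θ θ₁ θ₂ θ' i := by
  -- The binnings are fixed in increasing order, because the shared bias of a round depends on the
  -- preceding ones. Fixing one more round leaves the earlier bounds intact.
  have key : ∀ s ≤ r, ∃ (κ : (i : Fin r) → ((i : Fin r) → φ i) → (G i × W i) × M i)
      (D : (i : Fin r) → ((i : Fin r) → φ i) → S → (G i × W i) × M i → (i : Fin r) → φ i),
      ∀ i, i.val < s → binBias P (fun f => (κ i f).1) i + decodeError P s₁ (κ i) i (D i) +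
        decodeError P s₂ (κ i) i (D i) +
        sharedBias P (fun f j => (κ j (truncate (j.val + 1) f)).1.1) i (fun f => (κ i f).1.1) ≤
          binningBound P s₁ s₂ G W M θ θ₁ θ₂ θ' i := by
    intro s
    induction s with
    | zero =>
      intro _
      exact ⟨fun _ _ => Classical.arbitrary _, fun _ f _ _ => f,
        fun i hi => absurd hi (Nat.not_lt_zero _)⟩
    | succ s ih =>
      intro hs'
      obtain ⟨κ, D, h⟩ := ih (by omega)
      set i : Fin r := ⟨s, hs'⟩ with hi
      obtain ⟨κ', D', h'⟩ := exists_bin (W := W) (M := M) hP hP1 hs hθ hθ₁ hθ₂ hθ' i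
        (fun f j => (κ j (truncate (j.val + 1) f)).1.1) (fun f f' hff =>
          truncate_congr fun j hj => by
            rw [truncate_eq_iff] at hff
            rw [truncate_congr fun l hl => hff l (by omega)])
      have hsh : ∀ l : Fin r, l.val < s + 1 → ∀ γ,
          sharedBias P (fun f j => (Function.update κ i κ' j (truncate (j.val + 1) f)).1.1) l γ =
          sharedBias P (fun f j => (κ j (truncate (j.val + 1) f)).1.1) l γ := by
        intro l hl γ
        have : ∀ f : (i : Fin r) → φ i,
            truncate l.val (fun j => (Function.update κ i κ' j (truncate (j.val + 1) f)).1.1) =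
            truncate l.val (fun j => (κ j (truncate (j.val + 1) f)).1.1) := fun f =>
          truncate_congr fun j hj => by
            rw [Function.update_of_ne]
            rintro rfl
            simp only [hi] at hj
            omega
        simp only [sharedBias, this]
      refine ⟨Function.update κ i κ', Function.update D i D', fun l hl => ?_⟩
      rw [hsh l hl]
      by_cases hli : l = i
      · subst hli
        simpa using h'
      · simp only [Function.update_of_ne hli]
        refine h l ?_
        have : l.val ≠ s := fun h => hli (Fin.ext h)
        omega
  obtain ⟨κ, D, h⟩ := key r le_rfl
  exact ⟨κ, D, fun i => h i i.2⟩

end Bins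

/-! ### One-shot simulation. -/

section OneShot

variable {r : ℕ} {φ G W M : Fin r → Type*} [∀ i, Fintype (φ i)] [∀ i, Nonempty (φ i)]
  [∀ i, Fintype (G i)] [∀ i, Nonempty (G i)] [∀ i, Fintype (W i)] [∀ i, Nonempty (W i)]
  [∀ i, Fintype (M i)] [∀ i, Nonempty (M i)]
  {S X Y : Type*} [Fintype S] [Fintype X] [Fintype Y] {k : Fin r → ((i : Fin r) → φ i) → S → ℝ}

/-- One-shot simulation: for given bin alphabets `G`, `W`, `M`, with common randomness in the tuples
over `W` and messages in `M`, the output distribution is simulated up to a multiple of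
`binningBound`. -/
theorem exists_oneShot {q : X → ℝ} (hq0 : ∀ x, 0 ≤ q x) (hq1 : ∑ x, q x = 1)
    (hk : ∀ σ : Fin r → S, IsKernel fun i f => k i f (σ i))
    {own : Fin r → X → S} {s₁ s₂ : X → S} (hown : ∀ i x, own i x = s₁ x ∨ own i x = s₂ x)
    (hs : ∀ x x', s₁ x ≠ s₂ x')
    {d : ((i : Fin r) → φ i) → ((i : Fin r) → φ i) → X → Y → ℝ}
    (hd0 : ∀ f f' x y, 0 ≤ d f f' x y) (hd : ∀ f f' x, ∑ y, d f f' x y = 1)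
    {θ θ₁ θ₂ θ' : Fin r → ℝ} (hθ : ∀ i, 0 < θ i) (hθ₁ : ∀ i, 0 < θ₁ i) (hθ₂ : ∀ i, 0 < θ₂ i)
    (hθ' : ∀ i, 0 < θ' i) :
    ∃ (E : (i : Fin r) → ((j : Fin r) → M j) → S → ((j : Fin r) → W j) → M i → ℝ)
      (F : ((j : Fin r) → M j) → S → ((j : Fin r) → W j) → (j : Fin r) → φ j),
      (∀ i c s v m, 0 ≤ E i c s v m) ∧ (∀ i c s v, ∑ m, E i c s v m = 1) ∧
      (∀ i c c' s v, (∀ j < i, c j = c' j) → E i c s v = E i c' s v) ∧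
      ∑ x, ∑ y, |(∑ v, q x * ∑ c, (∏ i, E i c (own i x) v (c i)) *
          d (F c (s₁ x) v) (F c (s₂ x) v) x y) / Fintype.card ((i : Fin r) → W i) -
        law (seqJoint q k own fun f => d f f) (fun w => w.2) (x, y)| ≤
      3 * ∑ i, binningBound (seqJoint q k own fun f => d f f) s₁ s₂ G W M θ θ₁ θ₂ θ' i := by
  have hP := seqJoint_nonneg (own := own) (d := fun f => d f f) hq0 hk fun f x y => hd0 f f x y
  have hP1 := sum_seqJoint (own := own) (d := fun f => d f f) hq1 hk fun f x => hd f f x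
  obtain ⟨κ, D, hκ⟩ := exists_bins (G := G) (W := W) (M := M) hP hP1 hs hθ hθ₁ hθ₂ hθ'
  obtain ⟨g, hg⟩ := exists_shared_bins hq0 hk hown hd0 hd κ D
  refine ⟨fun i c s v => msgKernel k (fun i f => (κ i f).1) (fun i f => (κ i f).2) D i
      (fun j => (g j, v j)) c s, fun c s v => decodeSeq D (fun j => (g j, v j)) c s r,
    fun i c s v m => msgKernel_nonneg hk _ _ D i _ c s m,
    fun i c s v => sum_msgKernel hk _ _ D i _ c s,
    fun i c c' s v h => msgKernel_congr _ _ D i _ h s, hg.trans ?_⟩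
  have hV := sum_abs_shared_le (seqJoint q k own fun f => d f f) fun i f => (κ i f).1.1
  refine (add_le_add le_rfl hV).trans ?_
  rw [← Finset.sum_congr rfl fun i _ => rfl, Finset.mul_sum, Finset.mul_sum, Finset.mul_sum,
    ← Finset.sum_add_distrib, ← Finset.sum_add_distrib]
  refine Finset.sum_le_sum fun i _ => ?_
  -- The weights 2, 3 and 1 of decoding errors, bin biases and shared biases are all rounded up to
  -- 3.
  have h1 := hκ i
  have h2 : ∀ s, 0 ≤ decodeError (seqJoint q k own fun f => d f f) s (κ i) i (D i) := fun s =>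
    Finset.sum_nonneg fun w _ => mul_nonneg (hP w) (by split_ifs <;> simp)
  have h3 : 0 ≤ sharedBias (seqJoint q k own fun f => d f f)
      (fun f j => (κ j (truncate (j.val + 1) f)).1.1) i (fun f => (κ i f).1.1) :=
    Finset.sum_nonneg fun b _ => Finset.sum_nonneg fun z _ => abs_nonneg _
  have h4 := h2 s₁
  have h5 := h2 s₂
  linarith

end OneShot

/-! ### Exponential deviation bounds for i.i.d. letters. -/

section Chernoff

variable {Ω α ζ : Type*} [Fintype Ω] [Fintype α] [Fintype ζ]

/-- An exponential bound for the deviation of a sum of i.i.d. centred variables. -/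
lemma exists_iid_deviation_le {p : Ω → ℝ} (hp : p ∈ stdSimplex ℝ Ω) (ψ : Ω → ℝ)
    (hψ : ∑ w, p w * ψ w = 0) {ε : ℝ} (hε : 0 < ε) :
    ∃ ρ : ℝ, 0 ≤ ρ ∧ ρ < 1 ∧ ∀ n : ℕ, ∑ ω : Fin n → Ω, (∏ t, p (ω t)) *
      (if n * ε ≤ ∑ t, ψ (ω t) then 1 else 0) ≤ ρ ^ n := by
  set K : ℝ := ε + ∑ w, |ψ w| with hK
  have hs : 0 ≤ ∑ w, |ψ w| := Finset.sum_nonneg fun w _ => abs_nonneg _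
  have hKpos : 0 < K := by linarith
  have hψK : ∀ w, |ψ w - ε| ≤ K := fun w => by
    have := Finset.single_le_sum (f := fun w => |ψ w|) (fun w _ => abs_nonneg _) (Finset.mem_univ w)
    have h2 := abs_sub (ψ w) ε
    rw [abs_of_pos hε] at h2
    linarith
  -- From `exp x ≤ 1 + x + x ^ 2` for `|x| ≤ 1` the moment generating function is at most `1 - l * ε
  -- + l ^ 2 * K ^ 2`; this `l` is the minimizer.
  set l : ℝ := ε / (2 * K ^ 2) with hl
  have hlpos : 0 < l := by positivity
  have hlK : l * K ≤ 1 := by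
    rw [hl, div_mul_eq_mul_div, div_le_one (by positivity)]
    nlinarith
  set ρ := ∑ w, p w * Real.exp (l * (ψ w - ε)) with hρ
  refine ⟨ρ, Finset.sum_nonneg fun w _ => mul_nonneg (hp.1 w) (Real.exp_nonneg _), ?_, ?_⟩
  · have hexp : ∀ w, Real.exp (l * (ψ w - ε)) ≤ 1 + l * (ψ w - ε) + l ^ 2 * K ^ 2 := by
      intro w
      have h1 : |l * (ψ w - ε)| ≤ l * K := by
        rw [abs_mul, abs_of_pos hlpos]
        exact mul_le_mul_of_nonneg_left (hψK w) hlpos.le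
      have h2 := (abs_le.1 (Real.abs_exp_sub_one_sub_id_le (h1.trans hlK))).2
      have h3 : (l * (ψ w - ε)) ^ 2 ≤ (l * K) ^ 2 := by
        rw [← sq_abs]
        exact pow_le_pow_left₀ (abs_nonneg _) h1 2
      nlinarith
    have hle : ρ ≤ ∑ w, p w * (1 + l * (ψ w - ε) + l ^ 2 * K ^ 2) :=
      Finset.sum_le_sum fun w _ => mul_le_mul_of_nonneg_left (hexp w) (hp.1 w)
    have heq : ∑ w, p w * (1 + l * (ψ w - ε) + l ^ 2 * K ^ 2) = 1 - l * ε + l ^ 2 * K ^ 2 := by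
      have : ∀ w, p w * (1 + l * (ψ w - ε) + l ^ 2 * K ^ 2) =
          p w * (1 - l * ε + l ^ 2 * K ^ 2) + l * (p w * ψ w) := fun w => by ring
      simp only [this, Finset.sum_add_distrib, ← Finset.sum_mul, ← Finset.mul_sum, hp.2, hψ]
      ring
    have h4 : l * K ^ 2 = ε / 2 := by rw [hl]; field_simp
    nlinarith
  · intro n
    have : ∑ ω : Fin n → Ω, ∏ t, (p (ω t) * Real.exp (l * (ψ (ω t) - ε))) = ρ ^ n := by
      rw [sum_prod_eq_prod_sum fun _ w => p w * Real.exp (l * (ψ w - ε))]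
      simp [hρ]
    rw [← this]
    refine Finset.sum_le_sum fun ω _ => ?_
    rw [Finset.prod_mul_distrib]
    refine mul_le_mul_of_nonneg_left ?_ (Finset.prod_nonneg fun t _ => hp.1 _)
    rw [← Real.exp_sum, ← Finset.mul_sum]
    split_ifs with h
    · rw [← Real.exp_zero]
      refine Real.exp_le_exp.2 (mul_nonneg hlpos.le ?_)
      simp only [Finset.sum_sub_distrib, Finset.sum_const, Finset.card_univ, Fintype.card_fin,
        nsmul_eq_mul]
      linarith
    · exact Real.exp_nonneg _

/-- The negative logarithm of the conditional probability is a sum of i.i.d. terms with mean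
`condEntropy p A Z` in bits. Sequences of probability zero are set aside, as the logarithms are
meaningless there. -/
lemma exists_iid_upper_le {p : Ω → ℝ} (hp : p ∈ stdSimplex ℝ Ω) (A : Ω → α) (Z : Ω → ζ) {ε : ℝ}
    (hε : 0 < ε) :
    ∃ ρ : ℝ, 0 ≤ ρ ∧ ρ < 1 ∧ ∀ n : ℕ, ∑ ω : Fin n → Ω, (∏ t, p (ω t)) *
      (if (2 : ℝ) ^ (-(n * (condEntropy p A Z - ε))) * ∏ t, law p Z (Z (ω t)) <
        ∏ t, law p (fun w => (A w, Z w)) (A (ω t), Z (ω t)) then 1 else 0) ≤ ρ ^ n := by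
  set H := condEntropy p A Z with hH
  have hl2 := log_two_pos
  obtain ⟨ρ, h0, h1, h⟩ := exists_iid_deviation_le hp (fun w => H -
    (Real.log (law p Z (Z w)) - Real.log (law p (fun w => (A w, Z w)) (A w, Z w))) / Real.log 2)
    (by
      simp only [mul_sub, Finset.sum_sub_distrib, ← Finset.sum_mul, hp.2, one_mul]
      have := condEntropy_eq_sum p A Z
      simp only [mul_sub, sub_div, Finset.sum_sub_distrib] at this ⊢
      linarith) hε
  refine ⟨ρ, h0, h1, fun n => (Finset.sum_le_sum fun ω _ => ?_).trans (h n)⟩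
  rcases (Finset.prod_nonneg fun t _ => hp.1 (ω t) : 0 ≤ ∏ t, p (ω t)).eq_or_lt with h2 | h2
  · rw [← h2]; simp
  refine mul_le_mul_of_nonneg_left ?_ h2.le
  have hpos : ∀ t, 0 < p (ω t) := fun t => lt_of_le_of_ne (hp.1 _) fun h3 =>
    h2.ne' (Finset.prod_eq_zero (Finset.mem_univ t) h3.symm)
  have hz := fun t => law_self_pos hp.1 Z (hpos t)
  have haz := fun t => law_self_pos hp.1 (fun w => (A w, Z w)) (hpos t)
  by_cases hc : (2 : ℝ) ^ (-(n * (H - ε))) * ∏ t, law p Z (Z (ω t)) <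
        ∏ t, law p (fun w => (A w, Z w)) (A (ω t), Z (ω t))
  swap
  · rw [if_neg hc]; split_ifs <;> norm_num
  rw [if_pos hc, if_pos]
  have := Real.log_lt_log (mul_pos (Real.rpow_pos_of_pos two_pos _)
    (Finset.prod_pos fun t _ => hz t)) hc
  rw [Real.log_mul (Real.rpow_pos_of_pos two_pos _).ne' (Finset.prod_pos fun t _ => hz t).ne',
    Real.log_rpow two_pos, Real.log_prod (fun t _ => (hz t).ne'),
    Real.log_prod (fun t _ => (haz t).ne')] at this
  rw [Finset.sum_sub_distrib, Finset.sum_const, Finset.card_univ, Fintype.card_fin, nsmul_eq_mul,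
    ← Finset.sum_div, Finset.sum_sub_distrib, le_sub_comm, div_le_iff₀ hl2]
  nlinarith

lemma exists_iid_lower_le {p : Ω → ℝ} (hp : p ∈ stdSimplex ℝ Ω) (A : Ω → α) (Z : Ω → ζ) {ε : ℝ}
    (hε : 0 < ε) :
    ∃ ρ : ℝ, 0 ≤ ρ ∧ ρ < 1 ∧ ∀ n : ℕ, ∑ ω : Fin n → Ω, (∏ t, p (ω t)) *
      (if ∏ t, law p (fun w => (A w, Z w)) (A (ω t), Z (ω t)) <
        (2 : ℝ) ^ (-(n * (condEntropy p A Z + ε))) * ∏ t, law p Z (Z (ω t)) then 1 else 0)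
          ≤ ρ ^ n := by
  set H := condEntropy p A Z with hH
  have hl2 := log_two_pos
  obtain ⟨ρ, h0, h1, h⟩ := exists_iid_deviation_le hp (fun w =>
    (Real.log (law p Z (Z w)) - Real.log (law p (fun w => (A w, Z w)) (A w, Z w))) / Real.log 2 - H)
    (by
      simp only [mul_sub, Finset.sum_sub_distrib, ← Finset.sum_mul, hp.2, one_mul]
      have := condEntropy_eq_sum p A Z
      simp only [mul_sub, sub_div, Finset.sum_sub_distrib] at this ⊢
      linarith) hε
  refine ⟨ρ, h0, h1, fun n => (Finset.sum_le_sum fun ω _ => ?_).trans (h n)⟩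
  rcases (Finset.prod_nonneg fun t _ => hp.1 (ω t) : 0 ≤ ∏ t, p (ω t)).eq_or_lt with h2 | h2
  · rw [← h2]; simp
  refine mul_le_mul_of_nonneg_left ?_ h2.le
  have hpos : ∀ t, 0 < p (ω t) := fun t => lt_of_le_of_ne (hp.1 _) fun h3 =>
    h2.ne' (Finset.prod_eq_zero (Finset.mem_univ t) h3.symm)
  have hz := fun t => law_self_pos hp.1 Z (hpos t)
  have haz := fun t => law_self_pos hp.1 (fun w => (A w, Z w)) (hpos t)
  by_cases hc : ∏ t, law p (fun w => (A w, Z w)) (A (ω t), Z (ω t)) <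
      (2 : ℝ) ^ (-(n * (H + ε))) * ∏ t, law p Z (Z (ω t))
  swap
  · rw [if_neg hc]; split_ifs <;> norm_num
  rw [if_pos hc, if_pos]
  have := Real.log_lt_log (Finset.prod_pos fun t _ => haz t) hc
  rw [Real.log_mul (Real.rpow_pos_of_pos two_pos _).ne' (Finset.prod_pos fun t _ => hz t).ne',
    Real.log_rpow two_pos, Real.log_prod (fun t _ => (hz t).ne'),
    Real.log_prod (fun t _ => (haz t).ne')] at this
  rw [Finset.sum_sub_distrib, Finset.sum_const, Finset.card_univ, Fintype.card_fin, nsmul_eq_mul,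
    ← Finset.sum_div, Finset.sum_sub_distrib, le_sub_iff_add_le, le_div_iff₀ hl2]
  nlinarith

end Chernoff

/-! ### Blocks of letters with local uniform variables. -/

section Block

variable {X₁ X₂ Y₁ Y₂ : Type*} [Fintype X₁] [Fintype X₂] [Fintype Y₁] [Fintype Y₂] {r : ℕ}
  {m : Fin r → ℕ}

/-- The alphabet of the block symbols: `n` letters and a local uniform variable. -/
abbrev BlockSym (m : Fin r → ℕ) (n : ℕ) (u : Fin r → ℕ) (i : Fin r) : Type :=
  (Fin n → Fin (m i)) × Fin (u i)

/-- The sample space of a block of letters with local uniform variables. -/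
abbrev BlockSpace (X₁ X₂ Y₁ Y₂ : Type*) (m : Fin r → ℕ) (n : ℕ) (u : Fin r → ℕ) : Type _ :=
  ((i : Fin r) → BlockSym m n u i) × ((Fin n → X₁) × (Fin n → X₂)) ×
    ((Fin n → Y₁) × (Fin n → Y₂))

/-- A block is a sequence of letters together with the local uniform variables. -/
def blockEquiv (n : ℕ) (u : Fin r → ℕ) :
    (Fin n → AuxSpace X₁ X₂ Y₁ Y₂ m) × ((i : Fin r) → Fin (u i)) ≃
      BlockSpace X₁ X₂ Y₁ Y₂ m n u where
  toFun w := (fun i => (fun t => (w.1 t).1 i, w.2 i),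
    (fun t => (w.1 t).2.1, fun t => (w.1 t).2.2.1),
    (fun t => (w.1 t).2.2.2.1, fun t => (w.1 t).2.2.2.2))
  invFun w := (fun t => (fun i => (w.1 i).1 t, w.2.1.1 t, w.2.1.2 t, w.2.2.1 t, w.2.2.2 t),
    fun i => (w.1 i).2)
  left_inv _ := rfl
  right_inv _ := rfl

/-- The i.i.d. pmf of the letters, with independent uniform variables. -/
noncomputable def blockPMF (p : AuxSpace X₁ X₂ Y₁ Y₂ m → ℝ) (n : ℕ) (u : Fin r → ℕ)
    (w : BlockSpace X₁ X₂ Y₁ Y₂ m n u) : ℝ :=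
  (∏ t, p (((blockEquiv n u).symm w).1 t)) * ∏ i, (1 / (u i : ℝ))

variable (p : AuxSpace X₁ X₂ Y₁ Y₂ m → ℝ) (n : ℕ) (u : Fin r → ℕ) [∀ i, NeZero (u i)]

lemma sum_uniform_prefix (s : ℕ) (v₀ : (i : Fin r) → Fin (u i)) :
    ∑ v : (i : Fin r) → Fin (u i), (if ∀ i : Fin r, i.val < s → v i = v₀ i then
      ∏ i, (1 / (u i : ℝ)) else 0) = ∏ i : Fin r with i.val < s, (1 / (u i : ℝ)) := by
  have : ∀ v : (i : Fin r) → Fin (u i), (if ∀ i : Fin r, i.val < s → v i = v₀ i then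
      ∏ i, (1 / (u i : ℝ)) else 0) =
      ∏ i, (if i.val < s → v i = v₀ i then (1 / (u i : ℝ)) else 0) := by
    intro v
    split_ifs with h
    · exact Finset.prod_congr rfl fun i _ => by rw [if_pos (h i)]
    · push Not at h
      obtain ⟨i, hi, hne⟩ := h
      exact (Finset.prod_eq_zero (Finset.mem_univ i) (if_neg fun h' => hne (h' hi))).symm
  simp only [this]
  rw [sum_prod_eq_prod_sum fun i a => if i.val < s → a = v₀ i then (1 / (u i : ℝ)) else 0,
    Finset.prod_filter]
  refine Finset.prod_congr rfl fun i _ => ?_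
  have hu : (u i : ℝ) ≠ 0 := by exact_mod_cast NeZero.ne (u i)
  by_cases hi : i.val < s
  · simp [hi]
  · simp [hi, hu]

lemma sum_blockPMF_mul (g : (Fin n → AuxSpace X₁ X₂ Y₁ Y₂ m) → ℝ) :
    ∑ w, blockPMF p n u w * g ((blockEquiv n u).symm w).1 = ∑ ω, (∏ t, p (ω t)) * g ω := by
  rw [← Equiv.sum_comp (blockEquiv n u), Fintype.sum_prod_type]
  refine Finset.sum_congr rfl fun ω _ => ?_
  simp only [blockPMF, Equiv.symm_apply_apply]
  rw [Finset.sum_const, Finset.card_univ, Fintype.card_pi, nsmul_eq_mul, Nat.cast_prod,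
    mul_comm (∏ t, p (ω t)), mul_assoc, ← mul_assoc, ← Finset.prod_mul_distrib]
  rw [Finset.prod_eq_one, one_mul]
  intro i _
  have hu : (u i : ℝ) ≠ 0 := by exact_mod_cast NeZero.ne (u i)
  simp [hu]

/-- The law of a variable that consists of a function of each letter and the first uniform
variables. -/
lemma law_blockPMF {β γ : Type*} [Fintype γ] (B : BlockSpace X₁ X₂ Y₁ Y₂ m n u → β)
    (b : AuxSpace X₁ X₂ Y₁ Y₂ m → γ) (s : ℕ)
    (h : ∀ w w', B (blockEquiv n u w') = B (blockEquiv n u w) ↔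
      (∀ t, b (w'.1 t) = b (w.1 t)) ∧ ∀ i : Fin r, i.val < s → w'.2 i = w.2 i) (w) :
    law (blockPMF p n u) B (B w) = (∏ t, law p b (b (((blockEquiv n u).symm w).1 t))) *
      ∏ i : Fin r with i.val < s, (1 / (u i : ℝ)) := by
  obtain ⟨⟨ω, v⟩, rfl⟩ := (blockEquiv n u).surjective w
  rw [Equiv.symm_apply_apply, ← law_comp_equiv (blockPMF p n u) (blockEquiv n u) B]
  rw [← sum_uniform_prefix u s v, ← law_iid p b (fun t => b (ω t)), law, law, Finset.sum_mul_sum, Fintype.sum_prod_type]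
  refine Finset.sum_congr rfl fun ω' _ => Finset.sum_congr rfl fun v' _ => ?_
  simp only [h, blockPMF, Equiv.symm_apply_apply, funext_iff]
  by_cases h1 : ∀ t, b (ω' t) = b (ω t) <;>
  by_cases h2 : ∀ i : Fin r, i.val < s → v' i = v i <;> simp [h1, h2]

variable {α ζ : Type*} [Fintype α] [Fintype ζ]

/-- The uniform variables multiply conditional probabilities by a constant, so the tail is that of
the letters; `s` counts the uniform variables seen by `(A, Z)` and `s'` those seen by `Z`. The rate
`ρ` depends on neither `n` nor `u`. -/
lemma exists_upperTail_le (hp : p ∈ stdSimplex ℝ (AuxSpace X₁ X₂ Y₁ Y₂ m))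
    (a : AuxSpace X₁ X₂ Y₁ Y₂ m → α) (z : AuxSpace X₁ X₂ Y₁ Y₂ m → ζ) {ε : ℝ} (hε : 0 < ε) :
    ∃ ρ : ℝ, 0 ≤ ρ ∧ ρ < 1 ∧ ∀ (n : ℕ) (u : Fin r → ℕ) [∀ i, NeZero (u i)]
      {α' ζ' : Type*} (A : BlockSpace X₁ X₂ Y₁ Y₂ m n u → α') (Z : BlockSpace X₁ X₂ Y₁ Y₂ m n u → ζ') (s s' : ℕ),
      (∀ w w', (A (blockEquiv n u w'), Z (blockEquiv n u w')) =
          (A (blockEquiv n u w), Z (blockEquiv n u w)) ↔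
        (∀ t, (a (w'.1 t), z (w'.1 t)) = (a (w.1 t), z (w.1 t))) ∧
          ∀ i : Fin r, i.val < s → w'.2 i = w.2 i) →
      (∀ w w', Z (blockEquiv n u w') = Z (blockEquiv n u w) ↔
        (∀ t, z (w'.1 t) = z (w.1 t)) ∧ ∀ i : Fin r, i.val < s' → w'.2 i = w.2 i) →
      upperTail (blockPMF p n u) A Z ((2 : ℝ) ^ (-(n * (condEntropy p a z - ε))) *
        ((∏ i : Fin r with i.val < s, (1 / (u i : ℝ))) /
          ∏ i : Fin r with i.val < s', (1 / (u i : ℝ)))) ≤ ρ ^ n := by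
  obtain ⟨ρ, h0, h1, h⟩ := exists_iid_upper_le hp a z hε
  refine ⟨ρ, h0, h1, fun n u _ _ _ A Z s s' hA hZ => le_trans (le_of_eq ?_) (h n)⟩
  have hpos : ∀ s, 0 < ∏ i : Fin r with i.val < s, (1 / (u i : ℝ)) := fun s =>
    Finset.prod_pos fun i _ => one_div_pos.2 (by exact_mod_cast NeZero.pos (u i))
  rw [← sum_blockPMF_mul p n u]
  refine Finset.sum_congr rfl fun w _ => ?_
  rw [law_blockPMF p n u Z z s' hZ w, law_blockPMF p n u (fun w => (A w, Z w))
    (fun w => (a w, z w)) s hA w]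
  congr 1
  refine if_congr ?_ rfl rfl
  have e : ∀ x y : ℝ, x * ((∏ i : Fin r with i.val < s, (1 / (u i : ℝ))) /
      ∏ i : Fin r with i.val < s', (1 / (u i : ℝ))) *
      (y * ∏ i : Fin r with i.val < s', (1 / (u i : ℝ))) =
      x * y * ∏ i : Fin r with i.val < s, (1 / (u i : ℝ)) := fun x y => by
    have := (hpos s').ne'
    field_simp
  rw [e, mul_lt_mul_iff_left₀ (hpos s)]

lemma exists_lowerTail_le (hp : p ∈ stdSimplex ℝ (AuxSpace X₁ X₂ Y₁ Y₂ m))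
    (a : AuxSpace X₁ X₂ Y₁ Y₂ m → α) (z : AuxSpace X₁ X₂ Y₁ Y₂ m → ζ) {ε : ℝ} (hε : 0 < ε) :
    ∃ ρ : ℝ, 0 ≤ ρ ∧ ρ < 1 ∧ ∀ (n : ℕ) (u : Fin r → ℕ) [∀ i, NeZero (u i)]
      {α' ζ' : Type*} (A : BlockSpace X₁ X₂ Y₁ Y₂ m n u → α') (Z : BlockSpace X₁ X₂ Y₁ Y₂ m n u → ζ') (s s' : ℕ),
      (∀ w w', (A (blockEquiv n u w'), Z (blockEquiv n u w')) =
          (A (blockEquiv n u w), Z (blockEquiv n u w)) ↔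
        (∀ t, (a (w'.1 t), z (w'.1 t)) = (a (w.1 t), z (w.1 t))) ∧
          ∀ i : Fin r, i.val < s → w'.2 i = w.2 i) →
      (∀ w w', Z (blockEquiv n u w') = Z (blockEquiv n u w) ↔
        (∀ t, z (w'.1 t) = z (w.1 t)) ∧ ∀ i : Fin r, i.val < s' → w'.2 i = w.2 i) →
      lowerTail (blockPMF p n u) A Z ((2 : ℝ) ^ (-(n * (condEntropy p a z + ε))) *
        ((∏ i : Fin r with i.val < s, (1 / (u i : ℝ))) /
          ∏ i : Fin r with i.val < s', (1 / (u i : ℝ)))) ≤ ρ ^ n := by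
  obtain ⟨ρ, h0, h1, h⟩ := exists_iid_lower_le hp a z hε
  refine ⟨ρ, h0, h1, fun n u _ _ _ A Z s s' hA hZ => le_trans (le_of_eq ?_) (h n)⟩
  have hpos : ∀ s, 0 < ∏ i : Fin r with i.val < s, (1 / (u i : ℝ)) := fun s =>
    Finset.prod_pos fun i _ => one_div_pos.2 (by exact_mod_cast NeZero.pos (u i))
  rw [← sum_blockPMF_mul p n u]
  refine Finset.sum_congr rfl fun w _ => ?_
  rw [law_blockPMF p n u Z z s' hZ w, law_blockPMF p n u (fun w => (A w, Z w))
    (fun w => (a w, z w)) s hA w]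
  congr 1
  refine if_congr ?_ rfl rfl
  have e : ∀ x y : ℝ, x * ((∏ i : Fin r with i.val < s, (1 / (u i : ℝ))) /
      ∏ i : Fin r with i.val < s', (1 / (u i : ℝ))) *
      (y * ∏ i : Fin r with i.val < s', (1 / (u i : ℝ))) =
      x * y * ∏ i : Fin r with i.val < s, (1 / (u i : ℝ)) := fun x y => by
    have := (hpos s').ne'
    field_simp
  rw [e, mul_lt_mul_iff_left₀ (hpos s)]

end Block

/-! ### Conditional laws. -/

section CondLaw

variable {Ω α β γ δ : Type*} [Fintype Ω]

lemma law_id (p : Ω → ℝ) (w : Ω) : law p (fun w => w) w = p w :=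
  (Finset.sum_eq_single w (fun _ _ hw => if_neg hw)
    fun h => absurd (Finset.mem_univ w) h).trans (if_pos rfl)

/-- The conditional law of `A` given `B`, uniform where it is undefined. -/
noncomputable def condLaw [Fintype α] (p : Ω → ℝ) (A : Ω → α) (B : Ω → β) (a : α) (b : β) : ℝ :=
  if law p B b = 0 then 1 / (Fintype.card α : ℝ) else law p (fun w => (A w, B w)) (a, b) / law p B b

lemma condLaw_nonneg [Fintype α] {p : Ω → ℝ} (hp : ∀ w, 0 ≤ p w) (A : Ω → α) (B : Ω → β) (a : α)
    (b : β) : 0 ≤ condLaw p A B a b := by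
  unfold condLaw
  split_ifs
  · positivity
  · exact div_nonneg (law_nonneg hp _ _) (law_nonneg hp _ _)

lemma sum_condLaw [Fintype α] [Nonempty α] (p : Ω → ℝ) (A : Ω → α) (B : Ω → β) (b : β) :
    ∑ a, condLaw p A B a b = 1 := by
  unfold condLaw
  split_ifs with h
  · have hc : (Fintype.card α : ℝ) ≠ 0 := by exact_mod_cast Fintype.card_ne_zero
    simp [hc]
  · rw [← Finset.sum_div, law_fst_sum, div_self h]

/-- A Markov chain allows to factor a joint law. -/
lemma IsMarkov.law_eq_condLaw_mul [Fintype α] {p : Ω → ℝ} (hp : ∀ w, 0 ≤ p w) {A : Ω → α}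
    {B : Ω → β} {C : Ω → γ} (h : IsMarkov p A B C) (a : α) (b : β) (c : γ) :
    law p (fun w => (A w, B w, C w)) (a, b, c) =
      condLaw p A B a b * law p (fun w => (B w, C w)) (b, c) := by
  unfold condLaw
  split_ifs with h0
  · have h1 : law p (fun w => (B w, C w)) (b, c) = 0 :=
      le_antisymm ((law_pair_le_fst hp B C b c).trans h0.le) (law_nonneg hp _ _)
    have h2 := law_pair_le_snd hp A (fun w => (B w, C w)) a (b, c)
    rw [h1, mul_zero]
    exact le_antisymm (h2.trans h1.le) (law_nonneg hp _ _)
  · rw [div_mul_eq_mul_div, eq_div_iff h0]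
    exact h a b c

lemma IsMarkov.fst [Fintype δ] {p : Ω → ℝ} {A : Ω → α} {B : Ω → β} {C : Ω → γ} {D : Ω → δ}
    (h : IsMarkov p A B fun w => (C w, D w)) : IsMarkov p A B C := by
  intro a b c
  have e1 : law p (fun w => (A w, B w, C w)) (a, b, c) =
      ∑ d, law p (fun w => (A w, B w, C w, D w)) (a, b, c, d) := by
    rw [← law_snd_sum p (fun w => (A w, B w, C w)) D]
    refine Finset.sum_congr rfl fun d _ => ?_
    simp only [law, Prod.mk.injEq, and_assoc]
  have e2 : law p (fun w => (B w, C w)) (b, c) =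
      ∑ d, law p (fun w => (B w, C w, D w)) (b, c, d) := by
    rw [← law_snd_sum p (fun w => (B w, C w)) D]
    refine Finset.sum_congr rfl fun d _ => ?_
    simp only [law, Prod.mk.injEq, and_assoc]
  rw [e1, e2, Finset.sum_mul, Finset.mul_sum]
  exact Finset.sum_congr rfl fun d _ => h a b (c, d)

end CondLaw

/-! ### Factoring an admissible pmf into kernels. -/

section Factor

open AuxSpace

variable {X₁ X₂ Y₁ Y₂ : Type*} [Fintype X₁] [Fintype X₂] [Fintype Y₁] [Fintype Y₂] {r : ℕ}
  {m : Fin r → ℕ}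

/-- The side information of the terminal that speaks in round `i`. -/
def speaker {A B : Type*} (i : Fin r) (x : A × B) : A ⊕ B :=
  if Even i.val then Sum.inl x.1 else Sum.inr x.2

/-- A pmf on the auxiliary space as a sequential composition of kernels. -/
structure Factorization (p : AuxSpace X₁ X₂ Y₁ Y₂ m → ℝ) (qX : X₁ × X₂ → ℝ) where
  /-- The kernels of the rounds. -/
  k : Fin r → ((i : Fin r) → Fin (m i)) → X₁ ⊕ X₂ → ℝ
  /-- The output kernel of terminal 1. -/
  d₁ : ((i : Fin r) → Fin (m i)) → X₁ → Y₁ → ℝ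
  /-- The output kernel of terminal 2. -/
  d₂ : ((i : Fin r) → Fin (m i)) → X₂ → Y₂ → ℝ
  isKernel : ∀ σ : Fin r → X₁ ⊕ X₂, IsKernel fun i f => k i f (σ i)
  d₁_mem : ∀ f x, d₁ f x ∈ stdSimplex ℝ Y₁
  d₂_mem : ∀ f x, d₂ f x ∈ stdSimplex ℝ Y₂
  eq : ∀ w, p w = qX (x w) * (∏ i, k i w.1 (speaker i (x w))) * d₁ w.1 (x₁ w) (y₁ w) *
    d₂ w.1 (x₂ w) (y₂ w)

lemma past_update {i : Fin r} (f : (i : Fin r) → Fin (m i)) (a : Fin (m i)) :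
    past (Function.update f i a) i = past f i :=
  past_eq_iff.2 fun _ hj => Function.update_of_ne hj.ne _ _

lemma isKernel_condLaw [∀ i, Nonempty (Fin (m i))] {p : AuxSpace X₁ X₂ Y₁ Y₂ m → ℝ}
    (hp : ∀ w, 0 ≤ p w) (σ : Fin r → X₁ ⊕ X₂) :
    IsKernel fun i (f : (i : Fin r) → Fin (m i)) => Sum.elim
      (fun x => condLaw p (Fi i) (fun w => (past (F w) i, x₁ w)) (f i) (past f i, x))
      (fun x => condLaw p (Fi i) (fun w => (past (F w) i, x₂ w)) (f i) (past f i, x)) (σ i) where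
  nonneg i f := by
    rcases σ i with x | x <;> exact condLaw_nonneg hp _ _ _ _
  congr i f f' h := by
    rw [h i le_rfl, past_eq_iff.2 fun j hj => h j hj.le]
  sum_one i f := by
    simp only [past_update, Function.update_self]
    rcases σ i with x | x <;> exact sum_condLaw p _ _ _

/-- One step of the factorization: `g` is the source of the speaker and `g'` the other one, which
the Markov chain removes from the condition. -/
lemma law_prefix_succ {p : AuxSpace X₁ X₂ Y₁ Y₂ m → ℝ} [∀ i, Nonempty (Fin (m i))]
    (hp : ∀ w, 0 ≤ p w) {i : Fin r} {ξ η : Type*}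
    {g : AuxSpace X₁ X₂ Y₁ Y₂ m → ξ} {g' : AuxSpace X₁ X₂ Y₁ Y₂ m → η}
    (hM : IsMarkov p (Fi i) (fun w => (past (F w) i, g w)) g')
    (hg : ∀ w w', x w' = x w ↔ g w' = g w ∧ g' w' = g' w) (w : AuxSpace X₁ X₂ Y₁ Y₂ m) :
    law p (fun w => (truncate (i.val + 1) w.1, x w)) (truncate (i.val + 1) w.1, x w) =
      condLaw p (Fi i) (fun w => (past (F w) i, g w)) (w.1 i) (past w.1 i, g w) *
        law p (fun w => (truncate i.val w.1, x w)) (truncate i.val w.1, x w) := by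
  have h := hM.law_eq_condLaw_mul hp (w.1 i) (past w.1 i, g w) (g' w)
  rw [law_congr_ker p (A := fun w => (truncate (i.val + 1) w.1, x w))
      (B := fun w => (Fi i w, (past (F w) i, g w), g' w)) (w := w) ?_,
    law_congr_ker p (A := fun w => (truncate i.val w.1, x w))
      (B := fun w => ((past (F w) i, g w), g' w)) (w := w) ?_]
  · exact h
  · intro w'
    simp only [Prod.mk.injEq, truncate_eq_iff, past_eq_iff, hg, Fi, F]
    exact ⟨fun h => ⟨⟨h.1, h.2.1⟩, h.2.2⟩, fun h => ⟨h.1.1, h.1.2, h.2⟩⟩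
  · intro w'
    simp only [Prod.mk.injEq, truncate_eq_iff, past_eq_iff, hg, Fi, F]
    constructor
    · rintro ⟨h, h', h''⟩
      exact ⟨h i (Nat.lt_succ_self _), ⟨fun j hj => h j (Nat.lt_succ_of_lt hj), h'⟩, h''⟩
    · rintro ⟨h1, ⟨h2, h'⟩, h''⟩
      refine ⟨fun j hj => ?_, h', h''⟩
      rcases Nat.lt_succ_iff_lt_or_eq.1 hj with h | h
      · exact h2 j h
      · have : j = i := Fin.ext h
        subst this
        exact h1

/-- An admissible pmf factors into kernels. -/
lemma IsAdmissible.nonempty_factorization [NeZero r] [∀ i, Nonempty (Fin (m i))] [Nonempty Y₁]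
    [Nonempty Y₂] {qX : X₁ × X₂ → ℝ} {W : X₁ × X₂ → Y₁ × Y₂ → ℝ}
    (hW : ∀ x, W x ∈ stdSimplex ℝ (Y₁ × Y₂))
    {p : AuxSpace X₁ X₂ Y₁ Y₂ m → ℝ} (h : IsAdmissible qX W m p) :
    Nonempty (Factorization p qX) := by
  have hp := h.isPMF.1
  refine ⟨⟨_, fun f x => fun y => condLaw p y₁ (fun w => (F w, x₁ w)) y (f, x),
    fun f x => fun y => condLaw p y₂ (fun w => (F w, x₂ w)) y (f, x), isKernel_condLaw hp,
    fun f x => ⟨fun y => condLaw_nonneg hp _ _ _ _, sum_condLaw p _ _ _⟩,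
    fun f x => ⟨fun y => condLaw_nonneg hp _ _ _ _, sum_condLaw p _ _ _⟩, fun w => ?_⟩⟩
  have hx : law p x (x w) = qX (x w) := by
    rw [← law_snd_sum p x y]
    simp only [h.marginal, ← Finset.mul_sum, (hW (x w)).2, mul_one]
  have key : ∀ s ≤ r, law p (fun w => (truncate s w.1, x w)) (truncate s w.1, x w) =
      qX (x w) * ∏ i : Fin r with i.val < s, Sum.elim
        (fun x => condLaw p (Fi i) (fun w => (past (F w) i, x₁ w)) (w.1 i) (past w.1 i, x))
        (fun x => condLaw p (Fi i) (fun w => (past (F w) i, x₂ w)) (w.1 i) (past w.1 i, x))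
        (speaker i (x w)) := by
    intro s
    induction s with
    | zero =>
      intro _
      simp only [Nat.not_lt_zero, Finset.filter_false, Finset.prod_empty, mul_one]
      rw [← hx]
      refine law_congr_ker p fun w' => ?_
      simp [truncate_eq_iff]
    | succ s ih =>
      intro hs
      have ih := ih (by omega)
      set i : Fin r := ⟨s, hs⟩ with hi
      have hprod := prod_filter_lt_succ i fun i => Sum.elim
        (fun x => condLaw p (Fi i) (fun w => (past (F w) i, x₁ w)) (w.1 i) (past w.1 i, x))
        (fun x => condLaw p (Fi i) (fun w => (past (F w) i, x₂ w)) (w.1 i) (past w.1 i, x))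
        (speaker i (x w))
      change ∏ j : Fin r with j.val < s + 1, _ = (∏ j : Fin r with j.val < s, _) * _ at hprod
      rw [hprod, ← mul_assoc, ← ih]
      by_cases he : Even i.val
      · rw [mul_comm]
        simp only [speaker, if_pos he, Sum.elim_inl]
        exact law_prefix_succ hp (h.markov_odd_round i he)
          (fun w w' => by simp [x]) w
      · rw [mul_comm]
        simp only [speaker, if_neg he, Sum.elim_inr]
        exact law_prefix_succ hp (h.markov_even_round i (Nat.not_even_iff_odd.1 he))
          (fun w w' => by simp [x, and_comm]) w
  have hall : ∀ i : Fin r, i.val < r := fun i => i.2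
  have hF := key r le_rfl
  simp only [truncate_of_le le_rfl, Finset.filter_true, hall] at hF
  -- Split off `y₁` given `F` and `x₁`, then `y₂` given `F` and `x₂`. For the second step `y₁` is
  -- dropped from the other end of the chain, and the law of symbols and inputs remains.
  have h1 := h.markov_out₁.law_eq_condLaw_mul hp (y₁ w) (F w, x₁ w) (x₂ w, y₂ w)
  have h2 := (IsMarkov.fst h.markov_out₂).law_eq_condLaw_mul hp (y₂ w) (F w, x₂ w) (x₁ w)
  have e1 : law p (fun w => (y₁ w, (F w, x₁ w), (x₂ w, y₂ w)))
      (y₁ w, (F w, x₁ w), (x₂ w, y₂ w)) = p w := by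
    rw [← law_id p w]
    refine law_congr_ker p (B := fun w => w) fun w' => ?_
    simp only [Prod.mk.injEq, Prod.ext_iff, F, x₁, x₂, y₁, y₂]
    tauto
  have e2 : law p (fun w => ((F w, x₁ w), (x₂ w, y₂ w))) ((F w, x₁ w), (x₂ w, y₂ w)) =
      law p (fun w => (y₂ w, (F w, x₂ w), x₁ w)) (y₂ w, (F w, x₂ w), x₁ w) := by
    refine law_congr_ker p (A := fun w => ((F w, x₁ w), (x₂ w, y₂ w)))
      (B := fun w => (y₂ w, (F w, x₂ w), x₁ w)) fun w' => ?_
    simp only [Prod.mk.injEq]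
    tauto
  have e3 : law p (fun w => ((F w, x₂ w), x₁ w)) ((F w, x₂ w), x₁ w) =
      law p (fun w => (w.1, x w)) (w.1, x w) := by
    refine law_congr_ker p (A := fun w => ((F w, x₂ w), x₁ w))
      (B := fun w => (w.1, x w)) fun w' => ?_
    simp only [Prod.mk.injEq, x, F]
    tauto
  rw [e1, e2, h2, e3, hF] at h1
  rw [h1]
  simp only [F]
  ring

end Factor

/-! ### The one-shot scheme applied to blocks. -/

section BlockScheme

open AuxSpace

variable {X₁ X₂ Y₁ Y₂ : Type*} [Fintype X₁] [Fintype X₂] [Fintype Y₁] [Fintype Y₂] {r : ℕ}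
  {m : Fin r → ℕ} {p : AuxSpace X₁ X₂ Y₁ Y₂ m → ℝ} {qX : X₁ × X₂ → ℝ}

namespace Factorization

variable (Φ : Factorization p qX) (n : ℕ) (u : Fin r → ℕ) [∀ i, NeZero (u i)]

/-- The kernels of the block scheme. -/
noncomputable def blockKernel (i : Fin r) (f : (i : Fin r) → BlockSym m n u i)
    (s : (Fin n → X₁) ⊕ (Fin n → X₂)) : ℝ :=
  (∏ t, Φ.k i (fun j => (f j).1 t) (Sum.map (fun x => x t) (fun x => x t) s)) * (1 / (u i : ℝ))

/-- The output kernel of terminal 1 in the block scheme. -/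
def blockOut₁ (f : (i : Fin r) → BlockSym m n u i) (x : Fin n → X₁) (y : Fin n → Y₁) : ℝ :=
  ∏ t, Φ.d₁ (fun j => (f j).1 t) (x t) (y t)

/-- The output kernel of terminal 2 in the block scheme. -/
def blockOut₂ (f : (i : Fin r) → BlockSym m n u i) (x : Fin n → X₂) (y : Fin n → Y₂) : ℝ :=
  ∏ t, Φ.d₂ (fun j => (f j).1 t) (x t) (y t)

lemma blockOut₁_mem (f : (i : Fin r) → BlockSym m n u i) (x : Fin n → X₁) :
    Φ.blockOut₁ n u f x ∈ stdSimplex ℝ (Fin n → Y₁) :=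
  ⟨fun _ => Finset.prod_nonneg fun _ _ => (Φ.d₁_mem _ _).1 _, by
    unfold blockOut₁
    rw [sum_prod_eq_prod_sum fun t y => Φ.d₁ (fun j => (f j).1 t) (x t) y]
    exact Finset.prod_eq_one fun t _ => (Φ.d₁_mem _ _).2⟩

lemma blockOut₂_mem (f : (i : Fin r) → BlockSym m n u i) (x : Fin n → X₂) :
    Φ.blockOut₂ n u f x ∈ stdSimplex ℝ (Fin n → Y₂) :=
  ⟨fun _ => Finset.prod_nonneg fun _ _ => (Φ.d₂_mem _ _).1 _, by
    unfold blockOut₂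
    rw [sum_prod_eq_prod_sum fun t y => Φ.d₂ (fun j => (f j).1 t) (x t) y]
    exact Finset.prod_eq_one fun t _ => (Φ.d₂_mem _ _).2⟩

lemma isKernel_blockKernel (σ : Fin r → (Fin n → X₁) ⊕ (Fin n → X₂)) :
    IsKernel fun i f => Φ.blockKernel n u i f (σ i) where
  nonneg i f := mul_nonneg (Finset.prod_nonneg fun t _ =>
    (Φ.isKernel fun i => Sum.map (fun x => x t) (fun x => x t) (σ i)).nonneg i _) (by positivity)
  congr i f f' h := by
    unfold blockKernel
    congr 1
    refine Finset.prod_congr rfl fun t _ => ?_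
    exact (Φ.isKernel fun i => Sum.map (fun x => x t) (fun x => x t) (σ i)).congr i
      (fun j => (f j).1 t) (fun j => (f' j).1 t) fun j hj => by rw [h j hj]
  sum_one i f := by
    have hu : (u i : ℝ) ≠ 0 := by exact_mod_cast NeZero.ne (u i)
    have h : ∀ a t, (fun j => (Function.update f i a j).1 t) =
        Function.update (fun j => (f j).1 t) i (a.1 t) := by
      intro a t
      funext j
      by_cases hj : j = i
      · subst hj; simp
      · simp [hj]
    simp only [blockKernel, h]
    rw [Fintype.sum_prod_type]
    simp only [Finset.sum_const, Finset.card_univ, Fintype.card_fin, nsmul_eq_mul]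
    have e : ∀ a : ℝ, (u i : ℝ) * (a * (1 / (u i : ℝ))) = a := fun a => by field_simp
    simp only [e]
    rw [sum_prod_eq_prod_sum fun t a => Φ.k i (Function.update (fun j => (f j).1 t) i a)
      (Sum.map (fun x => x t) (fun x => x t) (σ i))]
    exact Finset.prod_eq_one fun t _ =>
      (Φ.isKernel fun i => Sum.map (fun x => x t) (fun x => x t) (σ i)).sum_one i _

/-- Products of single-letter kernels compose to the i.i.d. law, so that the single-letter entropies
of `p` govern the block scheme. -/
lemma seqJoint_block :
    seqJoint (fun x : (Fin n → X₁) × (Fin n → X₂) => ∏ t, qX (x.1 t, x.2 t)) (Φ.blockKernel n u)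
      speaker (fun f x (y : (Fin n → Y₁) × (Fin n → Y₂)) =>
        Φ.blockOut₁ n u f x.1 y.1 * Φ.blockOut₂ n u f x.2 y.2) = blockPMF p n u := by
  funext w
  have hs : ∀ (i : Fin r) t, Sum.map (fun x : Fin n → X₁ => x t) (fun x : Fin n → X₂ => x t)
      (speaker i w.2.1) = speaker i (w.2.1.1 t, w.2.1.2 t) := by
    intro i t
    unfold speaker
    split_ifs <;> rfl
  simp only [seqJoint, blockPMF, blockKernel, blockOut₁, blockOut₂, Φ.eq, hs,
    Finset.prod_mul_distrib]
  rw [Finset.prod_comm]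
  simp only [blockEquiv, Equiv.coe_fn_symm_mk, x, x₁, x₂, y₁, y₂]
  ring

end Factorization

variable {N : ℕ} [NeZero r]

/-- The alphabets of the common randomness attached to the rounds: all of it belongs to the first
round. -/
abbrev SharedSym (r N : ℕ) (i : Fin r) : Type := Fin (if i.val = 0 then N else 1)

lemma card_sharedSym : Fintype.card ((i : Fin r) → SharedSym r N i) = N := by
  rw [Fintype.card_pi]
  simp only [Fintype.card_fin]
  rw [Finset.prod_eq_single (0 : Fin r)]
  · simp
  · intro i _ hi
    rw [if_neg]
    intro h
    exact hi (Fin.ext (by simpa using h))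
  · simp

/-- The law of the inputs and outputs of a block. -/
lemma law_blockPMF_snd [∀ i, Nonempty (Fin (m i))] {W : X₁ × X₂ → Y₁ × Y₂ → ℝ}
    (h : IsAdmissible qX W m p) (n : ℕ) (u : Fin r → ℕ) [∀ i, NeZero (u i)]
    (z : ((Fin n → X₁) × (Fin n → X₂)) × ((Fin n → Y₁) × (Fin n → Y₂))) :
    law (blockPMF p n u) (fun w => w.2) z = target qX W n z := by
  set w : BlockSpace X₁ X₂ Y₁ Y₂ m n u := (fun _ => Classical.arbitrary _, z) with hw
  have := law_blockPMF p n u (fun w => w.2) (fun w => (x w, y w)) 0 (fun w w' => by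
    simp only [blockEquiv, Equiv.coe_fn_mk, Prod.mk.injEq, funext_iff, x, y, x₁, x₂, y₁, y₂,
      Nat.not_lt_zero, false_imp_iff, implies_true, and_true]
    exact ⟨fun h t => ⟨⟨h.1.1 t, h.1.2 t⟩, h.2.1 t, h.2.2 t⟩, fun h =>
      ⟨⟨fun t => (h t).1.1, fun t => (h t).1.2⟩, fun t => (h t).2.1, fun t => (h t).2.2⟩⟩) w
  rw [show z = w.2 from rfl, this]
  simp only [Nat.not_lt_zero, Finset.filter_false, Finset.prod_empty, mul_one, h.marginal]
  rfl

/-- A simulation code from the one-shot construction. -/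
theorem exists_code [∀ i, Nonempty (Fin (m i))] {W : X₁ × X₂ → Y₁ × Y₂ → ℝ}
    (hq : qX ∈ stdSimplex ℝ (X₁ × X₂)) (h : IsAdmissible qX W m p) (Φ : Factorization p qX)
    (n : ℕ) (u G M : Fin r → ℕ) [∀ i, NeZero (u i)] [∀ i, NeZero (G i)] [∀ i, NeZero (M i)]
    (hN : 0 < N) {θ θ₁ θ₂ θ' : Fin r → ℝ} (hθ : ∀ i, 0 < θ i) (hθ₁ : ∀ i, 0 < θ₁ i)
    (hθ₂ : ∀ i, 0 < θ₂ i) (hθ' : ∀ i, 0 < θ' i) :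
    ∃ K : Code X₁ X₂ Y₁ Y₂ r n N, K.size = M ∧
      tvDist (law (K.induced qX) K.inputOutput) (target qX W n) ≤
        3 * ∑ i, binningBound (blockPMF p n u) (fun x => Sum.inl x.1) (fun x => Sum.inr x.2)
          (fun i => Fin (G i)) (SharedSym r N) (fun i => Fin (M i)) θ θ₁ θ₂ θ' i := by
  have hne : ∀ i : Fin r, Nonempty (SharedSym r N i) := fun i => by
    refine ⟨⟨0, ?_⟩⟩
    split_ifs
    exacts [hN, one_pos]
  obtain ⟨E, D, hE0, hE1, hEc, hE⟩ := exists_oneShot (φ := BlockSym m n u)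
    (G := fun i => Fin (G i)) (W := SharedSym r N) (M := fun i => Fin (M i))
    (X := (Fin n → X₁) × (Fin n → X₂)) (Y := (Fin n → Y₁) × (Fin n → Y₂))
    (q := fun x => ∏ t, qX (x.1 t, x.2 t)) (k := Φ.blockKernel n u) (own := speaker)
    (s₁ := fun x => Sum.inl x.1) (s₂ := fun x => Sum.inr x.2)
    (d := fun f f' x y => Φ.blockOut₁ n u f x.1 y.1 * Φ.blockOut₂ n u f' x.2 y.2)
    (fun x => Finset.prod_nonneg fun t _ => hq.1 _)
    (by
      have e := Fintype.sum_equiv (Equiv.arrowProdEquivProdArrow (Fin n) (fun _ => X₁) (fun _ => X₂))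
        (fun a => ∏ t, qX (a t)) (fun x => ∏ t, qX (x.1 t, x.2 t)) (fun a => rfl)
      rw [← e]
      exact sum_prod_eq_one hq.2)
    (Φ.isKernel_blockKernel n u)
    (fun i x => by unfold speaker; split_ifs <;> simp)
    (fun x x' => Sum.inl_ne_inr)
    (fun f f' x y => mul_nonneg ((Φ.blockOut₁_mem n u f x.1).1 _) ((Φ.blockOut₂_mem n u f' x.2).1 _))
    (fun f f' x => by
      rw [Fintype.sum_prod_type]
      simp only [← Finset.mul_sum, (Φ.blockOut₂_mem n u f' x.2).2, mul_one,
        (Φ.blockOut₁_mem n u f x.1).2])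
    hθ hθ₁ hθ₂ hθ'
  rw [Φ.seqJoint_block n u, card_sharedSym] at hE
  have e : Fin N ≃ ((i : Fin r) → SharedSym r N i) :=
    Fintype.equivOfCardEq (by rw [card_sharedSym, Fintype.card_fin])
  -- An encoder sees the past only; the padding by zero is immaterial, because `E i` ignores the
  -- messages from round `i` on.
  set ext : (i : Fin r) → Past M i → (j : Fin r) → Fin (M j) :=
    fun i c j => if hj : j < i then c ⟨j, hj⟩ else 0 with hext
  have hpast : ∀ i (c : (j : Fin r) → Fin (M j)) s v, E i (ext i (past c i)) s v = E i c s v :=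
    fun i c s v => hEc i _ _ s v fun j hj => by simp [hext, hj, past]
  refine ⟨⟨M, fun i c x ω => E i (ext i c) (Sum.inl x) (e ω),
    fun i c x ω => E i (ext i c) (Sum.inr x) (e ω),
    fun c x ω => Φ.blockOut₁ n u (D c (Sum.inl x) (e ω)) x,
    fun c x ω => Φ.blockOut₂ n u (D c (Sum.inr x) (e ω)) x,
    fun i _ c x ω => ⟨hE0 i _ _ _, hE1 i _ _ _⟩, fun i _ c x ω => ⟨hE0 i _ _ _, hE1 i _ _ _⟩,
    fun c x ω => Φ.blockOut₁_mem n u _ _, fun c x ω => Φ.blockOut₂_mem n u _ _⟩, rfl, ?_⟩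
  refine le_trans ?_ hE
  have hnn : 0 ≤ ∑ x : (Fin n → X₁) × (Fin n → X₂), ∑ y : (Fin n → Y₁) × (Fin n → Y₂),
      |(∑ v, (∏ t, qX (x.1 t, x.2 t)) * ∑ c, (∏ i, E i c (speaker i x) v (c i)) *
          (Φ.blockOut₁ n u (D c (Sum.inl x.1) v) x.1 y.1 *
            Φ.blockOut₂ n u (D c (Sum.inr x.2) v) x.2 y.2)) / N -
        law (blockPMF p n u) (fun w => w.2) (x, y)| :=
    Finset.sum_nonneg fun x _ => Finset.sum_nonneg fun y _ => abs_nonneg _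
  -- The factor one half in the total variation distance is given away.
  refine le_trans (le_of_eq ?_) (half_le_self hnn)
  unfold tvDist
  rw [Fintype.sum_prod_type]
  congr 1
  refine Finset.sum_congr rfl fun x _ => Finset.sum_congr rfl fun y _ => ?_
  rw [law_blockPMF_snd h]
  congr 2
  obtain ⟨x₁, x₂⟩ := x
  obtain ⟨y₁, y₂⟩ := y
  rw [law_eq_sum_mul]
  simp only [Fintype.sum_prod_type, Code.induced, Code.inputOutput, Prod.mk.injEq]
  rw [← Equiv.sum_comp e, Finset.sum_div]
  refine Finset.sum_congr rfl fun ω _ => ?_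
  rw [Finset.sum_eq_single x₁ (fun a _ ha => by simp [ha]) (by simp),
    Finset.sum_eq_single x₂ (fun a _ ha => by simp [ha]) (by simp), Finset.mul_sum, Finset.sum_div]
  refine Finset.sum_congr rfl fun c _ => ?_
  rw [Finset.sum_eq_single y₁ (fun a _ ha => by simp [ha]) (by simp),
    Finset.sum_eq_single y₂ (fun a _ ha => by simp [ha]) (by simp)]
  simp only [and_self, if_true, mul_one, hpast]
  have hspk : ∀ i : Fin r, (if Even i.val then E i c (Sum.inl x₁) (e ω) (c i)
      else E i c (Sum.inr x₂) (e ω) (c i)) = E i c (speaker i (x₁, x₂)) (e ω) (c i) := by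
    intro i
    unfold speaker
    split_ifs <;> rfl
  simp only [hspk]
  ring

end BlockScheme

/-! ### Exponents of the binning bound. -/

section Rates

open AuxSpace Filter Topology

lemma tendsto_const_mul_two_rpow {c : ℝ} (hc : c < 0) (C : ℝ) :
    Tendsto (fun n : ℕ => C * (2 : ℝ) ^ ((n : ℝ) * c)) atTop (𝓝 0) := by
  have h : ∀ n : ℕ, (2 : ℝ) ^ ((n : ℝ) * c) = ((2 : ℝ) ^ c) ^ n := fun n => by
    rw [mul_comm, Real.rpow_mul (by norm_num), Real.rpow_natCast]
  simp only [h]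
  have := tendsto_pow_atTop_nhds_zero_of_lt_one (Real.rpow_nonneg (by norm_num : (0 : ℝ) ≤ 2) c)
    (Real.rpow_lt_one_of_one_lt_of_neg (by norm_num) hc)
  simpa using this.const_mul C

lemma le_ceil_two_rpow (x : ℝ) : (2 : ℝ) ^ x ≤ (⌈(2 : ℝ) ^ x⌉₊ : ℝ) := Nat.le_ceil _

lemma ceil_two_rpow_le {x : ℝ} (hx : 0 ≤ x) : (⌈(2 : ℝ) ^ x⌉₊ : ℝ) ≤ 2 * (2 : ℝ) ^ x := by
  have h1 : (1 : ℝ) ≤ (2 : ℝ) ^ x := Real.one_le_rpow (by norm_num) hx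
  have h2 := Nat.ceil_lt_add_one (zero_le_one.trans h1)
  linarith

lemma two_rpow_le_floor {x : ℝ} (hx : 0 ≤ x) : (2 : ℝ) ^ x ≤ 2 * (⌊(2 : ℝ) ^ x⌋₊ : ℝ) := by
  have h1 : (1 : ℝ) ≤ (2 : ℝ) ^ x := Real.one_le_rpow (by norm_num) hx
  have h2 := Nat.lt_floor_add_one ((2 : ℝ) ^ x)
  have h3 : (1 : ℝ) ≤ ⌊(2 : ℝ) ^ x⌋₊ := by exact_mod_cast Nat.le_floor (by simpa using h1)
  linarith

instance neZero_ceil_two_rpow (x : ℝ) : NeZero ⌈(2 : ℝ) ^ x⌉₊ :=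
  ⟨(Nat.ceil_pos.2 (Real.rpow_pos_of_pos two_pos x)).ne'⟩

variable {X₁ X₂ Y₁ Y₂ : Type*} [Fintype X₁] [Fintype X₂] [Fintype Y₁] [Fintype Y₂] {r : ℕ}
  {m : Fin r → ℕ} [∀ i, Nonempty (Fin (m i))]

lemma truncate_blockEquiv_iff {n : ℕ} {u : Fin r → ℕ} [∀ i, NeZero (u i)] (s : ℕ)
    (w w' : (Fin n → AuxSpace X₁ X₂ Y₁ Y₂ m) × ((i : Fin r) → Fin (u i))) :
    truncate s (blockEquiv n u w').1 = truncate s (blockEquiv n u w).1 ↔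
      (∀ t, truncate s (w'.1 t).1 = truncate s (w.1 t).1) ∧
        ∀ i : Fin r, i.val < s → w'.2 i = w.2 i := by
  simp only [truncate_eq_iff]
  simp only [blockEquiv, Equiv.coe_fn_mk, Prod.mk.injEq, funext_iff]
  exact ⟨fun h => ⟨fun t j hj => (h j hj).1 t, fun j hj => (h j hj).2⟩,
    fun h j hj => ⟨fun t => h.1 t j hj, h.2 j hj⟩⟩

lemma truncate_blockEquiv_pair_iff {n : ℕ} {u : Fin r → ℕ} [∀ i, NeZero (u i)] {s s' : ℕ}
    (hs : s' ≤ s) {ξ η : Type*} {g : BlockSpace X₁ X₂ Y₁ Y₂ m n u → ξ}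
    {g₀ : AuxSpace X₁ X₂ Y₁ Y₂ m → η}
    (hg : ∀ w w', g (blockEquiv n u w') = g (blockEquiv n u w) ↔ ∀ t, g₀ (w'.1 t) = g₀ (w.1 t))
    (w w' : (Fin n → AuxSpace X₁ X₂ Y₁ Y₂ m) × ((i : Fin r) → Fin (u i))) :
    ((truncate s (blockEquiv n u w').1, truncate s' (blockEquiv n u w').1,
        g (blockEquiv n u w')) =
      (truncate s (blockEquiv n u w).1, truncate s' (blockEquiv n u w).1, g (blockEquiv n u w)) ↔
      (∀ t, (truncate s (w'.1 t).1, truncate s' (w'.1 t).1, g₀ (w'.1 t)) =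
        (truncate s (w.1 t).1, truncate s' (w.1 t).1, g₀ (w.1 t))) ∧
        ∀ i : Fin r, i.val < s → w'.2 i = w.2 i) ∧
    ((truncate s' (blockEquiv n u w').1, g (blockEquiv n u w')) =
      (truncate s' (blockEquiv n u w).1, g (blockEquiv n u w)) ↔
      (∀ t, (truncate s' (w'.1 t).1, g₀ (w'.1 t)) = (truncate s' (w.1 t).1, g₀ (w.1 t))) ∧
        ∀ i : Fin r, i.val < s' → w'.2 i = w.2 i) := by
  simp only [Prod.mk.injEq, truncate_blockEquiv_iff, hg]
  constructor
  · exact ⟨fun h => ⟨fun t => ⟨h.1.1 t, h.2.1.1 t, h.2.2 t⟩, h.1.2⟩,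
      fun h => ⟨⟨fun t => (h.1 t).1, h.2⟩, ⟨fun t => (h.1 t).2.1,
        fun i hi => h.2 i (hi.trans_le hs)⟩, fun t => (h.1 t).2.2⟩⟩
  · exact ⟨fun h => ⟨fun t => ⟨h.1.1 t, h.2 t⟩, h.1.2⟩,
      fun h => ⟨⟨fun t => (h.1 t).1, h.2⟩, fun t => (h.1 t).2⟩⟩

lemma truncate_blockEquiv_snd_iff {n : ℕ} {u : Fin r → ℕ} [∀ i, NeZero (u i)] (s : ℕ)
    (w w' : (Fin n → AuxSpace X₁ X₂ Y₁ Y₂ m) × ((i : Fin r) → Fin (u i))) :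
    ((truncate s (blockEquiv n u w').1, (blockEquiv n u w').2) =
      (truncate s (blockEquiv n u w).1, (blockEquiv n u w).2) ↔
      (∀ t, (truncate s (w'.1 t).1, x (w'.1 t), y (w'.1 t)) =
        (truncate s (w.1 t).1, x (w.1 t), y (w.1 t))) ∧
        ∀ i : Fin r, i.val < s → w'.2 i = w.2 i) ∧
    ((blockEquiv n u w').2 = (blockEquiv n u w).2 ↔
      (∀ t, (x (w'.1 t), y (w'.1 t)) = (x (w.1 t), y (w.1 t))) ∧
        ∀ i : Fin r, i.val < 0 → w'.2 i = w.2 i) := by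
  have h2 : (blockEquiv n u w').2 = (blockEquiv n u w).2 ↔
      ∀ t, (x (w'.1 t), y (w'.1 t)) = (x (w.1 t), y (w.1 t)) := by
    simp only [blockEquiv, Equiv.coe_fn_mk, Prod.mk.injEq, funext_iff, x, y, x₁, x₂, y₁, y₂]
    exact ⟨fun h t => ⟨⟨h.1.1 t, h.1.2 t⟩, h.2.1 t, h.2.2 t⟩, fun h =>
      ⟨⟨fun t => (h t).1.1, fun t => (h t).1.2⟩, fun t => (h t).2.1, fun t => (h t).2.2⟩⟩
  rw [Prod.mk.injEq, h2, truncate_blockEquiv_iff]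
  refine ⟨⟨fun h => ⟨fun t => Prod.ext (h.1.1 t) (h.2 t), h.1.2⟩,
      fun h => ⟨⟨fun t => congrArg Prod.fst (h.1 t), h.2⟩, fun t => congrArg Prod.snd (h.1 t)⟩⟩, ?_⟩
  simp

variable {p : AuxSpace X₁ X₂ Y₁ Y₂ m → ℝ} [NeZero r]

/-- The rate of the common randomness attached to round `i`. -/
def sharedRate (R₀ : ℝ) (i : Fin r) : ℝ := if i.val = 0 then R₀ else 0

lemma card_sharedSym_le {R₀ : ℝ} (n : ℕ) (i : Fin r) :
    (Fintype.card (SharedSym r ⌊(2 : ℝ) ^ ((n : ℝ) * R₀)⌋₊ i) : ℝ) ≤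
      (2 : ℝ) ^ ((n : ℝ) * sharedRate R₀ i) := by
  rw [Fintype.card_fin]
  unfold sharedRate
  split_ifs
  · exact Nat.floor_le (Real.rpow_nonneg (by norm_num) _)
  · simp

lemma le_card_sharedSym {R₀ : ℝ} (hR : 0 ≤ R₀) (n : ℕ) (i : Fin r) :
    (2 : ℝ) ^ ((n : ℝ) * sharedRate R₀ i) ≤
      2 * (Fintype.card (SharedSym r ⌊(2 : ℝ) ^ ((n : ℝ) * R₀)⌋₊ i) : ℝ) := by
  rw [Fintype.card_fin]
  unfold sharedRate
  split_ifs
  · exact two_rpow_le_floor (mul_nonneg (Nat.cast_nonneg _) hR)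
  · simp

/-- With rates in the interior, the binning bound vanishes asymptotically. -/
theorem exists_binningBound_le (hp : p ∈ stdSimplex ℝ (AuxSpace X₁ X₂ Y₁ Y₂ m)) {R₀ ε : ℝ}
    (hR : 0 ≤ R₀) (hε : 0 < ε) {υ g μ : Fin r → ℝ} (hυ : ∀ i, 0 ≤ υ i) (hg : ∀ i, 0 ≤ g i)
    (hU : ∀ i : Fin r, g i + sharedRate R₀ i + ε <
      condEntropy p (fun w => truncate (i.val + 1) w.1) (fun w => (truncate i.val w.1, x w)) + υ i)
    (h₁ : ∀ i : Fin r,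
      condEntropy p (fun w => truncate (i.val + 1) w.1) (fun w => (truncate i.val w.1, x₁ w)) +
        ε + υ i < g i + sharedRate R₀ i + μ i)
    (h₂ : ∀ i : Fin r,
      condEntropy p (fun w => truncate (i.val + 1) w.1) (fun w => (truncate i.val w.1, x₂ w)) +
        ε + υ i < g i + sharedRate R₀ i + μ i)
    (hV : ∀ i : Fin r, (∑ j : Fin r with j.val < i.val + 1, g j) + ε <
      condEntropy p (fun w => truncate (i.val + 1) w.1) (fun w => (x w, y w)) +
        ∑ j : Fin r with j.val < i.val + 1, υ j) :
    ∃ θ θ₁ θ₂ θ' : ℕ → Fin r → ℝ, (∀ n i, 0 < θ n i) ∧ (∀ n i, 0 < θ₁ n i) ∧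
      (∀ n i, 0 < θ₂ n i) ∧ (∀ n i, 0 < θ' n i) ∧
      ∃ δ : Fin r → ℕ → ℝ, (∀ i, Tendsto (δ i) atTop (𝓝 0)) ∧ ∀ n i,
      binningBound (blockPMF p n fun i => ⌈(2 : ℝ) ^ ((n : ℝ) * υ i)⌉₊)
        (fun x => Sum.inl x.1) (fun x => Sum.inr x.2)
        (fun i => Fin ⌈(2 : ℝ) ^ ((n : ℝ) * g i)⌉₊) (SharedSym r ⌊(2 : ℝ) ^ ((n : ℝ) * R₀)⌋₊)
        (fun i => Fin ⌈(2 : ℝ) ^ ((n : ℝ) * μ i)⌉₊) (θ n) (θ₁ n) (θ₂ n) (θ' n) i ≤ δ i n := by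
  set a : Fin r → AuxSpace X₁ X₂ Y₁ Y₂ m → (i : Fin r) → Fin (m i) :=
    fun i w => truncate (i.val + 1) w.1 with ha
  set HU : Fin r → ℝ := fun i => condEntropy p (a i) (fun w => (truncate i.val w.1, x w)) with hHU
  set H₁ : Fin r → ℝ := fun i => condEntropy p (a i) (fun w => (truncate i.val w.1, x₁ w)) with hH₁
  set H₂ : Fin r → ℝ := fun i => condEntropy p (a i) (fun w => (truncate i.val w.1, x₂ w)) with hH₂
  set HV : Fin r → ℝ := fun i => condEntropy p (a i) (fun w => (x w, y w)) with hHV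
  choose ρU hU0 hU1 hUt using fun i => exists_upperTail_le p hp (a i)
    (fun w => (truncate i.val w.1, x w)) hε
  choose ρ₁ h₁0 h₁1 h₁t using fun i => exists_lowerTail_le p hp (a i)
    (fun w => (truncate i.val w.1, x₁ w)) hε
  choose ρ₂ h₂0 h₂1 h₂t using fun i => exists_lowerTail_le p hp (a i)
    (fun w => (truncate i.val w.1, x₂ w)) hε
  choose ρV hV0 hV1 hVt using fun i => exists_upperTail_le p hp (a i) (fun w => (x w, y w)) hε
  set u : ℕ → Fin r → ℕ := fun n i => ⌈(2 : ℝ) ^ ((n : ℝ) * υ i)⌉₊ with hu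
  have hune : ∀ n i, NeZero (u n i) := fun n i => neZero_ceil_two_rpow _
  set π : ℕ → ℕ → ℝ := fun n s => ∏ i : Fin r with i.val < s, (1 / (u n i : ℝ)) with hπ
  have hu0 : ∀ n i, (0 : ℝ) < u n i := fun n i => by exact_mod_cast NeZero.pos (u n i)
  have hπ0 : ∀ n s, 0 < π n s := fun n s => Finset.prod_pos fun i _ => one_div_pos.2 (hu0 n i)
  have hpow : ∀ x : ℝ, (0 : ℝ) < (2 : ℝ) ^ x := fun x => Real.rpow_pos_of_pos two_pos x
  have hπs : ∀ n (i : Fin r), π n (i.val + 1) / π n i.val = 1 / (u n i : ℝ) := fun n i => by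
    rw [hπ]
    simp only
    rw [prod_filter_lt_succ i fun i => 1 / (u n i : ℝ), mul_div_cancel_left₀]
    exact (hπ0 n i.val).ne'
  have hπz : ∀ n, π n 0 = 1 := fun n => by simp [hπ]
  -- The thresholds sit at distance `ε` from the conditional entropies, on the side where the tail
  -- is exponentially small. The ratios of `π` account for the uniform variable of round `i`, and in
  -- the last threshold for those of all rounds up to `i`.
  refine ⟨fun n i => (2 : ℝ) ^ (-(n * (HU i - ε))) * (π n (i.val + 1) / π n i.val),
    fun n i => (2 : ℝ) ^ (-(n * (H₁ i + ε))) * (π n (i.val + 1) / π n i.val),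
    fun n i => (2 : ℝ) ^ (-(n * (H₂ i + ε))) * (π n (i.val + 1) / π n i.val),
    fun n i => (2 : ℝ) ^ (-(n * (HV i - ε))) * (π n (i.val + 1) / π n 0),
    fun n i => mul_pos (hpow _) (div_pos (hπ0 _ _) (hπ0 _ _)),
    fun n i => mul_pos (hpow _) (div_pos (hπ0 _ _) (hπ0 _ _)),
    fun n i => mul_pos (hpow _) (div_pos (hπ0 _ _) (hπ0 _ _)),
    fun n i => mul_pos (hpow _) (div_pos (hπ0 _ _) (hπ0 _ _)),
    -- The constants 2, 4 and `2 ^ r` inside the exponential terms absorb the rounding of alphabet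
    -- sizes to integers.
    fun i n => (2 * ρU i ^ n + √(2 * (2 : ℝ) ^ ((n : ℝ) * (g i + sharedRate R₀ i + ε - HU i - υ i)))) +
      (ρ₁ i ^ n + 4 * (2 : ℝ) ^ ((n : ℝ) * (H₁ i + ε + υ i - g i - sharedRate R₀ i - μ i))) +
      (ρ₂ i ^ n + 4 * (2 : ℝ) ^ ((n : ℝ) * (H₂ i + ε + υ i - g i - sharedRate R₀ i - μ i))) +
      (2 * ρV i ^ n + √(2 ^ r * (2 : ℝ) ^ ((n : ℝ) * ((∑ j : Fin r with j.val < i.val + 1, g j) -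
        (∑ j : Fin r with j.val < i.val + 1, υ j) - HV i + ε)))), ?_, ?_⟩
  · intro i
    have t1 : ∀ {ρ : ℝ}, 0 ≤ ρ → ρ < 1 → Tendsto (fun n : ℕ => ρ ^ n) atTop (𝓝 0) :=
      fun h0 h1 => tendsto_pow_atTop_nhds_zero_of_lt_one h0 h1
    have t2 : ∀ {ρ : ℝ}, 0 ≤ ρ → ρ < 1 → Tendsto (fun n : ℕ => 2 * ρ ^ n) atTop (𝓝 0) :=
      fun h0 h1 => by simpa using (t1 h0 h1).const_mul 2
    have t3 : ∀ (C : ℝ) {c : ℝ}, c < 0 →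
        Tendsto (fun n : ℕ => √(C * (2 : ℝ) ^ ((n : ℝ) * c))) atTop (𝓝 0) := fun C c hc => by
      simpa using (tendsto_const_mul_two_rpow hc C).sqrt
    have c1 := hU i
    have c2 := h₁ i
    have c3 := h₂ i
    have c4 := hV i
    have := ((((t2 (hU0 i) (hU1 i)).add (t3 2 (by linarith :
        g i + sharedRate R₀ i + ε - HU i - υ i < 0))).add
      ((t1 (h₁0 i) (h₁1 i)).add (tendsto_const_mul_two_rpow (by linarith :
        H₁ i + ε + υ i - g i - sharedRate R₀ i - μ i < 0) 4))).add
      ((t1 (h₂0 i) (h₂1 i)).add (tendsto_const_mul_two_rpow (by linarith :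
        H₂ i + ε + υ i - g i - sharedRate R₀ i - μ i < 0) 4))).add
      ((t2 (hV0 i) (hV1 i)).add (t3 (2 ^ r) (by linarith :
        (∑ j : Fin r with j.val < i.val + 1, g j) -
        (∑ j : Fin r with j.val < i.val + 1, υ j) - HV i + ε < 0)))
    simpa using this
  · intro n i
    have hn : (0 : ℝ) ≤ n := Nat.cast_nonneg n
    have hGle : ∀ j, (⌈(2 : ℝ) ^ ((n : ℝ) * g j)⌉₊ : ℝ) ≤ 2 * (2 : ℝ) ^ ((n : ℝ) * g j) := fun j =>
      ceil_two_rpow_le (mul_nonneg hn (hg j))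
    have huge : ∀ j, 1 / (u n j : ℝ) ≤ (2 : ℝ) ^ (-((n : ℝ) * υ j)) := fun j => by
      rw [Real.rpow_neg (by norm_num), ← one_div]
      exact one_div_le_one_div_of_le (hpow _) (le_ceil_two_rpow _)
    have hule : (u n i : ℝ) ≤ 2 * (2 : ℝ) ^ ((n : ℝ) * υ i) :=
      ceil_two_rpow_le (mul_nonneg hn (hυ i))
    have hW1 := card_sharedSym_le (R₀ := R₀) n i
    have hW2 := le_card_sharedSym hR n i
    set Wn : ℝ := (Fintype.card (SharedSym r ⌊(2 : ℝ) ^ ((n : ℝ) * R₀)⌋₊ i) : ℝ) with hWn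
    have hW0 : 0 < Wn := by
      have := hpow ((n : ℝ) * sharedRate R₀ i)
      linarith
    have bS : ∀ H : ℝ, 1 / ((2 : ℝ) ^ (-(n * (H + ε))) * (π n (i.val + 1) / π n i.val) *
        ((⌈(2 : ℝ) ^ ((n : ℝ) * g i)⌉₊ : ℝ) * Wn * ⌈(2 : ℝ) ^ ((n : ℝ) * μ i)⌉₊)) ≤
        4 * (2 : ℝ) ^ ((n : ℝ) * (H + ε + υ i - g i - sharedRate R₀ i - μ i)) := by
      intro H
      have e1 : 4 * (2 : ℝ) ^ ((n : ℝ) * (H + ε + υ i - g i - sharedRate R₀ i - μ i)) =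
          (2 * (2 : ℝ) ^ ((n : ℝ) * υ i)) / ((2 : ℝ) ^ (-(n * (H + ε))) *
            ((2 : ℝ) ^ ((n : ℝ) * g i) * ((2 : ℝ) ^ ((n : ℝ) * sharedRate R₀ i) / 2) *
              (2 : ℝ) ^ ((n : ℝ) * μ i))) := by
        rw [eq_div_iff (by positivity)]
        have : (2 : ℝ) ^ ((n : ℝ) * υ i) =
            (2 : ℝ) ^ ((n : ℝ) * (H + ε + υ i - g i - sharedRate R₀ i - μ i)) *
              ((2 : ℝ) ^ (-(n * (H + ε))) * ((2 : ℝ) ^ ((n : ℝ) * g i) *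
              (2 : ℝ) ^ ((n : ℝ) * sharedRate R₀ i) * (2 : ℝ) ^ ((n : ℝ) * μ i))) := by
          rw [← Real.rpow_add two_pos, ← Real.rpow_add two_pos, ← Real.rpow_add two_pos,
            ← Real.rpow_add two_pos]
          congr 1
          ring
        rw [this]
        ring
      have e2 : 1 / ((2 : ℝ) ^ (-(n * (H + ε))) * (π n (i.val + 1) / π n i.val) *
          ((⌈(2 : ℝ) ^ ((n : ℝ) * g i)⌉₊ : ℝ) * Wn * ⌈(2 : ℝ) ^ ((n : ℝ) * μ i)⌉₊)) =
          (u n i : ℝ) / ((2 : ℝ) ^ (-(n * (H + ε))) *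
          ((⌈(2 : ℝ) ^ ((n : ℝ) * g i)⌉₊ : ℝ) * Wn * ⌈(2 : ℝ) ^ ((n : ℝ) * μ i)⌉₊)) := by
        have := (hu0 n i).ne'
        rw [hπs]
        field_simp
      rw [e1, e2]
      refine div_le_div₀ (by positivity) hule (by positivity) ?_
      refine mul_le_mul_of_nonneg_left ?_ (hpow _).le
      refine mul_le_mul (mul_le_mul (le_ceil_two_rpow _) (by linarith) (by positivity)
        (Nat.cast_nonneg _)) (le_ceil_two_rpow _) (by positivity) (by positivity)
    refine add_le_add (add_le_add (add_le_add (add_le_add ?_ (Real.sqrt_le_sqrt ?_))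
      (add_le_add ?_ ?_)) (add_le_add ?_ ?_)) (add_le_add ?_ (Real.sqrt_le_sqrt ?_))
    · refine mul_le_mul_of_nonneg_left ?_ (by norm_num)
      have hker := fun w w' => truncate_blockEquiv_pair_iff (u := u n) (Nat.le_succ i.val)
        (g := fun w : BlockSpace X₁ X₂ Y₁ Y₂ m n (u n) => w.2.1) (g₀ := fun w => x w) (fun w w' => by
          simp only [blockEquiv, Equiv.coe_fn_mk, Prod.mk.injEq, funext_iff, x, x₁, x₂]
          exact forall_and.symm) w w'
      exact hUt i n (u n) _ _ (i.val + 1) i.val (fun w w' => (hker w w').1)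
        (fun w w' => (hker w w').2)
    · beta_reduce
      rw [Fintype.card_prod, Fintype.card_fin, Nat.cast_mul, hπs, ← hWn]
      calc (⌈(2 : ℝ) ^ ((n : ℝ) * g i)⌉₊ : ℝ) * Wn *
            ((2 : ℝ) ^ (-(n * (HU i - ε))) * (1 / (u n i : ℝ)))
          ≤ (2 * (2 : ℝ) ^ ((n : ℝ) * g i)) * (2 : ℝ) ^ ((n : ℝ) * sharedRate R₀ i) *
            ((2 : ℝ) ^ (-(n * (HU i - ε))) * (2 : ℝ) ^ (-((n : ℝ) * υ i))) := by
            refine mul_le_mul (mul_le_mul (hGle i) hW1 hW0.le (by positivity))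
              (mul_le_mul_of_nonneg_left (huge i) (hpow _).le) ?_ (by positivity)
            have := hu0 n i
            positivity
        _ = _ := by
            rw [mul_assoc 2, mul_assoc 2, ← Real.rpow_add two_pos, ← Real.rpow_add two_pos,
              ← Real.rpow_add two_pos]
            congr 2
            ring
    · have hker := fun w w' => truncate_blockEquiv_pair_iff (u := u n) (Nat.le_succ i.val)
        (g := fun w : BlockSpace X₁ X₂ Y₁ Y₂ m n (u n) =>
          (Sum.inl w.2.1.1 : (Fin n → X₁) ⊕ (Fin n → X₂))) (g₀ := fun w => x₁ w) (fun w w' => by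
          simp only [blockEquiv, Equiv.coe_fn_mk, Sum.inl.injEq, funext_iff, x₁]) w w'
      exact h₁t i n (u n) _ _ (i.val + 1) i.val (fun w w' => (hker w w').1)
        (fun w w' => (hker w w').2)
    · rw [Fintype.card_prod, Fintype.card_prod, Fintype.card_fin, Fintype.card_fin ⌈_⌉₊,
        Nat.cast_mul, Nat.cast_mul, ← hWn]
      exact bS _
    · have hker := fun w w' => truncate_blockEquiv_pair_iff (u := u n) (Nat.le_succ i.val)
        (g := fun w : BlockSpace X₁ X₂ Y₁ Y₂ m n (u n) =>
          (Sum.inr w.2.1.2 : (Fin n → X₁) ⊕ (Fin n → X₂))) (g₀ := fun w => x₂ w) (fun w w' => by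
          simp only [blockEquiv, Equiv.coe_fn_mk, Sum.inr.injEq, funext_iff, x₂]) w w'
      exact h₂t i n (u n) _ _ (i.val + 1) i.val (fun w w' => (hker w w').1)
        (fun w w' => (hker w w').2)
    · rw [Fintype.card_prod, Fintype.card_prod, Fintype.card_fin, Fintype.card_fin ⌈_⌉₊,
        Nat.cast_mul, Nat.cast_mul, ← hWn]
      exact bS _
    · refine mul_le_mul_of_nonneg_left ?_ (by norm_num)
      have hker := fun w w' => truncate_blockEquiv_snd_iff (X₁ := X₁) (X₂ := X₂) (Y₁ := Y₁)
        (Y₂ := Y₂) (m := m) (n := n) (u := u n) (i.val + 1) w w'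
      exact hVt i n (u n) _ _ (i.val + 1) 0 (fun w w' => (hker w w').1) (fun w w' => (hker w w').2)
    · beta_reduce
      rw [hπz, div_one]
      simp only [Fintype.card_fin]
      calc (⌈(2 : ℝ) ^ ((n : ℝ) * g i)⌉₊ : ℝ) * ((2 : ℝ) ^ (-(n * (HV i - ε))) * π n (i.val + 1) *
            ∏ j : Fin r with j.val < i.val, (⌈(2 : ℝ) ^ ((n : ℝ) * g j)⌉₊ : ℝ))
          = (2 : ℝ) ^ (-(n * (HV i - ε))) * ∏ j : Fin r with j.val < i.val + 1,
              ((⌈(2 : ℝ) ^ ((n : ℝ) * g j)⌉₊ : ℝ) * (1 / (u n j : ℝ))) := by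
            rw [Finset.prod_mul_distrib,
              prod_filter_lt_succ i fun j => (⌈(2 : ℝ) ^ ((n : ℝ) * g j)⌉₊ : ℝ)]
            ring
        _ ≤ (2 : ℝ) ^ (-(n * (HV i - ε))) * ∏ j : Fin r with j.val < i.val + 1,
              (2 * (2 : ℝ) ^ ((n : ℝ) * (g j - υ j))) := by
            refine mul_le_mul_of_nonneg_left (Finset.prod_le_prod (fun j _ => ?_) fun j _ => ?_)
              (hpow _).le
            · exact mul_nonneg (Nat.cast_nonneg _) (one_div_nonneg.2 (hu0 n j).le)
            · refine (mul_le_mul (hGle j) (huge j) (one_div_nonneg.2 (hu0 n j).le)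
                (by positivity)).trans (le_of_eq ?_)
              rw [mul_assoc, ← Real.rpow_add two_pos]
              congr 2
              ring
        _ = 2 ^ (Finset.univ.filter fun j : Fin r => j.val < i.val + 1).card *
              (2 : ℝ) ^ ((n : ℝ) * ((∑ j : Fin r with j.val < i.val + 1, g j) -
                (∑ j : Fin r with j.val < i.val + 1, υ j) - HV i + ε)) := by
            rw [Finset.prod_mul_distrib, Finset.prod_const, ← Real.rpow_sum_of_pos two_pos,
              mul_left_comm, ← Real.rpow_add two_pos, ← Finset.mul_sum, Finset.sum_sub_distrib]
            congr 2
            ring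
        _ ≤ _ := by
            refine mul_le_mul_of_nonneg_right (pow_le_pow_right₀ (by norm_num) ?_) (hpow _).le
            exact (Finset.card_le_univ _).trans (by simp)

end Rates

/-! ### From exponents to codes. -/

section Achievability

open AuxSpace Filter Topology

lemma logb_ceil_two_rpow_le {x : ℝ} (hx : 0 ≤ x) : Real.logb 2 (⌈(2 : ℝ) ^ x⌉₊ : ℝ) ≤ x + 1 := by
  have h1 : (⌈(2 : ℝ) ^ x⌉₊ : ℝ) ≤ (2 : ℝ) ^ (x + 1) := by
    rw [Real.rpow_add two_pos, Real.rpow_one, mul_comm]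
    exact ceil_two_rpow_le hx
  have h0 : (0 : ℝ) < (⌈(2 : ℝ) ^ x⌉₊ : ℝ) :=
    lt_of_lt_of_le (Real.rpow_pos_of_pos two_pos x) (Nat.le_ceil _)
  calc Real.logb 2 (⌈(2 : ℝ) ^ x⌉₊ : ℝ) ≤ Real.logb 2 ((2 : ℝ) ^ (x + 1)) :=
        Real.logb_le_logb_of_le (by norm_num) h0 h1
    _ = x + 1 := Real.logb_rpow two_pos (by norm_num)

variable {X₁ X₂ Y₁ Y₂ : Type*} [Fintype X₁] [Fintype X₂] [Fintype Y₁] [Fintype Y₂] {r n N : ℕ}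

/-- Rounding the alphabet up costs at most one bit per message, hence at most `r` bits per block. -/
lemma Code.sum_entropy_message_le (K : Code X₁ X₂ Y₁ Y₂ r n N) {qX : X₁ × X₂ → ℝ}
    (hq : qX ∈ stdSimplex ℝ (X₁ × X₂)) (hN : 0 < N) [Nonempty X₁] [Nonempty X₂]
    (hn : 0 < n) {μ : Fin r → ℝ} (hμ : ∀ i, 0 ≤ μ i)
    (hK : ∀ i, K.size i = ⌈(2 : ℝ) ^ ((n : ℝ) * μ i)⌉₊) (s : Finset (Fin r)) :
    (1 / (n : ℝ)) * ∑ i ∈ s, entropy (K.induced qX) (K.message i) ≤ ∑ i ∈ s, μ i + r / n := by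
  have hn' : (0 : ℝ) < n := by exact_mod_cast hn
  have hp := K.induced_mem_stdSimplex hq hN
  have h : ∑ i ∈ s, entropy (K.induced qX) (K.message i) ≤ ∑ i ∈ s, ((n : ℝ) * μ i + 1) := by
    refine Finset.sum_le_sum fun i _ => (entropy_le_logb_card hp _).trans ?_
    rw [Fintype.card_fin, hK i]
    exact logb_ceil_two_rpow_le (mul_nonneg hn'.le (hμ i))
  have hc : (s.card : ℝ) ≤ r := by exact_mod_cast (s.card_le_univ).trans_eq (Fintype.card_fin r)
  rw [Finset.sum_add_distrib, ← Finset.mul_sum] at h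
  simp only [Finset.sum_const, nsmul_eq_mul, mul_one] at h
  rw [one_div, inv_mul_le_iff₀ hn', mul_add, mul_div_cancel₀ _ hn'.ne']
  linarith

lemma Code.sum_entropy_message_eq_zero (K : Code X₁ X₂ Y₁ Y₂ r n N) {qX : X₁ × X₂ → ℝ}
    (hq : qX ∈ stdSimplex ℝ (X₁ × X₂)) (hN : 0 < N) [Nonempty X₁] [Nonempty X₂]
    (hK : ∀ i, K.size i = 1) (s : Finset (Fin r)) :
    (1 / (n : ℝ)) * ∑ i ∈ s, entropy (K.induced qX) (K.message i) = 0 := by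
  have hp := K.induced_mem_stdSimplex hq hN
  rw [Finset.sum_eq_zero fun i _ => ?_, mul_zero]
  refine le_antisymm ((entropy_le_logb_card hp _).trans ?_) (entropy_nonneg hp _)
  rw [Fintype.card_fin, hK i]
  simp

variable [NeZero r] {m : Fin r → ℕ} [∀ i, Nonempty (Fin (m i))] {p : AuxSpace X₁ X₂ Y₁ Y₂ m → ℝ} {qX : X₁ × X₂ → ℝ}
  {W : X₁ × X₂ → Y₁ × Y₂ → ℝ}

/-- Achievability in terms of the rates of the random binning: `υ` of the local randomness, `g` of
the bins that are fixed by the derandomization, and `μ` of the messages. -/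
theorem achievable_of_rates (hq : qX ∈ stdSimplex ℝ (X₁ × X₂))
    (hW : ∀ x, W x ∈ stdSimplex ℝ (Y₁ × Y₂)) (h : IsAdmissible qX W m p) {R₀ R₁₂ R₂₁ ε : ℝ}
    (hR : 0 ≤ R₀) (hε : 0 < ε) {υ g μ : Fin r → ℝ} (hυ : ∀ i, 0 ≤ υ i) (hg : ∀ i, 0 ≤ g i)
    (hμ : ∀ i, 0 ≤ μ i)
    (hU : ∀ i : Fin r, g i + sharedRate R₀ i + ε <
      condEntropy p (fun w => truncate (i.val + 1) w.1) (fun w => (truncate i.val w.1, x w)) + υ i)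
    (h₁ : ∀ i : Fin r,
      condEntropy p (fun w => truncate (i.val + 1) w.1) (fun w => (truncate i.val w.1, x₁ w)) +
        ε + υ i < g i + sharedRate R₀ i + μ i)
    (h₂ : ∀ i : Fin r,
      condEntropy p (fun w => truncate (i.val + 1) w.1) (fun w => (truncate i.val w.1, x₂ w)) +
        ε + υ i < g i + sharedRate R₀ i + μ i)
    (hV : ∀ i : Fin r, (∑ j : Fin r with j.val < i.val + 1, g j) + ε <
      condEntropy p (fun w => truncate (i.val + 1) w.1) (fun w => (x w, y w)) +
        ∑ j : Fin r with j.val < i.val + 1, υ j)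
    (h₁₂ : ∑ i : Fin r with Even i.val, μ i < R₁₂) (h₂₁ : ∑ i : Fin r with Odd i.val, μ i < R₂₁) :
    Achievable r qX W (R₀, R₁₂, R₂₁) := by
  obtain ⟨w⟩ : Nonempty (AuxSpace X₁ X₂ Y₁ Y₂ m) := by
    by_contra hw
    rw [not_nonempty_iff] at hw
    simpa using h.isPMF.2
  have : Nonempty X₁ := ⟨w.2.1⟩
  have : Nonempty X₂ := ⟨w.2.2.1⟩
  have : Nonempty Y₁ := ⟨w.2.2.2.1⟩
  have : Nonempty Y₂ := ⟨w.2.2.2.2⟩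
  obtain ⟨Φ⟩ := h.nonempty_factorization hW
  have hR₁₂ : 0 ≤ R₁₂ := (Finset.sum_nonneg fun i _ => hμ i).trans h₁₂.le
  have hR₂₁ : 0 ≤ R₂₁ := (Finset.sum_nonneg fun i _ => hμ i).trans h₂₁.le
  have hN : ∀ n : ℕ, 0 < ⌊(2 : ℝ) ^ ((n : ℝ) * R₀)⌋₊ := fun n =>
    Nat.floor_pos.2 (Real.one_le_rpow (by norm_num) (by positivity))
  obtain ⟨θ, θ₁, θ₂, θ', hθ, hθ₁, hθ₂, hθ', δ, hδ, hb⟩ :=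
    exists_binningBound_le h.isPMF hR hε hυ hg hU h₁ h₂ hV
  have hcode : ∀ n : ℕ, ∃ K : Code X₁ X₂ Y₁ Y₂ r n ⌊(2 : ℝ) ^ ((n : ℝ) * R₀)⌋₊,
      (∀ i, K.size i = ⌈(2 : ℝ) ^ ((n : ℝ) * μ i)⌉₊) ∧
      tvDist (law (K.induced qX) K.inputOutput) (target qX W n) ≤ 3 * ∑ i, δ i n := fun n => by
    have : ∀ c : ℝ, NeZero ⌈(2 : ℝ) ^ ((n : ℝ) * c)⌉₊ := fun c => neZero_ceil_two_rpow _
    obtain ⟨K, hK, hd⟩ := exists_code hq h Φ n (fun i => ⌈(2 : ℝ) ^ ((n : ℝ) * υ i)⌉₊)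
      (fun i => ⌈(2 : ℝ) ^ ((n : ℝ) * g i)⌉₊) (fun i => ⌈(2 : ℝ) ^ ((n : ℝ) * μ i)⌉₊) (hN n)
      (hθ n) (hθ₁ n) (hθ₂ n) (hθ' n)
    exact ⟨K, fun i => by rw [hK], hd.trans (mul_le_mul_of_nonneg_left
      (Finset.sum_le_sum fun i _ => hb n i) (by norm_num))⟩
  -- The rate constraints bind at every block length, but for small n the rounding may violate them.
  -- There a code with one-letter messages is used, whose simulation quality is irrelevant in the
  -- limit.
  have hsilent : ∀ n : ℕ, ∃ K : Code X₁ X₂ Y₁ Y₂ r n ⌊(2 : ℝ) ^ ((n : ℝ) * R₀)⌋₊,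
      ∀ i, K.size i = 1 := fun n => by
    obtain ⟨K, hK, -⟩ := exists_code hq h Φ n (fun _ => 1) (fun _ => 1) (fun _ => 1) (hN n)
      (θ := fun _ => 1) (θ₁ := fun _ => 1) (θ₂ := fun _ => 1) (θ' := fun _ => 1)
      (fun _ => one_pos) (fun _ => one_pos) (fun _ => one_pos) (fun _ => one_pos)
    exact ⟨K, fun i => by rw [hK]⟩
  choose K hK hKd using hcode
  choose L hL using hsilent
  have hlim : ∀ a b : ℝ, a < b → ∀ᶠ n : ℕ in atTop, a + (r : ℝ) / n < b := fun a b hab => by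
    have : Tendsto (fun n : ℕ => a + (r : ℝ) / n) atTop (𝓝 (a + 0)) :=
      tendsto_const_nhds.add (tendsto_const_div_atTop_nhds_zero_nat _)
    rw [add_zero] at this
    exact this.eventually_lt_const hab
  obtain ⟨n₀, hn₀⟩ := eventually_atTop.1 ((hlim _ _ h₁₂).and (hlim _ _ h₂₁))
  refine ⟨hR, hR₁₂, hR₂₁, fun n => if n₀ ≤ n then K n else L n, fun n hn => ?_, ?_⟩
  · beta_reduce
    split_ifs with hnn
    · exact ⟨((K n).sum_entropy_message_le hq (hN n) hn hμ (hK n) _).trans (hn₀ n hnn).1.le,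
        ((K n).sum_entropy_message_le hq (hN n) hn hμ (hK n) _).trans (hn₀ n hnn).2.le⟩
    · exact ⟨((L n).sum_entropy_message_eq_zero hq (hN n) (hL n) _).trans_le hR₁₂,
        ((L n).sum_entropy_message_eq_zero hq (hN n) (hL n) _).trans_le hR₂₁⟩
  · have hlim0 : Tendsto (fun n => 3 * ∑ i, δ i n) atTop (𝓝 0) := by
      simpa using (tendsto_finsetSum Finset.univ fun i _ => hδ i).const_mul 3
    refine tendsto_of_tendsto_of_tendsto_of_le_of_le' tendsto_const_nhds hlim0
      (Eventually.of_forall fun n => tvDist_nonneg _ _) ?_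
    filter_upwards [eventually_ge_atTop n₀] with n hnn
    have key : ∀ C, C = K n →
        tvDist (law (C.induced qX) C.inputOutput) (target qX W n) ≤ 3 * ∑ i, δ i n := by
      rintro _ rfl
      exact hKd n
    exact key _ (if_pos hnn)

end Achievability

/-! ### Choice of the rates. -/

section Bookkeeping

open AuxSpace

variable {X₁ X₂ Y₁ Y₂ : Type*} [Fintype X₁] [Fintype X₂] [Fintype Y₁] [Fintype Y₂] {r : ℕ}
  {m : Fin r → ℕ} [∀ i, Nonempty (Fin (m i))] {p : AuxSpace X₁ X₂ Y₁ Y₂ m → ℝ}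
  {β γ : Type*} [Fintype β] [Fintype γ]

/-- The joint entropy of a variable and of the auxiliary variables of the first `s` rounds. -/
noncomputable def prefixEntropy (p : AuxSpace X₁ X₂ Y₁ Y₂ m → ℝ) (B : AuxSpace X₁ X₂ Y₁ Y₂ m → β)
    (s : ℕ) : ℝ :=
  entropy p fun w => (truncate s w.1, B w)

lemma prefixEntropy_zero (B : AuxSpace X₁ X₂ Y₁ Y₂ m → β) : prefixEntropy p B 0 = entropy p B :=
  entropy_congr_ker p fun w w' => by simp [truncate_eq_iff]

lemma prefixEntropy_top (B : AuxSpace X₁ X₂ Y₁ Y₂ m → β) :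
    prefixEntropy p B r = entropy p fun w => (F w, B w) := by
  simp only [prefixEntropy, truncate_of_le le_rfl, F]

lemma condEntropy_truncate_succ (B : AuxSpace X₁ X₂ Y₁ Y₂ m → β) (s : ℕ) :
    condEntropy p (fun w => truncate (s + 1) w.1) (fun w => (truncate s w.1, B w)) =
      prefixEntropy p B (s + 1) - prefixEntropy p B s := by
  rw [condEntropy, prefixEntropy, prefixEntropy]
  congr 1
  refine entropy_congr_ker p fun w w' => ?_
  simp only [Prod.mk.injEq, truncate_eq_iff]
  exact ⟨fun h => ⟨h.1, h.2.2⟩, fun h => ⟨h.1, fun j hj => h.1 j (hj.trans s.lt_succ_self), h.2⟩⟩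

lemma condEntropy_truncate (B : AuxSpace X₁ X₂ Y₁ Y₂ m → β) (s : ℕ) :
    condEntropy p (fun w => truncate s w.1) B = prefixEntropy p B s - prefixEntropy p B 0 := by
  rw [condEntropy, prefixEntropy_zero, prefixEntropy]

lemma prefixEntropy_mono (hp : ∀ w, 0 ≤ p w) (B : AuxSpace X₁ X₂ Y₁ Y₂ m → β) (s : ℕ) :
    prefixEntropy p B s ≤ prefixEntropy p B (s + 1) :=
  entropy_mono hp fun w w' h => by
    simp only [Prod.mk.injEq, truncate_eq_iff] at h ⊢
    exact ⟨fun j hj => h.1 j (hj.trans s.lt_succ_self), h.2⟩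

/-- Conditioning on more reduces the entropy of a round. -/
lemma prefixEntropy_sub_le (hp : ∀ w, 0 ≤ p w) {B : AuxSpace X₁ X₂ Y₁ Y₂ m → β}
    {C : AuxSpace X₁ X₂ Y₁ Y₂ m → γ} (hBC : ∀ w w', C w' = C w → B w' = B w) (s : ℕ) :
    prefixEntropy p C (s + 1) - prefixEntropy p C s ≤
      prefixEntropy p B (s + 1) - prefixEntropy p B s := by
  have h := entropy_submodular hp (fun w => truncate (s + 1) w.1) C
    (fun w => (truncate s w.1, B w))
  have mono : ∀ {w w' : AuxSpace X₁ X₂ Y₁ Y₂ m}, (∀ j : Fin r, j.val < s + 1 → w'.1 j = w.1 j) →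
    ∀ j : Fin r, j.val < s → w'.1 j = w.1 j := fun h j hj => h j (hj.trans s.lt_succ_self)
  have e₁ := entropy_congr_ker p
    (A := fun w => (truncate (s + 1) w.1, C w, (truncate s w.1, B w)))
    (B := fun w => (truncate (s + 1) w.1, C w)) fun w w' => by
      simp only [Prod.mk.injEq, truncate_eq_iff]
      exact ⟨fun h => ⟨h.1, h.2.1⟩, fun h => ⟨h.1, h.2, mono h.1, hBC w w' h.2⟩⟩
  have e₂ := entropy_congr_ker p
    (A := fun w => (truncate (s + 1) w.1, (truncate s w.1, B w)))
    (B := fun w => (truncate (s + 1) w.1, B w)) fun w w' => by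
      simp only [Prod.mk.injEq, truncate_eq_iff]
      exact ⟨fun h => ⟨h.1, h.2.2⟩, fun h => ⟨h.1, mono h.1, h.2⟩⟩
  have e₃ := entropy_congr_ker p
    (A := fun w => (C w, (truncate s w.1, B w)))
    (B := fun w => (truncate s w.1, C w)) fun w w' => by
      simp only [Prod.mk.injEq, truncate_eq_iff]
      exact ⟨fun h => ⟨h.2.1, h.1⟩, fun h => ⟨h.2, h.1, hBC w w' h.2⟩⟩
  rw [e₁, e₂, e₃] at h
  simp only [prefixEntropy]
  linarith

/-- Under the Markov chain of a round, the other source does not matter given one's own. -/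
lemma prefixEntropy_sub_eq (hp : ∀ w, 0 ≤ p w) (i : Fin r) {B : AuxSpace X₁ X₂ Y₁ Y₂ m → β}
    {C : AuxSpace X₁ X₂ Y₁ Y₂ m → γ} (h : IsMarkov p (Fi i) (fun w => (past (F w) i, B w)) C) :
    prefixEntropy p (fun w => (B w, C w)) (i.val + 1) - prefixEntropy p (fun w => (B w, C w)) i.val =
      prefixEntropy p B (i.val + 1) - prefixEntropy p B i.val := by
  have hm := entropy_markov hp h
  have hpast : ∀ w w' : AuxSpace X₁ X₂ Y₁ Y₂ m, past (F w') i = past (F w) i ↔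
      truncate i.val w'.1 = truncate i.val w.1 := fun w w' => by
    rw [past_eq_iff, truncate_eq_iff]
    rfl
  have hsucc : ∀ w w' : AuxSpace X₁ X₂ Y₁ Y₂ m, truncate (i.val + 1) w'.1 = truncate (i.val + 1) w.1 ↔
      Fi i w' = Fi i w ∧ past (F w') i = past (F w) i := fun w w' => by
    rw [past_eq_iff, truncate_eq_iff]
    refine ⟨fun h => ⟨h i i.val.lt_succ_self, fun j hj => h j (Nat.lt_succ_of_lt hj)⟩,
      fun h j hj => ?_⟩
    rcases (Nat.lt_succ_iff.1 hj).eq_or_lt with e | e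
    · rw [Fin.ext e]
      exact h.1
    · exact h.2 j e
  have e₁ : entropy p (fun w => (Fi i w, (past (F w) i, B w), C w)) =
      prefixEntropy p (fun w => (B w, C w)) (i.val + 1) := entropy_congr_ker p fun w w' => by
    simp only [Prod.mk.injEq, hsucc]
    tauto
  have e₂ : entropy p (fun w => (past (F w) i, B w)) = prefixEntropy p B i.val :=
    entropy_congr_ker p fun w w' => by simp only [Prod.mk.injEq, hpast]
  have e₃ : entropy p (fun w => (Fi i w, (past (F w) i, B w))) = prefixEntropy p B (i.val + 1) :=
    entropy_congr_ker p fun w w' => by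
      simp only [Prod.mk.injEq, hsucc]
      tauto
  have e₄ : entropy p (fun w => ((past (F w) i, B w), C w)) =
      prefixEntropy p (fun w => (B w, C w)) i.val := entropy_congr_ker p fun w w' => by
    simp only [Prod.mk.injEq, hpast]
    tauto
  rw [e₁, e₂, e₃, e₄] at hm
  linarith

lemma condMutualInfo_F_left (A : AuxSpace X₁ X₂ Y₁ Y₂ m → β) (B : AuxSpace X₁ X₂ Y₁ Y₂ m → γ) :
    condMutualInfo p F A B = (prefixEntropy p B r - prefixEntropy p B 0) -
      (prefixEntropy p (fun w => (A w, B w)) r - prefixEntropy p (fun w => (A w, B w)) 0) := by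
  simp only [condMutualInfo, condEntropy, prefixEntropy_zero, prefixEntropy_top]

lemma prefixEntropy_congr_ker {B : AuxSpace X₁ X₂ Y₁ Y₂ m → β} {C : AuxSpace X₁ X₂ Y₁ Y₂ m → γ}
    (h : ∀ w w', B w' = B w ↔ C w' = C w) (s : ℕ) : prefixEntropy p B s = prefixEntropy p C s :=
  entropy_congr_ker p fun w w' => by simp only [Prod.mk.injEq, h]

lemma condMutualInfo_first [NeZero r] (A : AuxSpace X₁ X₂ Y₁ Y₂ m → β)
    (B : AuxSpace X₁ X₂ Y₁ Y₂ m → γ) :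
    condMutualInfo p (Fi 0) A B = (prefixEntropy p B 1 - prefixEntropy p B 0) -
      (prefixEntropy p (fun w => (A w, B w)) 1 - prefixEntropy p (fun w => (A w, B w)) 0) := by
  have hk : ∀ w w' : AuxSpace X₁ X₂ Y₁ Y₂ m,
      Fi 0 w' = Fi 0 w ↔ truncate 1 w'.1 = truncate 1 w.1 := fun w w' => by
    rw [truncate_eq_iff]
    refine ⟨fun h j hj => ?_, fun h => h 0 (by simp)⟩
    rw [show j = 0 from Fin.ext (by simpa using hj)]
    exact h
  simp only [condMutualInfo, condEntropy, prefixEntropy_zero]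
  congr 2
  · exact entropy_congr_ker p fun w w' => by simp only [Prod.mk.injEq, hk]
  · exact entropy_congr_ker p fun w w' => by simp only [Prod.mk.injEq, hk]

lemma sum_filter_lt_sub (f : ℕ → ℝ) {s : ℕ} (hs : s ≤ r) :
    ∑ j : Fin r with j.val < s, (f (j.val + 1) - f j.val) = f s - f 0 := by
  rw [Finset.sum_filter,
    Fin.sum_univ_eq_sum_range (fun j => if j < s then f (j + 1) - f j else 0) r,
    ← Finset.sum_filter, ← Finset.sum_range_sub]
  refine Finset.sum_congr (Finset.ext fun j => ?_) fun _ _ => rfl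
  simp only [Finset.mem_filter, Finset.mem_range]
  exact ⟨fun h => h.2, fun h => ⟨h.trans_le hs, h⟩⟩

lemma sum_univ_sub (f : ℕ → ℝ) : ∑ j : Fin r, (f (j.val + 1) - f j.val) = f r - f 0 := by
  rw [← sum_filter_lt_sub f (le_refl r), Finset.filter_true_of_mem fun j _ => j.2]

/-- Not an equality, since the index `k` may be absent: for `r = 1` there is no second round. -/
lemma sum_ite_val_le {c : ℝ} (hc : 0 ≤ c) (k : ℕ) (s : Finset (Fin r)) :
    ∑ i ∈ s, (if i.val = k then c else 0) ≤ c := by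
  refine (Finset.sum_le_univ_sum_of_nonneg fun i => by split_ifs <;> simp [hc]).trans ?_
  rw [Fin.sum_univ_eq_sum_range (fun j => if j = k then c else 0) r, Finset.sum_ite_eq']
  split_ifs <;> simp [hc]

open Filter Topology in
/-- Every tuple of the single-letter region becomes achievable after an arbitrarily small increase
of the communication rates. -/
theorem achievable_add [NeZero r] {qX : X₁ × X₂ → ℝ} {W : X₁ × X₂ → Y₁ × Y₂ → ℝ}
    (hq : qX ∈ stdSimplex ℝ (X₁ × X₂)) (hW : ∀ x, W x ∈ stdSimplex ℝ (Y₁ × Y₂))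
    (h : IsAdmissible qX W m p) {R₀ R₁₂ R₂₁ δ : ℝ} (hδ : 0 < δ) (hR : 0 ≤ R₀)
    (hA : condMutualInfo p x₁ F x₂ ≤ R₁₂) (hB : condMutualInfo p x₂ F x₁ ≤ R₂₁)
    (hC : condMutualInfo p x₁ F x₂ + condMutualInfo p (Fi 0) y x ≤ R₀ + R₁₂)
    (hD : condMutualInfo p x₁ F x₂ + condMutualInfo p x₂ F x₁ + condMutualInfo p F y x ≤
      R₀ + R₁₂ + R₂₁) :
    Achievable r qX W (R₀, R₁₂ + δ, R₂₁ + δ) := by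
  have hp := h.isPMF.1
  set E := prefixEntropy p x with hE
  set E₁ := prefixEntropy p x₁ with hE₁
  set E₂ := prefixEntropy p x₂ with hE₂
  set V := prefixEntropy p (fun w => (x w, y w)) with hVdef
  have hxy : prefixEntropy p (fun w => (y w, x w)) = V :=
    funext fun s => prefixEntropy_congr_ker (fun w w' => by simp only [Prod.mk.injEq]; tauto) s
  have hx' : prefixEntropy p (fun w => (x₂ w, x₁ w)) = E :=
    funext fun s => prefixEntropy_congr_ker (fun w w' => by simp only [x, Prod.mk.injEq]; tauto) s
  have hx : prefixEntropy p (fun w => (x₁ w, x₂ w)) = E := rfl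
  rw [condMutualInfo_comm p x₁, condMutualInfo_F_left, hx] at hA hC hD
  rw [condMutualInfo_comm p x₂, condMutualInfo_F_left, hx'] at hB hD
  rw [condMutualInfo_first, hxy] at hC
  rw [condMutualInfo_F_left (p := p) y x, hxy] at hD
  simp only [← hE, ← hE₁, ← hE₂] at hA hB hC hD
  have hEmono : ∀ s, 0 ≤ E (s + 1) - E s := fun s => sub_nonneg.2 (prefixEntropy_mono hp _ s)
  have hle₁ : ∀ s, E (s + 1) - E s ≤ E₁ (s + 1) - E₁ s := fun s =>
    prefixEntropy_sub_le hp (fun w w' hw => congrArg Prod.fst hw) s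
  have hle₂ : ∀ s, E (s + 1) - E s ≤ E₂ (s + 1) - E₂ s := fun s =>
    prefixEntropy_sub_le hp (fun w w' hw => congrArg Prod.snd hw) s
  have hleV : ∀ s, V (s + 1) - V s ≤ E (s + 1) - E s := fun s =>
    prefixEntropy_sub_le hp (fun w w' hw => congrArg Prod.fst hw) s
  have heven : ∀ i : Fin r, Even i.val → E₁ (i.val + 1) - E₁ i.val = E (i.val + 1) - E i.val :=
    fun i hi => by
      rw [← hx]
      exact (prefixEntropy_sub_eq hp i (h.markov_odd_round i hi)).symm
  have hodd : ∀ i : Fin r, Odd i.val → E₂ (i.val + 1) - E₂ i.val = E (i.val + 1) - E i.val :=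
    fun i hi => by
      rw [← hx']
      exact (prefixEntropy_sub_eq hp i (h.markov_even_round i hi)).symm
  have hVE : Monotone fun s => E s - V s := monotone_nat_of_le_succ fun s => by
    have := hleV s
    linarith
  set A := E₂ r - E₂ 0 - (E r - E 0) with hAdef
  set B := E₁ r - E₁ 0 - (E r - E 0) with hBdef
  have hsumA : ∑ i : Fin r, ((E₂ (i.val + 1) - E₂ i.val) - (E (i.val + 1) - E i.val)) = A := by
    rw [Finset.sum_sub_distrib, sum_univ_sub E₂, sum_univ_sub E]
  have hsumB : ∑ i : Fin r, ((E₁ (i.val + 1) - E₁ i.val) - (E (i.val + 1) - E i.val)) = B := by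
    rw [Finset.sum_sub_distrib, sum_univ_sub E₁, sum_univ_sub E]
  have hr : (0 : ℝ) < r := by exact_mod_cast NeZero.pos r
  -- Each of at most `r` messages carries a slack of `4 * ε`, together at most `δ / 2`.
  set ε := δ / (8 * r) with hεdef
  have hε : 0 < ε := by positivity
  have hεr : (r : ℝ) * (4 * ε) = δ / 2 := by
    rw [hεdef]
    field_simp
    norm_num
  -- The unused communication rates, spent in the first round of each terminal; surplus message bits
  -- convey fresh local randomness.
  set e : Fin r → ℝ := fun i =>
    (if i.val = 0 then R₁₂ - A else 0) + if i.val = 1 then R₂₁ - B else 0 with hedef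
  have he : ∀ i, 0 ≤ e i := fun i => by
    have h1 := sub_nonneg.2 hA
    have h2 := sub_nonneg.2 hB
    simp only [hedef]
    split_ifs <;> linarith
  have hw : ∀ i : Fin r, 0 ≤ sharedRate R₀ i := fun i => by
    unfold sharedRate
    split_ifs <;> simp [hR]
  have hsum4 : ∀ s : Finset (Fin r), ∑ _i ∈ s, 4 * ε ≤ δ / 2 := fun s => by
    rw [Finset.sum_const, nsmul_eq_mul, ← hεr]
    refine mul_le_mul_of_nonneg_right ?_ (by positivity)
    exact_mod_cast (s.card_le_univ).trans_eq (Fintype.card_fin r)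
  have hE12 : ∑ i : Fin r with Even i.val, e i ≤ R₁₂ - A := by
    refine le_trans (Finset.sum_le_sum fun i hi => ?_)
      (sum_ite_val_le (sub_nonneg.2 hA) 0 (Finset.univ.filter fun i : Fin r => Even i.val))
    have hi1 : i.val ≠ 1 := fun h1 => by
      have := (Finset.mem_filter.1 hi).2
      rw [h1] at this
      exact absurd this (by decide)
    simp only [hedef, if_neg hi1, add_zero, le_refl]
  have hE21 : ∑ i : Fin r with Odd i.val, e i ≤ R₂₁ - B := by
    refine le_trans (Finset.sum_le_sum fun i hi => ?_)
      (sum_ite_val_le (sub_nonneg.2 hB) 1 (Finset.univ.filter fun i : Fin r => Odd i.val))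
    have hi0 : i.val ≠ 0 := fun h0 => by
      have := (Finset.mem_filter.1 hi).2
      rw [h0] at this
      exact absurd this (by decide)
    simp only [hedef, if_neg hi0, zero_add, le_refl]
  -- The shared bins will take the whole entropy of the round given the past and both inputs. Local
  -- randomness must therefore make up for the common randomness and, by choice, for the surplus
  -- message bits.
  set υ : Fin r → ℝ := fun i => 2 * ε + sharedRate R₀ i + e i with hυdef
  have hυ : ∀ i, 0 ≤ υ i := fun i => by
    have := hw i
    have := he i
    simp only [hυdef]
    linarith
  -- The Slepian–Wolf rate of the round: the uncertainty of the listener beyond that of somebody who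
  -- knows both sources. The speaker has no such excess, by the Markov chain.
  set d : Fin r → ℝ := fun i => if Even i.val
    then (E₂ (i.val + 1) - E₂ i.val) - (E (i.val + 1) - E i.val)
    else (E₁ (i.val + 1) - E₁ i.val) - (E (i.val + 1) - E i.val) with hddef
  have hd₁ : ∀ i, E₁ (i.val + 1) - E₁ i.val ≤ E (i.val + 1) - E i.val + d i := fun i => by
    simp only [hddef]
    split_ifs with hi
    · have := heven i hi
      have := hle₂ i.val
      linarith
    · linarith
  have hd₂ : ∀ i, E₂ (i.val + 1) - E₂ i.val ≤ E (i.val + 1) - E i.val + d i := fun i => by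
    simp only [hddef]
    split_ifs with hi
    · linarith
    · have := hodd i (Nat.not_even_iff_odd.1 hi)
      have := hle₁ i.val
      linarith
  have hd : ∀ i, 0 ≤ d i := fun i => by
    have := hd₁ i
    have := hle₁ i.val
    linarith
  have hdA : ∑ i : Fin r with Even i.val, d i ≤ A := by
    rw [← hsumA, Finset.sum_congr rfl fun i hi => if_pos (Finset.mem_filter.1 hi).2]
    exact Finset.sum_le_univ_sum_of_nonneg fun i => sub_nonneg.2 (hle₂ i.val)
  have hdB : ∑ i : Fin r with Odd i.val, d i ≤ B := by
    rw [← hsumB, Finset.sum_congr rfl fun i hi =>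
      if_neg (Nat.not_even_iff_odd.2 (Finset.mem_filter.1 hi).2)]
    exact Finset.sum_le_univ_sum_of_nonneg fun i => sub_nonneg.2 (hle₁ i.val)
  refine achievable_of_rates hq hW h (g := fun i => E (i.val + 1) - E i.val) (υ := υ)
    (μ := fun i => 4 * ε + e i + d i) hR hε hυ (fun i => hEmono _) (fun i => ?_) (fun i => ?_)
    (fun i => ?_) (fun i => ?_) (fun i => ?_) ?_ ?_
  · have := he i
    have := hd i
    linarith
  · rw [condEntropy_truncate_succ]
    have := he i
    simp only [hυdef]
    linarith
  · rw [condEntropy_truncate_succ]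
    have := hd₁ i
    simp only [hυdef]
    linarith
  · rw [condEntropy_truncate_succ]
    have := hd₂ i
    simp only [hυdef]
    linarith
  -- For the first round this is the third rate inequality, with the common randomness and the
  -- surplus of terminal 1. From the second round on the surplus of terminal 2 is available too; `E
  -- - V` is monotone, so the fourth inequality, which concerns all rounds, suffices.
  · rw [condEntropy_truncate, sum_filter_lt_sub E i.2]
    have h0 : υ 0 = 2 * ε + R₀ + (R₁₂ - A) := by simp [hυdef, sharedRate, hedef]
    rcases Nat.eq_zero_or_pos i.val with hi | hi
    · have hs : υ 0 ≤ ∑ j : Fin r with j.val < i.val + 1, υ j :=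
        Finset.single_le_sum (fun j _ => hυ j) (by simp)
      simp only [hi, zero_add] at hs ⊢
      linarith
    · have h1r : 1 < r := lt_of_le_of_lt hi i.2
      have h1 : υ ⟨1, h1r⟩ = 2 * ε + (R₂₁ - B) := by simp [hυdef, sharedRate, hedef]
      have hne : (0 : Fin r) ≠ ⟨1, h1r⟩ := fun hh => by simpa using congrArg Fin.val hh
      have hs : υ 0 + υ ⟨1, h1r⟩ ≤ ∑ j : Fin r with j.val < i.val + 1, υ j := by
        rw [← Finset.sum_pair hne]
        refine Finset.sum_le_sum_of_subset_of_nonneg (fun j hj => ?_) fun j _ _ => hυ j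
        rcases Finset.mem_insert.1 hj with rfl | hj
        · simp
        · rw [Finset.mem_singleton.1 hj]
          exact Finset.mem_filter.2 ⟨Finset.mem_univ _, Nat.succ_lt_succ hi⟩
      have hm := hVE (show i.val + 1 ≤ r from i.2)
      simp only at hm
      linarith
  · rw [Finset.sum_add_distrib, Finset.sum_add_distrib]
    have := hsum4 (Finset.univ.filter fun i : Fin r => Even i.val)
    linarith
  · rw [Finset.sum_add_distrib, Finset.sum_add_distrib]
    have := hsum4 (Finset.univ.filter fun i : Fin r => Odd i.val)
    linarith

omit [∀ i, Nonempty (Fin (m i))] in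
/-- The achievability part of the characterization. -/
theorem rateRegion_subset [NeZero r] {qX : X₁ × X₂ → ℝ} {W : X₁ × X₂ → Y₁ × Y₂ → ℝ}
    (hq : qX ∈ stdSimplex ℝ (X₁ × X₂)) (hW : ∀ x, W x ∈ stdSimplex ℝ (Y₁ × Y₂)) :
    rateRegion r qX W ⊆ simulationRegion r qX W := by
  rintro ⟨R₀, R₁₂, R₂₁⟩ ⟨h0, -, -, m, p, h, hA, hB, hC, hD⟩
  obtain ⟨w⟩ : Nonempty (AuxSpace X₁ X₂ Y₁ Y₂ m) := by
    by_contra hw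
    rw [not_nonempty_iff] at hw
    simpa using h.isPMF.2
  have : ∀ i, Nonempty (Fin (m i)) := fun i => ⟨w.1 i⟩
  refine Metric.mem_closure_iff.2 fun ε hε =>
    ⟨(R₀, R₁₂ + ε / 2, R₂₁ + ε / 2), achievable_add hq hW h (half_pos hε) h0 hA hB hC hD, ?_⟩
  simp only [Prod.dist_eq, dist_self, dist_self_add_right, Real.norm_eq_abs, abs_of_pos (half_pos hε)]
  simp [hε]

end Bookkeeping

end ChannelSim

/-- The simulation rate region of a two-way channel with `r ≥ 1` rounds of interactive
communication equals its single-letter characterization. -/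
theorem theorem1 {X₁ X₂ Y₁ Y₂ : Type*} [Fintype X₁] [Fintype X₂] [Fintype Y₁] [Fintype Y₂]
    (r : ℕ) [NeZero r]
    (qX : X₁ × X₂ → ℝ) (hqX : qX ∈ stdSimplex ℝ (X₁ × X₂))
    (W : X₁ × X₂ → Y₁ × Y₂ → ℝ) (hW : ∀ x, W x ∈ stdSimplex ℝ (Y₁ × Y₂)) :
    ChannelSim.simulationRegion r qX W = ChannelSim.rateRegion r qX W := by
  exact Set.Subset.antisymm (ChannelSim.simulationRegion_subset hqX hW)
    (ChannelSim.rateRegion_subset hqX hW)
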